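/- **Spaces.** Write $\langle x\rangle=(1+x^2)^{1/2}$. For an open $\Omega\subset\mathbb R$ let $L^{2,m}(\Omega)$ have the norm $\|\langle x\rangle^m f\|_{L^2(\Omega)}$, let $H^k(\Omega)$ be the usual $L^2$-based Sobolev space, and let $H^{1,1}(\Omega)=\{u\in L^{2,1}(\Omega):\ \partial_xu\in L^{2,1}(\Omega)\}$ (weak derivatives); an intersection of two spaces carries the sum of the two norms. Put $\mathbb R^+=(0,\infty)$. **Scattering data.** A pair $r_\pm\in H^1(\mathbb R)\cap L^{2,1}(\mathbb R)$ of complex-valued functions is called admissible if $r_-(z)=4z\,r_+(z)$ for a.e. $z\in\mathbb R$ and if, with $r(\lambda):=-2i\lambda\, r_+(\lambda^2)$ for $\lambda\in\mathbb R\cup i\mathbb R$, there is $c_0>0$ such that $1-|r(\lambda)|^2\ge c_0^2$ for a.e. $\lambda\in i\mathbb R$. **Riemann–Hilbert problem.** For $x\in\mathbb R$ let $$R(x;z)=\begin{bmatrix}\overline{r_+(z)}\,r_-(z)&\overline{r_+(z)}\,e^{-2izx}\\ r_-(z)e^{2izx}&0\end{bmatrix},\qquad z\in\mathbb R.$$ A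 solution at $x$ is a $2\times2$ matrix function $M(x;\cdot)$, analytic in $\mathbb C\setminus\mathbb R$, with $\sup_{y\ne0}\|M(x;\cdot+iy)-I\|_{L^2(\mathbb R)}<\infty$, with $M(x;z)\to I$ as $|\mathrm{Im}\,z|\to\infty$, and with boundary values $M_\pm(x;z)=\lim_{\epsilon\downarrow0}M(x;z\pm i\epsilon)$ for a.e. $z\in\mathbb R$ such that $M_\pm(x;\cdot)-I\in L^2(\mathbb R)$ and $M_+-M_-=M_-R$ a.e. on $\mathbb R$. Write $M_\pm=[\mu_\pm,\eta_\pm]$ for the columns, and $\mu_\pm^{(j)},\eta_\pm^{(j)}$ for their $j$-th components. **Reconstructed potential.** A function $u:\mathbb R^+\to\mathbb C$ with $|u|^2$ integrable on $\mathbb R^+$ is called reconstructed from $(r_+,r_-)$ if for every $x>0$ the function $\bar u\,e^{\frac1{2i}\int_{+\infty}^{\cdot}|u|^2}$ is differentiable at $x$ and, for a solution of the Riemann–Hilbert problem at $x$, $$u(x)\,e^{i\int_{+\infty}^x|u(y)|^2dy}=\frac{2}{\pi i}\int_{\mathbb R}\overline{r_+(z)}\,e^{-2izx}\mu_-^{(1)}(x;z)\,dz,$$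 $$e^{\frac1{2i}\int_{+\infty}^x|u(y)|^2dy}\,\partial_x\!\left(\bar u(x)\,e^{\frac1{2i}\int_{+\infty}^x|u(y)|^2dy}\right)=-\frac1\pi\int_{\mathbb R}r_-(z)\,e^{2izx}\eta_+^{(2)}(x;z)\,dz.$$ **Statement.** For every $\rho>0$ there is a constant $C=C(\rho)>0$ such that the following hold. 1. Let $(r_+,r_-)$ be admissible with $\|r_\pm\|_{H^1\cap L^{2,1}}\le\rho$. Then for every $x\in\mathbb R$ the Riemann–Hilbert problem has exactly one solution $M(x;\cdot)$; there is exactly one function $u$ on $\mathbb R^+$ reconstructed from $(r_+,r_-)$; and $u\in H^2(\mathbb R^+)\cap H^{1,1}(\mathbb R^+)$ with $$\|u\|_{H^2(\mathbb R^+)\cap H^{1,1}(\mathbb R^+)}\le C\left(\|r_+\|_{H^1\cap L^{2,1}}+\|r_-\|_{H^1\cap L^{2,1}}\right).$$ 2. Let $(r_+,r_-)$ and $(\tilde r_+,\tilde r_-)$ be admissible with $\|r_\pm\|_{H^1\cap L^{2,1}},\|\tilde r_\pm\|_{H^1\cap L^{2,1}}\le\rho$, and let $u,\tilde u$ be the reconstructed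 potentials. Then $$\|u-\tilde u\|_{H^2(\mathbb R^+)\cap H^{1,1}(\mathbb R^+)}\le C\left(\|r_+-\tilde r_+\|_{H^1\cap L^{2,1}}+\|r_--\tilde r_-\|_{H^1\cap L^{2,1}}\right).$$ -/

import Mathlib

open MeasureTheory Set Filter Topology
open scoped ContDiff NNReal ENNReal ComplexConjugate

namespace KaupNewell

/-! Weighted Sobolev spaces on an open subset of the real line. -/

/-- `g` is the weak (distributional) derivative of `f` on the open set `Ω`. -/
def IsWeakDeriv (Ω : Set ℝ) (f g : ℝ → ℂ) : Prop :=
  LocallyIntegrableOn f Ω ∧ LocallyIntegrableOn g Ω ∧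
    ∀ φ : ℝ → ℝ, ContDiff ℝ ∞ φ → HasCompactSupport φ → tsupport φ ⊆ Ω →
      ∫ x in Ω, ((deriv φ x : ℝ) : ℂ) * f x = -∫ x in Ω, ((φ x : ℝ) : ℂ) * g x

open Classical in
/-- The weak derivative of `f` on `Ω` (determined almost everywhere on `Ω`);
the zero function if there is none. -/
noncomputable def weakDeriv (Ω : Set ℝ) (f : ℝ → ℂ) : ℝ → ℂ :=
  if h : ∃ g, IsWeakDeriv Ω f g then h.choose else 0

/-- The function `⟨x⟩ ^ m * f x`, where `⟨x⟩ = (1 + x ^ 2) ^ (1 / 2)`. -/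
noncomputable def weighted (m : ℕ) (f : ℝ → ℂ) : ℝ → ℂ :=
  fun x => ((√(1 + x ^ 2) ^ m : ℝ) : ℂ) * f x

/-- `f` belongs to the weighted space `L^{2,m}(Ω)`. -/
def MemL2 (Ω : Set ℝ) (m : ℕ) (f : ℝ → ℂ) : Prop :=
  MemLp (weighted m f) 2 (volume.restrict Ω)

/-- The norm of `L^{2,m}(Ω)`. -/
noncomputable def normL2 (Ω : Set ℝ) (m : ℕ) (f : ℝ → ℂ) : ℝ :=
  (eLpNorm (weighted m f) 2 (volume.restrict Ω)).toReal

/-- `f` and its weak derivatives up to order `k` exist and belong to `L^{2,m}(Ω)`, that is,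
`f ∈ H^{k,m}(Ω)`. Here `H^{k,0} = H^k` and `H^{0,m} = L^{2,m}`. -/
def MemH (Ω : Set ℝ) : (k m : ℕ) → (ℝ → ℂ) → Prop
  | 0, m, f => MemL2 Ω m f
  | k + 1, m, f => MemL2 Ω m f ∧ (∃ g, IsWeakDeriv Ω f g) ∧ MemH Ω k m (weakDeriv Ω f)

/-- The sum of the squares of the `L^{2,m}(Ω)` norms of the weak derivatives of orders `0, …, k`. -/
noncomputable def sqNormH (Ω : Set ℝ) : (k m : ℕ) → (ℝ → ℂ) → ℝ
  | 0, m, f => normL2 Ω m f ^ 2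
  | k + 1, m, f => normL2 Ω m f ^ 2 + sqNormH Ω k m (weakDeriv Ω f)

/-- The norm of `H^{k,m}(Ω)`. -/
noncomputable def normH (Ω : Set ℝ) (k m : ℕ) (f : ℝ → ℂ) : ℝ :=
  √(sqNormH Ω k m f)

/-- The space `H^1(ℝ) ∩ L^{2,1}(ℝ)` of the scattering data. -/
def MemData (r : ℝ → ℂ) : Prop := MemH univ 1 0 r ∧ MemH univ 0 1 r

/-- The norm of `H^1(ℝ) ∩ L^{2,1}(ℝ)`. -/
noncomputable def normData (r : ℝ → ℂ) : ℝ := normH univ 1 0 r + normH univ 0 1 r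

/-- The space `H^2(ℝ^+) ∩ H^{1,1}(ℝ^+)` of the potentials on the positive half-line. -/
def MemPot (u : ℝ → ℂ) : Prop := MemH (Ioi 0) 2 0 u ∧ MemH (Ioi 0) 1 1 u

/-- The norm of `H^2(ℝ^+) ∩ H^{1,1}(ℝ^+)`. -/
noncomputable def normPot (u : ℝ → ℂ) : ℝ := normH (Ioi 0) 2 0 u + normH (Ioi 0) 1 1 u

/-! Scattering data. -/

/-- The reflection coefficient `r(λ) = -2 i λ r_+(λ ^ 2)` for `λ ∈ ℝ ∪ i ℝ`
(so that `λ ^ 2` is real). -/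
noncomputable def reflection (rp : ℝ → ℂ) (lam : ℂ) : ℂ :=
  -2 * Complex.I * lam * rp (lam ^ 2).re

/-- Admissible scattering data: `r_±` belong to `H^1(ℝ) ∩ L^{2,1}(ℝ)`, are related by
`r_-(z) = 4 z r_+(z)`, and satisfy `1 - |r(λ)|^2 ≥ c₀^2 > 0` for `λ ∈ i ℝ`. -/
structure IsScatteringData (rp rm : ℝ → ℂ) : Prop where
  mem_plus : MemData rp
  mem_minus : MemData rm
  relation : ∀ᵐ z : ℝ, rm z = 4 * (z : ℂ) * rp z
  smallness : ∃ c₀ : ℝ, 0 < c₀ ∧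
    ∀ᵐ γ : ℝ, c₀ ^ 2 ≤ 1 - ‖reflection rp (γ * Complex.I)‖ ^ 2

/-! The Riemann–Hilbert problem. -/

/-- The jump matrix `R(x;z)`. -/
noncomputable def jumpMatrix (rp rm : ℝ → ℂ) (x z : ℝ) : Matrix (Fin 2) (Fin 2) ℂ :=
  !![conj (rp z) * rm z, conj (rp z) * Complex.exp (-2 * Complex.I * z * x);
    rm z * Complex.exp (2 * Complex.I * z * x), 0]

/-- `M` solves, at the point `x`, the Riemann–Hilbert problem
`M_+ - M_- = M_- R` on `ℝ`, `M → I` at infinity, with `M - I` in the Hardy spaces `H²(ℂ^±)`.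
The functions `Mp` and `Mm` are the boundary values of `M` from `ℂ^+` and `ℂ^-`. -/
structure IsRHSolution (rp rm : ℝ → ℂ) (x : ℝ) (M : ℂ → Matrix (Fin 2) (Fin 2) ℂ)
    (Mp Mm : ℝ → Matrix (Fin 2) (Fin 2) ℂ) : Prop where
  analytic : ∀ i j, DifferentiableOn ℂ (fun z => M z i j) {z | z.im ≠ 0}
  hardy : ∃ K : ℝ≥0, ∀ y : ℝ, y ≠ 0 → ∀ i j,
    eLpNorm (fun s : ℝ => (M (s + y * Complex.I) - 1) i j) 2 volume ≤ K
  tendsto_one : Tendsto M (comap (fun z : ℂ => |z.im|) atTop) (𝓝 1)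
  boundary_plus : ∀ᵐ s : ℝ,
    Tendsto (fun ε : ℝ => M (s + ε * Complex.I)) (𝓝[>] 0) (𝓝 (Mp s))
  boundary_minus : ∀ᵐ s : ℝ,
    Tendsto (fun ε : ℝ => M (s - ε * Complex.I)) (𝓝[>] 0) (𝓝 (Mm s))
  memLp_plus : ∀ i j, MemLp (fun s => (Mp s - 1) i j) 2 volume
  memLp_minus : ∀ i j, MemLp (fun s => (Mm s - 1) i j) 2 volume
  jump : ∀ᵐ s : ℝ, Mp s - Mm s = Mm s * jumpMatrix rp rm x s

/-! Reconstruction of the potential on the positive half-line. -/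

/-- The integral of `|u|^2` from `+∞` to `x`. -/
noncomputable def massFromInfty (u : ℝ → ℂ) (x : ℝ) : ℝ := -∫ y in Ioi x, ‖u y‖ ^ 2

/-- The gauge factor `exp ((1 / (2 i)) ∫_{+∞}^x |u|^2)`. -/
noncomputable def gaugeFactor (u : ℝ → ℂ) (x : ℝ) : ℂ :=
  Complex.exp (1 / (2 * Complex.I) * massFromInfty u x)

/-- `u` is, on `ℝ^+`, the potential recovered from `r_±`: with `μ_-` the first column of `M_-` and
`η_+` the second column of `M_+`, the two reconstruction formulas hold for every `x > 0`. -/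
def IsReconstructed (rp rm : ℝ → ℂ) (u : ℝ → ℂ) : Prop :=
  IntegrableOn (fun y => ‖u y‖ ^ 2) (Ioi 0) ∧
  ∀ x : ℝ, 0 < x → ∃ M Mp Mm, IsRHSolution rp rm x M Mp Mm ∧
    u x * Complex.exp (Complex.I * massFromInfty u x) =
      2 / (Real.pi * Complex.I) *
        ∫ z : ℝ, conj (rp z) * Complex.exp (-2 * Complex.I * z * x) * Mm z 0 0 ∧
    DifferentiableAt ℝ (fun y => conj (u y) * gaugeFactor u y) x ∧
    gaugeFactor u x * deriv (fun y => conj (u y) * gaugeFactor u y) x =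
      -1 / Real.pi *
        ∫ z : ℝ, rm z * Complex.exp (2 * Complex.I * z * x) * Mp z 1 1

end KaupNewell

/-! The jump relation is equivalent to μ₊ − μ₋ = η₊ r₋ e^{2izx} and η₊ − η₋ = μ₋ r̄₊ e^{−2izx}.
After a Fourier transform each row of M becomes a pair (A, B) of functions on (0, ∞) coupled by two
Hankel operators (`IsRow`), a Marchenko system. Their kernels are built from φ = r̂₊/2π and φ′,
translated by c = 2x; the relation r₋ = 4z r₊ is what makes the second kernel the derivative of the
first. Write P_t and P¹_t for φ(t + ·) and φ′(t + ·) on the half-line. Eliminating B leaves an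
equation (1 + K_c) A = source in L²(0, ∞), with K_c A = −4i ∫_{t>c} ⟪P_t, A⟫ P¹_t dt.

The heart of the matter is a bound ‖α‖ ≤ C ‖(1 + K)α‖ in which C depends only on the size of the
kernel (`exists_norm_le_one_add_opK`). Let f = (1 + K)α, with α given by an integrable function A.
Pairing f with translates of A and integrating against 1/(1 + iτ)², the transform of z e^{−z},
yields ∫₀^∞ z e^{−z} |Â(−z)|² dz ≤ π ‖α‖ ‖f‖: after an integration by parts the contribution of K
has a favourable sign (`re_integral_wt_mul_deriv_nonpos`, `IsKernel.energyControlled`). Now Â is the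
boundary value of an analytic function of the upper half-plane, and such a function is determined by
its values on a half-line. Hence α is weakly small when f is small (`smallPairing_all`). Because K
is compact, uniformly over kernels of bounded size, Kα is then small in norm, and so is α. The
method of continuity turns the bound into invertibility of 1 + K.

The parameter c enters K_c only as an end point of integration, so its derivative in c has rank one
and the solution can be differentiated explicitly. The value b(c) = conj φ(c) + ⟪P_c, A_c⟫ consists
of a leading term, estimated in weighted L² through the data, and a remainder with additional
pointwise decay. The predicates `Bd` and `L2Bd` carry size and Lipschitz dependence on the kernel
through all products. The first reconstruction formula is Fourier inversion at 0 and says u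
e^{i∫|u|²} = w(2x) with w = −4i b; hence |u| is known, then the mass, then the phase, so u is
unique. The second formula comes from a reciprocity relation between the rows and an energy identity
for the first row (`IsRow.fst_zero_eq`).

For uniqueness of M, the solution constructed is bounded with determinant one. If N is another
solution, (N − M) adj M has Hardy entries and no jump, and such functions vanish
(`eq_zero_of_hardy`). -/

namespace KaupNewell

open scoped FourierTransform SchwartzMap

/-! ### Fourier transform on L¹ and on L² -/

/-- The Fourier transform with kernel `exp (i s z)`. -/
noncomputable def ft (f : ℝ → ℂ) (s : ℝ) : ℂ := ∫ z : ℝ, Complex.exp (Complex.I * s * z) * f z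

theorem norm_cexp_I_mul_mul (s z : ℝ) : ‖Complex.exp (Complex.I * s * z)‖ = 1 := by
  have : Complex.I * s * z = ((s * z : ℝ) : ℂ) * Complex.I := by push_cast; ring
  rw [this, Complex.norm_exp_ofReal_mul_I]

theorem ft_eq_fourier (f : ℝ → ℂ) (s : ℝ) : ft f s = 𝓕 f (-(s / (2 * Real.pi))) := by
  rw [Real.fourier_eq']
  unfold ft
  congr 1; ext z
  rw [smul_eq_mul]
  congr 2
  have : (Real.pi : ℂ) ≠ 0 := by exact_mod_cast Real.pi_ne_zero
  simp only [RCLike.inner_apply, conj_trivial]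
  push_cast
  field_simp

theorem ft_eq_fourierInv (f : ℝ → ℂ) (s : ℝ) : ft f s = 𝓕⁻ f (s / (2 * Real.pi)) := by
  rw [Real.fourierInv_eq_fourier_neg, ft_eq_fourier]

theorem fourier_eq_ft (f : ℝ → ℂ) (s : ℝ) : 𝓕 f s = ft f (-(2 * Real.pi * s)) := by
  rw [ft_eq_fourier]; field_simp

theorem fourierInv_eq_ft (f : ℝ → ℂ) (s : ℝ) : 𝓕⁻ f s = ft f (2 * Real.pi * s) := by
  rw [ft_eq_fourierInv]; field_simp

theorem integrable_cexp_mul {f : ℝ → ℂ} (hf : Integrable f) (s : ℝ) :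
    Integrable (fun z : ℝ => Complex.exp (Complex.I * s * z) * f z) := by
  refine hf.bdd_mul (c := 1) (by fun_prop) (ae_of_all _ fun z => ?_)
  rw [norm_cexp_I_mul_mul]

theorem norm_ft_le (f : ℝ → ℂ) (s : ℝ) : ‖ft f s‖ ≤ ∫ z, ‖f z‖ := by
  refine (norm_integral_le_integral_norm _).trans (le_of_eq ?_)
  simp_rw [norm_mul, norm_cexp_I_mul_mul, one_mul]

theorem continuous_ft {f : ℝ → ℂ} (hf : Integrable f) : Continuous (ft f) := by
  refine continuous_of_dominated (bound := fun z => ‖f z‖)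
    (fun s => (integrable_cexp_mul hf s).aestronglyMeasurable) (fun s => ?_) hf.norm ?_
  · refine ae_of_all _ fun z => ?_
    rw [norm_mul, norm_cexp_I_mul_mul, one_mul]
  · exact ae_of_all _ fun z => by fun_prop

theorem continuous_fourier_of_integrable {f : ℝ → ℂ} (hf : Integrable f) :
    Continuous (𝓕 f : ℝ → ℂ) := by
  have : (𝓕 f : ℝ → ℂ) = fun s => ft f (-(2 * Real.pi * s)) := funext (fourier_eq_ft f)
  rw [this]; exact (continuous_ft hf).comp (by fun_prop)

theorem continuous_fourierInv_of_integrable {f : ℝ → ℂ} (hf : Integrable f) :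
    Continuous (𝓕⁻ f : ℝ → ℂ) := by
  have : (𝓕⁻ f : ℝ → ℂ) = fun s => ft f (2 * Real.pi * s) := funext (fourierInv_eq_ft f)
  rw [this]; exact (continuous_ft hf).comp (by fun_prop)

/-- Fubini for the symmetric kernel e^{iasz}; the values a = 1, −2π, 2π serve `ft`, `𝓕` and `𝓕⁻`. -/
theorem integral_cexp_swap {f g : ℝ → ℂ} (hf : Integrable f) (hg : Integrable g) (a : ℝ) :
    ∫ s, ft f (a * s) * g s = ∫ z, f z * ft g (a * z) := by
  have h1 : Integrable (Function.uncurry fun s z : ℝ =>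
      Complex.exp (Complex.I * (a * s : ℝ) * z) * (g s * f z)) (volume.prod volume) := by
    refine (hg.mul_prod hf).bdd_mul (c := 1) (by fun_prop) (ae_of_all _ fun z => ?_)
    rw [norm_cexp_I_mul_mul]
  have h2 := integral_integral_swap h1
  have e1 : ∀ s, ft f (a * s) * g s
      = ∫ z : ℝ, Complex.exp (Complex.I * (a * s : ℝ) * z) * (g s * f z) := fun s => by
    unfold ft; rw [← integral_mul_const]; congr 1; ext z; ring
  have e2 : ∀ z, f z * ft g (a * z)
      = ∫ s : ℝ, Complex.exp (Complex.I * (a * s : ℝ) * z) * (g s * f z) := fun z => by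
    unfold ft; rw [← integral_const_mul]; congr 1; ext s
    have : Complex.I * ((a * z : ℝ) : ℂ) * s = Complex.I * ((a * s : ℝ) : ℂ) * z := by
      push_cast; ring
    rw [this]; ring
  simp_rw [e1, e2]; exact h2

theorem integral_ft_mul {f g : ℝ → ℂ} (hf : Integrable f) (hg : Integrable g) :
    ∫ s, ft f s * g s = ∫ z, f z * ft g z := by
  simpa using integral_cexp_swap hf hg 1

theorem integral_fourier_mul {f g : ℝ → ℂ} (hf : Integrable f) (hg : Integrable g) :
    ∫ s, 𝓕 f s * g s = ∫ z, f z * 𝓕 g z := by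
  simp_rw [fourier_eq_ft, ← neg_mul]; exact integral_cexp_swap hf hg _

theorem integral_fourierInv_mul {f g : ℝ → ℂ} (hf : Integrable f) (hg : Integrable g) :
    ∫ s, 𝓕⁻ f s * g s = ∫ z, f z * 𝓕⁻ g z := by
  simp_rw [fourierInv_eq_ft]; exact integral_cexp_swap hf hg _

/-- Tested against a smooth compactly supported function, both sides move the transform onto that
function: the left by duality of tempered distributions, the right by Fubini. -/
theorem coeFn_fourier_toLp {f : ℝ → ℂ} (hf : Integrable f) (h2 : MemLp f 2) :
    ((𝓕 (h2.toLp f) : Lp ℂ 2 (volume : Measure ℝ)) : ℝ → ℂ) =ᵐ[volume] 𝓕 f := by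
  apply ae_eq_of_integral_contDiff_smul_eq
  · exact (Lp.memLp _).locallyIntegrable (by norm_num)
  · exact (continuous_fourier_of_integrable hf).locallyIntegrable
  · intro g hg hc
    have h1 : HasCompactSupport (fun x => (g x : ℂ)) := hc.comp_left (g := ((↑) : ℝ → ℂ)) (by simp)
    let G : 𝓢(ℝ, ℂ) := h1.toSchwartzMap (Complex.ofRealCLM.contDiff.comp hg)
    have e := congrArg (fun T : 𝓢'(ℝ, ℂ) => T G) (Lp.fourier_toTemperedDistribution_eq (h2.toLp f))
    simp only [TemperedDistribution.fourier_apply, Lp.toTemperedDistribution_apply] at e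
    have e2 : ∫ x, g x • (𝓕 (h2.toLp f) : Lp ℂ 2 (volume : Measure ℝ)) x
      = ∫ x, G x • (𝓕 (h2.toLp f) : Lp ℂ 2 (volume : Measure ℝ)) x := rfl
    rw [e2, ← e]
    have e3 : ∫ x, 𝓕 G x • (h2.toLp f) x = ∫ x, 𝓕 (G : ℝ → ℂ) x * f x := by
      apply integral_congr_ae
      filter_upwards [h2.coeFn_toLp] with x hx
      rw [hx]; rfl
    rw [e3, integral_fourier_mul G.integrable hf]; rfl

theorem coeFn_fourierInv_toLp {f : ℝ → ℂ} (hf : Integrable f) (h2 : MemLp f 2) :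
    ((𝓕⁻ (h2.toLp f) : Lp ℂ 2 (volume : Measure ℝ)) : ℝ → ℂ) =ᵐ[volume] 𝓕⁻ f := by
  apply ae_eq_of_integral_contDiff_smul_eq
  · exact (Lp.memLp _).locallyIntegrable (by norm_num)
  · exact (continuous_fourierInv_of_integrable hf).locallyIntegrable
  · intro g hg hc
    have h1 : HasCompactSupport (fun x => (g x : ℂ)) := hc.comp_left (g := ((↑) : ℝ → ℂ)) (by simp)
    let G : 𝓢(ℝ, ℂ) := h1.toSchwartzMap (Complex.ofRealCLM.contDiff.comp hg)
    have e := congrArg (fun T : 𝓢'(ℝ, ℂ) => T G)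
      (Lp.fourierInv_toTemperedDistribution_eq (h2.toLp f))
    simp only [TemperedDistribution.fourierInv_apply, Lp.toTemperedDistribution_apply] at e
    have e2 : ∫ x, g x • (𝓕⁻ (h2.toLp f) : Lp ℂ 2 (volume : Measure ℝ)) x
      = ∫ x, G x • (𝓕⁻ (h2.toLp f) : Lp ℂ 2 (volume : Measure ℝ)) x := rfl
    rw [e2, ← e]
    have e3 : ∫ x, 𝓕⁻ G x • (h2.toLp f) x = ∫ x, 𝓕⁻ (G : ℝ → ℂ) x * f x := by
      apply integral_congr_ae
      filter_upwards [h2.coeFn_toLp] with x hx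
      rw [hx, SchwartzMap.fourierInv_coe, smul_eq_mul]
    rw [e3, integral_fourierInv_mul G.integrable hf]; rfl

/-- The `L²` Fourier transform, as a function. -/
noncomputable def l2ft {g : ℝ → ℂ} (hg : MemLp g 2) (s : ℝ) : ℂ :=
  (𝓕⁻ (hg.toLp g) : Lp ℂ 2 (volume : Measure ℝ)) (s / (2 * Real.pi))

theorem map_div_two_pi : Measure.map (fun s : ℝ => s / (2 * Real.pi)) volume
    = ENNReal.ofReal (2 * Real.pi) • volume := by
  have : (fun s : ℝ => s / (2 * Real.pi)) = fun s => s * (2 * Real.pi)⁻¹ := by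
    ext s; ring
  rw [this, Real.map_volume_mul_right (by positivity), inv_inv, abs_of_pos (by positivity)]

theorem quasiMeasurePreserving_div_two_pi :
    Measure.QuasiMeasurePreserving (fun s : ℝ => s / (2 * Real.pi)) volume volume := by
  refine ⟨by fun_prop, ?_⟩
  rw [map_div_two_pi]
  exact Measure.smul_absolutelyContinuous

theorem eLpNorm_comp_div_two_pi {g : ℝ → ℂ} (hg : AEStronglyMeasurable g) :
    eLpNorm (fun s => g (s / (2 * Real.pi))) 2 volume
      = ENNReal.ofReal √(2 * Real.pi) * eLpNorm g 2 volume := by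
  have h := eLpNorm_map_measure (p := 2) (f := fun s : ℝ => s / (2 * Real.pi)) (g := g)
    (μ := volume) (by rw [map_div_two_pi]; exact hg.smul_measure _) (by fun_prop)
  rw [Function.comp_def] at h
  rw [← h, map_div_two_pi, eLpNorm_smul_measure_of_ne_top (by norm_num), smul_eq_mul,
    Real.sqrt_eq_rpow, ENNReal.ofReal_rpow_of_pos (by positivity)]
  norm_num

theorem l2ft_ae_eq_ft {f : ℝ → ℂ} (hf : Integrable f) (h2 : MemLp f 2) :
    l2ft h2 =ᵐ[volume] ft f := by
  have := quasiMeasurePreserving_div_two_pi.ae (coeFn_fourierInv_toLp hf h2)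
  filter_upwards [this] with s hs
  rw [l2ft, hs, ft_eq_fourierInv]

theorem eLpNorm_l2ft {g : ℝ → ℂ} (hg : MemLp g 2) :
    eLpNorm (l2ft hg) 2 volume = ENNReal.ofReal √(2 * Real.pi) * eLpNorm g 2 volume := by
  unfold l2ft
  rw [eLpNorm_comp_div_two_pi (Lp.aestronglyMeasurable _)]
  congr 1
  have h := (Lp.fourierTransformₗᵢ ℝ ℂ).symm.norm_map (hg.toLp g)
  rw [Lp.norm_def, Lp.norm_def] at h
  rw [ENNReal.toReal_eq_toReal_iff' (Lp.eLpNorm_ne_top _) (Lp.eLpNorm_ne_top _)] at h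
  exact h.trans (eLpNorm_congr_ae hg.coeFn_toLp)

theorem memLp_l2ft {g : ℝ → ℂ} (hg : MemLp g 2) : MemLp (l2ft hg) 2 := by
  refine ⟨(Lp.aestronglyMeasurable _).comp_quasiMeasurePreserving
    quasiMeasurePreserving_div_two_pi, ?_⟩
  rw [eLpNorm_l2ft]
  exact ENNReal.mul_lt_top ENNReal.ofReal_lt_top hg.eLpNorm_lt_top

theorem eLpNorm_ft {f : ℝ → ℂ} (hf : Integrable f) (h2 : MemLp f 2) :
    eLpNorm (ft f) 2 volume = ENNReal.ofReal √(2 * Real.pi) * eLpNorm f 2 volume := by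
  rw [← eLpNorm_congr_ae (l2ft_ae_eq_ft hf h2), eLpNorm_l2ft]

theorem memLp_ft {f : ℝ → ℂ} (hf : Integrable f) (h2 : MemLp f 2) : MemLp (ft f) 2 :=
  (memLp_congr_ae (l2ft_ae_eq_ft hf h2)).1 (memLp_l2ft h2)

theorem conj_ft (f : ℝ → ℂ) (s : ℝ) : conj (ft f s) = ft (fun z => conj (f z)) (-s) := by
  unfold ft
  rw [← integral_conj]; congr 1; ext z
  rw [map_mul, ← Complex.exp_conj]
  congr 2; simp

/-- Here `g` is only in L², so Fubini is not available. The identity is Parseval's, applied to the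
conjugate of a rescaling `F` of `f` that converts the kernel e^{isz} into e^{2πisz}. -/
theorem integral_l2ft_mul {f g : ℝ → ℂ} (hg : MemLp g 2) (hf : Integrable f) (h2 : MemLp f 2) :
    ∫ s, l2ft hg s * f s = ∫ z, g z * ft f z := by
  have hpi : (2 * Real.pi) ≠ 0 := by positivity
  set F : ℝ → ℂ := fun w => (2 * Real.pi : ℝ) * f (2 * Real.pi * w) with hF
  have hF1 : Integrable F := (hf.comp_mul_left' hpi).const_mul _
  have hF2 : MemLp F 2 := by
    refine MemLp.const_mul ?_ _
    have hm : Measure.map (fun s : ℝ => 2 * Real.pi * s) volume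
        = ENNReal.ofReal (|(2 * Real.pi)⁻¹|) • volume := Real.map_volume_mul_left hpi
    have : MemLp f 2 (Measure.map (fun s : ℝ => 2 * Real.pi * s) volume) := by
      rw [hm]; exact h2.smul_measure ENNReal.ofReal_ne_top
    exact this.comp_of_map (by fun_prop)
  have hc2 : MemLp (fun w => conj (F w)) 2 := hF2.star
  have hc1 : Integrable (fun w => conj (F w)) :=
    memLp_one_iff_integrable.1 (memLp_one_iff_integrable.2 hF1).star
  have hft : ∀ z, ft f z = conj (𝓕 (fun w => conj (F w)) z) := fun z => by
    rw [fourier_eq_ft, conj_ft]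
    simp only [Complex.conj_conj, neg_neg]
    unfold ft
    have := Measure.integral_comp_mul_left
      (fun s : ℝ => Complex.exp (Complex.I * z * s) * f s) (2 * Real.pi)
    rw [abs_of_pos (by positivity), eq_inv_smul_iff₀ hpi, ← integral_smul] at this
    rw [← this]; congr 1; ext w
    simp only [hF, Complex.real_smul]
    push_cast
    rw [show Complex.I * z * (2 * Real.pi * w) = Complex.I * (2 * Real.pi * z) * w by ring]
    ring
  have key := (Lp.fourierTransformₗᵢ ℝ ℂ).inner_map_map (hc2.toLp _)
    ((Lp.fourierTransformₗᵢ ℝ ℂ).symm (hg.toLp g))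
  rw [LinearIsometryEquiv.apply_symm_apply] at key
  rw [L2.inner_def, L2.inner_def] at key
  have k1 : ∫ z, g z * ft f z = ∫ a, inner ℂ
      ((Lp.fourierTransformₗᵢ ℝ ℂ (hc2.toLp _) : Lp ℂ 2 (volume : Measure ℝ)) a)
      ((hg.toLp g) a) := by
    apply integral_congr_ae
    filter_upwards [coeFn_fourier_toLp hc1 hc2, hg.coeFn_toLp] with z h1 h3
    rw [h3, hft, RCLike.inner_apply]
    congr 2; exact h1.symm
  rw [k1, key]
  have := Measure.integral_comp_mul_left (fun s : ℝ => l2ft hg s * f s) (2 * Real.pi)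
  rw [abs_of_pos (by positivity), eq_inv_smul_iff₀ hpi, ← integral_smul] at this
  rw [← this]
  apply integral_congr_ae
  filter_upwards [hc2.coeFn_toLp] with w hw
  rw [hw, RCLike.inner_apply]
  simp only [l2ft, hF, map_mul, Complex.conj_conj, Complex.real_smul, Complex.conj_ofReal]
  rw [mul_div_cancel_left₀ _ hpi]
  have : (Lp.fourierTransformₗᵢ ℝ ℂ).symm (hg.toLp g) = 𝓕⁻ (hg.toLp g) := rfl
  rw [this]; ring

/-- The inverse transform of `r` is integrable as well as square integrable, so its pointwise
transform agrees almost everywhere with the L² transform, which inverts exactly. No continuity of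
`r` is needed. -/
theorem ft_inversion {r : ℝ → ℂ} (h1 : Integrable r) (h2 : MemLp r 2) (h : Integrable (ft r)) :
    ∀ᵐ z, r z = (1 / (2 * Real.pi) : ℝ) * ft (ft r) (-z) := by
  have hpi : (2 * Real.pi) ≠ 0 := by positivity
  have e0 : (𝓕⁻ r : ℝ → ℂ) = fun w => ft r (2 * Real.pi * w) := funext (fourierInv_eq_ft r)
  have hi : Integrable (𝓕⁻ r : ℝ → ℂ) := by rw [e0]; exact h.comp_mul_left' hpi
  have hl : MemLp (𝓕⁻ r : ℝ → ℂ) 2 :=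
    (memLp_congr_ae (coeFn_fourierInv_toLp h1 h2)).1 (Lp.memLp _)
  have hl' : hl.toLp _ = 𝓕⁻ (h2.toLp r) := by
    apply Lp.ext
    exact hl.coeFn_toLp.trans (coeFn_fourierInv_toLp h1 h2).symm
  have := coeFn_fourier_toLp hi hl
  rw [hl', FourierTransform.fourier_fourierInv_eq] at this
  filter_upwards [this, h2.coeFn_toLp] with z hz hz2
  rw [← hz2, hz, e0, fourier_eq_ft]
  unfold ft
  have := Measure.integral_comp_mul_left
    (fun s : ℝ => Complex.exp (Complex.I * (-z : ℝ) * s) * ∫ (z : ℝ), Complex.exp (Complex.I * s * z) * r z)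
    (2 * Real.pi)
  rw [abs_of_pos (by positivity)] at this
  rw [one_div, ← Complex.real_smul, ← this]
  congr 1; ext w
  congr 2; push_cast; ring

theorem hasDerivAt_ft {f : ℝ → ℂ} (hf : Integrable f) (hf' : Integrable fun z : ℝ => (z : ℂ) * f z)
    (s : ℝ) : HasDerivAt (ft f) (ft (fun z : ℝ => Complex.I * z * f z) s) s := by
  have h := Real.hasDerivAt_fourier hf (by simpa [Complex.real_smul] using hf')
    (-(s / (2 * Real.pi)))
  have hc : HasDerivAt (fun s : ℝ => -(s / (2 * Real.pi))) (-(1 / (2 * Real.pi))) s :=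
    ((hasDerivAt_id s).div_const _).neg
  have h3 := HasDerivAt.scomp s h hc
  have e : 𝓕 f ∘ (fun s : ℝ => -(s / (2 * Real.pi))) = ft f := by
    ext s; simp [ft_eq_fourier]
  rw [e] at h3
  refine h3.congr_deriv ?_
  rw [ft_eq_fourier, Real.fourier_eq', Real.fourier_eq', ← integral_smul]
  congr 1; ext z
  simp only [smul_eq_mul, Complex.real_smul]
  have : (Real.pi : ℂ) ≠ 0 := by exact_mod_cast Real.pi_ne_zero
  push_cast
  field_simp

/-! ### Weak derivatives in the frequency variable -/

theorem weakDeriv_test_complex {r g ψ : ℝ → ℂ} (h : IsWeakDeriv univ r g)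
    (hψ : ContDiff ℝ ∞ ψ) (hc : HasCompactSupport ψ) :
    ∫ x, deriv ψ x * r x = -∫ x, ψ x * g x := by
  obtain ⟨hr, hg, ht⟩ := h
  rw [locallyIntegrableOn_univ] at hr hg
  simp only [Measure.restrict_univ] at ht
  have hd : ∀ x, DifferentiableAt ℝ ψ x := fun x => (hψ.differentiable (by simp)) x
  have c1 : ContDiff ℝ ∞ (fun x => (ψ x).re) := Complex.reCLM.contDiff.comp hψ
  have c2 : ContDiff ℝ ∞ (fun x => (ψ x).im) := Complex.imCLM.contDiff.comp hψ
  have s1 : HasCompactSupport (fun x => (ψ x).re) := hc.comp_left (g := Complex.re) (by simp)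
  have s2 : HasCompactSupport (fun x => (ψ x).im) := hc.comp_left (g := Complex.im) (by simp)
  have t1 := ht _ c1 s1 (subset_univ _)
  have t2 := ht _ c2 s2 (subset_univ _)
  have d1 : ∀ x, deriv (fun x => (ψ x).re) x = (deriv ψ x).re := fun x =>
    (Complex.reCLM.hasFDerivAt.comp_hasDerivAt x (hd x).hasDerivAt).deriv
  have d2 : ∀ x, deriv (fun x => (ψ x).im) x = (deriv ψ x).im := fun x =>
    (Complex.imCLM.hasFDerivAt.comp_hasDerivAt x (hd x).hasDerivAt).deriv
  have cd : Continuous (deriv ψ) := hψ.continuous_deriv (by simp)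
  have key : ∀ (k : ℝ → ℝ) (f : ℝ → ℂ), LocallyIntegrable f → Continuous k →
      HasCompactSupport k → Integrable fun x => (k x : ℂ) * f x := fun k f hf hk hk' => by
    simpa [Complex.real_smul] using hf.integrable_smul_left_of_hasCompactSupport hk hk'
  have sd := hc.deriv
  have e1 : ∀ x, deriv ψ x * r x = ((deriv (fun x => (ψ x).re) x : ℝ) : ℂ) * r x
      + Complex.I * (((deriv (fun x => (ψ x).im) x : ℝ) : ℂ) * r x) := fun x => by
    rw [d1, d2]; nth_rewrite 1 [← Complex.re_add_im (deriv ψ x)]; ring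
  have e2 : ∀ x, ψ x * g x = (((ψ x).re : ℝ) : ℂ) * g x
      + Complex.I * (((ψ x).im : ℂ) * g x) := fun x => by
    nth_rewrite 1 [← Complex.re_add_im (ψ x)]; ring
  simp_rw [e1, e2]
  rw [integral_add, integral_add, integral_const_mul, integral_const_mul, t1, t2]
  · ring
  · exact key _ _ hg c1.continuous s1
  · exact (key _ _ hg c2.continuous s2).const_mul _
  · exact key _ _ hr (c1.continuous_deriv (by simp)) s1.deriv
  · exact (key _ _ hr (c2.continuous_deriv (by simp)) s2.deriv).const_mul _

theorem memLp_mul_integrable {f g : ℝ → ℂ} {μ : Measure ℝ} (hf : MemLp f 2 μ) (hg : MemLp g 2 μ) :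
    Integrable (fun x => f x * g x) μ :=
  hf.integrable_mul hg

/-- Test with χ(x/(n+1)) ψ. The derivative of the cut-off is O(1/n), and products of L² functions
dominate both integrals. -/
theorem weakDeriv_test_L2 {r g ψ : ℝ → ℂ} (h : IsWeakDeriv univ r g) (hr : MemLp r 2)
    (hg : MemLp g 2) (hψ : ContDiff ℝ ∞ ψ) (h1 : MemLp ψ 2) (h2 : MemLp (deriv ψ) 2) :
    ∫ x, deriv ψ x * r x = -∫ x, ψ x * g x := by
  let χ : ContDiffBump (0 : ℝ) := ⟨1, 2, by norm_num, by norm_num⟩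
  have hχ : ContDiff ℝ ∞ (χ : ℝ → ℝ) := χ.contDiff
  have hχd : Continuous (deriv (χ : ℝ → ℝ)) := hχ.continuous_deriv (by simp)
  obtain ⟨C, hC⟩ := hχd.bounded_above_of_compact_support χ.hasCompactSupport.deriv
  let X : ℕ → ℝ → ℂ := fun n x => ((χ (x / (n + 1)) : ℝ) : ℂ)
  have hX : ∀ n x, HasDerivAt (X n) ((deriv χ (x / (n + 1)) * (1 / ((n : ℝ) + 1)) : ℝ) : ℂ) x := by
    intro n x
    have a : HasDerivAt (fun x : ℝ => x / ((n : ℝ) + 1)) (1 / ((n : ℝ) + 1)) x :=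
      (hasDerivAt_id x).div_const _
    have b := ((hχ.differentiable (by simp)) (x / (n + 1))).hasDerivAt
    exact (b.comp x a).ofReal_comp
  have hXs : ∀ n, ContDiff ℝ ∞ (X n) := fun n =>
    Complex.ofRealCLM.contDiff.comp (hχ.comp (contDiff_id.div_const _))
  have hXc : ∀ n, HasCompactSupport (X n) := fun n => by
    have : HasCompactSupport (fun x : ℝ => χ (x / (n + 1))) := by
      have := χ.hasCompactSupport.comp_homeomorph
        (Homeomorph.mulRight₀ ((n : ℝ) + 1)⁻¹ (by positivity))
      simpa [Function.comp_def, div_eq_mul_inv] using this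
    exact this.comp_left (g := ((↑) : ℝ → ℂ)) (by simp)
  have hX1 : ∀ n x, ‖X n x‖ ≤ 1 := fun n x => by
    simp only [X, Complex.norm_real, Real.norm_eq_abs]
    rw [abs_of_nonneg χ.nonneg]; exact χ.le_one
  have hXl : ∀ x, ∀ᶠ n in atTop, X n x = 1 := fun x => by
    filter_upwards [eventually_ge_atTop ⌈|x|⌉₊] with n hn
    have : |x| ≤ n := (Nat.le_ceil _).trans (by exact_mod_cast hn)
    have hm : x / (n + 1) ∈ Metric.closedBall (0 : ℝ) χ.rIn := by
      rw [mem_closedBall_zero_iff, Real.norm_eq_abs, abs_div, abs_of_pos (by positivity : (0:ℝ) < n + 1)]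
      change _ ≤ (1 : ℝ)
      rw [div_le_one (by positivity)]; linarith
    simp only [X]; rw [χ.one_of_mem_closedBall hm]; simp
  have hd : ∀ n x, deriv (fun y => X n y * ψ y) x
      = ((deriv χ (x / (n + 1)) * (1 / ((n : ℝ) + 1)) : ℝ) : ℂ) * ψ x + X n x * deriv ψ x :=
    fun n x => ((hX n x).mul ((hψ.differentiable (by simp)) x).hasDerivAt).deriv
  have hn : ∀ n, ∫ x, deriv (fun y => X n y * ψ y) x * r x = -∫ x, X n x * ψ x * g x := fun n =>
    weakDeriv_test_complex h ((hXs n).mul hψ) (hXc n).mul_right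
  have l1 : Tendsto (fun n => ∫ x, deriv (fun y => X n y * ψ y) x * r x) atTop
      (𝓝 (∫ x, deriv ψ x * r x)) := by
    apply tendsto_integral_of_dominated_convergence
      (fun x => C * ‖ψ x * r x‖ + ‖deriv ψ x * r x‖)
    · intro n
      refine AEStronglyMeasurable.mul ?_ hr.1
      exact (((hXs n).mul hψ).continuous_deriv (by simp)).aestronglyMeasurable
    · exact ((memLp_mul_integrable h1 hr).norm.const_mul _).add (memLp_mul_integrable h2 hr).norm
    · intro n
      refine ae_of_all _ fun x => ?_
      rw [hd, add_mul]
      refine (norm_add_le _ _).trans (add_le_add ?_ ?_)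
      · rw [mul_assoc, norm_mul]
        refine mul_le_mul_of_nonneg_right ?_ (norm_nonneg _)
        rw [Complex.norm_real, norm_mul]
        have : ‖1 / ((n : ℝ) + 1)‖ ≤ 1 := by
          rw [Real.norm_of_nonneg (by positivity), div_le_one (by positivity)]; linarith [n.cast_nonneg (α := ℝ)]
        calc _ ≤ C * 1 := mul_le_mul (hC _) this (norm_nonneg _) ((norm_nonneg _).trans (hC 0))
          _ = C := mul_one _
      · rw [mul_assoc, norm_mul]
        exact mul_le_of_le_one_left (norm_nonneg _) (hX1 n x)
    · refine ae_of_all _ fun x => ?_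
      simp_rw [hd]
      refine Tendsto.mul_const _ ?_
      have a1 : Tendsto (fun n : ℕ => ((deriv χ (x / (n + 1)) * (1 / ((n : ℝ) + 1)) : ℝ) : ℂ))
          atTop (𝓝 0) := by
        rw [← Complex.ofReal_zero]
        refine (Complex.continuous_ofReal.tendsto _).comp ?_
        refine squeeze_zero_norm (a := fun n : ℕ => C * (1 / ((n : ℝ) + 1))) (fun n => ?_) ?_
        · rw [norm_mul, Real.norm_of_nonneg (by positivity : 0 ≤ 1 / ((n : ℝ) + 1))]
          exact mul_le_mul_of_nonneg_right (hC _) (by positivity)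
        · simpa using tendsto_one_div_add_atTop_nhds_zero_nat.const_mul C
      have a2 : Tendsto (fun n : ℕ => X n x) atTop (𝓝 1) :=
        tendsto_const_nhds.congr' ((hXl x).mono fun n hn => hn.symm)
      simpa using (a1.mul_const (ψ x)).add (a2.mul_const (deriv ψ x))
  have l2 : Tendsto (fun n => ∫ x, X n x * ψ x * g x) atTop (𝓝 (∫ x, ψ x * g x)) := by
    apply tendsto_integral_of_dominated_convergence (fun x => ‖ψ x * g x‖)
    · intro n
      exact ((hXs n).continuous.aestronglyMeasurable.mul h1.1).mul hg.1
    · exact (memLp_mul_integrable h1 hg).norm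
    · intro n
      refine ae_of_all _ fun x => ?_
      rw [mul_assoc, norm_mul]
      exact mul_le_of_le_one_left (norm_nonneg _) (hX1 n x)
    · refine ae_of_all _ fun x => ?_
      have a2 : Tendsto (fun n : ℕ => X n x) atTop (𝓝 1) :=
        tendsto_const_nhds.congr' ((hXl x).mono fun n hn => hn.symm)
      simpa using (a2.mul_const (ψ x)).mul_const (g x)
  simp_rw [hn] at l1
  exact tendsto_nhds_unique l1 l2.neg

/-- Duality moves both transforms onto a bump φ. What remains is the weak derivative identity tested
with `ft φ`, which has no compact support but lies in L² together with its derivative. -/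
theorem l2ft_weakDeriv {r g : ℝ → ℂ} (h : IsWeakDeriv univ r g) (hr1 : Integrable r)
    (hr : MemLp r 2) (hg : MemLp g 2) :
    l2ft hg =ᵐ[volume] fun s => -(Complex.I * s) * ft r s := by
  apply ae_eq_of_integral_contDiff_smul_eq
  · exact (memLp_l2ft hg).locallyIntegrable (by norm_num)
  · exact (Continuous.mul (by fun_prop) (continuous_ft hr1)).locallyIntegrable
  · intro φ hφ hc
    have hs : HasCompactSupport (fun x => (φ x : ℂ)) := hc.comp_left (g := ((↑) : ℝ → ℂ)) (by simp)
    have hφc : Continuous (fun x => (φ x : ℂ)) := Complex.continuous_ofReal.comp hφ.continuous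
    have hφ1 : Integrable (fun x => (φ x : ℂ)) := hφc.integrable_of_hasCompactSupport hs
    have hφ2 : MemLp (fun x => (φ x : ℂ)) 2 := hφc.memLp_of_hasCompactSupport hs
    have hzs : HasCompactSupport (fun x : ℝ => Complex.I * x * (φ x : ℂ)) := hs.mul_left
    have hz1 : Integrable (fun x : ℝ => Complex.I * x * (φ x : ℂ)) :=
      (Continuous.mul (by fun_prop) hφc).integrable_of_hasCompactSupport hzs
    have hz2 : MemLp (fun x : ℝ => Complex.I * x * (φ x : ℂ)) 2 :=
      (Continuous.mul (by fun_prop) hφc).memLp_of_hasCompactSupport hzs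
    have hz3 : Integrable (fun x : ℝ => (x : ℂ) * (φ x : ℂ)) :=
      (Continuous.mul (by fun_prop) hφc).integrable_of_hasCompactSupport hs.mul_left
    let G : 𝓢(ℝ, ℂ) := hs.toSchwartzMap (Complex.ofRealCLM.contDiff.comp hφ)
    have hsm : ContDiff ℝ ∞ (ft fun x => (φ x : ℂ)) := by
      have : (ft fun x => (φ x : ℂ)) = fun s => (𝓕⁻ G : 𝓢(ℝ, ℂ)) (s / (2 * Real.pi)) := by
        ext s; rw [ft_eq_fourierInv, SchwartzMap.fourierInv_coe]; rfl
      rw [this]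
      exact ((𝓕⁻ G : 𝓢(ℝ, ℂ)).smooth _).comp (contDiff_id.div_const _)
    have hder : deriv (ft fun x => (φ x : ℂ)) = ft fun x => Complex.I * x * (φ x : ℂ) :=
      funext fun s => (hasDerivAt_ft hφ1 hz3 s).deriv
    have key := weakDeriv_test_L2 h hr hg hsm (memLp_ft hφ1 hφ2) (hder ▸ memLp_ft hz1 hz2)
    rw [hder, integral_ft_mul hz1 hr1] at key
    have k2 := integral_l2ft_mul hg hφ1 hφ2
    calc ∫ x, φ x • l2ft hg x = ∫ x, l2ft hg x * φ x := by
          congr 1; ext x; rw [Complex.real_smul, mul_comm]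
      _ = ∫ x, ft (fun x => (φ x : ℂ)) x * g x := by rw [k2]; congr 1; ext x; ring
      _ = ∫ x, -(Complex.I * x * φ x * ft r x) := by rw [integral_neg, key, neg_neg]
      _ = _ := by congr 1; ext x; rw [Complex.real_smul]; ring

/-! ### From scattering data to the kernel φ -/

theorem weighted_one (f : ℝ → ℂ) : weighted 1 f = fun x : ℝ => ((√(1 + x ^ 2) : ℝ) : ℂ) * f x := by
  ext x; simp [weighted]

theorem weighted_zero (f : ℝ → ℂ) : weighted 0 f = f := by
  ext x; simp [weighted]

theorem one_le_bracket (x : ℝ) : 1 ≤ √(1 + x ^ 2) := by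
  rw [Real.one_le_sqrt]; nlinarith [sq_nonneg x]

theorem abs_le_bracket (x : ℝ) : |x| ≤ √(1 + x ^ 2) := by
  apply Real.abs_le_sqrt; linarith

theorem bracket_le (x : ℝ) : √(1 + x ^ 2) ≤ 1 + |x| := by
  apply Real.sqrt_le_iff.2 ⟨by positivity, ?_⟩
  nlinarith [sq_abs x, abs_nonneg x]

theorem memLp_bracket_inv : MemLp (fun x : ℝ => (((√(1 + x ^ 2))⁻¹ : ℝ) : ℂ)) 2 := by
  have hc : Continuous fun x : ℝ => (((√(1 + x ^ 2))⁻¹ : ℝ) : ℂ) := by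
    refine Complex.continuous_ofReal.comp (Continuous.inv₀ (by fun_prop) fun x => ?_)
    linarith [one_le_bracket x]
  rw [memLp_two_iff_integrable_sq_norm hc.aestronglyMeasurable]
  refine integrable_inv_one_add_sq.congr (ae_of_all _ fun x => ?_)
  simp only [Complex.norm_real, norm_inv, inv_pow]
  rw [Real.norm_of_nonneg (Real.sqrt_nonneg _), Real.sq_sqrt (by positivity)]

theorem eLpNorm_le_ofReal_iff {f : ℝ → ℂ} {μ : Measure ℝ} {N : ℝ} (hf : MemLp f 2 μ) (hN : 0 ≤ N) :
    eLpNorm f 2 μ ≤ ENNReal.ofReal N ↔ (eLpNorm f 2 μ).toReal ≤ N :=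
  ENNReal.le_ofReal_iff_toReal_le hf.eLpNorm_ne_top hN

/-- Integrability of `r` is Cauchy–Schwarz for ⟨x⟩⁻¹ and ⟨x⟩r; it allows the pointwise transform
`ft` to be used beside the L² one. -/
theorem MemData.spec {r : ℝ → ℂ} (h : MemData r) :
    Integrable r ∧ MemLp r 2 ∧ MemLp (fun z : ℝ => (z : ℂ) * r z) 2 ∧
    IsWeakDeriv univ r (weakDeriv univ r) ∧ MemLp (weakDeriv univ r) 2 ∧
    eLpNorm r 2 volume ≤ ENNReal.ofReal (normData r) ∧
    eLpNorm (fun z : ℝ => (z : ℂ) * r z) 2 volume ≤ ENNReal.ofReal (normData r) ∧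
    eLpNorm (weakDeriv univ r) 2 volume ≤ ENNReal.ofReal (normData r) := by
  obtain ⟨⟨h0, hd, hd2⟩, h1⟩ := h
  simp only [MemH, MemL2, weighted_zero, Measure.restrict_univ] at h0 hd2 h1
  have hn0 : 0 ≤ normData r := add_nonneg (Real.sqrt_nonneg _) (Real.sqrt_nonneg _)
  have b1 : normH univ 1 0 r ≤ normData r := le_add_of_nonneg_right (Real.sqrt_nonneg _)
  have b2 : normH univ 0 1 r ≤ normData r := le_add_of_nonneg_left (Real.sqrt_nonneg _)
  have c1 : (eLpNorm r 2 volume).toReal ≤ normH univ 1 0 r := by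
    simp only [normH, sqNormH, normL2, weighted_zero, Measure.restrict_univ]
    exact Real.le_sqrt_of_sq_le (le_add_of_nonneg_right (sq_nonneg _))
  have c2 : (eLpNorm (weakDeriv univ r) 2 volume).toReal ≤ normH univ 1 0 r := by
    simp only [normH, sqNormH, normL2, weighted_zero, Measure.restrict_univ]
    exact Real.le_sqrt_of_sq_le (le_add_of_nonneg_left (sq_nonneg _))
  have c3 : (eLpNorm (weighted 1 r) 2 volume).toReal ≤ normH univ 0 1 r := by
    simp only [normH, sqNormH, normL2, Measure.restrict_univ]
    exact Real.le_sqrt_of_sq_le le_rfl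
  have hle : ∀ z : ℝ, ‖(z : ℂ) * r z‖ ≤ ‖weighted 1 r z‖ := fun z => by
    rw [weighted_one, norm_mul, norm_mul, Complex.norm_real, Complex.norm_real, Real.norm_eq_abs,
      Real.norm_of_nonneg (Real.sqrt_nonneg _)]
    exact mul_le_mul_of_nonneg_right (abs_le_bracket z) (norm_nonneg _)
  have hz : MemLp (fun z : ℝ => (z : ℂ) * r z) 2 :=
    h1.mono ((Complex.continuous_ofReal.aestronglyMeasurable).mul h0.1) (ae_of_all _ hle)
  refine ⟨?_, h0, hz, ?_, hd2, ?_, ?_, ?_⟩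
  · refine (memLp_mul_integrable memLp_bracket_inv h1).congr (ae_of_all _ fun x => ?_)
    simp only [weighted_one]
    rw [← mul_assoc, ← Complex.ofReal_mul, inv_mul_cancel₀
      (by linarith [one_le_bracket x])]
    simp
  · rw [weakDeriv, dif_pos hd]; exact hd.choose_spec
  · exact (eLpNorm_le_ofReal_iff h0 hn0).2 (c1.trans b1)
  · refine (eLpNorm_mono hle).trans ((eLpNorm_le_ofReal_iff h1 hn0).2 (c3.trans b2))
  · exact (eLpNorm_le_ofReal_iff hd2 hn0).2 (c2.trans b1)

/-- `φ` is twice weakly differentiable with derivatives `φ₁`, `φ₂`, and `φ`, `s φ`, `φ₁`, `s φ₁`,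
`φ₂` have `L²` norm at most `N`. -/
structure IsKernel (N : ℝ) (φ φ₁ φ₂ : ℝ → ℂ) : Prop where
  nonneg : 0 ≤ N
  hasDeriv : ∀ t, HasDerivAt φ (φ₁ t) t
  cont : Continuous φ₁
  ftc : ∀ s t, ∫ x in s..t, φ₂ x = φ₁ t - φ₁ s
  mem0 : MemLp φ 2
  mem0' : MemLp (fun s : ℝ => (s : ℂ) * φ s) 2
  mem1 : MemLp φ₁ 2
  mem1' : MemLp (fun s : ℝ => (s : ℂ) * φ₁ s) 2
  mem2 : MemLp φ₂ 2
  le0 : eLpNorm φ 2 volume ≤ ENNReal.ofReal N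
  le0' : eLpNorm (fun s : ℝ => (s : ℂ) * φ s) 2 volume ≤ ENNReal.ofReal N
  le1 : eLpNorm φ₁ 2 volume ≤ ENNReal.ofReal N
  le1' : eLpNorm (fun s : ℝ => (s : ℂ) * φ₁ s) 2 volume ≤ ENNReal.ofReal N
  le2 : eLpNorm φ₂ 2 volume ≤ ENNReal.ofReal N

/-- The transform of izr is only an L² function, so differentiation under the transform is stated in
integrated form. It follows by pairing with the indicator of an interval, whose transform is
(e^{itz} − e^{isz})/(iz). -/
theorem integral_l2ft_I_mul {r : ℝ → ℂ} (h1 : Integrable r)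
    (hz : MemLp (fun z : ℝ => Complex.I * z * r z) 2) (s t : ℝ) :
    ∫ x in s..t, l2ft hz x = ft r t - ft r s := by
  wlog hst : s ≤ t generalizing s t
  · rw [intervalIntegral.integral_symm, this t s (le_of_not_ge hst)]; ring
  set e : ℝ → ℂ := (Ioc s t).indicator fun _ => 1 with he
  have hfin : volume (Ioc s t) ≠ ⊤ := by simp
  have e1 : Integrable e := (integrable_indicator_iff measurableSet_Ioc).2 (integrableOn_const hfin)
  have e2 : MemLp e 2 := memLp_indicator_const 2 measurableSet_Ioc 1 (Or.inr hfin)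
  have key := integral_l2ft_mul hz e1 e2
  have hft : ∀ z : ℝ, Complex.I * z * ft e z = Complex.exp (Complex.I * t * z)
      - Complex.exp (Complex.I * s * z) := fun z => by
    have h0 : ft e z = ∫ x in s..t, Complex.exp (Complex.I * z * x) := by
      rw [intervalIntegral.integral_of_le hst, ← integral_indicator measurableSet_Ioc]
      unfold ft; congr 1; ext x
      simp only [he, indicator]; split_ifs <;> simp
    rw [h0, ← intervalIntegral.integral_const_mul]
    have hd : ∀ x : ℝ, HasDerivAt (fun x : ℝ => Complex.exp (Complex.I * z * x))
        (Complex.I * z * Complex.exp (Complex.I * z * x)) x := fun x => by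
      have := (((hasDerivAt_id (x : ℂ)).const_mul (Complex.I * z)).cexp).comp_ofReal
      refine this.congr_deriv ?_
      simp; ring
    rw [intervalIntegral.integral_eq_sub_of_hasDerivAt (fun x _ => hd x)
      (Continuous.intervalIntegrable (by fun_prop) _ _)]
    congr 2 <;> ring
  rw [intervalIntegral.integral_of_le hst, ← integral_indicator measurableSet_Ioc]
  calc _ = ∫ x, l2ft hz x * e x := by
        congr 1; ext x; simp only [he, indicator]; split_ifs <;> simp
    _ = ∫ z : ℝ, (Complex.exp (Complex.I * t * z) * r z - Complex.exp (Complex.I * s * z) * r z) := by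
        rw [key]; congr 1; ext z
        rw [← sub_mul, ← hft]; ring
    _ = _ := integral_sub (integrable_cexp_mul h1 t) (integrable_cexp_mul h1 s)

theorem l2ft_sub {f g : ℝ → ℂ} (hf : MemLp f 2) (hg : MemLp g 2) :
    l2ft (hf.sub hg) =ᵐ[volume] fun s => l2ft hf s - l2ft hg s := by
  have e : (Lp.fourierTransformₗᵢ ℝ ℂ).symm ((hf.sub hg).toLp _)
      = (Lp.fourierTransformₗᵢ ℝ ℂ).symm (hf.toLp _) - (Lp.fourierTransformₗᵢ ℝ ℂ).symm (hg.toLp _) := by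
    rw [← map_sub]; rfl
  have h := quasiMeasurePreserving_div_two_pi.ae
    (Lp.coeFn_sub ((Lp.fourierTransformₗᵢ ℝ ℂ).symm (hf.toLp _))
      ((Lp.fourierTransformₗᵢ ℝ ℂ).symm (hg.toLp _)))
  filter_upwards [h] with s hs
  rw [← e] at hs
  exact hs

/-- The prefactors 1/(2π) and i/(8π) absorb the Plancherel constant √(2π), so that the kernel bounds
carry no further constant. -/
theorem eLpNorm_const_mul_le {f : ℝ → ℂ} {N : ℝ} (c : ℂ)
    (h : eLpNorm f 2 volume ≤ ENNReal.ofReal √(2 * Real.pi) * ENNReal.ofReal N)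
    (hc : ‖c‖ ≤ 1 / (2 * Real.pi)) :
    eLpNorm (fun s => c * f s) 2 volume ≤ ENNReal.ofReal N := by
  have : (fun s => c * f s) = c • f := rfl
  rw [this, eLpNorm_const_smul]
  have hp : (1 : ℝ) ≤ 2 * Real.pi := by linarith [Real.pi_gt_three]
  have hs : ‖c‖ₑ * ENNReal.ofReal √(2 * Real.pi) ≤ 1 := by
    rw [← ofReal_norm, ← ENNReal.ofReal_mul (norm_nonneg _), ENNReal.ofReal_le_one]
    have h1 : √(2 * Real.pi) ≤ 2 * Real.pi := by
      rw [Real.sqrt_le_left (by linarith)]; nlinarith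
    calc ‖c‖ * √(2 * Real.pi) ≤ 1 / (2 * Real.pi) * (2 * Real.pi) := by gcongr
      _ = 1 := by field_simp
  calc _ ≤ ‖c‖ₑ * (ENNReal.ofReal √(2 * Real.pi) * ENNReal.ofReal N) := by gcongr
    _ = (‖c‖ₑ * ENNReal.ofReal √(2 * Real.pi)) * ENNReal.ofReal N := by ring
    _ ≤ 1 * ENNReal.ofReal N := by gcongr
    _ = _ := one_mul _

theorem memLp_I_mul {r : ℝ → ℂ} (h : MemLp (fun z : ℝ => (z : ℂ) * r z) 2) :
    MemLp (fun z : ℝ => Complex.I * z * r z) 2 := by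
  simpa [mul_assoc] using h.const_mul Complex.I

theorem memLp_mul_ft {r : ℝ → ℂ} (h : MemData r) :
    MemLp (fun s : ℝ => (s : ℂ) * ft r s) 2 ∧
    eLpNorm (fun s : ℝ => (s : ℂ) * ft r s) 2 volume
      ≤ ENNReal.ofReal √(2 * Real.pi) * ENNReal.ofReal (normData r) := by
  obtain ⟨i1, m0, m1, wd, m2, n0, n1, n2⟩ := h.spec
  have e := l2ft_weakDeriv wd i1 m0 m2
  have e2 : (fun s : ℝ => (s : ℂ) * ft r s) =ᵐ[volume] fun s => Complex.I * l2ft m2 s := by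
    filter_upwards [e] with s hs
    rw [hs]; linear_combination (s * ft r s) * Complex.I_sq
  constructor
  · exact (memLp_congr_ae e2).2 ((memLp_l2ft m2).const_mul _)
  · rw [eLpNorm_congr_ae e2]
    have : (fun s => Complex.I * l2ft m2 s) = Complex.I • l2ft m2 := rfl
    rw [this, eLpNorm_const_smul, eLpNorm_l2ft]
    simp only [enorm_eq_nnnorm, Complex.nnnorm_I, ENNReal.coe_one, one_mul]
    gcongr

/-- Multiplication by z is differentiation of φ: since z r₊ = r₋/4, the derivative of ft r₊/(2π) is
(i/8π) ft r₋. The weight on r₋ supplies one more derivative, and the weak derivatives of r₊ and r₋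
in z supply the weights s. -/
theorem isKernel_of_data {rp rm : ℝ → ℂ} (hp : MemData rp) (hm : MemData rm)
    (hrel : ∀ᵐ z : ℝ, rm z = 4 * (z : ℂ) * rp z) :
    IsKernel (normData rp + normData rm) (fun s => (1 / (2 * Real.pi) : ℂ) * ft rp s)
      (fun s => (Complex.I / (8 * Real.pi) : ℂ) * ft rm s)
      (fun s => (Complex.I / (8 * Real.pi) : ℂ) * l2ft (memLp_I_mul hm.spec.2.2.1) s) := by
  obtain ⟨i1, m0, m1, wd, m2, n0, n1, n2⟩ := hp.spec
  obtain ⟨i1', m0', m1', wd', m2', n0', n1', n2'⟩ := hm.spec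
  have a1 : 0 ≤ normData rp := add_nonneg (Real.sqrt_nonneg _) (Real.sqrt_nonneg _)
  have a2 : 0 ≤ normData rm := add_nonneg (Real.sqrt_nonneg _) (Real.sqrt_nonneg _)
  have l1 : ENNReal.ofReal (normData rp) ≤ ENNReal.ofReal (normData rp + normData rm) :=
    ENNReal.ofReal_le_ofReal (by linarith)
  have l2 : ENNReal.ofReal (normData rm) ≤ ENNReal.ofReal (normData rp + normData rm) :=
    ENNReal.ofReal_le_ofReal (by linarith)
  have hpi : (Real.pi : ℂ) ≠ 0 := by exact_mod_cast Real.pi_ne_zero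
  have c1 : ‖(1 / (2 * Real.pi) : ℂ)‖ ≤ 1 / (2 * Real.pi) := by
    simp [abs_of_pos Real.pi_pos]
  have c2 : ‖(Complex.I / (8 * Real.pi) : ℂ)‖ ≤ 1 / (2 * Real.pi) := by
    simp only [norm_div, Complex.norm_I, norm_mul, Complex.norm_real, Complex.norm_ofNat,
      Real.norm_of_nonneg Real.pi_pos.le]
    gcongr; norm_num
  have hz : Integrable fun z : ℝ => (z : ℂ) * rp z := by
    refine (i1'.const_mul (1 / 4)).congr ?_
    filter_upwards [hrel] with z hz
    rw [hz]; ring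
  have hI : ∀ s, Complex.I / (8 * Real.pi) * ft rm s
      = 1 / (2 * Real.pi) * ft (fun z : ℝ => Complex.I * z * rp z) s := fun s => by
    unfold ft
    rw [← integral_const_mul, ← integral_const_mul]
    apply integral_congr_ae
    filter_upwards [hrel] with z hz
    rw [hz]; field_simp; ring
  refine ⟨by linarith, ?_, continuous_const.mul (continuous_ft i1'), ?_, (memLp_ft i1 m0).const_mul _,
    ?_, (memLp_ft i1' m0').const_mul _, ?_, (memLp_l2ft _).const_mul _, ?_, ?_, ?_, ?_, ?_⟩
  · intro t
    simp only [hI]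
    exact (hasDerivAt_ft i1 hz t).const_mul _
  · intro s t
    rw [intervalIntegral.integral_const_mul, integral_l2ft_I_mul i1' _ s t]; ring
  · refine ((memLp_mul_ft hp).1.const_mul (1 / (2 * Real.pi) : ℂ)).ae_eq (ae_of_all _ fun s => ?_)
    ring
  · refine ((memLp_mul_ft hm).1.const_mul (Complex.I / (8 * Real.pi) : ℂ)).ae_eq
      (ae_of_all _ fun s => ?_)
    ring
  · refine eLpNorm_const_mul_le _ ?_ c1
    rw [eLpNorm_ft i1 m0]; gcongr; exact n0.trans l1
  · have : (fun s : ℝ => (s : ℂ) * ((1 / (2 * Real.pi) : ℂ) * ft rp s))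
        = fun s : ℝ => (1 / (2 * Real.pi) : ℂ) * ((s : ℂ) * ft rp s) := by ext s; ring
    rw [this]
    refine eLpNorm_const_mul_le _ ((memLp_mul_ft hp).2.trans ?_) c1
    gcongr
  · refine eLpNorm_const_mul_le _ ?_ c2
    rw [eLpNorm_ft i1' m0']; gcongr; exact n0'.trans l2
  · have : (fun s : ℝ => (s : ℂ) * ((Complex.I / (8 * Real.pi) : ℂ) * ft rm s))
        = fun s : ℝ => (Complex.I / (8 * Real.pi) : ℂ) * ((s : ℂ) * ft rm s) := by ext s; ring
    rw [this]
    refine eLpNorm_const_mul_le _ ((memLp_mul_ft hm).2.trans ?_) c2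
    gcongr
  · refine eLpNorm_const_mul_le _ ?_ c2
    rw [eLpNorm_l2ft]; gcongr
    refine le_trans ?_ (n1'.trans l2)
    refine eLpNorm_mono fun z => ?_
    rw [mul_assoc, norm_mul, Complex.norm_I, one_mul]

theorem normData_nonneg (r : ℝ → ℂ) : 0 ≤ normData r :=
  add_nonneg (Real.sqrt_nonneg _) (Real.sqrt_nonneg _)

theorem IsWeakDeriv.sub {Ω : Set ℝ} {f g f' g' : ℝ → ℂ} (h : IsWeakDeriv Ω f g)
    (h' : IsWeakDeriv Ω f' g') :
    IsWeakDeriv Ω (fun x => f x - f' x) (fun x => g x - g' x) := by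
  refine ⟨h.1.sub h'.1, h.2.1.sub h'.2.1, fun φ hφ hc hs => ?_⟩
  have key : ∀ (k : ℝ → ℝ) (f : ℝ → ℂ), LocallyIntegrableOn f Ω → Continuous k →
      HasCompactSupport k → tsupport k ⊆ Ω →
      Integrable (fun x => (k x : ℂ) * f x) (volume.restrict Ω) := fun k f hf hk hk' hks => by
    have h1 : IntegrableOn (fun x => k x • f x) (tsupport k) :=
      (hf.integrableOn_compact_subset hks hk').continuousOn_smul hk.continuousOn hk'
    have h2 : Integrable (fun x => k x • f x) := by
      refine (integrableOn_iff_integrable_of_support_subset ?_).1 h1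
      intro x hx
      exact subset_tsupport _ fun h0 => hx (by simp [h0])
    simp only [Complex.real_smul] at h2
    exact h2.integrableOn
  have hd : Continuous (deriv φ) := hφ.continuous_deriv (by simp)
  have hds : tsupport (deriv φ) ⊆ Ω := 
    (closure_minimal support_deriv_subset (isClosed_tsupport _)).trans hs
  simp_rw [mul_sub]
  rw [integral_sub (key _ _ h.1 hd hc.deriv hds) (key _ _ h'.1 hd hc.deriv hds),
    integral_sub (key _ _ h.2.1 hφ.continuous hc hs) (key _ _ h'.2.1 hφ.continuous hc hs),
    h.2.2 φ hφ hc hs, h'.2.2 φ hφ hc hs]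
  ring

theorem IsWeakDeriv.ae_eq {Ω : Set ℝ} {f g g' : ℝ → ℂ} (hΩ : IsOpen Ω) (h : IsWeakDeriv Ω f g)
    (h' : IsWeakDeriv Ω f g') : g =ᵐ[volume.restrict Ω] g' := by
  have h2 := h.sub h'
  have := hΩ.ae_eq_zero_of_integral_contDiff_smul_eq_zero (f := fun x => g x - g' x) (μ := volume)
    h2.2.1 (fun φ hφ hc hs => by
      have := h2.2.2 φ hφ hc hs
      simp only [sub_self, mul_zero, integral_zero] at this
      rw [eq_comm, neg_eq_zero] at this
      rw [← this, ← integral_indicator hΩ.measurableSet]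
      congr 1; ext x
      by_cases hx : x ∈ Ω
      · simp [hx, Complex.real_smul]
      · have : φ x = 0 := by
          by_contra h0; exact hx (hs (subset_tsupport _ h0))
        simp [hx, this])
  rw [Filter.EventuallyEq, ae_restrict_iff' hΩ.measurableSet]
  filter_upwards [this] with x hx hxΩ
  exact sub_eq_zero.1 (hx hxΩ)

theorem IsWeakDeriv.weakDeriv_ae_eq {Ω : Set ℝ} {f g : ℝ → ℂ} (hΩ : IsOpen Ω)
    (h : IsWeakDeriv Ω f g) : weakDeriv Ω f =ᵐ[volume.restrict Ω] g := by
  have hd : ∃ g, IsWeakDeriv Ω f g := ⟨g, h⟩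
  have : IsWeakDeriv Ω f (weakDeriv Ω f) := by rw [weakDeriv, dif_pos hd]; exact hd.choose_spec
  exact this.ae_eq hΩ h

theorem weighted_sub (m : ℕ) (f g : ℝ → ℂ) :
    weighted m (fun x => f x - g x) = fun x => weighted m f x - weighted m g x := by
  ext x; simp [weighted, mul_sub]

theorem MemData.sub {r r' : ℝ → ℂ} (h : MemData r) (h' : MemData r') :
    MemData fun z => r z - r' z := by
  obtain ⟨_, _, _, wd, _⟩ := h.spec
  obtain ⟨_, _, _, wd', _⟩ := h'.spec
  have hw := wd.sub wd'
  obtain ⟨⟨h0, -, h2⟩, h1⟩ := h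
  obtain ⟨⟨h0', -, h2'⟩, h1'⟩ := h'
  refine ⟨⟨?_, ⟨_, hw⟩, ?_⟩, ?_⟩
  · rw [MemL2, weighted_sub]; exact h0.sub h0'
  · have e := hw.weakDeriv_ae_eq isOpen_univ
    simp only [MemH, MemL2, weighted_zero] at h2 h2' ⊢
    exact (memLp_congr_ae e).2 (h2.sub h2')
  · simp only [MemH]; rw [MemL2, weighted_sub]; exact h1.sub h1'

theorem ft_sub {f g : ℝ → ℂ} (hf : Integrable f) (hg : Integrable g) (s : ℝ) :
    ft (fun z => f z - g z) s = ft f s - ft g s := by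
  unfold ft
  rw [← integral_sub (integrable_cexp_mul hf s) (integrable_cexp_mul hg s)]
  simp_rw [mul_sub]

theorem IsKernel.congr {N : ℝ} {φ φ₁ φ₂ ψ₂ : ℝ → ℂ} (h : IsKernel N φ φ₁ φ₂)
    (e : φ₂ =ᵐ[volume] ψ₂) : IsKernel N φ φ₁ ψ₂ :=
  { h with
    ftc := fun s t => by
      rw [← h.ftc s t]
      exact intervalIntegral.integral_congr_ae (by filter_upwards [e] with x hx _ using hx.symm)
    mem2 := (memLp_congr_ae e).1 h.mem2
    le2 := by rw [← eLpNorm_congr_ae e]; exact h.le2 }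

/-- The passage from data to kernel is linear, so a difference of kernels is the kernel of the
difference. Every Lipschitz estimate below starts here. -/
theorem isKernel_sub_of_data {rp rm rp' rm' : ℝ → ℂ} (hp : MemData rp) (hm : MemData rm)
    (hrel : ∀ᵐ z : ℝ, rm z = 4 * (z : ℂ) * rp z) (hp' : MemData rp') (hm' : MemData rm')
    (hrel' : ∀ᵐ z : ℝ, rm' z = 4 * (z : ℂ) * rp' z) :
    IsKernel (normData (fun z => rp z - rp' z) + normData (fun z => rm z - rm' z))
      (fun s => (1 / (2 * Real.pi) : ℂ) * ft rp s - (1 / (2 * Real.pi) : ℂ) * ft rp' s)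
      (fun s => (Complex.I / (8 * Real.pi) : ℂ) * ft rm s
        - (Complex.I / (8 * Real.pi) : ℂ) * ft rm' s)
      (fun s => (Complex.I / (8 * Real.pi) : ℂ) * l2ft (memLp_I_mul hm.spec.2.2.1) s
        - (Complex.I / (8 * Real.pi) : ℂ) * l2ft (memLp_I_mul hm'.spec.2.2.1) s) := by
  have h := isKernel_of_data (hp.sub hp') (hm.sub hm') (by
    filter_upwards [hrel, hrel'] with z h1 h2
    rw [h1, h2]; ring)
  have e1 : (fun s => (1 / (2 * Real.pi) : ℂ) * ft (fun z => rp z - rp' z) s)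
      = fun s => (1 / (2 * Real.pi) : ℂ) * ft rp s - (1 / (2 * Real.pi) : ℂ) * ft rp' s := by
    ext s; rw [ft_sub hp.spec.1 hp'.spec.1, mul_sub]
  have e2 : (fun s => (Complex.I / (8 * Real.pi) : ℂ) * ft (fun z => rm z - rm' z) s)
      = fun s => (Complex.I / (8 * Real.pi) : ℂ) * ft rm s
        - (Complex.I / (8 * Real.pi) : ℂ) * ft rm' s := by
    ext s; rw [ft_sub hm.spec.1 hm'.spec.1, mul_sub]
  rw [e1, e2] at h
  refine h.congr ?_
  filter_upwards [l2ft_sub (memLp_I_mul hm.spec.2.2.1) (memLp_I_mul hm'.spec.2.2.1)] with s hs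
  rw [← mul_sub, ← hs]
  congr 1
  have : (fun z : ℝ => Complex.I * z * (rm z - rm' z))
    = (fun z : ℝ => Complex.I * z * rm z) - fun z : ℝ => Complex.I * z * rm' z := by
    ext z; simp only [Pi.sub_apply]; ring
  congr 1

/-! ### Translates of a function in L²(0, ∞) -/

/-- The space `L²(0, ∞)`. -/
abbrev HalfL2 : Type := Lp ℂ 2 (volume.restrict (Ioi (0 : ℝ)))

theorem measurePreserving_const_add (t : ℝ) : MeasurePreserving (fun ξ : ℝ => t + ξ) volume volume :=
  measurePreserving_add_left volume t

theorem memLp_shift {f : ℝ → ℂ} (hf : MemLp f 2) (t : ℝ) : MemLp (fun ξ => f (t + ξ)) 2 :=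
  hf.comp_measurePreserving (measurePreserving_const_add t)

theorem eLpNorm_shift {f : ℝ → ℂ} (hf : MemLp f 2) (t : ℝ) :
    eLpNorm (fun ξ => f (t + ξ)) 2 volume = eLpNorm f 2 volume :=
  eLpNorm_comp_measurePreserving hf.1 (measurePreserving_const_add t)

open Classical in
/-- The restriction to the half-line of the translate of `f` by `t`. -/
noncomputable def tr (f : ℝ → ℂ) (t : ℝ) : HalfL2 :=
  if h : MemLp f 2 then ((memLp_shift h t).restrict (Ioi 0)).toLp _ else 0

theorem tr_def {f : ℝ → ℂ} (hf : MemLp f 2) (t : ℝ) :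
    tr f t = ((memLp_shift hf t).restrict (Ioi 0)).toLp _ := by rw [tr, dif_pos hf]

theorem coeFn_tr {f : ℝ → ℂ} (hf : MemLp f 2) (t : ℝ) :
    tr f t =ᵐ[volume.restrict (Ioi 0)] fun ξ => f (t + ξ) := by
  rw [tr_def hf]; exact MemLp.coeFn_toLp _

theorem tr_sub {f g : ℝ → ℂ} (hf : MemLp f 2) (hg : MemLp g 2) (t : ℝ) :
    tr (fun s => f s - g s) t = tr f t - tr g t := by
  have h : MemLp (fun s => f s - g s) 2 := hf.sub hg
  rw [tr_def hf, tr_def hg, tr_def h]; rfl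

theorem norm_tr (f : ℝ → ℂ) (hf : MemLp f 2) (t : ℝ) :
    ‖tr f t‖ = (eLpNorm (fun ξ => f (t + ξ)) 2 (volume.restrict (Ioi 0))).toReal := by
  rw [tr_def hf, Lp.norm_toLp]

theorem norm_tr_le {f : ℝ → ℂ} {N : ℝ} (hf : MemLp f 2) (hN : 0 ≤ N)
    (h : eLpNorm f 2 volume ≤ ENNReal.ofReal N) (t : ℝ) : ‖tr f t‖ ≤ N := by
  rw [norm_tr f hf]
  refine ENNReal.toReal_le_of_le_ofReal hN ?_
  exact (eLpNorm_restrict_le _ _ _ _).trans ((eLpNorm_shift hf t).le.trans h)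

/-- On the half-line the argument t + ξ is at least t, so t ‖tr f t‖ is at most the norm of the
translate of s f(s): the weight becomes decay in t. -/
theorem norm_tr_le_div {f : ℝ → ℂ} {N : ℝ} (hf : MemLp f 2) (hN : 0 ≤ N)
    (h : eLpNorm f 2 volume ≤ ENNReal.ofReal N) (hf' : MemLp (fun s : ℝ => (s : ℂ) * f s) 2)
    (h' : eLpNorm (fun s : ℝ => (s : ℂ) * f s) 2 volume ≤ ENNReal.ofReal N) {t : ℝ} (ht : 0 ≤ t) :
    ‖tr f t‖ ≤ 2 * N / (1 + t) := by
  have h1 := norm_tr_le hf hN h t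
  have h2 := norm_tr_le hf' hN h' t
  have h3 : t * ‖tr f t‖ ≤ ‖tr (fun s : ℝ => (s : ℂ) * f s) t‖ := by
    have : t * ‖tr f t‖ = ‖(t : ℂ) • tr f t‖ := by
      rw [norm_smul, Complex.norm_real, Real.norm_of_nonneg ht]
    rw [this]
    refine Lp.norm_le_norm_of_ae_le ?_
    filter_upwards [coeFn_tr hf t, coeFn_tr hf' t, Lp.coeFn_smul (t : ℂ) (tr f t),
      ae_restrict_mem measurableSet_Ioi] with ξ e1 e2 e3 hξ
    rw [e3, e2, Pi.smul_apply, e1, norm_smul, norm_mul, Complex.norm_real, Complex.norm_real,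
      Real.norm_of_nonneg ht, Real.norm_of_nonneg (add_nonneg ht (le_of_lt hξ))]
    have : t ≤ t + ξ := le_add_of_nonneg_right (le_of_lt hξ)
    gcongr
  rw [le_div_iff₀ (by linarith)]
  linarith

theorem continuous_tr (f : ℝ → ℂ) : Continuous (tr f) := by
  by_cases hf : MemLp f 2
  swap
  · have : tr f = fun _ => 0 := by ext1 t; rw [tr, dif_neg hf]
    rw [this]; exact continuous_const
  let g : ℝ → C(ℝ, ℝ) := fun t => ⟨fun ξ => t + ξ, by fun_prop⟩
  have hg : Continuous g := ContinuousMap.continuous_of_continuous_uncurry _ (by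
    simp only [g, Function.uncurry_def, ContinuousMap.coe_mk]; fun_prop)
  have h1 : Continuous fun t => Lp.compMeasurePreserving (g t) (measurePreserving_const_add t)
      (hf.toLp f) := continuous_const.compMeasurePreservingLp hg _ (by norm_num)
  have h2 := (LpToLpRestrictCLM ℝ ℂ ℂ volume 2 (Ioi 0)).continuous.comp h1
  convert h2 using 1
  ext1 t
  apply Lp.ext
  refine (coeFn_tr hf t).trans ?_
  refine EventuallyEq.trans ?_ (LpToLpRestrictCLM_coeFn ℂ (Ioi 0) _).symm
  refine ae_restrict_of_ae ?_
  refine EventuallyEq.symm ((Lp.coeFn_compMeasurePreserving _ _).trans ?_)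
  exact (measurePreserving_const_add t).quasiMeasurePreserving.ae_eq hf.coeFn_toLp

theorem inner_tr {f : ℝ → ℂ} (hf : MemLp f 2) (t : ℝ) (A : HalfL2) :
    inner ℂ (tr f t) A = ∫ ξ in Ioi 0, conj (f (t + ξ)) * A ξ := by
  rw [L2.inner_def]
  apply integral_congr_ae
  filter_upwards [coeFn_tr hf t] with ξ h
  rw [h, RCLike.inner_apply, mul_comm]

theorem inner_tr' {f : ℝ → ℂ} (hf : MemLp f 2) (t : ℝ) (A : HalfL2) :
    inner ℂ A (tr f t) = ∫ ξ in Ioi 0, conj (A ξ) * f (t + ξ) := by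
  rw [L2.inner_def]
  apply integral_congr_ae
  filter_upwards [coeFn_tr hf t] with ξ h
  rw [h, RCLike.inner_apply, mul_comm]

theorem quasiMeasurePreserving_add :
    Measure.QuasiMeasurePreserving (fun p : ℝ × ℝ => p.1 + p.2) (volume.prod volume) volume :=
  Measure.quasiMeasurePreserving_snd.comp
    (measurePreserving_prod_add volume volume).quasiMeasurePreserving

theorem aestronglyMeasurable_add {f : ℝ → ℂ} (hf : AEStronglyMeasurable f) (s t : Set ℝ) :
    AEStronglyMeasurable (fun p : ℝ × ℝ => f (p.1 + p.2))
      ((volume.restrict s).prod (volume.restrict t)) := by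
  rw [Measure.prod_restrict]
  exact (hf.comp_quasiMeasurePreserving quasiMeasurePreserving_add).restrict

/-- Pairing with a vector and Fubini show that `tr f` is a primitive of `tr g`. Translation is
continuous in L², so the curve `tr g` is continuous even when g is not, and the derivative exists in
norm. -/
theorem hasDerivAt_tr {f g : ℝ → ℂ} (hf : MemLp f 2) (hg : MemLp g 2)
    (h : ∀ s t, ∫ x in s..t, g x = f t - f s) (t : ℝ) : HasDerivAt (tr f) (tr g t) t := by
  have key : ∀ s t, s ≤ t → tr f t - tr f s = ∫ τ in s..t, tr g τ := by
    intro s t hst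
    refine ext_inner_left ℂ fun A => ?_
    have e1 : inner ℂ A (∫ τ in s..t, tr g τ) = ∫ τ in s..t, inner ℂ A (tr g τ) :=
      ((innerSL ℂ A).intervalIntegral_comp_comm
        ((continuous_tr g).intervalIntegrable _ _)).symm
    rw [e1, inner_sub_right, inner_tr' hf, inner_tr' hf]
    simp_rw [inner_tr' hg]
    rw [intervalIntegral.integral_of_le hst]
    have hA := Lp.memLp A
    have hAi : ∀ f : ℝ → ℂ, MemLp f 2 → ∀ τ, IntegrableOn (fun ξ => conj (A ξ) * f (τ + ξ)) (Ioi 0) :=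
      fun f hf τ => memLp_mul_integrable hA.star ((memLp_shift hf τ).restrict _)
    have hint : Integrable (Function.uncurry fun τ ξ : ℝ => conj (A ξ) * g (τ + ξ))
        ((volume.restrict (Ioc s t)).prod (volume.restrict (Ioi 0))) := by
      have hm : AEStronglyMeasurable (Function.uncurry fun τ ξ : ℝ => conj (A ξ) * g (τ + ξ))
        ((volume.restrict (Ioc s t)).prod (volume.restrict (Ioi 0))) :=
        (AEStronglyMeasurable.comp_snd hA.star.1).mul (aestronglyMeasurable_add hg.1 _ _)
      rw [integrable_prod_iff hm]
      refine ⟨ae_of_all _ fun τ => hAi g hg τ, ?_⟩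
      refine Integrable.of_bound hm.norm.integral_prod_right'
        ((∫ ξ in Ioi 0, ‖A ξ‖ ^ 2) + ∫ ξ, ‖g ξ‖ ^ 2) (ae_of_all _ fun τ => ?_)
      rw [Real.norm_of_nonneg (integral_nonneg fun _ => norm_nonneg _)]
      simp only [Function.uncurry]
      have i1 : IntegrableOn (fun ξ => ‖A ξ‖ ^ 2) (Ioi 0) := hA.integrable_norm_pow (by norm_num)
      have i2 : Integrable (fun ξ => ‖g ξ‖ ^ 2) := hg.integrable_norm_pow (by norm_num)
      have i3 : Integrable (fun ξ => ‖g (τ + ξ)‖ ^ 2) := i2.comp_add_left τ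
      calc ∫ ξ in Ioi 0, ‖conj (A ξ) * g (τ + ξ)‖
          ≤ ∫ ξ in Ioi 0, (‖A ξ‖ ^ 2 + ‖g (τ + ξ)‖ ^ 2) := by
            refine integral_mono (hAi g hg τ).norm (i1.add i3.integrableOn) fun ξ => ?_
            simp only [norm_mul, RCLike.norm_conj]
            nlinarith [sq_nonneg (‖A ξ‖ - ‖g (τ + ξ)‖), sq_nonneg ‖A ξ‖, sq_nonneg ‖g (τ + ξ)‖]
        _ = (∫ ξ in Ioi 0, ‖A ξ‖ ^ 2) + ∫ ξ in Ioi 0, ‖g (τ + ξ)‖ ^ 2 :=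
            integral_add i1 i3.integrableOn
        _ ≤ (∫ ξ in Ioi 0, ‖A ξ‖ ^ 2) + ∫ ξ, ‖g (τ + ξ)‖ ^ 2 := by
            gcongr
            · exact ae_of_all _ fun _ => by positivity
            · exact Measure.restrict_le_self
        _ = _ := by rw [integral_add_left_eq_self (fun ξ => ‖g ξ‖ ^ 2) τ]
    rw [integral_integral_swap hint, ← integral_sub (hAi f hf t) (hAi f hf s)]
    congr 1; ext ξ
    rw [integral_const_mul, ← mul_sub]
    congr 1
    rw [← intervalIntegral.integral_of_le hst, intervalIntegral.integral_comp_add_right, h]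
  have key2 : ∀ t, tr f t = tr f 0 + ∫ τ in (0 : ℝ)..t, tr g τ := fun t => by
    rcases le_total 0 t with ht | ht
    · rw [← key 0 t ht]; abel
    · rw [intervalIntegral.integral_symm, ← key t 0 ht]; abel
  have : tr f = fun t => tr f 0 + ∫ τ in (0 : ℝ)..t, tr g τ := funext key2
  rw [this]
  exact ((continuous_tr g).integral_hasStrictDerivAt 0 t).hasDerivAt.const_add _

/-- The integral is the pairing of `tr f t` with the indicator of an interval of length at most one.
-/
theorem integral_tr_eq_inner {f : ℝ → ℂ} (hf : MemLp f 2) {t s : ℝ} (hts : t ≤ s) (hs : s ≤ t + 1) :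
    ‖∫ x in t..s, f x‖ ≤ ‖tr f t‖ := by
  have hfin : (volume.restrict (Ioi (0 : ℝ))) (Ioc 0 (s - t)) ≠ ⊤ :=
    ((Measure.restrict_apply_le _ _).trans_lt (by simp)).ne
  let e : HalfL2 := indicatorConstLp 2 (measurableSet_Ioc (a := (0 : ℝ)) (b := s - t)) hfin (1 : ℂ)
  have he : ‖e‖ ≤ 1 := by
    refine norm_indicatorConstLp_le.trans ?_
    rw [norm_one, one_mul, measureReal_restrict_apply measurableSet_Ioc,
      inter_eq_left.2 (fun x hx => hx.1)]
    simp only [Real.volume_real_Ioc]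
    apply Real.rpow_le_one (by positivity) _ (by positivity)
    rw [max_le_iff]; constructor <;> linarith
  have h1 : inner ℂ e (tr f t) = ∫ x in t..s, f x := by
    rw [L2.inner_indicatorConstLp_one, Measure.restrict_restrict measurableSet_Ioc,
      inter_eq_left.2 (fun x hx => hx.1)]
    have h0 : ∫ x in Ioc 0 (s - t), tr f t x = ∫ x in Ioc 0 (s - t), f (t + x) := by
      refine setIntegral_congr_ae measurableSet_Ioc ?_
      filter_upwards [(ae_restrict_iff' measurableSet_Ioi).1 (coeFn_tr hf t)] with x hx hx'
      exact hx hx'.1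
    rw [h0, ← intervalIntegral.integral_of_le (by linarith),
      intervalIntegral.integral_comp_add_left]
    simp
  rw [← h1]
  exact (norm_inner_le_norm _ _).trans (mul_le_of_le_one_left (norm_nonneg _) he)

/-- A Sobolev embedding with constant one: on (t, t + 1] the function differs from f(t) by at most
‖tr g t‖, so |f| ≥ |f(t)| − ‖tr g t‖ on an interval of length one. -/
theorem norm_apply_le_tr {f g : ℝ → ℂ} (hf : MemLp f 2) (hg : MemLp g 2)
    (h : ∀ s t, ∫ x in s..t, g x = f t - f s) (t : ℝ) : ‖f t‖ ≤ ‖tr f t‖ + ‖tr g t‖ := by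
  have hfin : (volume.restrict (Ioi (0 : ℝ))) (Ioc 0 1) ≠ ⊤ :=
    ((Measure.restrict_apply_le _ _).trans_lt (by simp)).ne
  by_cases h0 : ‖f t‖ ≤ ‖tr g t‖
  · linarith [norm_nonneg (tr f t)]
  let c : ℝ := ‖f t‖ - ‖tr g t‖
  have hc : 0 ≤ c := by simp only [c]; linarith
  let e : HalfL2 := indicatorConstLp 2 (measurableSet_Ioc (a := (0 : ℝ)) (b := 1)) hfin (c : ℂ)
  have he : ‖e‖ = c := by
    rw [norm_indicatorConstLp (by norm_num) (by norm_num),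
      measureReal_restrict_apply measurableSet_Ioc, inter_eq_left.2 (fun x hx => hx.1)]
    simp [abs_of_nonneg hc]
  have h1 : ‖e‖ ≤ ‖tr f t‖ := by
    refine Lp.norm_le_norm_of_ae_le ?_
    filter_upwards [coeFn_tr hf t, indicatorConstLp_coeFn (p := 2) (hs := measurableSet_Ioc)
      (hμs := hfin) (c := (c : ℂ))] with ξ e1 e2
    rw [e1, show e ξ = _ from e2]
    by_cases hξ : ξ ∈ Ioc (0 : ℝ) 1
    · rw [indicator_of_mem hξ, Complex.norm_real, Real.norm_of_nonneg hc]
      have h2 := integral_tr_eq_inner hg (t := t) (s := t + ξ) (by linarith [hξ.1]) (by linarith [hξ.2])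
      rw [h] at h2
      have := norm_sub_norm_le (f t) (f (t + ξ))
      rw [norm_sub_rev] at this
      simp only [c]; linarith
    · rw [indicator_of_notMem hξ]; simp
  rw [he] at h1
  simp only [c] at h1; linarith

/-! ### Half-line Laplace transform and unique continuation -/

/-- The one-sided Fourier–Laplace transform, for `0 ≤ im ζ`. -/
noncomputable def lap (G : ℝ → ℂ) (ζ : ℂ) : ℂ :=
  ∫ ξ in Ioi (0 : ℝ), Complex.exp (Complex.I * ξ * ζ) * G ξ

theorem norm_exp_I_mul (ξ : ℝ) (ζ : ℂ) :
    ‖Complex.exp (Complex.I * ξ * ζ)‖ = Real.exp (-(ξ * ζ.im)) := by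
  rw [Complex.norm_exp]; simp

theorem norm_exp_I_mul_le {ξ : ℝ} {ζ : ℂ} (hξ : 0 < ξ) (hζ : 0 ≤ ζ.im) :
    ‖Complex.exp (Complex.I * ξ * ζ)‖ ≤ 1 := by
  rw [norm_exp_I_mul, Real.exp_le_one_iff]
  have := mul_nonneg hξ.le hζ
  linarith

theorem integrableOn_lap {G : ℝ → ℂ} (hG : IntegrableOn G (Ioi 0)) {ζ : ℂ} (hζ : 0 ≤ ζ.im) :
    IntegrableOn (fun ξ : ℝ => Complex.exp (Complex.I * ξ * ζ) * G ξ) (Ioi 0) := by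
  refine Integrable.bdd_mul (c := 1) hG (by fun_prop) ?_
  filter_upwards [ae_restrict_mem measurableSet_Ioi] with ξ hξ
  exact norm_exp_I_mul_le hξ hζ

theorem norm_lap_le {G : ℝ → ℂ} (hG : IntegrableOn G (Ioi 0)) {ζ : ℂ} (hζ : 0 ≤ ζ.im) :
    ‖lap G ζ‖ ≤ ∫ ξ in Ioi (0 : ℝ), ‖G ξ‖ := by
  refine (norm_integral_le_integral_norm _).trans ?_
  refine setIntegral_mono_on (integrableOn_lap hG hζ).norm hG.norm measurableSet_Ioi fun ξ hξ => ?_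
  rw [norm_mul]
  exact mul_le_of_le_one_left (norm_nonneg _) (norm_exp_I_mul_le hξ hζ)

theorem continuousOn_lap {G : ℝ → ℂ} (hG : IntegrableOn G (Ioi 0)) :
    ContinuousOn (lap G) {ζ | 0 ≤ ζ.im} := by
  refine continuousOn_of_dominated (bound := fun ξ => ‖G ξ‖)
    (fun ζ hζ => (integrableOn_lap hG hζ).aestronglyMeasurable) (fun ζ hζ => ?_) hG.norm ?_
  · filter_upwards [ae_restrict_mem measurableSet_Ioi] with ξ hξ
    rw [norm_mul]
    exact mul_le_of_le_one_left (norm_nonneg _) (norm_exp_I_mul_le hξ hζ)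
  · exact ae_of_all _ fun ξ => by fun_prop

theorem differentiableAt_lap {G : ℝ → ℂ} (hG : IntegrableOn G (Ioi 0)) {ζ : ℂ} (hζ : 0 < ζ.im) :
    DifferentiableAt ℂ (lap G) ζ := by
  -- On the disc of radius d about ζ the imaginary part stays above d, and ξ e^{−ξd} ≤ 1/d then
  -- dominates the derivative without any moment of G.
  set d := ζ.im / 2 with hd
  have hdpos : 0 < d := by positivity
  have hball : ∀ w ∈ Metric.ball ζ d, d ≤ w.im := fun w hw => by
    have h1 : |(w - ζ).im| ≤ ‖w - ζ‖ := Complex.abs_im_le_norm _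
    have h2 : ‖w - ζ‖ < d := by rwa [← dist_eq_norm]
    have h3 := (abs_lt.1 (h1.trans_lt h2)).1
    rw [Complex.sub_im] at h3; linarith
  have := hasDerivAt_integral_of_dominated_loc_of_deriv_le (𝕜 := ℂ)
    (μ := volume.restrict (Ioi (0 : ℝ)))
    (F := fun w ξ => Complex.exp (Complex.I * (ξ : ℝ) * w) * G ξ)
    (F' := fun w ξ => Complex.exp (Complex.I * (ξ : ℝ) * w) * (Complex.I * (ξ : ℝ)) * G ξ)
    (x₀ := ζ) (bound := fun ξ => (1 / d) * ‖G ξ‖) (s := Metric.ball ζ d)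
    (Metric.ball_mem_nhds _ hdpos) ?_ (integrableOn_lap hG hζ.le) ?_ ?_ (hG.norm.const_mul _) ?_
  · exact this.2.differentiableAt
  · filter_upwards [Metric.ball_mem_nhds ζ hdpos] with w hw
    exact (integrableOn_lap hG (hdpos.le.trans (hball w hw))).aestronglyMeasurable
  · exact AEStronglyMeasurable.mul (Continuous.aestronglyMeasurable (by fun_prop))
      hG.aestronglyMeasurable
  · filter_upwards [ae_restrict_mem measurableSet_Ioi] with ξ hξ w hw
    have hξ' : 0 < ξ := hξ
    rw [norm_mul, norm_mul, norm_exp_I_mul]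
    refine mul_le_mul_of_nonneg_right ?_ (norm_nonneg _)
    rw [norm_mul, Complex.norm_I, one_mul, Complex.norm_real, Real.norm_of_nonneg hξ'.le]
    have h1 : Real.exp (-(ξ * w.im)) ≤ Real.exp (-(ξ * d)) :=
      Real.exp_le_exp.2 (by nlinarith [hball w hw])
    have h2 : ξ * d ≤ Real.exp (ξ * d) := by linarith [Real.add_one_le_exp (ξ * d)]
    calc _ ≤ Real.exp (-(ξ * d)) * ξ := by gcongr
      _ ≤ 1 / d := by
        rw [Real.exp_neg, inv_mul_le_iff₀ (Real.exp_pos _), mul_one_div, le_div_iff₀ hdpos]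
        exact h2
  · refine ae_of_all _ fun ξ w _ => ?_
    have h1 : HasDerivAt (fun w : ℂ => Complex.I * ξ * w) (Complex.I * ξ) w := by
      simpa using (hasDerivAt_id w).const_mul (Complex.I * (ξ : ℂ))
    exact h1.cexp.mul_const _

theorem diffContOnCl_lap {G : ℝ → ℂ} (hG : IntegrableOn G (Ioi 0)) :
    DiffContOnCl ℂ (lap G) {ζ | 0 < ζ.im} := by
  refine ⟨fun ζ hζ => (differentiableAt_lap hG hζ).differentiableWithinAt, ?_⟩
  rw [Complex.closure_setOfPred_lt_im]
  exact continuousOn_lap hG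

/-- A bounded function on the closed upper half-plane, analytic inside, that vanishes on a half-line
of the boundary vanishes on the other half-line. -/
theorem eq_zero_of_eq_zero_on_neg {F : ℂ → ℂ} (hF : DiffContOnCl ℂ F {ζ | 0 < ζ.im}) {C : ℝ}
    (hb : ∀ ζ : ℂ, 0 ≤ ζ.im → ‖F ζ‖ ≤ C) (h0 : ∀ x : ℝ, x < 0 → F x = 0) (x : ℝ) (hx : 0 < x) :
    F x = 0 := by
  have hC : 0 ≤ C := (norm_nonneg _).trans (hb 0 le_rfl)
  -- parametrize by the strip `0 < re w < 1`
  let g : ℂ → ℂ := fun w => Complex.exp (Complex.I * Real.pi * (1 - w))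
  have hgim : ∀ w, (g w).im = Real.exp (Real.pi * w.im) * Real.sin (Real.pi * (1 - w.re)) := by
    intro w; simp only [g, Complex.exp_im]; congr 1 <;> simp
  have hclosure : closure {ζ : ℂ | 0 < ζ.im} = {ζ | 0 ≤ ζ.im} := Complex.closure_setOfPred_lt_im 0
  have hdg : Differentiable ℂ g := by fun_prop
  have hmaps : MapsTo g (Complex.HadamardThreeLines.verticalStrip 0 1) {ζ | 0 < ζ.im} := by
    intro w hw
    obtain ⟨h1, h2⟩ : 0 < w.re ∧ w.re < 1 := hw
    change 0 < (g w).im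
    rw [hgim]
    refine mul_pos (Real.exp_pos _) (Real.sin_pos_of_pos_of_lt_pi ?_ ?_)
    · exact mul_pos Real.pi_pos (by linarith)
    · nlinarith [Real.pi_pos]
  have hmaps' : ∀ w ∈ Complex.HadamardThreeLines.verticalClosedStrip 0 1, 0 ≤ (g w).im := by
    intro w hw
    obtain ⟨h1, h2⟩ : 0 ≤ w.re ∧ w.re ≤ 1 := hw
    rw [hgim]
    refine mul_nonneg (Real.exp_pos _).le (Real.sin_nonneg_of_nonneg_of_le_pi ?_ ?_)
    · exact mul_nonneg Real.pi_pos.le (by linarith)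
    · nlinarith [Real.pi_pos]
  have hd : DiffContOnCl ℂ (F ∘ g) (Complex.HadamardThreeLines.verticalStrip 0 1) :=
    hF.comp hdg.diffContOnCl hmaps
  have hzero : ∀ w : ℂ, 0 ≤ w.re → w.re < 1 → F (g w) = 0 := by
    -- Three lines theorem: the bound is 0 on re w = 0, which g sends to the negative half-line, and
    -- C on re w = 1. Interpolation gives a factor 0^{1 − re w}, which is 0 for re w < 1.
    intro w h1 h2
    have := Complex.HadamardThreeLines.norm_le_interp_of_mem_verticalClosedStrip₀₁' (F ∘ g)
      (z := w) (a := 0) (b := C) ⟨h1, h2.le⟩ hd ?_ ?_ ?_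
    · rw [Real.zero_rpow (by linarith), zero_mul] at this
      exact norm_le_zero_iff.1 this
    · refine ⟨C, ?_⟩
      rintro _ ⟨w, hw, rfl⟩
      exact hb _ (hmaps' w hw)
    · intro w hw
      have hre : w.re = 0 := hw
      have : g w = ((-Real.exp (Real.pi * w.im) : ℝ) : ℂ) := by
        apply Complex.ext
        · simp only [g, Complex.exp_re]
          simp only [Complex.mul_re, Complex.I_re, Complex.ofReal_re, zero_mul, Complex.I_im,
            Complex.ofReal_im, mul_zero, sub_self, Complex.sub_re, Complex.one_re, hre,
            Complex.mul_im, one_mul, zero_add, Complex.sub_im, Complex.one_im, zero_sub]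
          simp
        · rw [hgim, hre, Complex.ofReal_im]; simp
      simp only [Function.comp]
      rw [this, h0 _ (neg_neg_of_pos (Real.exp_pos _)), norm_zero]
    · intro w hw
      have hre : w.re = 1 := hw
      exact hb _ (hmaps' w ⟨by rw [hre]; norm_num, by rw [hre]⟩)
  -- approach the positive half-line from inside
  let γ : ℝ → ℂ := fun θ => g (1 - θ + Complex.I * (-(Real.log x) / Real.pi : ℝ) * (-1))
  have hγ0 : γ 0 = x := by
    have hpi : (Real.pi : ℂ) ≠ 0 := by exact_mod_cast Real.pi_ne_zero
    simp only [γ, g]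
    have : Complex.I * Real.pi * (1 - (1 - ((0 : ℝ) : ℂ) +
        Complex.I * (-(Real.log x) / Real.pi : ℝ) * (-1))) = (Real.log x : ℂ) := by
      push_cast; field_simp; ring_nf; simp
    rw [this, ← Complex.ofReal_exp, Real.exp_log hx]
  have hγc : Continuous γ := by fun_prop
  have hre : ∀ θ : ℝ, (1 - (θ : ℂ) + Complex.I * (-(Real.log x) / Real.pi : ℝ) * (-1)).re = 1 - θ := by
    intro θ; simp
  have hlim : Tendsto (fun θ => F (γ θ)) (𝓝[>] 0) (𝓝 (F (γ 0))) := by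
    have hcw : ContinuousWithinAt F {ζ | 0 ≤ ζ.im} (γ 0) := by
      have h1 := hF.continuousOn
      rw [hclosure] at h1
      exact h1 _ (by simp [hγ0])
    refine hcw.tendsto.comp (tendsto_nhdsWithin_iff.2 ⟨hγc.continuousAt.continuousWithinAt, ?_⟩)
    filter_upwards [Ioo_mem_nhdsGT (show (0 : ℝ) < 1 by norm_num)] with θ hθ
    exact hmaps' _ ⟨by rw [hre]; linarith [hθ.2], by rw [hre]; linarith [hθ.1]⟩
  have hev : ∀ᶠ θ in 𝓝[>] (0 : ℝ), F (γ θ) = 0 := by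
    filter_upwards [Ioo_mem_nhdsGT (show (0 : ℝ) < 1 by norm_num)] with θ hθ
    exact hzero _ (by rw [hre]; linarith [hθ.2]) (by rw [hre]; linarith [hθ.1])
  rw [← hγ0]
  exact tendsto_nhds_unique hlim (tendsto_const_nhds.congr' (hev.mono fun _ h => h.symm))

theorem memLp_exp_div (z : ℝ) : MemLp (fun ξ : ℝ =>
    conj (Complex.exp (-Complex.I * ξ * z) / (1 + Complex.I * ξ))) 2 := by
  have hne : ∀ ξ : ℝ, (1 + Complex.I * ξ : ℂ) ≠ 0 := fun ξ h => by
    have := congrArg Complex.re h; simp at this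
  refine memLp_bracket_inv.mono ?_ (ae_of_all _ fun ξ => ?_)
  · refine Continuous.aestronglyMeasurable (Complex.continuous_conj.comp ?_)
    exact Continuous.div (by fun_prop) (by fun_prop) hne
  · rw [RCLike.norm_conj, norm_div, Complex.norm_real, norm_inv, Real.norm_of_nonneg (Real.sqrt_nonneg _)]
    have h1 : ‖Complex.exp (-Complex.I * ξ * z)‖ = 1 := by
      rw [Complex.norm_exp]; simp
    have h2 : ‖(1 + Complex.I * ξ : ℂ)‖ = √(1 + ξ ^ 2) := by
      rw [Complex.norm_eq_sqrt_sq_add_sq]; simp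
    rw [h1, h2, one_div]

/-- The functions `ξ ↦ conj (exp (-i ξ z) / (1 + i ξ))`, `z > 0`, on the half-line. -/
noncomputable def halfExp (z : ℝ) : HalfL2 := tr (fun ξ : ℝ =>
    conj (Complex.exp (-Complex.I * ξ * z) / (1 + Complex.I * ξ))) 0

theorem inner_halfExp (z : ℝ) (α : HalfL2) : inner ℂ (halfExp z) α =
    ∫ ξ in Ioi (0 : ℝ), Complex.exp (-Complex.I * ξ * z) / (1 + Complex.I * ξ) * α ξ := by
  rw [halfExp, inner_tr (memLp_exp_div z)]
  simp only [zero_add, Complex.conj_conj]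

/-- Division by 1 + iξ makes α integrable, so its Laplace transform is bounded and continuous up to
the axis. Orthogonality says that it vanishes on the negative half-line, hence on the whole line,
and Plancherel gives α = 0. -/
theorem eq_zero_of_inner_halfExp {α : HalfL2} (h : ∀ z : ℝ, 0 < z → inner ℂ (halfExp z) α = 0) :
    α = 0 := by
  have hne : ∀ ξ : ℝ, (1 + Complex.I * ξ : ℂ) ≠ 0 := fun ξ h => by
    have := congrArg Complex.re h; simp at this
  let G : ℝ → ℂ := fun ξ => (Ioi (0 : ℝ)).indicator (fun ξ => α ξ / (1 + Complex.I * ξ)) ξ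
  have hm : MemLp (fun ξ : ℝ => (1 + Complex.I * ξ : ℂ)⁻¹) 2 := by
    refine (memLp_exp_div 0).star.ae_eq (ae_of_all _ fun ξ => ?_)
    simp
  have hb : ∀ ξ : ℝ, ‖(1 + Complex.I * ξ : ℂ)⁻¹‖ ≤ 1 := fun ξ => by
    have h2 : ‖(1 + Complex.I * ξ : ℂ)‖ = √(1 + ξ ^ 2) := by
      rw [Complex.norm_eq_sqrt_sq_add_sq]; simp
    rw [norm_inv, h2]
    exact inv_le_one_of_one_le₀ (one_le_bracket ξ)
  have hG0 : IntegrableOn (fun ξ : ℝ => α ξ / (1 + Complex.I * ξ)) (Ioi 0) :=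
    memLp_mul_integrable (Lp.memLp α) (hm.restrict _)
  have hG1 : Integrable G := (integrable_indicator_iff measurableSet_Ioi).2 hG0
  have hG2 : MemLp G 2 := by
    refine (memLp_indicator_iff_restrict measurableSet_Ioi).2 ?_
    refine (Lp.memLp α).mono hG0.aestronglyMeasurable (ae_of_all _ fun ξ => ?_)
    rw [div_eq_mul_inv, norm_mul]
    exact mul_le_of_le_one_right (norm_nonneg _) (hb ξ)
  have hGI : IntegrableOn G (Ioi 0) := hG1.integrableOn
  have hlap : ∀ x : ℝ, lap G x = ft G x := fun x => by
    unfold lap ft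
    rw [← integral_indicator measurableSet_Ioi]
    congr 1; ext ξ
    by_cases hξ : ξ ∈ Ioi (0 : ℝ)
    · rw [indicator_of_mem hξ]; ring_nf
    · rw [indicator_of_notMem hξ]; simp only [G]; rw [indicator_of_notMem hξ, mul_zero]
  have hneg : ∀ x : ℝ, x < 0 → lap G x = 0 := fun x hx => by
    rw [← h (-x) (by linarith), inner_halfExp]
    unfold lap
    refine setIntegral_congr_fun measurableSet_Ioi fun ξ hξ => ?_
    simp only [G]
    rw [indicator_of_mem hξ]
    push_cast
    rw [show -Complex.I * ξ * -x = Complex.I * ξ * x by ring]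
    ring
  have hpos := eq_zero_of_eq_zero_on_neg (diffContOnCl_lap hGI) (fun ζ hζ => norm_lap_le hGI hζ) hneg
  have hft : ft G =ᵐ[volume] fun _ => 0 := by
    have : ∀ᵐ x : ℝ, x ≠ 0 := by simp [ae_iff, measure_singleton]
    filter_upwards [this] with x hx
    rw [← hlap]
    rcases lt_or_gt_of_ne hx with hx | hx
    · exact hneg x hx
    · exact hpos x hx
  have hn := eLpNorm_ft hG1 hG2
  rw [eLpNorm_congr_ae hft, eLpNorm_zero', eq_comm, mul_eq_zero] at hn
  have hn' : eLpNorm G 2 volume = 0 := by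
    refine hn.resolve_left ?_
    rw [ENNReal.ofReal_eq_zero, not_le]
    have := Real.pi_pos
    positivity
  rw [eLpNorm_eq_zero_iff hG1.aestronglyMeasurable (by norm_num)] at hn'
  apply Lp.ext
  refine EventuallyEq.trans ?_ (Lp.coeFn_zero _ _ _).symm
  filter_upwards [ae_restrict_of_ae hn', ae_restrict_mem measurableSet_Ioi] with ξ h1 h2
  simp only [G] at h1
  rw [indicator_of_mem h2] at h1
  simpa [hne] using h1

theorem span_halfExp_dense :
    (Submodule.span ℂ (halfExp '' Ioi 0)).topologicalClosure = ⊤ := by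
  rw [Submodule.topologicalClosure_eq_top_iff, Submodule.eq_bot_iff]
  intro α hα
  refine eq_zero_of_inner_halfExp fun z hz => ?_
  exact hα _ (Submodule.subset_span ⟨z, hz, rfl⟩)

theorem integrableOn_mul_exp_neg : IntegrableOn (fun z : ℝ => z * Real.exp (-z)) (Ioi 0) := by
  refine (Real.GammaIntegral_convergent (s := 2) (by norm_num)).congr_fun (fun z hz => ?_)
    measurableSet_Ioi
  simp only []
  rw [show (2 : ℝ) - 1 = 1 by norm_num, Real.rpow_one]; ring

theorem preimage_const_add_Ioi' (a b : ℝ) : (fun y : ℝ => a + y) ⁻¹' Ioi (a + b) = Ioi b := by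
  ext y; simp

theorem setIntegral_comp_add_left_Ioi {E : Type*} [NormedAddCommGroup E] [NormedSpace ℝ E]
    (g : ℝ → E) (a b : ℝ) : ∫ y in Ioi b, g (a + y) = ∫ y in Ioi (a + b), g y := by
  rw [← preimage_const_add_Ioi' a b]
  exact (measurePreserving_add_left volume a).setIntegral_preimage_emb
    (measurableEmbedding_addLeft a) g _

theorem integrableOn_comp_add_left_Ioi {E : Type*} [NormedAddCommGroup E] (g : ℝ → E) (a b : ℝ) :
    IntegrableOn (fun y => g (a + y)) (Ioi b) ↔ IntegrableOn g (Ioi (a + b)) := by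
  rw [← preimage_const_add_Ioi' a b]
  exact (measurePreserving_add_left volume a).integrableOn_comp_preimage
    (measurableEmbedding_addLeft a)

/-! ### Small energy on a half-line of frequencies implies weak smallness -/

/-- The weighted energy of the Fourier transform on a half-line of frequencies. -/
noncomputable def energy (A : ℝ → ℂ) : ℝ :=
  ∫ z in Ioi (0 : ℝ), z * Real.exp (-z) * ‖ft A (-z)‖ ^ 2

theorem integrableOn_energy {A : ℝ → ℂ} (hA : Integrable A) :
    IntegrableOn (fun z : ℝ => z * Real.exp (-z) * ‖ft A (-z)‖ ^ 2) (Ioi 0) := by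
  refine Integrable.mul_bdd (c := (∫ z, ‖A z‖) ^ 2) integrableOn_mul_exp_neg ?_ (ae_of_all _ fun z => ?_)
  · have := continuous_ft hA
    exact Continuous.aestronglyMeasurable (by fun_prop)
  · rw [Real.norm_of_nonneg (by positivity)]
    gcongr; exact norm_ft_le _ _

theorem integral_exp_neg_mul_one_add (ξ : ℝ) :
    ∫ y in Ioi (0 : ℝ), Complex.exp (-(1 + Complex.I * ξ) * y) = 1 / (1 + Complex.I * ξ) := by
  rw [integral_exp_mul_complex_Ioi (by simp)]
  simp only [Complex.ofReal_zero, mul_zero, Complex.exp_zero, neg_div_neg_eq]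

/-- Writing 1/(1 + iξ) as ∫₀^∞ e^{−(1+iξ)y} dy turns the pairing into an average of `ft A` over the
frequencies below −z, precisely those seen by the energy. -/
theorem inner_halfExp_tr {A : ℝ → ℂ} (hA : Integrable A) (h2 : MemLp A 2)
    (h0 : ∀ ξ ≤ 0, A ξ = 0) (z : ℝ) :
    inner ℂ (halfExp z) (tr A 0) = ∫ y in Ioi (0 : ℝ), (Real.exp (-y) : ℂ) * ft A (-(z + y)) := by
  rw [inner_halfExp]
  have e1 : ∫ ξ in Ioi (0 : ℝ), Complex.exp (-Complex.I * ξ * z) / (1 + Complex.I * ξ) * tr A 0 ξ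
      = ∫ ξ : ℝ, Complex.exp (-Complex.I * ξ * z) / (1 + Complex.I * ξ) * A ξ := by
    have : ∫ ξ in Ioi (0 : ℝ), Complex.exp (-Complex.I * ξ * z) / (1 + Complex.I * ξ) * tr A 0 ξ
      = ∫ ξ in Ioi (0 : ℝ), Complex.exp (-Complex.I * ξ * z) / (1 + Complex.I * ξ) * A ξ := by
      apply integral_congr_ae
      filter_upwards [coeFn_tr h2 0] with ξ h
      rw [h, zero_add]
    rw [this]
    refine setIntegral_eq_integral_of_forall_compl_eq_zero fun ξ hξ => ?_
    rw [h0 ξ (not_lt.1 hξ), mul_zero]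
  rw [e1]
  have hint : Integrable (Function.uncurry fun (ξ y : ℝ) =>
      Complex.exp (-Complex.I * ξ * (z + y)) * (A ξ * (Real.exp (-y) : ℂ)))
      (volume.prod (volume.restrict (Ioi 0))) := by
    have he : IntegrableOn (fun y : ℝ => (Real.exp (-y) : ℂ)) (Ioi 0) := by
      have := (integrableOn_exp_neg_Ioi 0).ofReal (𝕜 := ℂ)
      exact this
    refine (hA.mul_prod he).bdd_mul (c := 1) (by fun_prop) (ae_of_all _ fun p => ?_)
    rw [Complex.norm_exp]; simp
  have e2 : ∀ ξ : ℝ, Complex.exp (-Complex.I * ξ * z) / (1 + Complex.I * ξ) * A ξ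
      = ∫ y in Ioi (0 : ℝ), Complex.exp (-Complex.I * ξ * (z + y)) * (A ξ * (Real.exp (-y) : ℂ)) := by
    intro ξ
    rw [div_eq_mul_one_div, ← integral_exp_neg_mul_one_add, mul_assoc, ← integral_mul_const,
      ← integral_const_mul]
    congr 1; ext y
    have : Complex.exp (-Complex.I * ξ * (z + y)) * Complex.exp (-y)
        = Complex.exp (-Complex.I * ξ * z) * Complex.exp (-(1 + Complex.I * ξ) * y) := by
      rw [← Complex.exp_add, ← Complex.exp_add]; congr 1; ring
    push_cast
    linear_combination (-(A ξ)) * this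
  simp_rw [e2]
  rw [integral_integral_swap hint]
  congr 1; ext y
  unfold ft
  rw [← integral_const_mul]
  congr 1; ext ξ
  push_cast
  rw [show -Complex.I * ξ * (z + y) = Complex.I * (-(z + y)) * ξ by ring]; ring

/-- Young's inequality with parameter l against the energy density. The weight at z + y is at least
z e^{−z} e^{−y}, which produces the constant e^z/z. -/
theorem norm_inner_halfExp_le {A : ℝ → ℂ} (hA : Integrable A) (h2 : MemLp A 2)
    (h0 : ∀ ξ ≤ 0, A ξ = 0) {z : ℝ} (hz : 0 < z) {l : ℝ} (hl : 0 < l) :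
    ‖inner ℂ (halfExp z) (tr A 0)‖ ≤ l * (Real.exp z / z) + energy A / l := by
  rw [inner_halfExp_tr hA h2 h0]
  have hE := integrableOn_energy hA
  have hE' : IntegrableOn (fun y : ℝ => (z + y) * Real.exp (-(z + y)) * ‖ft A (-(z + y))‖ ^ 2)
      (Ioi 0) := by
    refine (integrableOn_comp_add_left_Ioi
      (fun y : ℝ => y * Real.exp (-y) * ‖ft A (-y)‖ ^ 2) z 0).2 ?_
    exact hE.mono_set (Ioi_subset_Ioi (by linarith))
  have hexp : IntegrableOn (fun y : ℝ => Real.exp (-y)) (Ioi 0) := integrableOn_exp_neg_Ioi 0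
  calc ‖∫ y in Ioi (0 : ℝ), (Real.exp (-y) : ℂ) * ft A (-(z + y))‖
      ≤ ∫ y in Ioi (0 : ℝ), (l * (Real.exp z / z) * Real.exp (-y)
          + 1 / l * ((z + y) * Real.exp (-(z + y)) * ‖ft A (-(z + y))‖ ^ 2)) := by
        refine norm_integral_le_of_norm_le ((hexp.const_mul _).add (hE'.const_mul _)) ?_
        filter_upwards [ae_restrict_mem measurableSet_Ioi] with y hy
        have hy' : 0 < y := hy
        rw [norm_mul, Complex.norm_real, Real.norm_of_nonneg (Real.exp_pos _).le]
        set a := ‖ft A (-(z + y))‖ with ha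
        have ha0 : 0 ≤ a := norm_nonneg _
        set w := (z + y) * Real.exp (-(z + y)) with hw
        have hwpos : 0 < w := by positivity
        have h1 : Real.exp (-y) * a ≤ l * (Real.exp (-y) ^ 2 / w) + 1 / l * (w * a ^ 2) := by
          have : 0 ≤ (l * Real.exp (-y) - w * a) ^ 2 + l * Real.exp (-y) * w * a := by positivity
          have h3 : l * (Real.exp (-y) ^ 2 / w) + 1 / l * (w * a ^ 2) - Real.exp (-y) * a
            = ((l * Real.exp (-y) - w * a) ^ 2 + l * Real.exp (-y) * w * a) / (l * w) := by
            field_simp; ring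
          have h4 : 0 ≤ ((l * Real.exp (-y) - w * a) ^ 2 + l * Real.exp (-y) * w * a) / (l * w) := by
            positivity
          linarith
        refine h1.trans (add_le_add_left ?_ _)
        rw [mul_assoc]
        refine mul_le_mul_of_nonneg_left ?_ hl.le
        rw [div_le_iff₀ hwpos, hw]
        have h5 : Real.exp (-(z + y)) = (Real.exp z)⁻¹ * Real.exp (-y) := by
          rw [← Real.exp_neg, ← Real.exp_add]; congr 1; ring
        rw [h5]
        have h6 : Real.exp z / z * Real.exp (-y) * ((z + y) * ((Real.exp z)⁻¹ * Real.exp (-y)))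
            = Real.exp (-y) ^ 2 * ((z + y) / z) := by
          have := (Real.exp_pos z).ne'
          field_simp
        rw [h6]
        refine le_mul_of_one_le_right (by positivity) ?_
        rw [le_div_iff₀ hz]; linarith
    _ = l * (Real.exp z / z) * (∫ y in Ioi (0 : ℝ), Real.exp (-y))
          + 1 / l * ∫ y in Ioi (0 : ℝ), (z + y) * Real.exp (-(z + y)) * ‖ft A (-(z + y))‖ ^ 2 := by
        rw [integral_add (hexp.const_mul _) (hE'.const_mul _), integral_const_mul, integral_const_mul]
    _ ≤ _ := by
        rw [integral_exp_neg_Ioi_zero, mul_one, one_div, inv_mul_eq_div]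
        gcongr
        have h7 := setIntegral_comp_add_left_Ioi
          (fun y : ℝ => y * Real.exp (-y) * ‖ft A (-y)‖ ^ 2) z 0
        rw [h7, add_zero]
        refine setIntegral_mono_set hE ?_ (Ioi_subset_Ioi hz.le).eventuallyLE
        filter_upwards [ae_restrict_mem measurableSet_Ioi] with y hy
        have hy' : 0 < y := hy
        simp only [Pi.zero_apply]
        positivity

/-- `α` is given by an integrable function whose energy is controlled by `f`. -/
def EnergyControlled (α f : HalfL2) : Prop :=
  ∃ A : ℝ → ℂ, Integrable A ∧ MemLp A 2 ∧ (∀ ξ ≤ 0, A ξ = 0) ∧ α = tr A 0 ∧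
    energy A ≤ Real.pi * ‖α‖ * ‖f‖

/-- `⟪h, α⟫` is small whenever the energy of `α` is controlled by a small `f`. -/
def SmallPairing (h : HalfL2) : Prop :=
  ∀ ε > 0, ∃ C, 0 ≤ C ∧ ∀ α f : HalfL2, EnergyControlled α f → ‖inner ℂ h α‖ ≤ ε * ‖α‖ + C * ‖f‖

theorem smallPairing_halfExp {z : ℝ} (hz : 0 < z) : SmallPairing (halfExp z) := by
  intro ε hε
  set K := Real.exp z / z with hK
  have hKpos : 0 < K := by positivity
  have hpi := Real.pi_pos
  refine ⟨Real.pi / (ε / K), by positivity, ?_⟩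
  rintro α f ⟨A, h1, h2, h3, rfl, hE⟩
  rcases eq_or_ne (tr A 0) 0 with h | h
  · rw [h, inner_zero_right, norm_zero, norm_zero]; positivity
  have hn : 0 < ‖tr A 0‖ := norm_pos_iff.2 h
  -- This l turns the first term into ε‖α‖; since the energy is at most π‖α‖‖f‖, the factor ‖α‖
  -- cancels in the second and a multiple of ‖f‖ is left.
  have := norm_inner_halfExp_le h1 h2 h3 hz (l := ε / K * ‖tr A 0‖) (by positivity)
  refine this.trans (add_le_add (le_of_eq ?_) ?_)
  · rw [← hK]; field_simp
  · rw [div_le_iff₀ (by positivity)]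
    refine hE.trans (le_of_eq ?_)
    field_simp

theorem SmallPairing.zero : SmallPairing 0 := fun ε hε =>
  ⟨0, le_rfl, fun α f _ => by rw [inner_zero_left, norm_zero]; positivity⟩

theorem SmallPairing.add {h h' : HalfL2} (hh : SmallPairing h) (hh' : SmallPairing h') :
    SmallPairing (h + h') := by
  intro ε hε
  obtain ⟨C, hC, H⟩ := hh (ε / 2) (by positivity)
  obtain ⟨C', hC', H'⟩ := hh' (ε / 2) (by positivity)
  refine ⟨C + C', by positivity, fun α f hg => ?_⟩
  rw [inner_add_left]
  calc _ ≤ _ := norm_add_le _ _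
    _ ≤ _ := add_le_add (H α f hg) (H' α f hg)
    _ = _ := by ring

theorem SmallPairing.smul {h : HalfL2} (hh : SmallPairing h) (c : ℂ) : SmallPairing (c • h) := by
  intro ε hε
  obtain ⟨C, hC, H⟩ := hh (ε / (‖c‖ + 1)) (by positivity)
  refine ⟨‖c‖ * C, by positivity, fun α f hg => ?_⟩
  rw [inner_smul_left, norm_mul, RCLike.norm_conj]
  calc _ ≤ ‖c‖ * (ε / (‖c‖ + 1) * ‖α‖ + C * ‖f‖) :=
        mul_le_mul_of_nonneg_left (H α f hg) (norm_nonneg _)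
    _ = (‖c‖ / (‖c‖ + 1)) * (ε * ‖α‖) + ‖c‖ * C * ‖f‖ := by ring
    _ ≤ _ := by
      refine add_le_add_left ?_ _
      refine mul_le_of_le_one_left (by positivity) ?_
      rw [div_le_one (by positivity)]; linarith

theorem SmallPairing.of_approx {h : HalfL2} (hh : ∀ ε > 0, ∃ h', SmallPairing h' ∧ ‖h - h'‖ < ε) :
    SmallPairing h := by
  intro ε hε
  obtain ⟨h', hs, hd⟩ := hh (ε / 2) (by positivity)
  obtain ⟨C, hC, H⟩ := hs (ε / 2) (by positivity)
  refine ⟨C, hC, fun α f hg => ?_⟩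
  have : inner ℂ h α = inner ℂ (h - h') α + inner ℂ h' α := by rw [← inner_add_left]; simp
  rw [this]
  calc _ ≤ _ := norm_add_le _ _
    _ ≤ ε / 2 * ‖α‖ + (ε / 2 * ‖α‖ + C * ‖f‖) :=
        add_le_add ((norm_inner_le_norm _ _).trans (by gcongr)) (H α f hg)
    _ = _ := by ring

/-- The vectors with this property form a closed subspace containing the dense family `halfExp`. The
constant depends on `h` in an unspecified way, as unique continuation gives no rate. -/
theorem smallPairing_all (h : HalfL2) : SmallPairing h := by
  refine SmallPairing.of_approx fun ε hε => ?_
  have hmem : h ∈ closure (Submodule.span ℂ (halfExp '' Ioi 0) : Set HalfL2) := by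
    rw [← Submodule.topologicalClosure_coe, span_halfExp_dense]; trivial
  obtain ⟨h', hs, hd⟩ := Metric.mem_closure_iff.1 hmem ε hε
  rw [dist_eq_norm] at hd
  refine ⟨h', ?_, hd⟩
  clear hd
  induction hs using Submodule.span_induction with
  | mem x hx => obtain ⟨z, hz, rfl⟩ := hx; exact smallPairing_halfExp hz
  | zero => exact SmallPairing.zero
  | add x y _ _ hx hy => exact hx.add hy
  | smul c x _ hx => exact hx.smul c

/-- Compactness: the constant found at one point for ε/2 serves a whole neighbourhood for ε, the
error being ‖γ s − γ x‖ ‖α‖. -/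
theorem smallPairing_uniform {γ : ℝ → HalfL2} (hγ : Continuous γ) {K : Set ℝ} (hK : IsCompact K)
    {ε : ℝ} (hε : 0 < ε) : ∃ C, 0 ≤ C ∧ ∀ s ∈ K, ∀ α f : HalfL2, EnergyControlled α f →
      ‖inner ℂ (γ s) α‖ ≤ ε * ‖α‖ + C * ‖f‖ := by
  refine hK.induction_on (p := fun K => ∃ C, 0 ≤ C ∧ ∀ s ∈ K, ∀ α f : HalfL2,
    EnergyControlled α f → ‖inner ℂ (γ s) α‖ ≤ ε * ‖α‖ + C * ‖f‖) ?_ ?_ ?_ ?_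
  · exact ⟨0, le_rfl, by simp⟩
  · rintro s t hst ⟨C, hC, H⟩
    exact ⟨C, hC, fun s hs => H s (hst hs)⟩
  · rintro s t ⟨C, hC, H⟩ ⟨C', hC', H'⟩
    refine ⟨max C C', le_max_of_le_left hC, fun s hs α f hg => ?_⟩
    rcases hs with hs | hs
    · exact (H s hs α f hg).trans (by gcongr; exact le_max_left _ _)
    · exact (H' s hs α f hg).trans (by gcongr; exact le_max_right _ _)
  · intro x hx
    obtain ⟨C, hC, H⟩ := smallPairing_all (γ x) (ε / 2) (by positivity)
    refine ⟨{s | ‖γ s - γ x‖ < ε / 2}, ?_, C, hC, fun s hs α f hg => ?_⟩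
    · refine mem_nhdsWithin_of_mem_nhds ?_
      have hc : Continuous fun s => ‖γ s - γ x‖ := by fun_prop
      exact (isOpen_lt hc continuous_const).mem_nhds (by simpa using hε)
    · have : inner ℂ (γ s) α = inner ℂ (γ s - γ x) α + inner ℂ (γ x) α := by
        rw [← inner_add_left]; simp
      rw [this]
      have hs' : ‖γ s - γ x‖ < ε / 2 := hs
      calc _ ≤ _ := norm_add_le _ _
        _ ≤ ε / 2 * ‖α‖ + (ε / 2 * ‖α‖ + C * ‖f‖) :=
            add_le_add ((norm_inner_le_norm _ _).trans (by gcongr)) (H α f hg)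
        _ = _ := by ring

/-! ### Correlations and positivity -/

/-- The bilinear correlation `τ ↦ ∫ F(s) G(s + τ) ds`. -/
noncomputable def xcorr (F G : ℝ → ℂ) (τ : ℝ) : ℂ := ∫ s, F s * G (s + τ)

theorem integrable_shear {F G : ℝ → ℂ} (hF : Integrable F) (hG : Integrable G) :
    Integrable (fun p : ℝ × ℝ => F p.1 * G (p.1 + p.2)) (volume.prod volume) :=
  (measurePreserving_prod_add volume volume).integrable_comp_of_integrable (hF.mul_prod hG)

theorem integrable_xcorr {F G : ℝ → ℂ} (hF : Integrable F) (hG : Integrable G) :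
    Integrable (xcorr F G) :=
  (integrable_shear hF hG).integral_prod_right

theorem ft_xcorr {F G : ℝ → ℂ} (hF : Integrable F) (hG : Integrable G) (z : ℝ) :
    ft (xcorr F G) z = ft F (-z) * ft G z := by
  have key : Integrable (Function.uncurry fun (s τ : ℝ) =>
      Complex.exp (Complex.I * z * τ) * (F s * G (s + τ))) (volume.prod volume) := by
    refine ((integrable_shear hF hG).bdd_mul (c := 1) ?_ (ae_of_all _ fun p => ?_))
    · exact Continuous.aestronglyMeasurable (by fun_prop)
    · rw [norm_cexp_I_mul_mul]
  calc ft (xcorr F G) z = ∫ τ : ℝ, ∫ s, Complex.exp (Complex.I * z * τ) * (F s * G (s + τ)) := by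
        simp only [ft, xcorr, integral_const_mul]
    _ = ∫ s, ∫ τ : ℝ, Complex.exp (Complex.I * z * τ) * (F s * G (s + τ)) :=
        (integral_integral_swap key).symm
    _ = ∫ s : ℝ, Complex.exp (Complex.I * (-z : ℝ) * s) * F s * ft G z := by
        congr 1; ext s
        rw [ft, ← integral_const_mul,
          ← integral_add_left_eq_self (fun τ : ℝ => Complex.exp (Complex.I * (-z : ℝ) * s) * F s *
            (Complex.exp (Complex.I * z * τ) * G τ)) s]
        congr 1; ext τ
        have : Complex.exp (Complex.I * z * τ) = Complex.exp (Complex.I * (-z : ℝ) * s) *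
            Complex.exp (Complex.I * z * (s + τ : ℝ)) := by
          rw [← Complex.exp_add]; push_cast; ring_nf
        rw [this]; ring
    _ = ft F (-z) * ft G z := by rw [integral_mul_const]; rfl

theorem conj_xcorr_self (G : ℝ → ℂ) (τ : ℝ) :
    xcorr (fun s => conj (G s)) G (-τ) = conj (xcorr (fun s => conj (G s)) G τ) := by
  rw [xcorr, xcorr, ← integral_conj,
    ← integral_add_right_eq_self (fun s : ℝ => conj (G s) * G (s + -τ)) τ]
  congr 1; ext s; simp [mul_comm]

theorem ft_xcorr_self {G : ℝ → ℂ} (hG : Integrable G) (z : ℝ) :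
    ft (xcorr (fun s => conj (G s)) G) z = (‖ft G z‖ ^ 2 : ℝ) := by
  have hc : Integrable fun s => conj (G s) :=
    (Complex.conjLIE.toContinuousLinearEquiv.toContinuousLinearMap.restrictScalars ℝ).integrable_comp hG
  rw [ft_xcorr hc hG, ← conj_ft]
  rw [← Complex.normSq_eq_norm_sq, Complex.normSq_eq_conj_mul_self]

theorem integral_eq_two_re {g : ℝ → ℂ} (hg : Integrable g) (h : ∀ τ, g (-τ) = conj (g τ)) :
    ∫ τ, g τ = ((2 * (∫ τ in Ioi 0, g τ).re : ℝ) : ℂ) := by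
  have h1 : ∫ τ in Iic 0, g τ = conj (∫ τ in Ioi 0, g τ) := by
    have := integral_comp_neg_Ioi (0 : ℝ) g
    rw [neg_zero] at this
    rw [← this, ← integral_conj]
    exact integral_congr_ae (ae_of_all _ h)
  have h2 := integral_add_compl (measurableSet_Ioi (a := (0 : ℝ))) hg
  rw [compl_Ioi, h1] at h2
  rw [← h2, Complex.add_conj]

/-- The transform of a weight on the half-line of positive frequencies. -/
noncomputable def wt (ν : ℝ → ℝ) (τ : ℝ) : ℂ :=
  ∫ z in Ioi (0 : ℝ), Complex.exp (-Complex.I * τ * z) * ν z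

/-- Both factors are Hermitian in τ, so twice the real part over the half-line is the integral over
the line, which transposition of the transform turns into ∫ ν |Ĝ|². For a nonnegative weight this is
the source of all signs. -/
theorem two_re_integral_wt_mul_xcorr {ν : ℝ → ℝ} (hν : IntegrableOn ν (Ioi 0)) {G : ℝ → ℂ}
    (hG : Integrable G) :
    2 * (∫ τ in Ioi 0, wt ν τ * xcorr (fun s => conj (G s)) G τ).re
      = ∫ z in Ioi (0 : ℝ), ν z * ‖ft G (-z)‖ ^ 2 := by
  set C := xcorr (fun s => conj (G s)) G with hC
  have hc : Integrable fun s => conj (G s) :=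
    (Complex.conjLIE.toContinuousLinearEquiv.toContinuousLinearMap.restrictScalars ℝ).integrable_comp hG
  have hCi : Integrable C := integrable_xcorr hc hG
  set W : ℝ → ℂ := (Ioi (0 : ℝ)).indicator fun z => (ν z : ℂ) with hW
  have hWi : Integrable W := (integrable_indicator_iff measurableSet_Ioi).2 hν.ofReal
  have hwt : ∀ τ, wt ν τ = ft W (-τ) := by
    intro τ
    rw [wt, ft, ← integral_indicator measurableSet_Ioi]
    congr 1; ext z
    by_cases hz : z ∈ Ioi (0 : ℝ)
    · simp [hW, hz]
    · simp [hW, hz]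
  have hwc : ∀ τ, wt ν (-τ) = conj (wt ν τ) := by
    intro τ
    rw [wt, wt, ← integral_conj]
    congr 1; ext z
    rw [map_mul, ← Complex.exp_conj]
    simp
  have hint : Integrable fun τ => wt ν τ * C τ := by
    refine hCi.bdd_mul (c := ∫ z, ‖W z‖) ?_ (ae_of_all _ fun τ => ?_)
    · refine Continuous.aestronglyMeasurable ?_
      rw [show wt ν = fun τ => ft W (-τ) from funext hwt]
      exact (continuous_ft hWi).comp continuous_neg
    · rw [hwt]; exact norm_ft_le _ _
  have h1 := integral_eq_two_re hint fun τ => by rw [hwc, hC, conj_xcorr_self, map_mul]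
  have h2 : ∫ τ, wt ν τ * C τ = ∫ z in Ioi (0 : ℝ), ((ν z * ‖ft G (-z)‖ ^ 2 : ℝ) : ℂ) := by
    have e1 : ∫ τ, wt ν τ * C τ = ∫ τ, ft W τ * C (-τ) := by
      rw [← integral_neg_eq_self]
      congr 1; ext τ; rw [hwt, neg_neg]
    have hCn : Integrable fun τ => C (-τ) := hCi.comp_neg
    rw [e1, integral_ft_mul hWi hCn, ← integral_indicator measurableSet_Ioi]
    congr 1; ext z
    have e2 : ft (fun τ => C (-τ)) z = ft C (-z) := by
      rw [ft, ft, ← integral_neg_eq_self]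
      congr 1; ext τ; push_cast; ring_nf
    rw [e2, hC, ft_xcorr_self hG]
    by_cases hz : z ∈ Ioi (0 : ℝ)
    · simp [hW, indicator_of_mem hz]
    · simp [hW, indicator_of_notMem hz]
  rw [h1, integral_complex_ofReal] at h2
  exact_mod_cast h2

/-! ### The Marchenko operator and its energy estimate -/

theorem IsKernel.ftc0 {N : ℝ} {φ φ₁ φ₂ : ℝ → ℂ} (h : IsKernel N φ φ₁ φ₂) (s t : ℝ) :
    ∫ x in s..t, φ₁ x = φ t - φ s :=
  intervalIntegral.integral_eq_sub_of_hasDerivAt (fun x _ => h.hasDeriv x)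
    (h.cont.intervalIntegrable _ _)

theorem IsKernel.hasDerivAt_tr0 {N : ℝ} {φ φ₁ φ₂ : ℝ → ℂ} (h : IsKernel N φ φ₁ φ₂) (t : ℝ) :
    HasDerivAt (tr φ) (tr φ₁ t) t :=
  hasDerivAt_tr h.mem0 h.mem1 h.ftc0 t

theorem IsKernel.hasDerivAt_tr1 {N : ℝ} {φ φ₁ φ₂ : ℝ → ℂ} (h : IsKernel N φ φ₁ φ₂) (t : ℝ) :
    HasDerivAt (tr φ₁) (tr φ₂ t) t :=
  hasDerivAt_tr h.mem1 h.mem2 h.ftc t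

theorem IsKernel.norm_tr0 {N : ℝ} {φ φ₁ φ₂ : ℝ → ℂ} (h : IsKernel N φ φ₁ φ₂) {t : ℝ} (ht : 0 ≤ t) :
    ‖tr φ t‖ ≤ 2 * N / (1 + t) := norm_tr_le_div h.mem0 h.nonneg h.le0 h.mem0' h.le0' ht

theorem IsKernel.norm_tr1 {N : ℝ} {φ φ₁ φ₂ : ℝ → ℂ} (h : IsKernel N φ φ₁ φ₂) {t : ℝ} (ht : 0 ≤ t) :
    ‖tr φ₁ t‖ ≤ 2 * N / (1 + t) := norm_tr_le_div h.mem1 h.nonneg h.le1 h.mem1' h.le1' ht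

theorem integrable_of_memLp_mul {f : ℝ → ℂ} (hf : MemLp f 2)
    (hf' : MemLp (fun s : ℝ => (s : ℂ) * f s) 2) : Integrable f := by
  have hb : MemLp (fun s : ℝ => ((√(1 + s ^ 2) : ℝ) : ℂ) * f s) 2 := by
    refine (hf.norm.add hf'.norm).mono ?_ (ae_of_all _ fun s => ?_)
    · exact (Continuous.aestronglyMeasurable (by fun_prop)).mul hf.1
    · simp only [Pi.add_apply]
      rw [norm_mul, Complex.norm_real, Real.norm_of_nonneg (by positivity),
        Real.norm_of_nonneg (by positivity), norm_mul, Complex.norm_real, Real.norm_eq_abs]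
      nlinarith [bracket_le s, norm_nonneg (f s)]
  refine (memLp_mul_integrable memLp_bracket_inv hb).congr (ae_of_all _ fun s => ?_)
  have : (√(1 + s ^ 2) : ℝ) ≠ 0 := by positivity
  simp only []
  push_cast
  rw [← mul_assoc, inv_mul_cancel₀ (by exact_mod_cast this), one_mul]

theorem integrable_conj {f : ℝ → ℂ} {μ : Measure ℝ} (hf : Integrable f μ) :
    Integrable (fun s => conj (f s)) μ :=
  (Complex.conjLIE.toContinuousLinearEquiv.toContinuousLinearMap.restrictScalars
    ℝ).integrable_comp hf

theorem IsKernel.integrable0 {N : ℝ} {φ φ₁ φ₂ : ℝ → ℂ} (h : IsKernel N φ φ₁ φ₂) : Integrable φ :=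
  integrable_of_memLp_mul h.mem0 h.mem0'

theorem IsKernel.integrable1 {N : ℝ} {φ φ₁ φ₂ : ℝ → ℂ} (h : IsKernel N φ φ₁ φ₂) : Integrable φ₁ :=
  integrable_of_memLp_mul h.mem1 h.mem1'

/-- The operator `A ↦ -4i ∫_{t > c} ⟪P_t, A⟫ P¹_t dt`. -/
noncomputable def opK (φ φ₁ : ℝ → ℂ) (c : ℝ) : HalfL2 →L[ℂ] HalfL2 :=
  ∫ t in Ioi c, (-4 * Complex.I) • InnerProductSpace.rankOne ℂ (tr φ₁ t) (tr φ t)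

theorem integrableOn_div_sq (M : ℝ) : IntegrableOn (fun t : ℝ => M / (1 + t) ^ 2) (Ioi 0) := by
  have := (integrableOn_comp_add_left_Ioi (fun t : ℝ => M * t ^ (-2 : ℝ)) 1 0).2
    (by
      rw [add_zero]
      exact (integrableOn_Ioi_rpow_of_lt (by norm_num) one_pos).const_mul M)
  refine this.congr_fun (fun t ht => ?_) measurableSet_Ioi
  simp only []
  rw [Real.rpow_neg (by have : (0:ℝ) < t := ht; positivity), div_eq_mul_inv]
  norm_cast

theorem integral_div_sq (M : ℝ) : ∫ t in Ioi (0 : ℝ), M / (1 + t) ^ 2 = M := by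
  have h := setIntegral_comp_add_left_Ioi (fun t : ℝ => M * t ^ (-2 : ℝ)) 1 0
  rw [add_zero, integral_const_mul M (fun t : ℝ => t ^ (-2 : ℝ)),
    integral_Ioi_rpow_of_lt (by norm_num) one_pos, Real.one_rpow] at h
  refine Eq.trans ?_ (h.trans (by norm_num))
  refine setIntegral_congr_fun measurableSet_Ioi fun t ht => ?_
  have : (0 : ℝ) < t := ht
  rw [Real.rpow_neg (by positivity), div_eq_mul_inv]
  norm_cast

theorem IntegrableOn.of_continuous_Ioi {E : Type*} [NormedAddCommGroup E] {g : ℝ → E}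
    (hg : Continuous g) {a : ℝ} (h : IntegrableOn g (Ioi a)) (c : ℝ) : IntegrableOn g (Ioi c) := by
  refine ((hg.integrableOn_Icc (a := c) (b := a)).union h).mono_set fun t ht => ?_
  by_cases hta : t ≤ a
  · exact Or.inl ⟨le_of_lt ht, hta⟩
  · exact Or.inr (not_le.1 hta)

theorem continuous_rankOne {E : Type*} [NormedAddCommGroup E] [InnerProductSpace ℂ E]
    {f g : ℝ → E} (hf : Continuous f) (hg : Continuous g) :
    Continuous fun t => InnerProductSpace.rankOne ℂ (f t) (g t) := by
  have : (fun t => InnerProductSpace.rankOne ℂ (f t) (g t)) = fun t =>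
      ContinuousLinearMap.smulRightL ℂ E E (innerSL ℂ (g t)) (f t) := by
    ext1 t; ext1 x
    simp
  rw [this]
  exact (ContinuousLinearMap.smulRightL ℂ E E).continuous₂.comp
    (((innerSL ℂ).continuous.comp hg).prodMk hf)

theorem IsKernel.integrableOn_rankOne {N N' : ℝ} {φ φ₁ φ₂ ψ ψ₁ ψ₂ : ℝ → ℂ}
    (h : IsKernel N φ φ₁ φ₂) (h' : IsKernel N' ψ ψ₁ ψ₂) (c : ℝ) :
    IntegrableOn (fun t => (-4 * Complex.I) • InnerProductSpace.rankOne ℂ (tr φ₁ t) (tr ψ t))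
      (Ioi c) := by
  have hc : Continuous fun t => (-4 * Complex.I) •
      InnerProductSpace.rankOne ℂ (tr φ₁ t) (tr ψ t) := by
    have := continuous_rankOne (continuous_tr φ₁) (continuous_tr ψ)
    exact this.const_smul (-4 * Complex.I)
  refine IntegrableOn.of_continuous_Ioi hc (a := 0) ?_ c
  refine Integrable.mono' (integrableOn_div_sq (16 * N * N')) hc.aestronglyMeasurable ?_
  filter_upwards [ae_restrict_mem measurableSet_Ioi] with t ht
  have ht' : (0 : ℝ) < t := ht
  rw [norm_smul, InnerProductSpace.norm_rankOne]
  have h1 := h.norm_tr1 ht'.le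
  have h2 := h'.norm_tr0 ht'.le
  calc _ = 4 * (‖tr φ₁ t‖ * ‖tr ψ t‖) := by simp
    _ ≤ 4 * (2 * N / (1 + t) * (2 * N' / (1 + t))) := by
        have := h.nonneg
        gcongr
    _ = _ := by field_simp; ring

theorem IsKernel.integrableOn_opK {N : ℝ} {φ φ₁ φ₂ : ℝ → ℂ} (h : IsKernel N φ φ₁ φ₂) (c : ℝ)
    (α : HalfL2) : IntegrableOn (fun t => (-4 * Complex.I * inner ℂ (tr φ t) α) • tr φ₁ t)
      (Ioi c) := by
  refine ((ContinuousLinearMap.apply ℂ HalfL2 α).integrable_comp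
    (h.integrableOn_rankOne h c)).congr (ae_of_all _ fun t => ?_)
  simp [mul_smul]

theorem IsKernel.opK_apply {N : ℝ} {φ φ₁ φ₂ : ℝ → ℂ} (h : IsKernel N φ φ₁ φ₂) (c : ℝ)
    (α : HalfL2) : opK φ φ₁ c α = ∫ t in Ioi c, (-4 * Complex.I * inner ℂ (tr φ t) α) • tr φ₁ t := by
  rw [opK, ContinuousLinearMap.integral_apply (h.integrableOn_rankOne h c)]
  congr 1; ext1 t
  simp [mul_smul]

theorem IsKernel.inner_opK {N : ℝ} {φ φ₁ φ₂ : ℝ → ℂ} (h : IsKernel N φ φ₁ φ₂) (c : ℝ)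
    (x α : HalfL2) : inner ℂ x (opK φ φ₁ c α) =
      ∫ t in Ioi c, (-4 * Complex.I * inner ℂ (tr φ t) α) * inner ℂ x (tr φ₁ t) := by
  rw [h.opK_apply, ← innerSL_apply_apply ℂ, ← ContinuousLinearMap.integral_comp_comm _
    (h.integrableOn_opK c α)]
  simp only [innerSL_apply_apply, inner_smul_right]

theorem hasDerivAt_xcorr {F G G' : ℝ → ℂ} (hF : Integrable F) (hG : ∀ t, HasDerivAt G (G' t) t)
    (hc : Continuous G') {C : ℝ} (hC : ∀ t, ‖G t‖ ≤ C) (hC' : ∀ t, ‖G' t‖ ≤ C) (τ : ℝ) :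
    HasDerivAt (xcorr F G) (xcorr F G' τ) τ := by
  have hGc : Continuous G := continuous_iff_continuousAt.2 fun t => (hG t).continuousAt
  have hm : ∀ {Q : ℝ → ℂ}, Continuous Q → ∀ τ, AEStronglyMeasurable fun s => F s * Q (s + τ) :=
    fun {Q} hQ τ => hF.1.mul (Continuous.aestronglyMeasurable (by fun_prop))
  refine (hasDerivAt_integral_of_dominated_loc_of_deriv_le (F := fun τ s => F s * G (s + τ))
    (F' := fun τ s => F s * G' (s + τ)) (bound := fun s => ‖F s‖ * C) (s := univ) univ_mem
    (Eventually.of_forall fun τ => hm hGc τ) ?_ (hm hc τ) (ae_of_all _ fun s τ _ => ?_)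
    (hF.norm.mul_const C) (ae_of_all _ fun s τ _ => ?_)).2
  · refine hF.mul_bdd (c := C) ?_ (ae_of_all _ fun s => hC _)
    exact Continuous.aestronglyMeasurable (by fun_prop)
  · rw [norm_mul]; gcongr; exact hC' _
  · have := (hG (s + τ)).comp_const_add s τ
    exact this.const_mul (F s)

theorem norm_xcorr_le {F G : ℝ → ℂ} (hF : Integrable F) {C : ℝ} (hC : ∀ t, ‖G t‖ ≤ C) (τ : ℝ) :
    ‖xcorr F G τ‖ ≤ (∫ s, ‖F s‖) * C := by
  rw [← integral_mul_const]
  refine norm_integral_le_of_norm_le (hF.norm.mul_const C) (ae_of_all _ fun s => ?_)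
  rw [norm_mul]; gcongr; exact hC _

theorem integrableOn_pow_mul_exp_neg (n : ℕ) :
    IntegrableOn (fun z : ℝ => z ^ n * Real.exp (-z)) (Ioi 0) := by
  refine (Real.GammaIntegral_convergent (s := n + 1) (by positivity)).congr_fun (fun z hz => ?_)
    measurableSet_Ioi
  simp only [add_sub_cancel_right, Real.rpow_natCast]; ring

theorem wt_eq_ft (ν : ℝ → ℝ) (τ : ℝ) :
    wt ν τ = ft ((Ioi (0 : ℝ)).indicator fun z => (ν z : ℂ)) (-τ) := by
  rw [wt, ft, ← integral_indicator measurableSet_Ioi]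
  congr 1; ext z
  by_cases hz : z ∈ Ioi (0 : ℝ)
  · simp [hz]
  · simp [hz]

theorem hasDerivAt_wt_pow (n : ℕ) (τ : ℝ) : HasDerivAt (wt fun z => z ^ n * Real.exp (-z))
    (-Complex.I * wt (fun z => z ^ (n + 1) * Real.exp (-z)) τ) τ := by
  have hi : ∀ n : ℕ, Integrable ((Ioi (0 : ℝ)).indicator fun z =>
      ((z ^ n * Real.exp (-z) : ℝ) : ℂ)) := fun n =>
    (integrable_indicator_iff measurableSet_Ioi).2 (integrableOn_pow_mul_exp_neg n).ofReal
  have e : (fun z : ℝ => (z : ℂ) * (Ioi (0 : ℝ)).indicator (fun z =>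
      ((z ^ n * Real.exp (-z) : ℝ) : ℂ)) z) = (Ioi (0 : ℝ)).indicator fun z =>
      ((z ^ (n + 1) * Real.exp (-z) : ℝ) : ℂ) := by
    ext z
    by_cases hz : z ∈ Ioi (0 : ℝ)
    · rw [indicator_of_mem hz, indicator_of_mem hz]; push_cast; ring
    · rw [indicator_of_notMem hz, indicator_of_notMem hz, mul_zero]
  have h := hasDerivAt_ft (hi n) (by rw [e]; exact hi (n + 1)) (-τ)
  have h2 := HasDerivAt.scomp τ h (hasDerivAt_neg τ)
  rw [show wt (fun z => z ^ n * Real.exp (-z)) = _ from funext (wt_eq_ft _), wt_eq_ft]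
  refine h2.congr_deriv ?_
  rw [neg_one_smul, neg_mul, ← e, ft, ft, ← integral_const_mul]
  congr 2; ext z; ring

theorem wt_exp (τ : ℝ) : wt (fun z => z ^ 0 * Real.exp (-z)) τ = 1 / (1 + Complex.I * τ) := by
  rw [wt, ← integral_exp_neg_mul_one_add]
  congr 1; ext z
  push_cast
  rw [pow_zero, one_mul, ← Complex.exp_add]; ring_nf

theorem one_add_I_mul_ne_zero (τ : ℝ) : (1 + Complex.I * τ : ℂ) ≠ 0 := by
  intro h
  have := congrArg Complex.re h
  simp at this

/-- Found by differentiating the transform 1/(1 + iτ) of e^{−z}. Only its modulus (1 + τ²)⁻¹ and its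
value 1 at τ = 0 are used later. -/
theorem wt_mul_exp (τ : ℝ) :
    wt (fun z => z ^ 1 * Real.exp (-z)) τ = 1 / (1 + Complex.I * τ) ^ 2 := by
  have h1 := hasDerivAt_wt_pow 0 τ
  rw [show wt (fun z => z ^ 0 * Real.exp (-z)) = _ from funext wt_exp] at h1
  have h2 : HasDerivAt (fun τ : ℝ => 1 / (1 + Complex.I * τ : ℂ))
      (-Complex.I / (1 + Complex.I * τ) ^ 2) τ := by
    have h3 : HasDerivAt (fun τ : ℝ => (1 + Complex.I * τ : ℂ)) Complex.I τ := by
      simpa using ((hasDerivAt_id τ).ofReal_comp.const_mul Complex.I).const_add (1 : ℂ)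
    simp only [one_div]
    exact h3.inv (one_add_I_mul_ne_zero τ)
  have h3 := h1.unique h2
  have h4 : -Complex.I * (wt (fun z => z ^ 1 * Real.exp (-z)) τ) =
      -Complex.I * (1 / (1 + Complex.I * τ) ^ 2) := by rw [mul_one_div]; exact h3
  exact mul_left_cancel₀ (neg_ne_zero.2 Complex.I_ne_zero) h4

theorem norm_wt_mul_exp (τ : ℝ) : ‖wt (fun z => z ^ 1 * Real.exp (-z)) τ‖ = (1 + τ ^ 2)⁻¹ := by
  rw [wt_mul_exp, norm_div, norm_pow, norm_one, ← Complex.normSq_eq_norm_sq, Complex.normSq_apply]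
  simp [sq]

theorem norm_wt_le (n : ℕ) (τ : ℝ) : ‖wt (fun z => z ^ n * Real.exp (-z)) τ‖ ≤
    ∫ z, ‖(Ioi (0 : ℝ)).indicator (fun z => ((z ^ n * Real.exp (-z) : ℝ) : ℂ)) z‖ := by
  rw [wt_eq_ft]; exact norm_ft_le _ _

/-- The pairing of a function on the half-line with its translates. -/
theorem inner_tr_zero {A f : ℝ → ℂ} (h2 : MemLp A 2) (hf : MemLp f 2) (h0 : ∀ ξ ≤ 0, A ξ = 0)
    (t : ℝ) : inner ℂ (tr f t) (tr A 0) = xcorr A (fun s => conj (f s)) t := by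
  rw [inner_tr hf, xcorr, ← setIntegral_eq_integral_of_forall_compl_eq_zero (s := Ioi 0)
    (f := fun s => A s * conj (f (s + t))) fun s hs => by rw [h0 s (not_lt.1 hs), zero_mul]]
  refine integral_congr_ae ?_
  filter_upwards [coeFn_tr h2 0] with ξ hξ
  rw [hξ, zero_add, mul_comm, add_comm]

/-- For τ ≥ 0 the translate of A to the right by τ is still supported in the half-line, so the
restriction built into `tr` loses nothing and the integral runs over the whole line. -/
theorem inner_tr_neg {A f : ℝ → ℂ} (h2 : MemLp A 2) (hf : MemLp f 2) (h0 : ∀ ξ ≤ 0, A ξ = 0)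
    {τ : ℝ} (hτ : 0 ≤ τ) (t : ℝ) :
    inner ℂ (tr A (-τ)) (tr f t) = xcorr (fun s => conj (A s)) f (t + τ) := by
  rw [inner_tr h2, xcorr]
  have e : ∫ ξ in Ioi 0, conj (A (-τ + ξ)) * tr f t ξ = ∫ ξ in Ioi 0, conj (A (-τ + ξ)) * f (t + ξ) := by
    refine integral_congr_ae ?_
    filter_upwards [coeFn_tr hf t] with ξ hξ
    rw [hξ]
  rw [e, setIntegral_eq_integral_of_forall_compl_eq_zero
    fun s hs => by
      have : s ≤ 0 := not_lt.1 hs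
      rw [h0 (-τ + s) (by linarith), map_zero, zero_mul],
    ← integral_add_left_eq_self _ τ]
  congr 1; ext s; ring_nf

theorem norm_tr_zero {A : ℝ → ℂ} (h2 : MemLp A 2) (h0 : ∀ ξ ≤ 0, A ξ = 0) :
    eLpNorm A 2 volume = ENNReal.ofReal ‖tr A 0‖ := by
  have e : (fun ξ => A (0 + ξ)) = A := by ext; rw [zero_add]
  rw [norm_tr A h2, e, ← eLpNorm_indicator_eq_eLpNorm_restrict measurableSet_Ioi,
    indicator_eq_self.2 fun s hs => by
      by_contra h
      exact hs (h0 s (not_lt.1 h)), ENNReal.ofReal_toReal h2.2.ne]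

theorem norm_tr_le_norm_tr_zero {A : ℝ → ℂ} (h2 : MemLp A 2) (h0 : ∀ ξ ≤ 0, A ξ = 0) (t : ℝ) :
    ‖tr A t‖ ≤ ‖tr A 0‖ :=
  norm_tr_le h2 (norm_nonneg _) (norm_tr_zero h2 h0).le t

theorem xcorr_conj_conj {F G : ℝ → ℂ} (τ : ℝ) :
    xcorr (fun s => conj (F s)) G τ = conj (xcorr F (fun s => conj (G s)) τ) := by
  rw [xcorr, xcorr, ← integral_conj]; simp

theorem integrableOn_wt_mul : IntegrableOn (wt fun z => z ^ 1 * Real.exp (-z)) (Ioi 0) := by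
  refine (integrable_inv_one_add_sq.integrableOn).mono' ?_ (ae_of_all _ fun τ =>
    (norm_wt_mul_exp τ).le)
  exact (continuous_iff_continuousAt.2 fun τ =>
    (hasDerivAt_wt_pow 1 τ).continuousAt).aestronglyMeasurable

/-- The correlation in the integrand is R′, where R(τ) = ∫₀^∞ B(t) conj B(t + τ) dt. With k the
weight's transform, k′ = −iκ for κ the transform of z² e^{−z}, and integration by parts gives 4i ∫ k
R′ = −4i R(0) − 4 ∫ κ R. Here R(0) is real, so its term is imaginary, and the real part of ∫ κ R is
half of a nonnegative energy. -/
theorem re_integral_wt_mul_deriv_nonpos {B D : ℝ → ℂ} (hB : Integrable B) (hD : Integrable D)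
    (hBD : ∀ t, HasDerivAt B (D t) t) (hDc : Continuous D) {C : ℝ} (hC : ∀ t, ‖B t‖ ≤ C)
    (hC' : ∀ t, ‖D t‖ ≤ C) :
    (4 * Complex.I * ∫ τ in Ioi 0, wt (fun z => z ^ 1 * Real.exp (-z)) τ *
      xcorr ((Ioi 0).indicator B) (fun s => conj (D s)) τ).re ≤ 0 := by
  set F := (Ioi (0 : ℝ)).indicator B with hF
  have hFi : Integrable F := hB.indicator measurableSet_Ioi
  set k := wt fun z => z ^ 1 * Real.exp (-z) with hk
  set κ := wt fun z => z ^ 2 * Real.exp (-z) with hκ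
  set R := xcorr F (fun s => conj (B s)) with hR
  set R' := xcorr F (fun s => conj (D s)) with hR'
  have hRi : Integrable R := integrable_xcorr hFi (integrable_conj hB)
  have hRi' : Integrable R' := integrable_xcorr hFi (integrable_conj hD)
  have hRd : ∀ τ, HasDerivAt R (R' τ) τ := fun τ =>
    hasDerivAt_xcorr hFi (fun t => (Complex.conjLIE.toContinuousLinearEquiv.toContinuousLinearMap.restrictScalars ℝ).hasFDerivAt.comp_hasDerivAt t (hBD t))
      (Complex.continuous_conj.comp hDc) (C := C) (fun t => by simpa using hC t)
      (fun t => by simpa using hC' t) τ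
  have hkd : ∀ τ, HasDerivAt k (-Complex.I * κ τ) τ := fun τ => hasDerivAt_wt_pow 1 τ
  have hkc : Continuous k := continuous_iff_continuousAt.2 fun τ => (hkd τ).continuousAt
  have hκc : Continuous κ := continuous_iff_continuousAt.2 fun τ =>
    (hasDerivAt_wt_pow 2 τ).continuousAt
  have hRc : Continuous R := continuous_iff_continuousAt.2 fun τ => (hRd τ).continuousAt
  have hRb : ∀ τ, ‖R τ‖ ≤ (∫ s, ‖F s‖) * C :=
    norm_xcorr_le hFi fun t => by simpa using hC t
  have i1 : IntegrableOn (k * R') (Ioi 0) :=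
    hRi'.integrableOn.bdd_mul hkc.aestronglyMeasurable (ae_of_all _ (norm_wt_le 1))
  have i2 : IntegrableOn ((fun τ => -Complex.I * κ τ) * R) (Ioi 0) := by
    refine hRi.integrableOn.bdd_mul (by fun_prop) (c := ∫ z, ‖(Ioi (0 : ℝ)).indicator
      (fun z => ((z ^ 2 * Real.exp (-z) : ℝ) : ℂ)) z‖) (ae_of_all _ fun τ => ?_)
    rw [norm_mul, norm_neg, Complex.norm_I, one_mul]
    exact norm_wt_le 2 τ
  have l1 : Tendsto (k * R) (𝓝[>] 0) (𝓝 (k 0 * R 0)) :=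
    ((hkc.mul hRc).tendsto 0).mono_left nhdsWithin_le_nhds
  have l2 : Tendsto (k * R) atTop (𝓝 0) := by
    have : Tendsto (fun τ : ℝ => (1 + τ ^ 2)⁻¹ * ((∫ s, ‖F s‖) * C)) atTop
        (𝓝 (0 * ((∫ s, ‖F s‖) * C))) := by
      refine Tendsto.mul_const _ (tendsto_inv_atTop_zero.comp ?_)
      exact tendsto_atTop_add_const_left _ _ (tendsto_pow_atTop two_ne_zero)
    rw [zero_mul] at this
    refine squeeze_zero_norm (fun τ => ?_) this
    rw [Pi.mul_apply, norm_mul, hk, norm_wt_mul_exp]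
    gcongr; exact hRb τ
  have hp := integral_Ioi_mul_deriv_eq_deriv_mul (fun τ _ => hkd τ) (fun τ _ => hRd τ) i1 i2 l1 l2
  have hk0 : k 0 = 1 := by rw [hk, wt_mul_exp]; simp
  have hR0 : (Complex.I * R 0).re = 0 := by
    have : R 0 = ((∫ s, ‖F s‖ ^ 2 : ℝ) : ℂ) := by
      rw [hR, xcorr, ← integral_complex_ofReal]
      congr 1; ext s
      rw [add_zero, ← Complex.normSq_eq_norm_sq, Complex.normSq_eq_conj_mul_self, mul_comm, hF]
      by_cases hs : s ∈ Ioi (0 : ℝ)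
      · rw [indicator_of_mem hs]
      · rw [indicator_of_notMem hs]; simp
    rw [this]; simp
  have hpos := two_re_integral_wt_mul_xcorr (integrableOn_pow_mul_exp_neg 2) (integrable_conj hFi)
  have hpos' : 0 ≤ (∫ τ in Ioi 0, κ τ * R τ).re := by
    -- For τ > 0 cutting B off to the half-line in the second slot as well changes nothing, and R
    -- becomes an autocorrelation.
    have e : ∫ τ in Ioi 0, κ τ * R τ = ∫ τ in Ioi 0, κ τ *
        xcorr (fun s => conj (conj (F s))) (fun s => conj (F s)) τ := by
      refine setIntegral_congr_fun measurableSet_Ioi fun τ hτ => ?_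
      congr 1
      rw [hR, xcorr, xcorr]
      congr 1; ext s
      by_cases hs : s ∈ Ioi (0 : ℝ)
      · have : s + τ ∈ Ioi (0 : ℝ) := mem_Ioi.2 (add_pos (mem_Ioi.1 hs) (mem_Ioi.1 hτ))
        simp [hF, indicator_of_mem hs, indicator_of_mem this]
      · simp [hF, indicator_of_notMem hs]
    rw [e]
    have : 0 ≤ ∫ z in Ioi (0 : ℝ), z ^ 2 * Real.exp (-z) * ‖ft (fun s => conj (F s)) (-z)‖ ^ 2 :=
      integral_nonneg fun z => by positivity
    linarith
  rw [hp, hk0]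
  have e2 : ∫ τ in Ioi 0, -Complex.I * κ τ * R τ = -Complex.I * ∫ τ in Ioi 0, κ τ * R τ := by
    rw [← integral_const_mul]; congr 1; ext τ; ring
  rw [e2]
  have e3 : 4 * Complex.I * (0 - 1 * R 0 - -Complex.I * ∫ τ in Ioi 0, κ τ * R τ)
      = -4 * (Complex.I * R 0) - 4 * ∫ τ in Ioi 0, κ τ * R τ := by
    linear_combination 4 * (∫ τ in Ioi 0, κ τ * R τ) * Complex.I_mul_I
  rw [e3]
  simp only [Complex.sub_re, neg_mul, Complex.neg_re]
  rw [show (4 : ℂ) = ((4 : ℝ) : ℂ) by norm_num, Complex.re_ofReal_mul, Complex.re_ofReal_mul, hR0]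
  linarith

/-- Let B(t) = ⟪P_t, α⟫ and f = α + Kα. The autocorrelation of A at τ > 0 equals ⟪A(· − τ), f⟫ + 4i
∫₀^∞ B(t) conj B′(t + τ) dt. Integrated against 1/(1 + iτ)², the second term has nonpositive real
part and the first is at most ‖α‖ ‖f‖ ∫₀^∞ (1 + τ²)⁻¹ dτ = (π/2) ‖α‖ ‖f‖; the energy is twice the
real part of the sum. -/
theorem IsKernel.energyControlled {N : ℝ} {φ φ₁ φ₂ : ℝ → ℂ} (h : IsKernel N φ φ₁ φ₂) {A : ℝ → ℂ}
    (hA : Integrable A) (h2 : MemLp A 2) (h0 : ∀ ξ ≤ 0, A ξ = 0) :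
    EnergyControlled (tr A 0) (tr A 0 + opK φ φ₁ 0 (tr A 0)) := by
  refine ⟨A, hA, h2, h0, rfl, ?_⟩
  set α := tr A 0 with hα
  set f := α + opK φ φ₁ 0 α with hf
  set B := xcorr A (fun s => conj (φ s)) with hB
  set D := xcorr A (fun s => conj (φ₁ s)) with hD
  set k := wt fun z => z ^ 1 * Real.exp (-z) with hk
  have hBin : ∀ t, inner ℂ (tr φ t) α = B t := inner_tr_zero h2 h.mem0 h0
  have hDin : ∀ t, inner ℂ (tr φ₁ t) α = D t := inner_tr_zero h2 h.mem1 h0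
  have hBi : Integrable B := integrable_xcorr hA (integrable_conj h.integrable0)
  have hDi : Integrable D := integrable_xcorr hA (integrable_conj h.integrable1)
  have hBD : ∀ t, HasDerivAt B (D t) t := fun t => by
    have := (h.hasDerivAt_tr0 t).inner ℂ (hasDerivAt_const t α)
    simp only [inner_zero_right, zero_add, hBin, hDin] at this
    exact this
  have hDc : Continuous D := by
    rw [show D = fun t => inner ℂ (tr φ₁ t) α from funext fun t => (hDin t).symm]
    exact (continuous_tr φ₁).inner continuous_const
  have hC : ∀ t, ‖B t‖ ≤ N * ‖α‖ := fun t => by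
    rw [← hBin]
    exact (norm_inner_le_norm _ _).trans (by gcongr; exact norm_tr_le h.mem0 h.nonneg h.le0 t)
  have hC' : ∀ t, ‖D t‖ ≤ N * ‖α‖ := fun t => by
    rw [← hDin]
    exact (norm_inner_le_norm _ _).trans (by gcongr; exact norm_tr_le h.mem1 h.nonneg h.le1 t)
  have hneg := re_integral_wt_mul_deriv_nonpos hBi hDi hBD hDc hC hC'
  set V := xcorr ((Ioi 0).indicator B) (fun s => conj (D s)) with hV
  have hVi : Integrable V := integrable_xcorr (hBi.indicator measurableSet_Ioi) (integrable_conj hDi)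
  have hkc : Continuous k := continuous_iff_continuousAt.2 fun τ =>
    (hasDerivAt_wt_pow 1 τ).continuousAt
  have hRA : ∀ τ ∈ Ioi (0 : ℝ), xcorr (fun s => conj (A s)) A τ =
      inner ℂ (tr A (-τ)) f + 4 * Complex.I * V τ := by
    intro τ hτ
    have hτ' : 0 ≤ τ := le_of_lt hτ
    have e : V τ = ∫ t in Ioi 0, B t * conj (D (t + τ)) := by
      rw [hV, xcorr, ← integral_indicator measurableSet_Ioi]
      congr 1; ext t
      by_cases ht : t ∈ Ioi (0 : ℝ)
      · rw [indicator_of_mem ht, indicator_of_mem ht]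
      · rw [indicator_of_notMem ht, indicator_of_notMem ht, zero_mul]
    have e2 : inner ℂ (tr A (-τ)) (opK φ φ₁ 0 α) = -(4 * Complex.I * V τ) := by
      rw [h.inner_opK, e, ← integral_const_mul, ← integral_neg]
      congr 1; ext1 t
      rw [hBin, inner_tr_neg h2 h.mem1 h0 hτ', xcorr_conj_conj, hD]
      ring
    rw [hf, inner_add_right, e2, neg_add_cancel_right, hα, inner_tr_neg h2 h2 h0 hτ', zero_add]
  have hE : energy A = 2 * (∫ τ in Ioi 0, k τ * xcorr (fun s => conj (A s)) A τ).re := by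
    rw [hk, two_re_integral_wt_mul_xcorr (integrableOn_pow_mul_exp_neg 1) hA, energy]
    simp
  have hb : ∀ τ, ‖inner ℂ (tr A (-τ)) f‖ ≤ ‖α‖ * ‖f‖ := fun τ =>
    (norm_inner_le_norm _ _).trans (by gcongr; exact norm_tr_le_norm_tr_zero h2 h0 _)
  have hic : Continuous fun τ : ℝ => inner ℂ (tr A (-τ)) f :=
    ((continuous_tr A).comp continuous_neg).inner continuous_const
  have i1 : IntegrableOn (fun τ => k τ * inner ℂ (tr A (-τ)) f) (Ioi 0) :=
    integrableOn_wt_mul.mul_bdd (c := ‖α‖ * ‖f‖) hic.aestronglyMeasurable (ae_of_all _ hb)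
  have i2 : IntegrableOn (fun τ => k τ * V τ) (Ioi 0) :=
    hVi.integrableOn.bdd_mul hkc.aestronglyMeasurable (ae_of_all _ (norm_wt_le 1))
  have hsum : ∫ τ in Ioi 0, k τ * xcorr (fun s => conj (A s)) A τ =
      (∫ τ in Ioi 0, k τ * inner ℂ (tr A (-τ)) f) + 4 * Complex.I * ∫ τ in Ioi 0, k τ * V τ := by
    rw [← integral_const_mul, ← integral_add i1 (i2.const_mul _)]
    refine setIntegral_congr_fun measurableSet_Ioi fun τ hτ => ?_
    rw [hRA τ hτ]; ring
  have hle : (∫ τ in Ioi 0, k τ * inner ℂ (tr A (-τ)) f).re ≤ Real.pi / 2 * (‖α‖ * ‖f‖) := by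
    refine (Complex.re_le_norm _).trans ?_
    have e : Real.pi / 2 * (‖α‖ * ‖f‖) = ∫ τ in Ioi (0 : ℝ), (1 + τ ^ 2)⁻¹ * (‖α‖ * ‖f‖) := by
      rw [integral_mul_const, integral_Ioi_inv_one_add_sq]; simp
    rw [e]
    refine norm_integral_le_of_norm_le (integrable_inv_one_add_sq.integrableOn.mul_const _)
      (ae_of_all _ fun τ => ?_)
    rw [norm_mul, hk, norm_wt_mul_exp]
    gcongr; exact hb τ
  rw [hE, hsum, Complex.add_re]
  linarith

/-! ### Uniform coercivity and invertibility of 1 + K -/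

section Abstract
variable {E : Type*} [NormedAddCommGroup E] [NormedSpace ℂ E] [CompleteSpace E]

theorem isUnit_of_near {U V : E →L[ℂ] E} (hU : IsUnit U) {C : ℝ} (hC : 0 ≤ C)
    (hb : ∀ x, ‖x‖ ≤ C * ‖U x‖) (h : C * ‖V - U‖ < 1) : IsUnit V := by
  obtain ⟨u, rfl⟩ := hU
  have hi : ‖(↑u⁻¹ : E →L[ℂ] E)‖ ≤ C := ContinuousLinearMap.opNorm_le_bound _ hC fun x => by
    have := hb ((↑u⁻¹ : E →L[ℂ] E) x)
    have e : (u : E →L[ℂ] E) ((↑u⁻¹ : E →L[ℂ] E) x) = x :=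
      congrArg (fun T : E →L[ℂ] E => T x) u.mul_inv
    rwa [e] at this
  have h1 : ‖-((↑u⁻¹ : E →L[ℂ] E) * (V - u))‖ < 1 := by
    rw [norm_neg]
    refine (norm_mul_le _ _).trans_lt (lt_of_le_of_lt ?_ h)
    gcongr
  have h2 := u.isUnit.mul (isUnit_one_sub_of_norm_lt_one h1)
  have e : (u : E →L[ℂ] E) * (1 - -((↑u⁻¹ : E →L[ℂ] E) * (V - u))) = V := by
    rw [sub_neg_eq_add, mul_add, mul_one, ← mul_assoc, Units.mul_inv, one_mul]
    abel
  rwa [e] at h2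

/-- Method of continuity: the bound is uniform along 1 + sT, so invertibility passes from s = 0 to s
= 1 in steps of length 1/n, each a Neumann perturbation as soon as C‖T‖ < n. -/
theorem isUnit_one_add_of_bound {T : E →L[ℂ] E} {C : ℝ} (hC : 0 ≤ C)
    (hb : ∀ s : ℝ, 0 ≤ s → s ≤ 1 → ∀ x, ‖x‖ ≤ C * ‖x + (s : ℂ) • T x‖) : IsUnit (1 + T) := by
  obtain ⟨n, hn⟩ := exists_nat_gt (C * ‖T‖)
  have hn0 : (0 : ℝ) < n := lt_of_le_of_lt (by positivity) hn
  have key : ∀ j : ℕ, j ≤ n → IsUnit (1 + ((j / n : ℝ) : ℂ) • T) := by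
    intro j
    induction j with
    | zero => intro _; simp
    | succ j ih =>
      intro hj
      refine isUnit_of_near (ih (by omega)) hC (fun x => ?_) ?_
      · simpa using hb (j / n) (by positivity) ((div_le_one hn0).2 (by exact_mod_cast (by omega))) x
      · have e : (1 + (((j + 1 : ℕ) / n : ℝ) : ℂ) • T) - (1 + ((j / n : ℝ) : ℂ) • T)
            = ((1 / n : ℝ) : ℂ) • T := by
          rw [add_sub_add_left_eq_sub, ← sub_smul]
          congr 1; push_cast; ring
        rw [e, norm_smul, Complex.norm_real, Real.norm_of_nonneg (by positivity)]
        rw [show C * (1 / n * ‖T‖) = C * ‖T‖ / n by ring, div_lt_one hn0]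
        exact hn
  have := key n le_rfl
  rwa [div_self hn0.ne', Complex.ofReal_one, one_smul] at this

end Abstract

/-- The primitive of A at s is a pairing with a translate of one fixed indicator. These translates
form a continuous curve over a compact interval, so `smallPairing_uniform` applies to them. -/
theorem inner_tr_indicator {M : ℝ} {A : ℝ → ℂ} (h2 : MemLp A 2) {s : ℝ} (hs : s ∈ Icc 0 M) :
    inner ℂ (tr ((Ioc 0 M).indicator fun _ => 1) (M - s)) (tr A 0) = ∫ ξ in Ioc 0 s, A ξ := by
  have hm : MemLp ((Ioc 0 M).indicator fun _ => (1 : ℂ)) 2 :=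
    memLp_indicator_const _ measurableSet_Ioc _ (Or.inr (by simp))
  have hsub : Ioc 0 s ⊆ Ioi (0 : ℝ) := fun x hx => hx.1
  rw [inner_tr hm, ← integral_indicator measurableSet_Ioi, ← integral_indicator measurableSet_Ioc]
  have hA := (ae_restrict_iff' measurableSet_Ioi).1 (coeFn_tr h2 0)
  refine integral_congr_ae ?_
  filter_upwards [hA] with ξ hξ
  by_cases h : ξ ∈ Ioi (0 : ℝ)
  · rw [indicator_of_mem h, hξ h, zero_add]
    have h' : 0 < ξ := h
    by_cases h3 : ξ ≤ s
    · rw [indicator_of_mem (show M - s + ξ ∈ Ioc 0 M from ⟨by linarith [hs.2], by linarith⟩),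
        indicator_of_mem (show ξ ∈ Ioc 0 s from ⟨h, h3⟩)]; simp
    · rw [indicator_of_notMem (fun h4 => h3 (by linarith [h4.2])),
        indicator_of_notMem (fun h4 => h3 h4.2)]; simp
  · rw [indicator_of_notMem h, indicator_of_notMem fun h' => h (hsub h')]

/-- Integration by parts with A merely integrable, by Fubini on the triangle ξ < s. -/
theorem integral_mul_eq_sub_of_ftc {A ψ ψ' : ℝ → ℂ} {M : ℝ} (hAi : IntegrableOn A (Ioc 0 M))
    (hψ' : Continuous ψ') (hd : ∀ t, HasDerivAt ψ (ψ' t) t) :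
    ∫ ξ in Ioc 0 M, ψ ξ * A ξ =
      ψ M * (∫ ξ in Ioc 0 M, A ξ) - ∫ s in Ioc 0 M, ψ' s * ∫ ξ in Ioc 0 s, A ξ := by
  set μ := volume.restrict (Ioc 0 M) with hμ
  have hψi : Integrable ψ' μ := (hψ'.integrableOn_Icc).mono_set Ioc_subset_Icc_self
  have hψc : Continuous ψ := continuous_iff_continuousAt.2 fun t => (hd t).continuousAt
  set T : Set (ℝ × ℝ) := {p | p.2 < p.1} with hT
  have hTm : MeasurableSet T := measurableSet_lt measurable_snd measurable_fst
  have key : Integrable (T.indicator fun p : ℝ × ℝ => ψ' p.1 * A p.2) (μ.prod μ) :=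
    (hψi.mul_prod hAi).indicator hTm
  have swap := integral_integral_swap (f := fun s ξ => T.indicator (fun p : ℝ × ℝ => ψ' p.1 * A p.2) (s, ξ)) key
  have e1 : ∫ s in Ioc 0 M, ψ' s * ∫ ξ in Ioc 0 s, A ξ =
      ∫ s, ∫ ξ, T.indicator (fun p : ℝ × ℝ => ψ' p.1 * A p.2) (s, ξ) ∂μ ∂μ := by
    refine setIntegral_congr_fun measurableSet_Ioc fun s hs => ?_
    have : ∀ ξ, T.indicator (fun p : ℝ × ℝ => ψ' p.1 * A p.2) (s, ξ) =
        (Iio s).indicator (fun ξ => ψ' s * A ξ) ξ := fun ξ => by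
      by_cases h : ξ < s
      · rw [indicator_of_mem (show (s, ξ) ∈ T from h), indicator_of_mem (show ξ ∈ Iio s from h)]
      · rw [indicator_of_notMem (show (s, ξ) ∉ T from h), indicator_of_notMem (show ξ ∉ Iio s from h)]
    simp only [this]
    rw [integral_indicator measurableSet_Iio, hμ, Measure.restrict_restrict measurableSet_Iio,
      integral_const_mul]
    congr 1
    rw [show Iio s ∩ Ioc 0 M = Ioo 0 s from by
      ext x; simp only [mem_inter_iff, mem_Iio, mem_Ioc, mem_Ioo]
      exact ⟨fun h => ⟨h.2.1, h.1⟩, fun h => ⟨h.2, h.1, (h.2.le.trans hs.2)⟩⟩]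
    exact integral_Ioc_eq_integral_Ioo
  have e2 : ∫ ξ, ∫ s, T.indicator (fun p : ℝ × ℝ => ψ' p.1 * A p.2) (s, ξ) ∂μ ∂μ =
      ∫ ξ in Ioc 0 M, (ψ M - ψ ξ) * A ξ := by
    refine setIntegral_congr_fun measurableSet_Ioc fun ξ hξ => ?_
    have : ∀ s, T.indicator (fun p : ℝ × ℝ => ψ' p.1 * A p.2) (s, ξ) =
        (Ioi ξ).indicator (fun s => ψ' s * A ξ) s := fun s => by
      by_cases h : ξ < s
      · rw [indicator_of_mem (show (s, ξ) ∈ T from h), indicator_of_mem (show s ∈ Ioi ξ from h)]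
      · rw [indicator_of_notMem (show (s, ξ) ∉ T from h), indicator_of_notMem (show s ∉ Ioi ξ from h)]
    simp only [this]
    rw [integral_indicator measurableSet_Ioi, hμ, Measure.restrict_restrict measurableSet_Ioi,
      integral_mul_const]
    congr 1
    rw [show Ioi ξ ∩ Ioc 0 M = Ioc ξ M from by
      ext x; simp only [mem_inter_iff, mem_Ioi, mem_Ioc]
      exact ⟨fun h => ⟨h.1, h.2.2⟩, fun h => ⟨h.1, hξ.1.trans h.1, h.2⟩⟩,
      ← intervalIntegral.integral_of_le hξ.2]
    exact intervalIntegral.integral_eq_sub_of_hasDerivAt (fun x _ => hd x)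
      (hψ'.intervalIntegrable _ _)
  have i1 : IntegrableOn (fun ξ => ψ ξ * A ξ) (Ioc 0 M) := by
    obtain ⟨C, hC⟩ := isCompact_Icc.exists_bound_of_continuousOn (hψc.continuousOn (s := Icc 0 M))
    refine hAi.bdd_mul (c := C) hψc.aestronglyMeasurable ?_
    filter_upwards [ae_restrict_mem measurableSet_Ioc] with ξ hξ
    exact hC ξ ⟨hξ.1.le, hξ.2⟩
  rw [e1, swap, e2, ← integral_const_mul, ← integral_sub (hAi.const_mul _)]
  · congr 1; ext ξ; ring
  · refine ((hAi.const_mul (ψ M)).sub i1).congr (ae_of_all _ fun ξ => ?_)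
    simp only [Pi.sub_apply]; ring

theorem IsKernel.norm_tr_le_3 {N : ℝ} {φ φ₁ φ₂ : ℝ → ℂ} (h : IsKernel N φ φ₁ φ₂) (t : ℝ) :
    ‖tr φ t‖ ≤ N ∧ ‖tr φ₁ t‖ ≤ N ∧ ‖tr φ₂ t‖ ≤ N ∧ ‖φ t‖ ≤ 2 * N ∧ ‖φ₁ t‖ ≤ 2 * N := by
  have h0 := norm_tr_le h.mem0 h.nonneg h.le0 t
  have h1 := norm_tr_le h.mem1 h.nonneg h.le1 t
  have h2 := norm_tr_le h.mem2 h.nonneg h.le2 t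
  exact ⟨h0, h1, h2, (norm_apply_le_tr h.mem0 h.mem1 h.ftc0 t).trans (by linarith),
    (norm_apply_le_tr h.mem1 h.mem2 h.ftc t).trans (by linarith)⟩

/-- Beyond a large M the decay of `tr φ` makes the pairing small. On (0, M] an integration by parts
leaves only primitives of A, which are pairings with a fixed compact family, multiplied by uniformly
bounded values of φ and φ₁. Hence the constant depends on N and ε but not on the kernel or on t. -/
theorem exists_inner_tr_le {N : ℝ} (hN : 0 ≤ N) {ε : ℝ} (hε : 0 < ε) :
    ∃ C, 0 ≤ C ∧ ∀ φ φ₁ φ₂ : ℝ → ℂ, IsKernel N φ φ₁ φ₂ → ∀ t : ℝ, 0 ≤ t → ∀ α f : HalfL2,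
      EnergyControlled α f → ‖inner ℂ (tr φ t) α‖ ≤ ε * ‖α‖ + C * ‖f‖ := by
  obtain ⟨M, hM0, hM⟩ : ∃ M : ℝ, 0 ≤ M ∧ 2 * N / (1 + M) ≤ ε / 2 := by
    refine ⟨4 * N / ε, by positivity, ?_⟩
    rw [div_le_iff₀ (by positivity)]
    have : ε / 2 * (1 + 4 * N / ε) = ε / 2 + 2 * N := by field_simp; ring
    linarith
  -- The first summand bounds the boundary term at M, the second the integral of φ₁ over (0, M]; the
  -- 1 keeps the sum positive when N = 0.
  have hM1 : 0 < 2 * N + M * (2 * N) + 1 := by positivity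
  obtain ⟨C, hC, H⟩ := smallPairing_uniform (γ := fun s =>
    tr ((Ioc 0 M).indicator fun _ => 1) (M - s)) ((continuous_tr _).comp (by fun_prop))
    (isCompact_Icc (a := 0) (b := M)) (ε := ε / (2 * (2 * N + M * (2 * N) + 1))) (by positivity)
  refine ⟨(2 * N + M * (2 * N) + 1) * C, by positivity, ?_⟩
  intro φ φ₁ φ₂ h t ht α f hg
  have H' : ∀ s ∈ Icc 0 M, _ := fun s hs => H s hs α f hg
  set S := ε / (2 * (2 * N + M * (2 * N) + 1)) * ‖α‖ + C * ‖f‖ with hS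
  obtain ⟨A, hA, h2, h0, rfl, -⟩ := hg
  have hI : ∀ s ∈ Icc 0 M, ‖∫ ξ in Ioc 0 s, A ξ‖ ≤ S := fun s hs => by
    rw [← inner_tr_indicator h2 hs]; exact H' s hs
  have hB := inner_tr_zero h2 h.mem0 h0 t
  have hbd : ∀ s, ‖conj (φ (s + t))‖ ≤ 2 * N := fun s => by
    rw [RCLike.norm_conj]; exact (h.norm_tr_le_3 _).2.2.2.1
  have hφc : Continuous φ := continuous_iff_continuousAt.2 fun t => (h.hasDeriv t).continuousAt
  have hint : Integrable fun s => A s * conj (φ (s + t)) := by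
    refine hA.mul_bdd (c := 2 * N) ?_ (ae_of_all _ hbd)
    exact Continuous.aestronglyMeasurable (by fun_prop)
  have hu : ∫ s in Ioi 0, A s * conj (φ (s + t)) = (∫ s in Ioc 0 M, A s * conj (φ (s + t))) +
      ∫ s in Ioi M, A s * conj (φ (s + t)) := by
    rw [← setIntegral_union Ioc_disjoint_Ioi_same measurableSet_Ioi hint.integrableOn
      hint.integrableOn, Ioc_union_Ioi_eq_Ioi hM0]
  have hsplit : inner ℂ (tr φ t) (tr A 0) = (∫ s in Ioc 0 M, conj (φ (s + t)) * A s) +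
      inner ℂ (tr φ (t + M)) (tr A M) := by
    rw [hB, xcorr, ← setIntegral_eq_integral_of_forall_compl_eq_zero (s := Ioi 0)
      (f := fun s => A s * conj (φ (s + t))) fun s hs => by rw [h0 s (not_lt.1 hs), zero_mul],
      hu]
    congr 1
    · congr 1; ext s; ring
    · rw [inner_tr h.mem0]
      have := setIntegral_comp_add_left_Ioi (fun s => A s * conj (φ (s + t))) M 0
      rw [add_zero] at this
      rw [← this]
      refine integral_congr_ae ?_
      filter_upwards [coeFn_tr h2 M] with ξ hξ
      rw [hξ, mul_comm]; ring_nf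
  have htail : ‖inner ℂ (tr φ (t + M)) (tr A M)‖ ≤ ε / 2 * ‖tr A 0‖ := by
    refine (norm_inner_le_norm _ _).trans ?_
    refine mul_le_mul ?_ (norm_tr_le_norm_tr_zero h2 h0 M) (norm_nonneg _) (by positivity)
    refine (h.norm_tr0 (by positivity)).trans (le_trans ?_ hM)
    have := h.nonneg
    gcongr; linarith
  have hmain : ‖∫ s in Ioc 0 M, conj (φ (s + t)) * A s‖ ≤ (2 * N + M * (2 * N)) * S := by
    have hd : ∀ s, HasDerivAt (fun s => conj (φ (s + t))) (conj (φ₁ (s + t))) s := fun s =>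
      (Complex.conjLIE.toContinuousLinearEquiv.toContinuousLinearMap.restrictScalars
        ℝ).hasFDerivAt.comp_hasDerivAt s ((h.hasDeriv (s + t)).comp_add_const s t)
    rw [integral_mul_eq_sub_of_ftc hA.integrableOn
      (Complex.continuous_conj.comp (h.cont.comp (continuous_id.add continuous_const))) hd]
    refine (norm_sub_le _ _).trans ?_
    have b1 : ‖conj (φ (M + t)) * ∫ ξ in Ioc 0 M, A ξ‖ ≤ 2 * N * S := by
      rw [norm_mul]; exact mul_le_mul (hbd M) (hI M ⟨hM0, le_rfl⟩) (norm_nonneg _) (by positivity)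
    have b2 : ‖∫ s in Ioc 0 M, conj (φ₁ (s + t)) * ∫ ξ in Ioc 0 s, A ξ‖ ≤ (2 * N * S) * M := by
      have := norm_setIntegral_le_of_norm_le_const (μ := volume) (s := Ioc 0 M) (C := 2 * N * S)
        (f := fun s => conj (φ₁ (s + t)) * ∫ ξ in Ioc 0 s, A ξ) (by simp) fun s hs => by
        rw [norm_mul, RCLike.norm_conj]
        exact mul_le_mul (h.norm_tr_le_3 _).2.2.2.2 (hI s ⟨hs.1.le, hs.2⟩) (norm_nonneg _) (by positivity)
      simpa [hM0] using this
    calc _ ≤ _ := add_le_add b1 b2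
      _ = _ := by ring
  rw [hsplit]
  have hSnn : 0 ≤ S := by positivity
  calc _ ≤ _ := norm_add_le _ _
    _ ≤ (2 * N + M * (2 * N) + 1) * S + ε / 2 * ‖tr A 0‖ := by
      exact add_le_add (hmain.trans (mul_le_mul_of_nonneg_right (by linarith) hSnn)) htail
    _ = _ := by rw [hS]; field_simp; ring

theorem integrableOn_rpow_three_half : IntegrableOn (fun t : ℝ => (1 + t) ^ (-(3 / 2) : ℝ)) (Ioi 0) := by
  refine (integrableOn_comp_add_left_Ioi (fun t : ℝ => t ^ (-(3 / 2) : ℝ)) 1 0).2 ?_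
  rw [add_zero]
  exact integrableOn_Ioi_rpow_of_lt (by norm_num) one_pos

theorem integral_rpow_three_half : ∫ t in Ioi (0 : ℝ), (1 + t) ^ (-(3 / 2) : ℝ) = 2 := by
  rw [setIntegral_comp_add_left_Ioi (fun t : ℝ => t ^ (-(3 / 2) : ℝ)), add_zero,
    integral_Ioi_rpow_of_lt (by norm_num) one_pos]
  norm_num

/-- Geometric mean of the two bounds: b√t ≤ √(xy) ≤ δx + y/δ. Half a power of decay is kept, so b/t
is integrable at infinity while the small bound y still enters. -/
theorem le_mul_add_div {b x y t δ : ℝ} (hb : 0 ≤ b) (hx : 0 ≤ x) (hδ : 0 < δ)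
    (ht : 0 < t) (h1 : b ≤ x / t) (h2 : b ≤ y) : b / t ≤ t ^ (-(3 / 2) : ℝ) * (δ * x + y / δ) := by
  have hy : 0 ≤ y := hb.trans h2
  have e : t ^ (-(3 / 2) : ℝ) = (t * √t)⁻¹ := by
    rw [Real.rpow_neg ht.le, Real.sqrt_eq_rpow, ← Real.rpow_one_add' ht.le (by norm_num)]
    norm_num
  have hst : 0 < √t := Real.sqrt_pos.2 ht
  have key : b * √t ≤ δ * x + y / δ := by
    have h3 : (b * √t) ^ 2 ≤ x * y := by
      rw [mul_pow, Real.sq_sqrt ht.le]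
      have : b * t ≤ x := (le_div_iff₀ ht).1 h1
      calc b ^ 2 * t = b * t * b := by ring
        _ ≤ x * y := mul_le_mul this h2 hb hx
    have h4 : x * y ≤ (δ * x + y / δ) ^ 2 := by
      have : (δ * x + y / δ) ^ 2 = (δ * x) ^ 2 + 2 * (x * y) + (y / δ) ^ 2 := by field_simp; ring
      rw [this]; nlinarith [mul_nonneg hx hy, sq_nonneg (δ * x), sq_nonneg (y / δ)]
    exact abs_le_of_sq_le_sq' (h3.trans h4) (by positivity) |>.2
  rw [e, inv_mul_eq_div, div_le_div_iff₀ ht (by positivity)]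
  calc b * (t * √t) = b * √t * t := by ring
    _ ≤ _ := by gcongr

/-- A bound on ⟪P_t, α⟫ uniform in t is not integrable against ‖P¹_t‖ = O(1/(1 + t));
`le_mul_add_div` combines it with the decay of ‖P_t‖. The factor 16 is 8 times the integral 2 of (1
+ t)^{−3/2}. -/
theorem IsKernel.norm_opK_le {N : ℝ} {φ φ₁ φ₂ : ℝ → ℂ} (h : IsKernel N φ φ₁ φ₂) {α : HalfL2}
    {S : ℝ} (hS : ∀ t, 0 ≤ t → ‖inner ℂ (tr φ t) α‖ ≤ S) {δ : ℝ} (hδ : 0 < δ) :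
    ‖opK φ φ₁ 0 α‖ ≤ 16 * N * (δ * (2 * N * ‖α‖) + S / δ) := by
  have hN := h.nonneg
  rw [h.opK_apply]
  have e : 16 * N * (δ * (2 * N * ‖α‖) + S / δ) = ∫ t in Ioi (0 : ℝ),
      (1 + t) ^ (-(3 / 2) : ℝ) * (8 * N * (δ * (2 * N * ‖α‖) + S / δ)) := by
    rw [integral_mul_const, integral_rpow_three_half]; ring
  rw [e]
  refine norm_integral_le_of_norm_le (integrableOn_rpow_three_half.mul_const _) ?_
  filter_upwards [ae_restrict_mem measurableSet_Ioi] with t ht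
  have ht' : (0 : ℝ) < t := ht
  have hb1 : ‖inner ℂ (tr φ t) α‖ ≤ 2 * N * ‖α‖ / (1 + t) := by
    refine (norm_inner_le_norm _ _).trans ?_
    rw [mul_div_right_comm]
    gcongr; exact h.norm_tr0 ht'.le
  have := le_mul_add_div (norm_nonneg _) (by positivity) hδ (by positivity) hb1 (hS t ht'.le)
  calc ‖(-4 * Complex.I * inner ℂ (tr φ t) α) • tr φ₁ t‖
      = 4 * (‖inner ℂ (tr φ t) α‖ * ‖tr φ₁ t‖) := by
        rw [norm_smul, norm_mul]; simp; ring
    _ ≤ 4 * (‖inner ℂ (tr φ t) α‖ * (2 * N / (1 + t))) := by gcongr; exact h.norm_tr1 ht'.le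
    _ = 8 * N * (‖inner ℂ (tr φ t) α‖ / (1 + t)) := by ring
    _ ≤ 8 * N * ((1 + t) ^ (-(3 / 2) : ℝ) * (δ * (2 * N * ‖α‖) + S / δ)) := by gcongr
    _ = _ := by ring

theorem exists_tr_near (α : HalfL2) {ε : ℝ} (hε : 0 < ε) : ∃ A : ℝ → ℂ, Integrable A ∧ MemLp A 2 ∧
    (∀ ξ ≤ 0, A ξ = 0) ∧ ‖α - tr A 0‖ < ε := by
  obtain ⟨g, hg, hm⟩ := (Lp.memLp α).exists_simpleFunc_eLpNorm_sub_lt (by simp)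
    (ε := ENNReal.ofReal ε) (by simpa using hε)
  have hi := (SimpleFunc.memLp_iff_integrable (by simp) (by simp)).1 hm
  have h2 : MemLp ((Ioi (0 : ℝ)).indicator g) 2 := (memLp_indicator_iff_restrict measurableSet_Ioi).2 hm
  refine ⟨(Ioi (0 : ℝ)).indicator g, (integrable_indicator_iff measurableSet_Ioi).2 hi, h2,
    fun ξ hξ => indicator_of_notMem (not_lt.2 hξ) _, ?_⟩
  rw [Lp.norm_def]
  refine (ENNReal.toReal_lt_of_lt_ofReal (lt_of_eq_of_lt (eLpNorm_congr_ae ?_) hg))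
  filter_upwards [Lp.coeFn_sub α (tr ((Ioi (0 : ℝ)).indicator g) 0), coeFn_tr h2 0,
    ae_restrict_mem measurableSet_Ioi] with ξ h1 h3 h4
  rw [h1, Pi.sub_apply, Pi.sub_apply, h3, zero_add, indicator_of_mem h4]

/-- Uniform coercivity of `1 + K`. -/
theorem exists_norm_le_one_add_opK {N : ℝ} (hN : 0 ≤ N) : ∃ C, 0 ≤ C ∧ ∀ φ φ₁ φ₂ : ℝ → ℂ,
    IsKernel N φ φ₁ φ₂ → ∀ α : HalfL2, ‖α‖ ≤ C * ‖α + opK φ φ₁ 0 α‖ := by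
  -- With δ and ε chosen from N alone, the terms proportional to ‖α‖ in the bound for ‖Kα‖ have
  -- coefficients at most 1/4 each, so they can be absorbed and half of ‖α‖ remains.
  obtain ⟨δ, hδ, hδ'⟩ : ∃ δ : ℝ, 0 < δ ∧ 16 * N * (δ * (2 * N)) ≤ 1 / 4 := by
    refine ⟨1 / (128 * N ^ 2 + 1), by positivity, ?_⟩
    rw [show 16 * N * (1 / (128 * N ^ 2 + 1) * (2 * N)) = 32 * N ^ 2 / (128 * N ^ 2 + 1) by ring,
      div_le_iff₀ (by positivity)]
    linarith
  obtain ⟨ε, hε, hε'⟩ : ∃ ε : ℝ, 0 < ε ∧ 16 * N * (ε / δ) ≤ 1 / 4 := by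
    refine ⟨δ / (64 * N + 1), by positivity, ?_⟩
    rw [show 16 * N * (δ / (64 * N + 1) / δ) = 16 * N / (64 * N + 1) by field_simp,
      div_le_iff₀ (by positivity)]
    linarith
  obtain ⟨C, hC, H⟩ := exists_inner_tr_le hN hε
  refine ⟨2 * (1 + 16 * N * (C / δ)), by positivity, fun φ φ₁ φ₂ h α => ?_⟩
  -- The energy argument needs an integrable representative of α. The inequality is a closed
  -- condition, so it suffices to prove it on a dense set.
  have hcl : IsClosed {α : HalfL2 | ‖α‖ ≤ 2 * (1 + 16 * N * (C / δ)) * ‖α + opK φ φ₁ 0 α‖} :=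
    isClosed_le continuous_norm (continuous_const.mul
      (continuous_id.add (opK φ φ₁ 0).continuous).norm)
  refine hcl.closure_subset (Metric.mem_closure_iff.2 fun η hη => ?_)
  obtain ⟨A, hA, h2, h0, hn⟩ := exists_tr_near α hη
  refine ⟨tr A 0, ?_, by rwa [dist_eq_norm]⟩
  have hE := h.energyControlled hA h2 h0
  set β := tr A 0
  have hK := h.norm_opK_le (α := β) (fun t ht => H φ φ₁ φ₂ h t ht β _ hE) hδ
  set f := β + opK φ φ₁ 0 β with hf
  have hb : ‖β‖ ≤ ‖f‖ + ‖opK φ φ₁ 0 β‖ := by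
    have : β = f - opK φ φ₁ 0 β := by rw [hf]; abel
    calc ‖β‖ = ‖f - opK φ φ₁ 0 β‖ := by rw [← this]
      _ ≤ _ := norm_sub_le _ _
  have e : 16 * N * (δ * (2 * N * ‖β‖) + (ε * ‖β‖ + C * ‖f‖) / δ) =
      16 * N * (δ * (2 * N)) * ‖β‖ + 16 * N * (ε / δ) * ‖β‖ + 16 * N * (C / δ) * ‖f‖ := by ring
  rw [e] at hK
  have hβ := norm_nonneg β
  show ‖β‖ ≤ _ * ‖f‖
  nlinarith [mul_le_mul_of_nonneg_right hδ' hβ, mul_le_mul_of_nonneg_right hε' hβ]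

theorem IsKernel.smul {N : ℝ} {φ φ₁ φ₂ : ℝ → ℂ} (h : IsKernel N φ φ₁ φ₂) {c : ℂ} (hc : ‖c‖ ≤ 1) :
    IsKernel N (fun s => c * φ s) (fun s => c * φ₁ s) (fun s => c * φ₂ s) := by
  have hle : ∀ {f : ℝ → ℂ}, eLpNorm f 2 volume ≤ ENNReal.ofReal N →
      eLpNorm (fun s => c * f s) 2 volume ≤ ENNReal.ofReal N := fun hf =>
    (eLpNorm_mono fun s => by
      rw [norm_mul]; exact mul_le_of_le_one_left (norm_nonneg _) hc).trans hf
  have e : ∀ f : ℝ → ℂ, (fun s : ℝ => (s : ℂ) * (c * f s)) = fun s : ℝ => c * ((s : ℂ) * f s) :=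
    fun f => by ext; ring
  exact
  { nonneg := h.nonneg
    hasDeriv := fun t => (h.hasDeriv t).const_mul c
    cont := continuous_const.mul h.cont
    ftc := fun s t => by rw [intervalIntegral.integral_const_mul, h.ftc]; ring
    mem0 := h.mem0.const_mul c
    mem0' := by rw [e]; exact h.mem0'.const_mul c
    mem1 := h.mem1.const_mul c
    mem1' := by rw [e]; exact h.mem1'.const_mul c
    mem2 := h.mem2.const_mul c
    le0 := hle h.le0
    le0' := by rw [e]; exact hle h.le0'
    le1 := hle h.le1
    le1' := by rw [e]; exact hle h.le1'
    le2 := hle h.le2 }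

theorem tr_mul {f : ℝ → ℂ} (hf : MemLp f 2) (c : ℂ) (t : ℝ) :
    tr (fun s => c * f s) t = c • tr f t := by
  rw [tr_def hf, tr_def (hf.const_mul c)]; rfl

theorem IsKernel.opK_smul {N : ℝ} {φ φ₁ φ₂ : ℝ → ℂ} (h : IsKernel N φ φ₁ φ₂) (c : ℂ) (x : ℝ) :
    opK (fun s => c * φ s) (fun s => c * φ₁ s) x = (c * conj c) • opK φ φ₁ x := by
  rw [opK, opK, ← integral_smul]
  congr 1; ext1 t
  rw [tr_mul h.mem0, tr_mul h.mem1, smul_comm (c * conj c)]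
  congr 1
  ext1 α
  simp only [InnerProductSpace.rankOne_apply, inner_smul_left, _root_.smul_apply,
    smul_smul]
  congr 1; ring

/-- K is quadratic in the kernel, so the kernel √s φ, which is no larger than φ, has operator sK.
The uniform coercivity therefore holds along the whole path needed by the method of continuity. -/
theorem IsKernel.isUnit_one_add_opK {N : ℝ} {φ φ₁ φ₂ : ℝ → ℂ} (h : IsKernel N φ φ₁ φ₂) :
    IsUnit (1 + opK φ φ₁ 0) := by
  obtain ⟨C, hC, H⟩ := exists_norm_le_one_add_opK h.nonneg
  refine isUnit_one_add_of_bound hC fun s hs hs1 x => ?_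
  have hn : ‖((√s : ℝ) : ℂ)‖ ≤ 1 := by
    rw [Complex.norm_real, Real.norm_of_nonneg (Real.sqrt_nonneg _)]
    exact Real.sqrt_le_one.2 hs1
  have := H _ _ _ (h.smul hn) x
  rwa [h.opK_smul, Complex.conj_ofReal, ← Complex.ofReal_mul, Real.mul_self_sqrt hs] at this

/-! ### Dependence of the solution on the end point c -/

section Abstract
variable {E : Type*} [NormedAddCommGroup E]

theorem hasDerivAt_integral_Ioi [NormedSpace ℝ E] [CompleteSpace E] {g : ℝ → E} (hg : Continuous g)
    {a : ℝ} (hi : IntegrableOn g (Ioi a)) (c : ℝ) :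
    HasDerivAt (fun c => ∫ t in Ioi c, g t) (-g c) c := by
  have e : (fun c => ∫ t in Ioi c, g t) = fun c => (∫ t in Ioi a, g t) - ∫ t in a..c, g t := by
    ext c
    rw [← intervalIntegral.integral_interval_add_Ioi hi (IntegrableOn.of_continuous_Ioi hg hi c)]
    abel
  rw [e]
  exact (intervalIntegral.integral_hasDerivAt_right (hg.intervalIntegrable _ _)
    hg.stronglyMeasurable.stronglyMeasurableAtFilter hg.continuousAt).const_sub _

variable [NormedSpace ℂ E]

theorem hasDerivAt_clm_apply {T : ℝ → E →L[ℂ] E} {T' : E →L[ℂ] E} {u : ℝ → E} {u' : E} {c : ℝ}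
    (hT : HasDerivAt T T' c) (hu : HasDerivAt u u' c) :
    HasDerivAt (fun c => T c (u c)) (T' (u c) + T c u') c := by
  have h := (ContinuousLinearMap.restrictScalarsL ℂ E E ℝ ℝ).hasFDerivAt.comp_hasDerivAt c hT
  exact h.clm_apply hu

theorem hasDerivAt_inverse [CompleteSpace E] {T : ℝ → E →L[ℂ] E} {T' : E →L[ℂ] E} {c : ℝ}
    (hT : HasDerivAt T T' c) (hu : IsUnit (T c)) :
    HasDerivAt (fun c => Ring.inverse (T c)) (-(Ring.inverse (T c) * T' * Ring.inverse (T c))) c := by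
  obtain ⟨u, hu⟩ := hu
  have h := hasFDerivAt_ringInverse (𝕜 := ℝ) u
  rw [hu] at h
  refine (h.comp_hasDerivAt c hT).congr_deriv ?_
  rw [← hu, Ring.inverse_unit]
  simp

theorem inverse_apply {T : E →L[ℂ] E} (hu : IsUnit T) (x : E) : T (Ring.inverse T x) = x :=
  congrArg (fun S : E →L[ℂ] E => S x) (Ring.mul_inverse_cancel T hu)

theorem norm_inverse_le {T : E →L[ℂ] E} (hu : IsUnit T) {C : ℝ} (hC : 0 ≤ C)
    (h : ∀ x, ‖x‖ ≤ C * ‖T x‖) : ‖Ring.inverse T‖ ≤ C :=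
  ContinuousLinearMap.opNorm_le_bound _ hC fun x => by
    have := h (Ring.inverse T x)
    rwa [inverse_apply hu] at this

theorem inverse_sub_inverse {T S : E →L[ℂ] E} (hT : IsUnit T) (hS : IsUnit S) :
    Ring.inverse T - Ring.inverse S = Ring.inverse T * (S - T) * Ring.inverse S := by
  rw [mul_sub, sub_mul, Ring.inverse_mul_cancel T hT, one_mul, mul_assoc,
    Ring.mul_inverse_cancel S hS, mul_one]

end Abstract

/-- The resolvent `(1 + K_c)⁻¹`. -/
noncomputable def resK (φ φ₁ : ℝ → ℂ) (c : ℝ) : HalfL2 →L[ℂ] HalfL2 :=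
  Ring.inverse (1 + opK φ φ₁ c)

/-- The source term `-4i ∫_{t > c} conj φ(t) P¹_t dt`. -/
noncomputable def srcF (φ φ₁ : ℝ → ℂ) (c : ℝ) : HalfL2 :=
  ∫ t in Ioi c, (-4 * Complex.I * conj (φ t)) • tr φ₁ t

/-- The solution of `(1 + K_c) A = -F_c`. -/
noncomputable def solA (φ φ₁ : ℝ → ℂ) (c : ℝ) : HalfL2 := -(resK φ φ₁ c (srcF φ φ₁ c))

/-- The direction in which `solA` moves with c; its negative is the L² function of the second row of
the Riemann–Hilbert problem. -/
noncomputable def solY (φ φ₁ : ℝ → ℂ) (c : ℝ) : HalfL2 :=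
  (-4 * Complex.I) • resK φ φ₁ c (tr φ₁ c)

/-- The remainder in `b = conj φ + ⟪P, A⟫`. -/
noncomputable def remB (φ φ₁ : ℝ → ℂ) (c : ℝ) : ℂ := inner ℂ (tr φ c) (solA φ φ₁ c)

/-- The value at 0 of the second function of the first row. The reconstructed potential at x has
modulus 4 |b(2x)|. -/
noncomputable def bval (φ φ₁ : ℝ → ℂ) (c : ℝ) : ℂ := conj (φ c) + remB φ φ₁ c

/-- Here and below, primes and `derY` denote derivatives in c, already expressed through the
resolvent and translates. The function φ₂, which need not be continuous, enters only through `tr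
φ₂`, so even `remB''` is continuous. -/
noncomputable def remB' (φ φ₁ : ℝ → ℂ) (c : ℝ) : ℂ :=
  inner ℂ (tr φ₁ c) (solA φ φ₁ c) + bval φ φ₁ c * inner ℂ (tr φ c) (solY φ φ₁ c)

noncomputable def bval' (φ φ₁ : ℝ → ℂ) (c : ℝ) : ℂ := conj (φ₁ c) + remB' φ φ₁ c

noncomputable def derY (φ φ₁ φ₂ : ℝ → ℂ) (c : ℝ) : HalfL2 :=
  (-4 * Complex.I) • resK φ φ₁ c (tr φ₂ c) + inner ℂ (tr φ c) (solY φ φ₁ c) • solY φ φ₁ c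

noncomputable def remB'' (φ φ₁ φ₂ : ℝ → ℂ) (c : ℝ) : ℂ :=
  inner ℂ (tr φ₂ c) (solA φ φ₁ c) + 2 * bval φ φ₁ c * inner ℂ (tr φ₁ c) (solY φ φ₁ c)
    + bval' φ φ₁ c * inner ℂ (tr φ c) (solY φ φ₁ c)
    + bval φ φ₁ c * inner ℂ (tr φ c) (derY φ φ₁ φ₂ c)

theorem tr_shift {f : ℝ → ℂ} (hf : MemLp f 2) (c t : ℝ) :
    tr (fun s => f (c + s)) t = tr f (c + t) := by
  rw [tr_def hf, tr_def (memLp_shift hf c)]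
  congr 1; ext ξ; rw [add_assoc]

/-- Writing s = (c + s) − c in the weighted norms costs the factor 1 + |c|, so uniform bounds
obtained this way are restricted to bounded c. -/
theorem IsKernel.shift {N : ℝ} {φ φ₁ φ₂ : ℝ → ℂ} (h : IsKernel N φ φ₁ φ₂) (c : ℝ) :
    IsKernel (N * (1 + |c|)) (fun s => φ (c + s)) (fun s => φ₁ (c + s)) (fun s => φ₂ (c + s)) := by
  have hN := h.nonneg
  have hNle : N ≤ N * (1 + |c|) := by nlinarith [abs_nonneg c]
  have hmul : ∀ {f : ℝ → ℂ}, MemLp f 2 → MemLp (fun s : ℝ => (s : ℂ) * f s) 2 →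
      eLpNorm f 2 volume ≤ ENNReal.ofReal N →
      eLpNorm (fun s : ℝ => (s : ℂ) * f s) 2 volume ≤ ENNReal.ofReal N →
      MemLp (fun s : ℝ => (s : ℂ) * f (c + s)) 2 ∧
      eLpNorm (fun s : ℝ => (s : ℂ) * f (c + s)) 2 volume ≤ ENNReal.ofReal (N * (1 + |c|)) := by
    intro f h1 h2 h3 h4
    have e : (fun s : ℝ => (s : ℂ) * f (c + s)) =
        (fun s : ℝ => ((c + s : ℝ) : ℂ) * f (c + s)) - fun s : ℝ => (c : ℂ) * f (c + s) := by
      ext s; simp only [Pi.sub_apply]; push_cast; ring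
    have m1 := memLp_shift h2 c
    have m2 := (memLp_shift h1 c).const_mul (c : ℂ)
    rw [e]
    refine ⟨m1.sub m2, (eLpNorm_sub_le m1.1 m2.1 (by norm_num)).trans ?_⟩
    have e2 : eLpNorm (fun s : ℝ => (c : ℂ) * f (c + s)) 2 volume ≤ ENNReal.ofReal (|c| * N) := by
      rw [show (fun s : ℝ => (c : ℂ) * f (c + s)) = (c : ℂ) • fun s => f (c + s) from rfl,
        eLpNorm_const_smul, eLpNorm_shift h1, ENNReal.ofReal_mul (abs_nonneg c)]
      refine mul_le_mul' ?_ h3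
      rw [← ofReal_norm, Complex.norm_real, Real.norm_eq_abs]
    have e1 := (eLpNorm_shift h2 c).trans_le h4
    refine (add_le_add e1 e2).trans ?_
    rw [← ENNReal.ofReal_add hN (by positivity)]
    exact ENNReal.ofReal_le_ofReal (by ring_nf; rfl)
  have hs : ∀ {f : ℝ → ℂ}, MemLp f 2 → eLpNorm f 2 volume ≤ ENNReal.ofReal N →
      eLpNorm (fun s : ℝ => f (c + s)) 2 volume ≤ ENNReal.ofReal (N * (1 + |c|)) := fun h1 h2 => by
    rw [eLpNorm_shift h1]; exact h2.trans (ENNReal.ofReal_le_ofReal hNle)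
  exact
  { nonneg := by positivity
    hasDeriv := fun t => (h.hasDeriv (c + t)).comp_const_add c t
    cont := h.cont.comp (by fun_prop)
    ftc := fun s t => by
      rw [intervalIntegral.integral_comp_add_left (fun x => φ₂ x), h.ftc]
    mem0 := memLp_shift h.mem0 c
    mem0' := (hmul h.mem0 h.mem0' h.le0 h.le0').1
    mem1 := memLp_shift h.mem1 c
    mem1' := (hmul h.mem1 h.mem1' h.le1 h.le1').1
    mem2 := memLp_shift h.mem2 c
    le0 := hs h.mem0 h.le0
    le0' := (hmul h.mem0 h.mem0' h.le0 h.le0').2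
    le1 := hs h.mem1 h.le1
    le1' := (hmul h.mem1 h.mem1' h.le1 h.le1').2
    le2 := hs h.mem2 h.le2 }

theorem IsKernel.mono {N N' : ℝ} {φ φ₁ φ₂ : ℝ → ℂ} (h : IsKernel N φ φ₁ φ₂) (hN : N ≤ N') :
    IsKernel N' φ φ₁ φ₂ :=
  have := ENNReal.ofReal_le_ofReal hN
  { h with
    nonneg := h.nonneg.trans hN
    le0 := h.le0.trans this
    le0' := h.le0'.trans this
    le1 := h.le1.trans this
    le1' := h.le1'.trans this
    le2 := h.le2.trans this }

/-- The parameter c has two roles: as an end point it is convenient for differentiation, as a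
translation of the kernel it brings back the theory at c = 0. -/
theorem opK_shift {φ φ₁ : ℝ → ℂ} (h : MemLp φ 2) (h1 : MemLp φ₁ 2) (c : ℝ) :
    opK (fun s => φ (c + s)) (fun s => φ₁ (c + s)) 0 = opK φ φ₁ c := by
  rw [opK, opK]
  have := setIntegral_comp_add_left_Ioi (fun t => (-4 * Complex.I) •
    InnerProductSpace.rankOne ℂ (tr φ₁ t) (tr φ t)) c 0
  rw [add_zero] at this
  rw [← this]
  congr 1; ext1 t
  rw [tr_shift h, tr_shift h1]

theorem IsKernel.isUnit {N : ℝ} {φ φ₁ φ₂ : ℝ → ℂ} (h : IsKernel N φ φ₁ φ₂) (c : ℝ) :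
    IsUnit (1 + opK φ φ₁ c) := by
  rw [← opK_shift h.mem0 h.mem1]
  exact (h.shift c).isUnit_one_add_opK

theorem IsKernel.norm_opK_le_div {N : ℝ} {φ φ₁ φ₂ : ℝ → ℂ} (h : IsKernel N φ φ₁ φ₂) {c : ℝ}
    (hc : 0 ≤ c) : ‖opK φ φ₁ c‖ ≤ 16 * N ^ 2 / (1 + c) := by
  have hN := h.nonneg
  have e : ∫ t in Ioi c, 16 * N ^ 2 / (1 + t) ^ 2 = 16 * N ^ 2 / (1 + c) := by
    rw [setIntegral_comp_add_left_Ioi (fun t : ℝ => 16 * N ^ 2 / t ^ 2)]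
    have h2 := integral_Ioi_rpow_of_lt (a := -2) (by norm_num) (c := 1 + c) (by positivity)
    have e3 : ∫ t in Ioi (1 + c), 16 * N ^ 2 / t ^ 2 = ∫ t in Ioi (1 + c), 16 * N ^ 2 * t ^ (-2 : ℝ) := by
      refine setIntegral_congr_fun measurableSet_Ioi fun t ht => ?_
      have : (0 : ℝ) < t := lt_trans (by positivity) (mem_Ioi.1 ht)
      rw [Real.rpow_neg this.le, div_eq_mul_inv]; norm_cast
    rw [e3, integral_const_mul, h2]
    norm_num
    rw [Real.rpow_neg_one]; ring
  rw [opK, ← e]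
  refine norm_integral_le_of_norm_le ((integrableOn_div_sq _).mono_set (Ioi_subset_Ioi hc)) ?_
  filter_upwards [ae_restrict_mem measurableSet_Ioi] with t ht
  have ht' : (0 : ℝ) ≤ t := hc.trans (le_of_lt ht)
  rw [norm_smul, InnerProductSpace.norm_rankOne]
  have h1 := h.norm_tr1 ht'
  have h2 := h.norm_tr0 ht'
  calc _ = 4 * (‖tr φ₁ t‖ * ‖tr φ t‖) := by simp
    _ ≤ 4 * (2 * N / (1 + t) * (2 * N / (1 + t))) := by gcongr
    _ = _ := by field_simp; ring

/-- Uniform boundedness of the resolvents. -/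
theorem exists_norm_resK_le {N : ℝ} (hN : 0 ≤ N) : ∃ C, 0 ≤ C ∧ ∀ φ φ₁ φ₂ : ℝ → ℂ,
    IsKernel N φ φ₁ φ₂ → ∀ c, 0 ≤ c → ‖resK φ φ₁ c‖ ≤ C := by
  -- Beyond c₀ the bound 16N²/(1 + c) on ‖K_c‖ is at most 1/2, so no energy argument is needed. Up
  -- to c₀, the coercivity at 0 is applied to the shifted kernel, of size at most N(1 + c₀).
  set c₀ := 32 * N ^ 2 with hc₀
  obtain ⟨C, hC, H⟩ := exists_norm_le_one_add_opK (N := N * (1 + c₀)) (by positivity)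
  refine ⟨max C 2, by positivity, fun φ φ₁ φ₂ h c hc => ?_⟩
  rw [resK]
  refine norm_inverse_le (h.isUnit c) (by positivity) fun x => ?_
  change ‖x‖ ≤ max C 2 * ‖x + opK φ φ₁ c x‖
  by_cases hcc : c ≤ c₀
  · have := H _ _ _ ((h.shift c).mono (by gcongr; rwa [abs_of_nonneg hc])) x
    rw [opK_shift h.mem0 h.mem1] at this
    exact this.trans (by gcongr; exact le_max_left _ _)
  · have h1 : ‖opK φ φ₁ c‖ ≤ 1 / 2 := by
      refine (h.norm_opK_le_div hc).trans ?_
      rw [div_le_iff₀ (by positivity)]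
      push Not at hcc
      linarith
    have h2 : ‖opK φ φ₁ c x‖ ≤ 1 / 2 * ‖x‖ :=
      (ContinuousLinearMap.le_opNorm _ _).trans (by gcongr)
    have h3 : ‖x‖ ≤ ‖x + opK φ φ₁ c x‖ + ‖opK φ φ₁ c x‖ := by
      simpa using norm_sub_le (x + opK φ φ₁ c x) (opK φ φ₁ c x)
    calc ‖x‖ ≤ 2 * ‖x + opK φ φ₁ c x‖ := by linarith
      _ ≤ _ := by gcongr; exact le_max_right _ _

section
variable {N : ℝ} {φ φ₁ φ₂ : ℝ → ℂ}

theorem IsKernel.hasDerivAt_opK (h : IsKernel N φ φ₁ φ₂) (c : ℝ) :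
    HasDerivAt (opK φ φ₁) ((4 * Complex.I) • InnerProductSpace.rankOne ℂ (tr φ₁ c) (tr φ c)) c := by
  have hc : Continuous fun t => (-4 * Complex.I) • InnerProductSpace.rankOne ℂ (tr φ₁ t) (tr φ t) := by
    have := continuous_rankOne (continuous_tr φ₁) (continuous_tr φ)
    exact this.const_smul (-4 * Complex.I)
  refine (hasDerivAt_integral_Ioi hc (h.integrableOn_rankOne h 0) c).congr_deriv ?_
  rw [← neg_smul]; congr 1; ring

theorem IsKernel.continuous (h : IsKernel N φ φ₁ φ₂) : Continuous φ :=
  continuous_iff_continuousAt.2 fun t => (h.hasDeriv t).continuousAt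

theorem IsKernel.norm_apply (h : IsKernel N φ φ₁ φ₂) {t : ℝ} (ht : 0 ≤ t) :
    ‖φ t‖ ≤ 4 * N / (1 + t) := by
  refine (norm_apply_le_tr h.mem0 h.mem1 h.ftc0 t).trans ?_
  have := add_le_add (h.norm_tr0 ht) (h.norm_tr1 ht)
  refine this.trans (le_of_eq (by ring))

theorem IsKernel.continuous_srcF_integrand (h : IsKernel N φ φ₁ φ₂) :
    Continuous fun t => (-4 * Complex.I * conj (φ t)) • tr φ₁ t :=
  (continuous_const.mul (Complex.continuous_conj.comp h.continuous)).smul (continuous_tr φ₁)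

theorem IsKernel.integrableOn_srcF (h : IsKernel N φ φ₁ φ₂) (c : ℝ) :
    IntegrableOn (fun t => (-4 * Complex.I * conj (φ t)) • tr φ₁ t) (Ioi c) := by
  have hN := h.nonneg
  refine IntegrableOn.of_continuous_Ioi h.continuous_srcF_integrand (a := 0) ?_ c
  refine Integrable.mono' (integrableOn_div_sq (32 * N * N))
    h.continuous_srcF_integrand.aestronglyMeasurable ?_
  filter_upwards [ae_restrict_mem measurableSet_Ioi] with t ht
  have ht' : (0 : ℝ) < t := ht
  have h1 := h.norm_tr1 ht'.le
  have h2 := h.norm_apply ht'.le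
  calc _ = 4 * (‖φ t‖ * ‖tr φ₁ t‖) := by rw [norm_smul, norm_mul]; simp; ring
    _ ≤ 4 * (4 * N / (1 + t) * (2 * N / (1 + t))) := by gcongr
    _ = _ := by field_simp; ring

theorem IsKernel.hasDerivAt_srcF (h : IsKernel N φ φ₁ φ₂) (c : ℝ) :
    HasDerivAt (srcF φ φ₁) ((4 * Complex.I * conj (φ c)) • tr φ₁ c) c := by
  refine (hasDerivAt_integral_Ioi h.continuous_srcF_integrand (h.integrableOn_srcF 0)
    c).congr_deriv ?_
  rw [← neg_smul]; congr 1; ring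

theorem IsKernel.hasDerivAt_resK (h : IsKernel N φ φ₁ φ₂) (c : ℝ) :
    HasDerivAt (resK φ φ₁) (-(resK φ φ₁ c * ((4 * Complex.I) • InnerProductSpace.rankOne ℂ
      (tr φ₁ c) (tr φ c)) * resK φ φ₁ c)) c :=
  hasDerivAt_inverse ((h.hasDerivAt_opK c).const_add 1) (h.isUnit c)

/-- As K_c depends on c only through its end point, its derivative has rank one, and the derivative
of the resolvent sends every vector to a multiple of `solY`. -/
theorem resK_rankOne (c : ℝ) (x : HalfL2) : (resK φ φ₁ c * ((4 * Complex.I) •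
    InnerProductSpace.rankOne ℂ (tr φ₁ c) (tr φ c)) * resK φ φ₁ c) x =
      -(inner ℂ (tr φ c) (resK φ φ₁ c x)) • solY φ φ₁ c := by
  change resK φ φ₁ c (((4 * Complex.I) • InnerProductSpace.rankOne ℂ (tr φ₁ c) (tr φ c))
    (resK φ φ₁ c x)) = _
  rw [solY]
  simp only [_root_.smul_apply, InnerProductSpace.rankOne_apply, map_smul, smul_smul]
  congr 1; ring

/-- The derivative of the resolvent and that of the source both point along `solY`, with
coefficients ⟪P_c, A_c⟫ and conj φ(c), whose sum is b(c). -/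
theorem IsKernel.hasDerivAt_solA (h : IsKernel N φ φ₁ φ₂) (c : ℝ) :
    HasDerivAt (solA φ φ₁) (bval φ φ₁ c • solY φ φ₁ c) c := by
  refine (hasDerivAt_clm_apply (h.hasDerivAt_resK c) (h.hasDerivAt_srcF c)).neg.congr_deriv ?_
  rw [_root_.neg_apply, resK_rankOne, map_smul, bval, remB, solA, inner_neg_right, solY]
  module

theorem IsKernel.hasDerivAt_solY (h : IsKernel N φ φ₁ φ₂) (c : ℝ) :
    HasDerivAt (solY φ φ₁) (derY φ φ₁ φ₂ c) c := by
  refine ((hasDerivAt_clm_apply (h.hasDerivAt_resK c) (h.hasDerivAt_tr1 c)).const_smul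
    (-4 * Complex.I)).congr_deriv ?_
  rw [_root_.neg_apply, resK_rankOne, derY]
  have : inner ℂ (tr φ c) (solY φ φ₁ c) =
      -4 * Complex.I * inner ℂ (tr φ c) (resK φ φ₁ c (tr φ₁ c)) := by
    rw [solY, inner_smul_right]
  rw [this]
  module

theorem IsKernel.hasDerivAt_remB (h : IsKernel N φ φ₁ φ₂) (c : ℝ) :
    HasDerivAt (remB φ φ₁) (remB' φ φ₁ c) c := by
  refine ((h.hasDerivAt_tr0 c).inner ℂ (h.hasDerivAt_solA c)).congr_deriv ?_
  rw [inner_smul_right, remB', add_comm]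

theorem IsKernel.hasDerivAt_bval (h : IsKernel N φ φ₁ φ₂) (c : ℝ) :
    HasDerivAt (bval φ φ₁) (bval' φ φ₁ c) c :=
  HasDerivAt.add ((Complex.conjLIE.toContinuousLinearEquiv.toContinuousLinearMap.restrictScalars
    ℝ).hasFDerivAt.comp_hasDerivAt c (h.hasDeriv c)) (h.hasDerivAt_remB c)

theorem IsKernel.hasDerivAt_remB' (h : IsKernel N φ φ₁ φ₂) (c : ℝ) :
    HasDerivAt (remB' φ φ₁) (remB'' φ φ₁ φ₂ c) c := by
  refine (((h.hasDerivAt_tr1 c).inner ℂ (h.hasDerivAt_solA c)).add ((h.hasDerivAt_bval c).mul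
    ((h.hasDerivAt_tr0 c).inner ℂ (h.hasDerivAt_solY c)))).congr_deriv ?_
  rw [inner_smul_right, remB'']
  ring

end

/-! ### Calculus of decay rates and Lipschitz constants -/

/-- A kernel together with its derivatives, of size at most `N`. -/
structure Ker (N : ℝ) where
  φ : ℝ → ℂ
  φ₁ : ℝ → ℂ
  φ₂ : ℝ → ℂ
  isKernel : IsKernel N φ φ₁ φ₂

/-- The difference of two kernels has size at most `δ`. -/
def Ker.Close {N : ℝ} (κ κ' : Ker N) (δ : ℝ) : Prop :=
  IsKernel δ (fun s => κ.φ s - κ'.φ s) (fun s => κ.φ₁ s - κ'.φ₁ s) (fun s => κ.φ₂ s - κ'.φ₂ s)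

/-- `X` and its Lipschitz constant with respect to the kernel are `O((1 + c)⁻ᵏ)` on `c ≥ 0`. -/
def Bd {N : ℝ} {V : Type*} [NormedAddCommGroup V] (k : ℕ) (X : Ker N → ℝ → V) : Prop :=
  ∃ M, 0 ≤ M ∧ (∀ κ c, 0 ≤ c → ‖X κ c‖ ≤ M / (1 + c) ^ k) ∧
    ∀ κ κ' δ, Ker.Close κ κ' δ → ∀ c, 0 ≤ c → ‖X κ c - X κ' c‖ ≤ M * δ / (1 + c) ^ k

section Calculus
variable {N : ℝ} {V W Z : Type*} [NormedAddCommGroup V] [NormedAddCommGroup W]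
  [NormedAddCommGroup Z] {k l : ℕ} {X : Ker N → ℝ → V} {Y : Ker N → ℝ → V}

theorem Bd.mono (hX : Bd k X) (hl : l ≤ k) : Bd l X := by
  obtain ⟨M, hM, h1, h2⟩ := hX
  refine ⟨M, hM, fun κ c hc => (h1 κ c hc).trans ?_, fun κ κ' δ h c hc =>
    (h2 κ κ' δ h c hc).trans ?_⟩
  · gcongr; linarith
  · have := h.nonneg
    gcongr; linarith

theorem Bd.add (hX : Bd k X) (hY : Bd k Y) : Bd k fun κ c => X κ c + Y κ c := by
  obtain ⟨M, hM, h1, h2⟩ := hX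
  obtain ⟨M', hM', h1', h2'⟩ := hY
  refine ⟨M + M', by positivity, fun κ c hc => ?_, fun κ κ' δ h c hc => ?_⟩
  · rw [add_div]
    exact (norm_add_le _ _).trans (add_le_add (h1 κ c hc) (h1' κ c hc))
  · rw [add_mul, add_div, add_sub_add_comm]
    exact (norm_add_le _ _).trans (add_le_add (h2 κ κ' δ h c hc) (h2' κ κ' δ h c hc))

theorem Bd.congr (hX : Bd k X) (h : ∀ κ c, X κ c = Y κ c) : Bd k Y := by
  rwa [show Y = X from funext fun κ => funext fun c => (h κ c).symm]

/-- One argument for all products used below: decay rates add, and the Lipschitz constant follows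
the Leibniz rule. -/
theorem Bd.bilin {X : Ker N → ℝ → V} {Y : Ker N → ℝ → W} (hX : Bd k X) (hY : Bd l Y)
    (β : V → W → Z) (h0 : ∀ x y, ‖β x y‖ ≤ ‖x‖ * ‖y‖)
    (h1 : ∀ x x' y, β (x - x') y = β x y - β x' y) (h2 : ∀ x y y', β x (y - y') = β x y - β x y') :
    Bd (k + l) fun κ c => β (X κ c) (Y κ c) := by
  obtain ⟨M, hM, a1, a2⟩ := hX
  obtain ⟨M', hM', b1, b2⟩ := hY
  refine ⟨2 * (M * M'), by positivity, fun κ c hc => ?_, fun κ κ' δ h c hc => ?_⟩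
  · calc _ ≤ _ := h0 _ _
      _ ≤ M / (1 + c) ^ k * (M' / (1 + c) ^ l) := by
        gcongr
        · exact a1 κ c hc
        · exact b1 κ c hc
      _ = (M * M') / (1 + c) ^ (k + l) := by rw [pow_add]; field_simp
      _ ≤ _ := div_le_div_of_nonneg_right (by nlinarith [mul_nonneg hM hM']) (by positivity)
  · have hδ := h.nonneg
    have e : β (X κ c) (Y κ c) - β (X κ' c) (Y κ' c) =
        β (X κ c) (Y κ c - Y κ' c) + β (X κ c - X κ' c) (Y κ' c) := by rw [h1, h2]; abel
    rw [e]
    calc _ ≤ _ := norm_add_le _ _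
      _ ≤ M / (1 + c) ^ k * (M' * δ / (1 + c) ^ l) + M * δ / (1 + c) ^ k * (M' / (1 + c) ^ l) := by
        refine add_le_add ((h0 _ _).trans ?_) ((h0 _ _).trans ?_)
        · gcongr
          · exact a1 κ c hc
          · exact b2 κ κ' δ h c hc
        · gcongr
          · exact a2 κ κ' δ h c hc
          · exact b1 κ' c hc
      _ = _ := by rw [pow_add]; field_simp; ring

theorem Bd.mul {X Y : Ker N → ℝ → ℂ} (hX : Bd k X) (hY : Bd l Y) :
    Bd (k + l) fun κ c => X κ c * Y κ c :=
  hX.bilin hY (fun x y => x * y) (fun _ _ => (norm_mul _ _).le) (fun _ _ _ => sub_mul _ _ _)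
    fun _ _ _ => mul_sub _ _ _

theorem Bd.smul [NormedSpace ℂ V] {X : Ker N → ℝ → ℂ} (hX : Bd k X) (hY : Bd l Y) :
    Bd (k + l) fun κ c => X κ c • Y κ c :=
  hX.bilin hY (fun x y => x • y) (fun _ _ => (norm_smul _ _).le) (fun _ _ _ => sub_smul _ _ _)
    fun _ _ _ => smul_sub _ _ _

theorem Bd.const (v : V) : Bd 0 fun (_ : Ker N) (_ : ℝ) => v :=
  ⟨‖v‖, norm_nonneg _, fun κ c hc => by simp, fun κ κ' δ h c hc => by
    have := h.nonneg
    simp only [sub_self, norm_zero]; positivity⟩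

theorem Bd.const_mul {X : Ker N → ℝ → ℂ} (hX : Bd k X) (a : ℂ) : Bd k fun κ c => a * X κ c := by
  simpa using (Bd.const (N := N) a).mul hX

theorem Bd.const_smul [NormedSpace ℂ V] (hX : Bd k X) (a : ℂ) : Bd k fun κ c => a • X κ c := by
  simpa using (Bd.const (N := N) a).smul hX

theorem Bd.neg (hX : Bd k X) : Bd k fun κ c => -X κ c := by
  obtain ⟨M, hM, h1, h2⟩ := hX
  refine ⟨M, hM, fun κ c hc => by rw [norm_neg]; exact h1 κ c hc, fun κ κ' δ h c hc => ?_⟩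
  rw [neg_sub_neg, norm_sub_rev]; exact h2 κ κ' δ h c hc

theorem Bd.conj {X : Ker N → ℝ → ℂ} (hX : Bd k X) : Bd k fun κ c => conj (X κ c) := by
  obtain ⟨M, hM, h1, h2⟩ := hX
  refine ⟨M, hM, fun κ c hc => by rw [RCLike.norm_conj]; exact h1 κ c hc, fun κ κ' δ h c hc => ?_⟩
  rw [← map_sub, RCLike.norm_conj]; exact h2 κ κ' δ h c hc

theorem Bd.inner [InnerProductSpace ℂ V] (hX : Bd k X) (hY : Bd l Y) :
    Bd (k + l) fun κ c => inner ℂ (X κ c) (Y κ c) :=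
  hX.bilin hY (fun x y => Inner.inner ℂ x y) (fun _ _ => norm_inner_le_norm _ _)
    (fun _ _ _ => inner_sub_left _ _ _) fun _ _ _ => inner_sub_right _ _ _

theorem Bd.clm_apply [NormedSpace ℂ V] {T : Ker N → ℝ → V →L[ℂ] V} (hT : Bd k T) (hX : Bd l X) :
    Bd (k + l) fun κ c => T κ c (X κ c) :=
  hT.bilin hX (fun T x => T x) (fun _ _ => ContinuousLinearMap.le_opNorm _ _)
    (fun _ _ _ => rfl) fun _ _ _ => map_sub _ _ _

theorem Bd.rankOne [InnerProductSpace ℂ V] (hX : Bd k X) (hY : Bd l Y) :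
    Bd (k + l) fun κ c => InnerProductSpace.rankOne ℂ (X κ c) (Y κ c) :=
  hX.bilin hY (fun x y => InnerProductSpace.rankOne ℂ x y)
    (fun x y => (InnerProductSpace.norm_rankOne x y).le)
    (fun _ _ _ => by rw [map_sub]; rfl) fun _ _ _ => map_sub _ _ _

theorem integral_Ioi_div_sq (M : ℝ) {c : ℝ} (hc : 0 ≤ c) :
    ∫ t in Ioi c, M / (1 + t) ^ 2 = M / (1 + c) := by
  rw [setIntegral_comp_add_left_Ioi (fun t : ℝ => M / t ^ 2)]
  have h2 := integral_Ioi_rpow_of_lt (a := -2) (by norm_num) (c := 1 + c) (by positivity)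
  have e3 : ∫ t in Ioi (1 + c), M / t ^ 2 = ∫ t in Ioi (1 + c), M * t ^ (-2 : ℝ) := by
    refine setIntegral_congr_fun measurableSet_Ioi fun t ht => ?_
    have : (0 : ℝ) < t := lt_trans (by positivity) (mem_Ioi.1 ht)
    rw [Real.rpow_neg this.le, div_eq_mul_inv]; norm_cast
  rw [e3, integral_const_mul, h2]
  norm_num
  rw [Real.rpow_neg_one]; ring

theorem Bd.integrableOn (hX : Bd 2 X) (hc : ∀ κ, Continuous (X κ)) (κ : Ker N) (c : ℝ) :
    IntegrableOn (X κ) (Ioi c) := by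
  obtain ⟨M, hM, h1, h2⟩ := hX
  refine IntegrableOn.of_continuous_Ioi (hc κ) (a := 0) ?_ c
  refine (integrableOn_div_sq M).mono' (hc κ).aestronglyMeasurable ?_
  filter_upwards [ae_restrict_mem measurableSet_Ioi] with t ht
  exact h1 κ t (le_of_lt ht)

theorem Bd.integral [NormedSpace ℝ V] (hX : Bd 2 X) (hc : ∀ κ, Continuous (X κ)) :
    Bd 1 fun κ c => ∫ t in Ioi c, X κ t := by
  have hi := hX.integrableOn hc
  obtain ⟨M, hM, h1, h2⟩ := hX
  refine ⟨M, hM, fun κ c h0 => ?_, fun κ κ' δ h c h0 => ?_⟩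
  · rw [pow_one, ← integral_Ioi_div_sq M h0]
    refine norm_integral_le_of_norm_le ((integrableOn_div_sq _).mono_set (Ioi_subset_Ioi h0)) ?_
    filter_upwards [ae_restrict_mem measurableSet_Ioi] with t ht
    exact h1 κ t (h0.trans (le_of_lt ht))
  · rw [← integral_sub (hi κ c) (hi κ' c), pow_one, ← integral_Ioi_div_sq _ h0]
    refine norm_integral_le_of_norm_le ((integrableOn_div_sq _).mono_set (Ioi_subset_Ioi h0)) ?_
    filter_upwards [ae_restrict_mem measurableSet_Ioi] with t ht
    exact h2 κ κ' δ h t (h0.trans (le_of_lt ht))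

/-- For a quantity linear in the kernel, the size estimate applied to the difference of two kernels
is the Lipschitz estimate. -/
theorem Bd.of_kernel {X : Ker N → ℝ → V} (hN : 0 ≤ N) (F : (ℝ → ℂ) → (ℝ → ℂ) → (ℝ → ℂ) → ℝ → V)
    {a : ℝ} (ha : 0 ≤ a) (hF : ∀ {N φ φ₁ φ₂}, IsKernel N φ φ₁ φ₂ → ∀ c, 0 ≤ c →
      ‖F φ φ₁ φ₂ c‖ ≤ a * N / (1 + c) ^ k) (h1 : ∀ κ c, X κ c = F κ.φ κ.φ₁ κ.φ₂ c)
    (h2 : ∀ (κ κ' : Ker N) c, X κ c - X κ' c = F (fun s => κ.φ s - κ'.φ s)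
      (fun s => κ.φ₁ s - κ'.φ₁ s) (fun s => κ.φ₂ s - κ'.φ₂ s) c) : Bd k X := by
  refine ⟨a * N + a, by positivity, fun κ c hc => ?_, fun κ κ' δ h c hc => ?_⟩
  · rw [h1]
    refine (hF κ.isKernel c hc).trans ?_
    gcongr; linarith
  · rw [h2]
    refine (hF h c hc).trans ?_
    have := h.nonneg
    gcongr; nlinarith [mul_nonneg ha hN]

end Calculus

section Estimates
variable {N : ℝ}

theorem bd_tr0 (hN : 0 ≤ N) : Bd 1 fun (κ : Ker N) c => tr κ.φ c :=
  Bd.of_kernel hN (fun φ _ _ c => tr φ c) zero_le_two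
    (fun h c hc => by rw [pow_one]; exact h.norm_tr0 hc) (fun _ _ => rfl)
    fun κ κ' c => (tr_sub κ.isKernel.mem0 κ'.isKernel.mem0 c).symm

theorem bd_tr1 (hN : 0 ≤ N) : Bd 1 fun (κ : Ker N) c => tr κ.φ₁ c :=
  Bd.of_kernel hN (fun _ φ₁ _ c => tr φ₁ c) zero_le_two
    (fun h c hc => by rw [pow_one]; exact h.norm_tr1 hc) (fun _ _ => rfl)
    fun κ κ' c => (tr_sub κ.isKernel.mem1 κ'.isKernel.mem1 c).symm

theorem bd_tr2 (hN : 0 ≤ N) : Bd 0 fun (κ : Ker N) c => tr κ.φ₂ c :=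
  Bd.of_kernel hN (fun _ _ φ₂ c => tr φ₂ c) zero_le_one
    (fun h c hc => by simpa using (h.norm_tr_le_3 c).2.2.1) (fun _ _ => rfl)
    fun κ κ' c => (tr_sub κ.isKernel.mem2 κ'.isKernel.mem2 c).symm

theorem bd_φ (hN : 0 ≤ N) : Bd 1 fun (κ : Ker N) c => κ.φ c :=
  Bd.of_kernel hN (fun φ _ _ c => φ c) zero_le_four
    (fun h c hc => by simpa using h.norm_apply hc) (fun _ _ => rfl) fun _ _ _ => rfl

theorem bd_φ₁ (hN : 0 ≤ N) : Bd 0 fun (κ : Ker N) c => κ.φ₁ c :=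
  Bd.of_kernel hN (fun _ φ₁ _ c => φ₁ c) zero_le_two
    (fun h c hc => by simpa using (h.norm_tr_le_3 c).2.2.2.2) (fun _ _ => rfl) fun _ _ _ => rfl

theorem bd_opK (hN : 0 ≤ N) : Bd 1 fun (κ : Ker N) c => opK κ.φ κ.φ₁ c := by
  refine Bd.integral (X := fun (κ : Ker N) t => (-4 * Complex.I) •
    InnerProductSpace.rankOne ℂ (tr κ.φ₁ t) (tr κ.φ t))
    (((bd_tr1 hN).rankOne (bd_tr0 hN)).const_smul _) fun κ => ?_
  have := continuous_rankOne (continuous_tr κ.φ₁) (continuous_tr κ.φ)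
  exact this.const_smul (-4 * Complex.I)

theorem bd_srcF (hN : 0 ≤ N) : Bd 1 fun (κ : Ker N) c => srcF κ.φ κ.φ₁ c :=
  Bd.integral (X := fun (κ : Ker N) t => (-4 * Complex.I * conj (κ.φ t)) • tr κ.φ₁ t)
    (((bd_φ hN).conj.const_mul _).smul (bd_tr1 hN)) fun κ => κ.isKernel.continuous_srcF_integrand

/-- The resolvent identity R − R′ = R (K′ − K) R′ reduces the Lipschitz bound to that of K. -/
theorem bd_resK (hN : 0 ≤ N) : Bd 0 fun (κ : Ker N) c => resK κ.φ κ.φ₁ c := by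
  obtain ⟨C, hC, H⟩ := exists_norm_resK_le hN
  have H' : ∀ (κ : Ker N) c, 0 ≤ c → ‖resK κ.φ κ.φ₁ c‖ ≤ C := fun κ => H _ _ _ κ.isKernel
  obtain ⟨M, hM, -, h2⟩ := (bd_opK hN).mono (Nat.zero_le 1)
  refine ⟨C + C * M * C, by positivity, fun κ c hc => ?_, fun κ κ' δ h c hc => ?_⟩
  · rw [pow_zero, div_one]
    exact (H' κ c hc).trans (by linarith [show 0 ≤ C * M * C by positivity])
  · have hδ := h.nonneg
    have h3 := h2 κ κ' δ h c hc
    rw [pow_zero, div_one] at h3 ⊢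
    change ‖Ring.inverse (1 + opK κ.φ κ.φ₁ c) - Ring.inverse (1 + opK κ'.φ κ'.φ₁ c)‖ ≤ _
    rw [inverse_sub_inverse (κ.isKernel.isUnit c) (κ'.isKernel.isUnit c),
      add_sub_add_left_eq_sub]
    calc _ ≤ ‖resK κ.φ κ.φ₁ c‖ * ‖opK κ'.φ κ'.φ₁ c - opK κ.φ κ.φ₁ c‖ * ‖resK κ'.φ κ'.φ₁ c‖ :=
          (norm_mul_le _ _).trans (mul_le_mul_of_nonneg_right (norm_mul_le _ _) (norm_nonneg _))
      _ ≤ C * (M * δ) * C := by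
          gcongr
          · exact H' κ c hc
          · rw [norm_sub_rev]; exact h3
          · exact H' κ' c hc
      _ ≤ _ := by nlinarith [mul_nonneg hC hδ]

theorem bd_solA (hN : 0 ≤ N) : Bd 1 fun (κ : Ker N) c => solA κ.φ κ.φ₁ c :=
  ((bd_resK hN).clm_apply (bd_srcF hN)).neg

theorem bd_solY (hN : 0 ≤ N) : Bd 1 fun (κ : Ker N) c => solY κ.φ κ.φ₁ c :=
  ((bd_resK hN).clm_apply (bd_tr1 hN)).const_smul _

/-- Two factors of order 1/(1 + c) give one power more than φ itself has, which is enough for the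
weighted space L^{2,1}. -/
theorem bd_remB (hN : 0 ≤ N) : Bd 2 fun (κ : Ker N) c => remB κ.φ κ.φ₁ c :=
  (bd_tr0 hN).inner (bd_solA hN)

theorem bd_bval (hN : 0 ≤ N) : Bd 1 fun (κ : Ker N) c => bval κ.φ κ.φ₁ c :=
  (bd_φ hN).conj.add ((bd_remB hN).mono one_le_two)

theorem bd_inner_solY (hN : 0 ≤ N) :
    Bd 2 fun (κ : Ker N) c => inner ℂ (tr κ.φ c) (solY κ.φ κ.φ₁ c) :=
  (bd_tr0 hN).inner (bd_solY hN)

theorem bd_remB' (hN : 0 ≤ N) : Bd 2 fun (κ : Ker N) c => remB' κ.φ κ.φ₁ c :=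
  ((bd_tr1 hN).inner (bd_solA hN)).add (((bd_bval hN).mul (bd_inner_solY hN)).mono (by norm_num))

theorem bd_bval' (hN : 0 ≤ N) : Bd 0 fun (κ : Ker N) c => bval' κ.φ κ.φ₁ c :=
  (bd_φ₁ hN).conj.add ((bd_remB' hN).mono (by norm_num))

theorem bd_derY (hN : 0 ≤ N) : Bd 0 fun (κ : Ker N) c => derY κ.φ κ.φ₁ κ.φ₂ c :=
  (((bd_resK hN).clm_apply (bd_tr2 hN)).const_smul _).add
    (((bd_inner_solY hN).smul (bd_solY hN)).mono (by norm_num))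

/-- The term with `tr φ₂` keeps only the single power of decay supplied by `solA`; that suffices,
because the second derivative is wanted in unweighted L². -/
theorem bd_remB'' (hN : 0 ≤ N) : Bd 1 fun (κ : Ker N) c => remB'' κ.φ κ.φ₁ κ.φ₂ c :=
  (((((bd_tr2 hN).inner (bd_solA hN)).mono (by norm_num)).add
    ((((bd_bval hN).const_mul 2).mul ((bd_tr1 hN).inner (bd_solY hN))).mono (by norm_num))).add
    (((bd_bval' hN).mul (bd_inner_solY hN)).mono (by norm_num))).add
    (((bd_bval hN).mul ((bd_tr0 hN).inner (bd_derY hN))).mono (by norm_num))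

end Estimates

/-! ### Weighted L² bounds -/

/-- `X` and its Lipschitz constant with respect to the kernel are bounded in `L^{2,m}(0, ∞)`. -/
def L2Bd {N : ℝ} (m : ℕ) (X : Ker N → ℝ → ℂ) : Prop :=
  ∃ M, 0 ≤ M ∧ (∀ κ, AEStronglyMeasurable (X κ) (volume.restrict (Ioi 0))) ∧
    (∀ κ, eLpNorm (weighted m (X κ)) 2 (volume.restrict (Ioi 0)) ≤ ENNReal.ofReal M) ∧
    ∀ κ κ' δ, Ker.Close κ κ' δ → eLpNorm (weighted m (fun c => X κ c - X κ' c)) 2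
      (volume.restrict (Ioi 0)) ≤ ENNReal.ofReal (M * δ)

theorem aestronglyMeasurable_weighted {m : ℕ} {f : ℝ → ℂ} {μ : Measure ℝ}
    (hf : AEStronglyMeasurable f μ) : AEStronglyMeasurable (weighted m f) μ :=
  (Continuous.aestronglyMeasurable (by fun_prop)).mul hf

theorem norm_weighted (m : ℕ) (f : ℝ → ℂ) (x : ℝ) :
    ‖weighted m f x‖ = √(1 + x ^ 2) ^ m * ‖f x‖ := by
  rw [weighted, norm_mul, Complex.norm_real, Real.norm_of_nonneg (by positivity)]

theorem eLpNorm_inv_le (M : ℝ) (hM : 0 ≤ M) :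
    eLpNorm (fun x : ℝ => M / (1 + x)) 2 (volume.restrict (Ioi 0)) ≤ ENNReal.ofReal M := by
  have hm : AEStronglyMeasurable (fun x : ℝ => M / (1 + x)) (volume.restrict (Ioi 0)) := by
    refine ContinuousOn.aestronglyMeasurable ?_ measurableSet_Ioi
    exact continuousOn_const.div (by fun_prop) fun x hx => by
      have : (0 : ℝ) < x := hx
      positivity
  have hi : Integrable (fun x : ℝ => (M / (1 + x)) ^ 2) (volume.restrict (Ioi 0)) := by
    refine (integrableOn_div_sq (M ^ 2)).congr (ae_of_all _ fun x => by simp only [div_pow])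
  have h2 : MemLp (fun x : ℝ => M / (1 + x)) 2 (volume.restrict (Ioi 0)) :=
    (memLp_two_iff_integrable_sq hm).2 hi
  rw [h2.eLpNorm_eq_integral_rpow_norm (by simp) (by simp)]
  refine ENNReal.ofReal_le_ofReal ?_
  have e : ∫ x in Ioi (0 : ℝ), ‖M / (1 + x)‖ ^ (2 : ℝ≥0∞).toReal = M ^ 2 := by
    rw [← integral_div_sq (M ^ 2)]
    congr 1; ext x
    simp [div_pow]
  rw [e, ENNReal.toReal_ofNat, ← one_div, ← Real.sqrt_eq_rpow, Real.sqrt_sq hM]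

theorem eLpNorm_weighted_le_of_bound {m : ℕ} {f : ℝ → ℂ} {M : ℝ} (hM : 0 ≤ M)
    (h : ∀ x, 0 ≤ x → ‖f x‖ ≤ M / (1 + x) ^ (m + 1)) :
    eLpNorm (weighted m f) 2 (volume.restrict (Ioi 0)) ≤ ENNReal.ofReal M := by
  refine (eLpNorm_mono_ae_real ?_).trans (eLpNorm_inv_le M hM)
  filter_upwards [ae_restrict_mem measurableSet_Ioi] with x hx
  have hx' : (0 : ℝ) < x := hx
  rw [norm_weighted]
  have h1 : √(1 + x ^ 2) ≤ 1 + x := by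
    have := bracket_le x
    rwa [abs_of_pos hx'] at this
  calc _ ≤ (1 + x) ^ m * (M / (1 + x) ^ (m + 1)) := by
        gcongr; exact h x hx'.le
    _ = _ := by rw [pow_succ]; field_simp

section
variable {N : ℝ} {m k : ℕ}

/-- Decay of order m + 1 leaves, after the weight of order m, a multiple of 1/(1 + c), which is
square integrable on the half-line. -/
theorem Bd.l2Bd {X : Ker N → ℝ → ℂ} (hX : Bd k X) (hc : ∀ κ, Continuous (X κ)) (hk : m + 1 ≤ k) :
    L2Bd m X := by
  obtain ⟨M, hM, h1, h2⟩ := hX.mono hk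
  refine ⟨M, hM, fun κ => (hc κ).aestronglyMeasurable, fun κ =>
    eLpNorm_weighted_le_of_bound hM (h1 κ), fun κ κ' δ h => ?_⟩
  have := h.nonneg
  exact eLpNorm_weighted_le_of_bound (by positivity) (h2 κ κ' δ h)

theorem weighted_add (m : ℕ) (f g : ℝ → ℂ) :
    weighted m (fun x => f x + g x) = weighted m f + weighted m g := by
  ext x; simp [weighted, mul_add]

theorem L2Bd.add {X Y : Ker N → ℝ → ℂ} (hX : L2Bd m X) (hY : L2Bd m Y) :
    L2Bd m fun κ c => X κ c + Y κ c := by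
  obtain ⟨M, hM, hm, h1, h2⟩ := hX
  obtain ⟨M', hM', hm', h1', h2'⟩ := hY
  refine ⟨M + M', by positivity, fun κ => (hm κ).add (hm' κ), fun κ => ?_, fun κ κ' δ h => ?_⟩
  · rw [weighted_add, ENNReal.ofReal_add hM hM']
    exact (eLpNorm_add_le (aestronglyMeasurable_weighted (hm κ))
      (aestronglyMeasurable_weighted (hm' κ)) (by norm_num)).trans (add_le_add (h1 κ) (h1' κ))
  · have hδ := h.nonneg
    rw [add_mul, ENNReal.ofReal_add (by positivity) (by positivity)]
    simp_rw [add_sub_add_comm]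
    rw [weighted_add]
    exact (eLpNorm_add_le (aestronglyMeasurable_weighted ((hm κ).sub (hm κ')))
      (aestronglyMeasurable_weighted ((hm' κ).sub (hm' κ'))) (by norm_num)).trans
      (add_le_add (h2 κ κ' δ h) (h2' κ κ' δ h))

theorem eLpNorm_weighted_mul_le {f g : ℝ → ℂ} {M M' : ℝ}
    (hf : eLpNorm (weighted m f) 2 (volume.restrict (Ioi 0)) ≤ ENNReal.ofReal M)
    (hM' : 0 ≤ M') (hg : ∀ x, 0 ≤ x → ‖g x‖ ≤ M') :
    eLpNorm (weighted m fun x => f x * g x) 2 (volume.restrict (Ioi 0)) ≤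
      ENNReal.ofReal (M' * M) := by
  refine (eLpNorm_le_mul_eLpNorm_of_ae_le_mul (c := M') (g := weighted m f) ?_ 2).trans ?_
  · filter_upwards [ae_restrict_mem measurableSet_Ioi] with x hx
    rw [norm_weighted, norm_weighted, norm_mul]
    have := hg x (le_of_lt hx)
    calc _ ≤ √(1 + x ^ 2) ^ m * (‖f x‖ * M') := by gcongr
      _ = _ := by ring
  · rw [ENNReal.ofReal_mul hM']; gcongr

theorem L2Bd.mul {X Y : Ker N → ℝ → ℂ} (hX : L2Bd m X) (hY : Bd 0 Y) (hc : ∀ κ, Continuous (Y κ)) :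
    L2Bd m fun κ c => X κ c * Y κ c := by
  obtain ⟨M, hM, hm, h1, h2⟩ := hX
  obtain ⟨M', hM', h1', h2'⟩ := hY
  refine ⟨2 * (M' * M), by positivity, fun κ => (hm κ).mul (hc κ).aestronglyMeasurable, fun κ => ?_,
    fun κ κ' δ h => ?_⟩
  · refine (eLpNorm_weighted_mul_le (h1 κ) hM' fun x hx => by simpa using h1' κ x hx).trans ?_
    exact ENNReal.ofReal_le_ofReal (by nlinarith [mul_nonneg hM' hM])
  · have hδ := h.nonneg
    have e : (fun c => X κ c * Y κ c - X κ' c * Y κ' c) = fun c =>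
        (X κ c - X κ' c) * Y κ c + X κ' c * (Y κ c - Y κ' c) := by ext c; ring
    rw [e, weighted_add, show 2 * (M' * M) * δ = M' * (M * δ) + M' * δ * M by ring,
      ENNReal.ofReal_add (by positivity) (by positivity)]
    refine (eLpNorm_add_le (aestronglyMeasurable_weighted (((hm κ).sub (hm κ')).mul
      (hc κ).aestronglyMeasurable)) (aestronglyMeasurable_weighted ((hm κ').mul
      ((hc κ).sub (hc κ')).aestronglyMeasurable)) (by norm_num)).trans (add_le_add ?_ ?_)
    · exact eLpNorm_weighted_mul_le (h2 κ κ' δ h) hM'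
        fun x hx => by simpa using h1' κ x hx
    · exact eLpNorm_weighted_mul_le (h1 κ') (by positivity)
        fun x hx => by simpa using h2' κ κ' δ h x hx

theorem L2Bd.const_mul {X : Ker N → ℝ → ℂ} (hX : L2Bd m X) (a : ℂ) :
    L2Bd m fun κ c => a * X κ c := by
  have := hX.mul (Bd.const a) fun κ => continuous_const
  simpa only [mul_comm] using this

theorem L2Bd.zero_of_one {X : Ker N → ℝ → ℂ} (hX : L2Bd 1 X) : L2Bd 0 X := by
  obtain ⟨M, hM, hm, h1, h2⟩ := hX
  have key : ∀ f : ℝ → ℂ, eLpNorm (weighted 0 f) 2 (volume.restrict (Ioi 0)) ≤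
      eLpNorm (weighted 1 f) 2 (volume.restrict (Ioi 0)) := fun f => eLpNorm_mono fun x => by
    rw [norm_weighted, norm_weighted]
    gcongr
    · exact one_le_bracket x
    · norm_num
  exact ⟨M, hM, hm, fun κ => (key _).trans (h1 κ), fun κ κ' δ h => (key _).trans (h2 κ κ' δ h)⟩

theorem eLpNorm_conj {f : ℝ → ℂ} {μ : Measure ℝ} :
    eLpNorm (fun x => conj (f x)) 2 μ = eLpNorm f 2 μ :=
  eLpNorm_congr_norm_ae (ae_of_all _ fun _ => RCLike.norm_conj _)

theorem eLpNorm_weighted_one_le {f : ℝ → ℂ} {M : ℝ} (hM : 0 ≤ M) (hf : AEStronglyMeasurable f)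
    (h0 : eLpNorm f 2 volume ≤ ENNReal.ofReal M)
    (h1 : eLpNorm (fun s : ℝ => (s : ℂ) * f s) 2 volume ≤ ENNReal.ofReal M) :
    eLpNorm (weighted 1 f) 2 (volume.restrict (Ioi 0)) ≤ ENNReal.ofReal (2 * M) := by
  have hm : AEStronglyMeasurable (fun s : ℝ => (s : ℂ) * f s) :=
    (Continuous.aestronglyMeasurable (by fun_prop)).mul hf
  refine (eLpNorm_mono_measure _ Measure.restrict_le_self).trans ?_
  have e : eLpNorm (weighted 1 f) 2 volume ≤
      eLpNorm ((fun s => ‖f s‖) + fun s : ℝ => ‖(s : ℂ) * f s‖) 2 volume := by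
    refine eLpNorm_mono_real fun s => ?_
    rw [norm_weighted, pow_one, Pi.add_apply, norm_mul, Complex.norm_real, Real.norm_eq_abs]
    nlinarith [bracket_le s, norm_nonneg (f s)]
  refine e.trans ((eLpNorm_add_le hf.norm hm.norm (by norm_num)).trans ?_)
  rw [eLpNorm_norm, eLpNorm_norm, two_mul, ENNReal.ofReal_add hM hM]
  exact add_le_add h0 h1

theorem L2Bd.of_kernel {X : Ker N → ℝ → ℂ} (hN : 0 ≤ N)
    (F : (ℝ → ℂ) → (ℝ → ℂ) → (ℝ → ℂ) → ℝ → ℂ)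
    {a : ℝ} (ha : 0 ≤ a) (hF : ∀ {N φ φ₁ φ₂}, IsKernel N φ φ₁ φ₂ →
      AEStronglyMeasurable (F φ φ₁ φ₂) ∧
      eLpNorm (weighted m (F φ φ₁ φ₂)) 2 (volume.restrict (Ioi 0)) ≤ ENNReal.ofReal (a * N))
    (h1 : ∀ κ c, X κ c = F κ.φ κ.φ₁ κ.φ₂ c)
    (h2 : ∀ (κ κ' : Ker N) c, X κ c - X κ' c = F (fun s => κ.φ s - κ'.φ s)
      (fun s => κ.φ₁ s - κ'.φ₁ s) (fun s => κ.φ₂ s - κ'.φ₂ s) c) : L2Bd m X := by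
  have e : ∀ κ, X κ = F κ.φ κ.φ₁ κ.φ₂ := fun κ => funext (h1 κ)
  refine ⟨a * N + a, by positivity, fun κ => ?_, fun κ => ?_, fun κ κ' δ h => ?_⟩
  · rw [e]; exact (hF κ.isKernel).1.restrict
  · rw [e]
    exact (hF κ.isKernel).2.trans (ENNReal.ofReal_le_ofReal (by linarith))
  · have hδ := h.nonneg
    simp_rw [h2]
    exact (hF h).2.trans (ENNReal.ofReal_le_ofReal (by nlinarith [mul_nonneg ha hN]))

/-- The pointwise decay 1/(1 + c) of φ would not give L^{2,1}. Leading terms are therefore estimated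
directly by the weighted L² norms of the kernel, and only remainders by pointwise decay. -/
theorem l2Bd_conj_φ (hN : 0 ≤ N) : L2Bd 1 fun (κ : Ker N) c => conj (κ.φ c) :=
  L2Bd.of_kernel hN (fun φ _ _ c => conj (φ c)) zero_le_two (fun {N φ φ₁ φ₂} h =>
    have hm := Complex.continuous_conj.comp_aestronglyMeasurable h.mem0.1
    ⟨hm, eLpNorm_weighted_one_le h.nonneg hm (eLpNorm_conj.trans_le h.le0) (by
      refine le_trans (eLpNorm_mono fun s => ?_) h.le0'
      simp)⟩) (fun _ _ => rfl) fun _ _ _ => (map_sub _ _ _).symm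

theorem l2Bd_conj_φ₁ (hN : 0 ≤ N) : L2Bd 1 fun (κ : Ker N) c => conj (κ.φ₁ c) :=
  L2Bd.of_kernel hN (fun _ φ₁ _ c => conj (φ₁ c)) zero_le_two (fun {N φ φ₁ φ₂} h =>
    have hm := Complex.continuous_conj.comp_aestronglyMeasurable h.mem1.1
    ⟨hm, eLpNorm_weighted_one_le h.nonneg hm (eLpNorm_conj.trans_le h.le1) (by
      refine le_trans (eLpNorm_mono fun s => ?_) h.le1'
      simp)⟩) (fun _ _ => rfl) fun _ _ _ => (map_sub _ _ _).symm

theorem l2Bd_conj_φ₂ (hN : 0 ≤ N) : L2Bd 0 fun (κ : Ker N) c => conj (κ.φ₂ c) :=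
  L2Bd.of_kernel hN (fun _ _ φ₂ c => conj (φ₂ c)) zero_le_one (fun {N φ φ₁ φ₂} h =>
    have hm := Complex.continuous_conj.comp_aestronglyMeasurable h.mem2.1
    ⟨hm, by
      rw [weighted_zero, one_mul]
      exact (eLpNorm_mono_measure _ Measure.restrict_le_self).trans
        (eLpNorm_conj.trans_le h.le2)⟩) (fun _ _ => rfl) fun _ _ _ => (map_sub _ _ _).symm

end

/-! ### Primitives and weak derivatives -/

/-- `f` is an indefinite integral of the locally integrable function `g`. -/
def IsPrimitive (f g : ℝ → ℂ) : Prop :=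
  (∀ s t, IntervalIntegrable g volume s t) ∧ ∀ s t, ∫ x in s..t, g x = f t - f s

theorem IsPrimitive.of_hasDerivAt {f g : ℝ → ℂ} (h : ∀ t, HasDerivAt f (g t) t)
    (hg : Continuous g) : IsPrimitive f g :=
  ⟨fun s t => hg.intervalIntegrable s t, fun s t =>
    intervalIntegral.integral_eq_sub_of_hasDerivAt (fun x _ => h x) (hg.intervalIntegrable s t)⟩

theorem IsPrimitive.add {f g f' g' : ℝ → ℂ} (h : IsPrimitive f g) (h' : IsPrimitive f' g') :
    IsPrimitive (fun x => f x + f' x) fun x => g x + g' x :=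
  ⟨fun s t => (h.1 s t).add (h'.1 s t), fun s t => by
    rw [intervalIntegral.integral_add (h.1 s t) (h'.1 s t), h.2, h'.2]; ring⟩

theorem IsPrimitive.const_mul {f g : ℝ → ℂ} (h : IsPrimitive f g) (a : ℂ) :
    IsPrimitive (fun x => a * f x) fun x => a * g x :=
  ⟨fun s t => (h.1 s t).const_mul a, fun s t => by
    rw [intervalIntegral.integral_const_mul, h.2]; ring⟩

theorem IsPrimitive.conj {f g : ℝ → ℂ} (h : IsPrimitive f g) :
    IsPrimitive (fun x => conj (f x)) fun x => conj (g x) :=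
  ⟨fun s t => ⟨integrable_conj (h.1 s t).1, integrable_conj (h.1 s t).2⟩, fun s t => by
    rw [← map_sub, ← h.2, intervalIntegral.intervalIntegral_eq_integral_uIoc,
      intervalIntegral.intervalIntegral_eq_integral_uIoc, integral_conj]
    split_ifs <;> simp⟩

theorem IsPrimitive.continuous {f g : ℝ → ℂ} (h : IsPrimitive f g) : Continuous f := by
  have : f = fun t => (∫ x in (0 : ℝ)..t, g x) + f 0 := by ext t; rw [h.2]; ring
  rw [this]
  exact (intervalIntegral.continuous_primitive h.1 0).add continuous_const

/-- The product rule with one factor only absolutely continuous, as needed for the second derivative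
of the potential. -/
theorem IsPrimitive.mul {f g e e' : ℝ → ℂ} (h : IsPrimitive f g) (he : ∀ t, HasDerivAt e (e' t) t)
    (hc : Continuous e') : IsPrimitive (fun x => f x * e x) fun x => g x * e x + f x * e' x := by
  have hec : Continuous e := continuous_iff_continuousAt.2 fun t => (he t).continuousAt
  have hi : ∀ s t, IntervalIntegrable (fun x => g x * e x) volume s t := fun s t =>
    (h.1 s t).mul_continuousOn hec.continuousOn
  have hi' : ∀ s t, IntervalIntegrable (fun x => f x * e' x) volume s t := fun s t =>
    (h.continuous.mul hc).intervalIntegrable s t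
  have key : ∀ s t, s ≤ t → ∫ x in s..t, (g x * e x + f x * e' x) = f t * e t - f s * e s := by
    intro s t hst
    have hM : 0 ≤ t - s := by linarith
    have hgs : IntervalIntegrable (fun x => g (s + x)) volume 0 (t - s) := by
      have := (h.1 s t).comp_add_left s
      simpa using this
    have hA : IntegrableOn (fun x => g (s + x)) (Ioc 0 (t - s)) :=
      (intervalIntegrable_iff_integrableOn_Ioc_of_le hM).1 hgs
    have h1 := integral_mul_eq_sub_of_ftc hA (hc.comp (continuous_const.add continuous_id))
      (fun x => (he (s + x)).comp_const_add s x)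
    have h2 : ∀ y ∈ Icc 0 (t - s), ∫ ξ in Ioc 0 y, g (s + ξ) = f (s + y) - f s := fun y hy => by
      rw [← intervalIntegral.integral_of_le hy.1, intervalIntegral.integral_comp_add_left,
        add_zero, h.2]
    have h5 : ∫ y in Ioc 0 (t - s), (e' ∘ ((fun _ => s) + id)) y * ∫ ξ in Ioc 0 y, g (s + ξ) =
        ∫ y in Ioc 0 (t - s), e' (s + y) * (f (s + y) - f s) :=
      setIntegral_congr_fun measurableSet_Ioc fun y hy => by
        simp only [Function.comp_apply, Pi.add_apply, id_eq]
        rw [h2 y ⟨hy.1.le, hy.2⟩]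
    rw [h2 _ ⟨hM, le_rfl⟩] at h1
    replace h1 := h1.trans (congrArg _ h5)
    rw [← intervalIntegral.integral_of_le hM, ← intervalIntegral.integral_of_le hM,
      intervalIntegral.integral_comp_add_left (fun x => e x * g x),
      intervalIntegral.integral_comp_add_left (fun x => e' x * (f x - f s)), add_zero,
      add_sub_cancel] at h1
    have h3 : ∫ x in s..t, e' x * (f x - f s) =
        (∫ x in s..t, f x * e' x) - f s * (e t - e s) := by
      rw [← (IsPrimitive.of_hasDerivAt he hc).2, ← intervalIntegral.integral_const_mul,
        ← intervalIntegral.integral_sub (hi' s t) ((hc.intervalIntegrable s t).const_mul _)]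
      congr 1; ext x; ring
    rw [intervalIntegral.integral_add (hi s t) (hi' s t)]
    have h4 : ∫ x in s..t, g x * e x = ∫ x in s..t, e x * g x := by
      congr 1; ext x; ring
    rw [h4, h1, h3]; ring
  refine ⟨fun s t => (hi s t).add (hi' s t), fun s t => ?_⟩
  rcases le_total s t with hst | hst
  · exact key s t hst
  · rw [intervalIntegral.integral_symm, key t s hst]; ring

/-- The product rule for f and the test function, integrated over an interval whose interior
contains the support, has vanishing boundary terms. -/
theorem IsPrimitive.isWeakDeriv {f g : ℝ → ℂ} (h : IsPrimitive f g) {Ω : Set ℝ} :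
    IsWeakDeriv Ω f g := by
  have hgl : LocallyIntegrable g := fun x => by
    refine ⟨Icc (x - 1) (x + 1), Icc_mem_nhds (by linarith) (by linarith), ?_⟩
    exact (intervalIntegrable_iff_integrableOn_Icc_of_le (by linarith)).1 (h.1 _ _)
  refine ⟨h.continuous.locallyIntegrable.locallyIntegrableOn _, hgl.locallyIntegrableOn _,
    fun φ hφ hc hs => ?_⟩
  have hφ1 : ∀ t, HasDerivAt (fun x => (φ x : ℂ)) ((deriv φ t : ℝ) : ℂ) t := fun t =>
    ((hφ.differentiable (by simp)) t).hasDerivAt.ofReal_comp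
  have hd : Continuous (deriv φ) := hφ.continuous_deriv (by simp)
  have hm := h.mul hφ1 (Complex.continuous_ofReal.comp hd)
  obtain ⟨a, b, hab, hsub⟩ : ∃ a b, a ≤ b ∧ tsupport φ ⊆ Ioo a b := by
    obtain ⟨R, hR, hR'⟩ := hc.isCompact.isBounded.subset_ball_lt 0 0
    refine ⟨-R, R, by linarith, hR'.trans ?_⟩
    rw [Real.ball_eq_Ioo]; simp
  have h0 : ∀ x, x ∉ tsupport φ → φ x = 0 := fun x hx => image_eq_zero_of_notMem_tsupport hx
  have h0' : ∀ x, x ∉ tsupport φ → deriv φ x = 0 := fun x hx => by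
    have := support_deriv_subset (f := φ)
    by_contra hne
    exact hx (this hne)
  have e1 : ∀ F : ℝ → ℂ, (∀ x, x ∉ tsupport φ → F x = 0) → ∫ x in Ω, F x = ∫ x in a..b, F x := by
    intro F hF
    have e2 : ∫ x in Ω, F x = ∫ x, F x :=
      setIntegral_eq_integral_of_forall_compl_eq_zero fun x hx => hF x fun hx' => hx (hs hx')
    have e3 : ∫ x in Ioc a b, F x = ∫ x, F x :=
      setIntegral_eq_integral_of_forall_compl_eq_zero fun x hx => hF x fun hx' =>
        hx (Ioo_subset_Ioc_self (hsub hx'))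
    rw [intervalIntegral.integral_of_le hab, e2, e3]
  rw [e1 _ fun x hx => by rw [h0' x hx]; simp, e1 _ fun x hx => by rw [h0 x hx]; simp]
  have h2 : ∫ x in a..b, (g x * (φ x : ℂ) + f x * ((deriv φ x : ℝ) : ℂ)) =
      f b * (φ b : ℂ) - f a * (φ a : ℂ) := hm.2 a b
  rw [h0 b fun hb => lt_irrefl _ (hsub hb).2, h0 a fun ha => lt_irrefl _ (hsub ha).1,
    Complex.ofReal_zero, mul_zero, mul_zero, sub_zero,
    intervalIntegral.integral_add] at h2
  · rw [eq_neg_iff_add_eq_zero, ← h2, add_comm]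
    congr 1 <;> (congr 1; ext x; simp [mul_comm])
  · exact (h.1 a b).mul_continuousOn (Complex.continuous_ofReal.comp hφ.continuous).continuousOn
  · exact (h.continuous.mul (Complex.continuous_ofReal.comp hd)).intervalIntegrable _ _

theorem IsPrimitive.comp_mul {f g : ℝ → ℂ} (h : IsPrimitive f g) {a : ℝ} (ha : a ≠ 0) :
    IsPrimitive (fun x => f (a * x)) fun x => a * g (a * x) := by
  refine ⟨fun s t => ?_, fun s t => ?_⟩
  · have := (h.1 (a * s) (a * t)).comp_mul_left (c := a)
    rw [mul_div_cancel_left₀ _ ha, mul_div_cancel_left₀ _ ha] at this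
    exact this.const_mul _
  · rw [intervalIntegral.integral_const_mul, intervalIntegral.integral_comp_mul_left _ ha, h.2,
      Complex.real_smul, Complex.ofReal_inv, mul_inv_cancel_left₀ (by exact_mod_cast ha)]

theorem IsKernel.isPrimitive1 {N : ℝ} {φ φ₁ φ₂ : ℝ → ℂ} (h : IsKernel N φ φ₁ φ₂) :
    IsPrimitive φ₁ φ₂ :=
  ⟨fun _ _ => ((h.mem2.locallyIntegrable (by norm_num)).integrableOn_isCompact
    isCompact_uIcc).intervalIntegrable, h.ftc⟩

/-! ### The potential and its two derivatives -/

/-- At c = 2x this is the right-hand side of the first reconstruction formula. -/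
noncomputable def wv (φ φ₁ : ℝ → ℂ) (c : ℝ) : ℂ := -4 * Complex.I * bval φ φ₁ c

noncomputable def wv' (φ φ₁ : ℝ → ℂ) (c : ℝ) : ℂ := -4 * Complex.I * bval' φ φ₁ c

/-- The cubic term `|w|² w`. -/
noncomputable def cub (φ φ₁ : ℝ → ℂ) (c : ℝ) : ℂ := wv φ φ₁ c * wv φ φ₁ c * conj (wv φ φ₁ c)

noncomputable def cub' (φ φ₁ : ℝ → ℂ) (c : ℝ) : ℂ :=
  2 * wv φ φ₁ c * wv' φ φ₁ c * conj (wv φ φ₁ c) + wv φ φ₁ c * wv φ φ₁ c * conj (wv' φ φ₁ c)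

noncomputable def massC (φ φ₁ : ℝ → ℂ) (c : ℝ) : ℝ := ∫ t in Ioi c, ‖wv φ φ₁ t‖ ^ 2

/-- The factor 1/2 is the Jacobian of c = 2x: the mass of u beyond x is half the mass of w beyond
2x. -/
noncomputable def phase (φ φ₁ : ℝ → ℂ) (c : ℝ) : ℂ :=
  Complex.exp (Complex.I * (massC φ φ₁ c / 2 : ℝ))

noncomputable def phase' (φ φ₁ : ℝ → ℂ) (c : ℝ) : ℂ :=
  -(Complex.I / 2) * (wv φ φ₁ c * conj (wv φ φ₁ c)) * phase φ φ₁ c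

noncomputable def pot (φ φ₁ : ℝ → ℂ) (c : ℝ) : ℂ := wv φ φ₁ c * phase φ φ₁ c

/-- Differentiating the phase adds −(i/2)|w|²w to w′. The sum is arranged as the term with φ₁,
controlled in weighted L², plus terms with pointwise decay. -/
noncomputable def amp (φ φ₁ : ℝ → ℂ) (c : ℝ) : ℂ :=
  -4 * Complex.I * conj (φ₁ c) + (-4 * Complex.I * remB' φ φ₁ c + -(Complex.I / 2) * cub φ φ₁ c)

noncomputable def amp' (φ φ₁ φ₂ : ℝ → ℂ) (c : ℝ) : ℂ :=
  -4 * Complex.I * conj (φ₂ c) +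
    (-4 * Complex.I * remB'' φ φ₁ φ₂ c + -(Complex.I / 2) * cub' φ φ₁ c)

noncomputable def pot' (φ φ₁ : ℝ → ℂ) (c : ℝ) : ℂ := amp φ φ₁ c * phase φ φ₁ c

noncomputable def pot'' (φ φ₁ φ₂ : ℝ → ℂ) (c : ℝ) : ℂ :=
  amp' φ φ₁ φ₂ c * phase φ φ₁ c + amp φ φ₁ c * phase' φ φ₁ c

section
variable {N : ℝ} {φ φ₁ φ₂ : ℝ → ℂ}

theorem continuous_of_hasDerivAt {E : Type*} [NormedAddCommGroup E] [NormedSpace ℝ E] {f f' : ℝ → E}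
    (h : ∀ t, HasDerivAt f (f' t) t) : Continuous f :=
  continuous_iff_continuousAt.2 fun t => (h t).continuousAt

theorem IsKernel.continuous_bval (h : IsKernel N φ φ₁ φ₂) : Continuous (bval φ φ₁) :=
  continuous_of_hasDerivAt h.hasDerivAt_bval

theorem IsKernel.continuous_remB (h : IsKernel N φ φ₁ φ₂) : Continuous (remB φ φ₁) :=
  continuous_of_hasDerivAt h.hasDerivAt_remB

theorem IsKernel.continuous_remB' (h : IsKernel N φ φ₁ φ₂) : Continuous (remB' φ φ₁) :=
  continuous_of_hasDerivAt h.hasDerivAt_remB'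

theorem IsKernel.continuous_bval' (h : IsKernel N φ φ₁ φ₂) : Continuous (bval' φ φ₁) :=
  (Complex.continuous_conj.comp h.cont).add h.continuous_remB'

theorem IsKernel.continuous_solA (h : IsKernel N φ φ₁ φ₂) : Continuous (solA φ φ₁) :=
  continuous_of_hasDerivAt h.hasDerivAt_solA

theorem IsKernel.continuous_solY (h : IsKernel N φ φ₁ φ₂) : Continuous (solY φ φ₁) :=
  continuous_of_hasDerivAt h.hasDerivAt_solY

theorem IsKernel.continuous_derY (h : IsKernel N φ φ₁ φ₂) : Continuous (derY φ φ₁ φ₂) := by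
  have h1 : Continuous (resK φ φ₁) := continuous_of_hasDerivAt h.hasDerivAt_resK
  have h2 := h.continuous_solY
  have h3 : Continuous fun c => resK φ φ₁ c (tr φ₂ c) := h1.clm_apply (continuous_tr φ₂)
  have h4 : Continuous fun c => inner ℂ (tr φ c) (solY φ φ₁ c) := (continuous_tr φ).inner h2
  exact (h3.const_smul (-4 * Complex.I)).add (h4.smul h2)

theorem IsKernel.continuous_remB'' (h : IsKernel N φ φ₁ φ₂) : Continuous (remB'' φ φ₁ φ₂) := by
  have hb := h.continuous_bval
  have hb' := h.continuous_bval'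
  have h1 : Continuous fun c => inner ℂ (tr φ₂ c) (solA φ φ₁ c) :=
    (continuous_tr φ₂).inner h.continuous_solA
  have h2 : Continuous fun c => inner ℂ (tr φ₁ c) (solY φ φ₁ c) :=
    (continuous_tr φ₁).inner h.continuous_solY
  have h3 : Continuous fun c => inner ℂ (tr φ c) (solY φ φ₁ c) :=
    (continuous_tr φ).inner h.continuous_solY
  have h4 : Continuous fun c => inner ℂ (tr φ c) (derY φ φ₁ φ₂ c) :=
    (continuous_tr φ).inner h.continuous_derY
  exact ((h1.add ((continuous_const.mul hb).mul h2)).add (hb'.mul h3)).add (hb.mul h4)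

theorem IsKernel.hasDerivAt_wv (h : IsKernel N φ φ₁ φ₂) (c : ℝ) :
    HasDerivAt (wv φ φ₁) (wv' φ φ₁ c) c := (h.hasDerivAt_bval c).const_mul _

theorem IsKernel.continuous_wv (h : IsKernel N φ φ₁ φ₂) : Continuous (wv φ φ₁) :=
  continuous_of_hasDerivAt h.hasDerivAt_wv

theorem IsKernel.continuous_wv' (h : IsKernel N φ φ₁ φ₂) : Continuous (wv' φ φ₁) :=
  continuous_const.mul h.continuous_bval'

theorem hasDerivAt_conj {f : ℝ → ℂ} {f' : ℂ} {c : ℝ} (h : HasDerivAt f f' c) :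
    HasDerivAt (fun x => conj (f x)) (conj f') c :=
  (Complex.conjLIE.toContinuousLinearEquiv.toContinuousLinearMap.restrictScalars
    ℝ).hasFDerivAt.comp_hasDerivAt c h

theorem IsKernel.hasDerivAt_cub (h : IsKernel N φ φ₁ φ₂) (c : ℝ) :
    HasDerivAt (cub φ φ₁) (cub' φ φ₁ c) c := by
  have h1 := h.hasDerivAt_wv c
  refine ((h1.mul h1).mul (hasDerivAt_conj h1)).congr_deriv ?_
  simp only [Pi.mul_apply, cub']
  ring

theorem IsKernel.continuous_cub' (h : IsKernel N φ φ₁ φ₂) : Continuous (cub' φ φ₁) := by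
  have h1 := h.continuous_wv
  have h2 := h.continuous_wv'
  have h3 := Complex.continuous_conj.comp h1
  have h4 := Complex.continuous_conj.comp h2
  exact (((continuous_const.mul h1).mul h2).mul h3).add ((h1.mul h1).mul h4)

end

section
variable {N : ℝ}

theorem bd_wv (hN : 0 ≤ N) : Bd 1 fun (κ : Ker N) c => wv κ.φ κ.φ₁ c := (bd_bval hN).const_mul _

theorem bd_wv' (hN : 0 ≤ N) : Bd 0 fun (κ : Ker N) c => wv' κ.φ κ.φ₁ c := (bd_bval' hN).const_mul _

theorem bd_cub (hN : 0 ≤ N) : Bd 3 fun (κ : Ker N) c => cub κ.φ κ.φ₁ c :=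
  ((bd_wv hN).mul (bd_wv hN)).mul (bd_wv hN).conj

theorem bd_cub' (hN : 0 ≤ N) : Bd 2 fun (κ : Ker N) c => cub' κ.φ κ.φ₁ c :=
  ((((bd_wv hN).const_mul 2).mul (bd_wv' hN)).mul (bd_wv hN).conj).add
    (((bd_wv hN).mul (bd_wv hN)).mul (bd_wv' hN).conj)

theorem Bd.re {k : ℕ} {X : Ker N → ℝ → ℂ} (hX : Bd k X) : Bd k fun κ c => (X κ c).re := by
  obtain ⟨M, hM, h1, h2⟩ := hX
  refine ⟨M, hM, fun κ c hc => (Complex.abs_re_le_norm _).trans (h1 κ c hc),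
    fun κ κ' δ h c hc => ?_⟩
  rw [← Complex.sub_re]
  exact (Complex.abs_re_le_norm _).trans (h2 κ κ' δ h c hc)

theorem bd_norm_sq_wv (hN : 0 ≤ N) : Bd 2 fun (κ : Ker N) c => ‖wv κ.φ κ.φ₁ c‖ ^ 2 :=
  ((bd_wv hN).mul (bd_wv hN).conj).re.congr fun κ c => by
    rw [Complex.mul_conj, Complex.ofReal_re, Complex.normSq_eq_norm_sq]

theorem Ker.continuous_norm_sq_wv (κ : Ker N) : Continuous fun c => ‖wv κ.φ κ.φ₁ c‖ ^ 2 :=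
  κ.isKernel.continuous_wv.norm.pow 2

theorem bd_massC (hN : 0 ≤ N) : Bd 1 fun (κ : Ker N) c => massC κ.φ κ.φ₁ c :=
  (bd_norm_sq_wv hN).integral Ker.continuous_norm_sq_wv

theorem Ker.integrableOn_norm_sq_wv (κ : Ker N) (c : ℝ) :
    IntegrableOn (fun t => ‖wv κ.φ κ.φ₁ t‖ ^ 2) (Ioi c) :=
  (bd_norm_sq_wv κ.isKernel.nonneg).integrableOn Ker.continuous_norm_sq_wv κ c

theorem Ker.hasDerivAt_phase (κ : Ker N) (c : ℝ) :
    HasDerivAt (phase κ.φ κ.φ₁) (phase' κ.φ κ.φ₁ c) c := by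
  have h1 := hasDerivAt_integral_Ioi κ.continuous_norm_sq_wv (κ.integrableOn_norm_sq_wv 0) c
  have h2 := ((h1.div_const 2).ofReal_comp.const_mul Complex.I).cexp
  refine h2.congr_deriv ?_
  rw [phase', phase, Complex.mul_conj, Complex.normSq_eq_norm_sq, massC]
  push_cast; ring

theorem Ker.continuous_phase (κ : Ker N) : Continuous (phase κ.φ κ.φ₁) :=
  continuous_of_hasDerivAt κ.hasDerivAt_phase

theorem Ker.continuous_phase' (κ : Ker N) : Continuous (phase' κ.φ κ.φ₁) := by
  have h1 := κ.isKernel.continuous_wv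
  exact (continuous_const.mul (h1.mul (Complex.continuous_conj.comp h1))).mul κ.continuous_phase

theorem norm_phase (φ φ₁ : ℝ → ℂ) (c : ℝ) : ‖phase φ φ₁ c‖ = 1 := by
  rw [phase, mul_comm, Complex.norm_exp_ofReal_mul_I]

theorem bd_phase (hN : 0 ≤ N) : Bd 0 fun (κ : Ker N) c => phase κ.φ κ.φ₁ c := by
  obtain ⟨M, hM, -, h2⟩ := (bd_massC hN).mono (Nat.zero_le 1)
  refine ⟨M + 1, by positivity, fun κ c hc => ?_, fun κ κ' δ h c hc => ?_⟩
  · rw [norm_phase]; simpa using hM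
  · have hδ := h.nonneg
    have h3 := h2 κ κ' δ h c hc
    rw [pow_zero, div_one] at h3 ⊢
    set a := massC κ.φ κ.φ₁ c with ha
    set b := massC κ'.φ κ'.φ₁ c with hb
    have e : phase κ.φ κ.φ₁ c - phase κ'.φ κ'.φ₁ c = phase κ'.φ κ'.φ₁ c *
        (Complex.exp (Complex.I * ((a - b) / 2 : ℝ)) - 1) := by
      rw [mul_sub, mul_one, phase, phase, ← Complex.exp_add, ← ha, ← hb]
      congr 2; push_cast; ring
    rw [e, norm_mul, norm_phase, one_mul]
    refine Real.norm_exp_I_mul_ofReal_sub_one_le.trans ?_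
    rw [norm_div, Real.norm_ofNat]
    linarith [norm_nonneg (a - b)]

theorem Ker.hasDerivAt_pot (κ : Ker N) (c : ℝ) :
    HasDerivAt (pot κ.φ κ.φ₁) (pot' κ.φ κ.φ₁ c) c := by
  refine ((κ.isKernel.hasDerivAt_wv c).mul (κ.hasDerivAt_phase c)).congr_deriv ?_
  rw [pot', amp, phase', wv', bval', cub]
  ring

theorem Ker.continuous_amp (κ : Ker N) : Continuous (amp κ.φ κ.φ₁) :=
  (continuous_const.mul (Complex.continuous_conj.comp κ.isKernel.cont)).add
    ((continuous_const.mul κ.isKernel.continuous_remB').add (continuous_const.mul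
      (continuous_of_hasDerivAt κ.isKernel.hasDerivAt_cub)))

theorem Ker.continuous_pot' (κ : Ker N) : Continuous (pot' κ.φ κ.φ₁) :=
  κ.continuous_amp.mul κ.continuous_phase

theorem Ker.isPrimitive_pot (κ : Ker N) : IsPrimitive (pot κ.φ κ.φ₁) (pot' κ.φ κ.φ₁) :=
  IsPrimitive.of_hasDerivAt κ.hasDerivAt_pot κ.continuous_pot'

theorem Ker.isPrimitive_amp (κ : Ker N) : IsPrimitive (amp κ.φ κ.φ₁) (amp' κ.φ κ.φ₁ κ.φ₂) :=
  (κ.isKernel.isPrimitive1.conj.const_mul _).add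
    (((IsPrimitive.of_hasDerivAt κ.isKernel.hasDerivAt_remB'
      κ.isKernel.continuous_remB'').const_mul _).add
    ((IsPrimitive.of_hasDerivAt κ.isKernel.hasDerivAt_cub
      κ.isKernel.continuous_cub').const_mul _))

theorem Ker.isPrimitive_pot' (κ : Ker N) :
    IsPrimitive (pot' κ.φ κ.φ₁) (pot'' κ.φ κ.φ₁ κ.φ₂) :=
  κ.isPrimitive_amp.mul κ.hasDerivAt_phase κ.continuous_phase'

theorem l2Bd_pot (hN : 0 ≤ N) : L2Bd 1 fun (κ : Ker N) c => pot κ.φ κ.φ₁ c :=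
  (((l2Bd_conj_φ hN).add ((bd_remB hN).l2Bd (fun κ => κ.isKernel.continuous_remB)
    le_rfl)).const_mul (-4 * Complex.I)).mul (bd_phase hN) fun κ => κ.continuous_phase

theorem l2Bd_amp (hN : 0 ≤ N) : L2Bd 1 fun (κ : Ker N) c => amp κ.φ κ.φ₁ c :=
  ((l2Bd_conj_φ₁ hN).const_mul _).add
    ((((bd_remB' hN).l2Bd (fun κ => κ.isKernel.continuous_remB') le_rfl).const_mul _).add
    (((bd_cub hN).l2Bd (fun κ => continuous_of_hasDerivAt κ.isKernel.hasDerivAt_cub)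
      (by norm_num)).const_mul _))

theorem l2Bd_amp' (hN : 0 ≤ N) : L2Bd 0 fun (κ : Ker N) c => amp' κ.φ κ.φ₁ κ.φ₂ c :=
  ((l2Bd_conj_φ₂ hN).const_mul _).add
    ((((bd_remB'' hN).l2Bd (fun κ => κ.isKernel.continuous_remB'') le_rfl).const_mul _).add
    (((bd_cub' hN).l2Bd (fun κ => κ.isKernel.continuous_cub') (by norm_num)).const_mul _))

theorem l2Bd_pot' (hN : 0 ≤ N) : L2Bd 1 fun (κ : Ker N) c => pot' κ.φ κ.φ₁ c :=
  (l2Bd_amp hN).mul (bd_phase hN) fun κ => κ.continuous_phase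

theorem bd_phase' (hN : 0 ≤ N) : Bd 0 fun (κ : Ker N) c => phase' κ.φ κ.φ₁ c :=
  ((((bd_wv hN).mul (bd_wv hN).conj).const_mul (-(Complex.I / 2))).mul (bd_phase hN)).mono
    (Nat.zero_le _)

theorem l2Bd_pot'' (hN : 0 ≤ N) : L2Bd 0 fun (κ : Ker N) c => pot'' κ.φ κ.φ₁ κ.φ₂ c :=
  ((l2Bd_amp' hN).mul (bd_phase hN) fun κ => κ.continuous_phase).add
    ((l2Bd_amp hN).zero_of_one.mul (bd_phase' hN) fun κ => κ.continuous_phase')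

end

/-! ### Norm estimates for the potential -/

theorem eLpNorm_weighted_comp_two_mul_le (m : ℕ) {f : ℝ → ℂ}
    (hf : AEStronglyMeasurable f (volume.restrict (Ioi 0))) :
    eLpNorm (weighted m fun x => f (2 * x)) 2 (volume.restrict (Ioi 0)) ≤
      eLpNorm (weighted m f) 2 (volume.restrict (Ioi 0)) := by
  have hmap : Measure.map (fun x : ℝ => 2 * x) (volume.restrict (Ioi 0)) =
      ENNReal.ofReal (1 / 2) • volume.restrict (Ioi 0) := by
    have h1 := Real.map_volume_mul_left (a := 2) two_ne_zero
    have h2 : Measure.map (fun x : ℝ => 2 * x) (volume.restrict (Ioi 0)) =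
        (Measure.map (fun x : ℝ => 2 * x) volume).restrict (Ioi 0) := by
      rw [Measure.restrict_map (by fun_prop) measurableSet_Ioi]
      congr 2; ext x; simp
    rw [h2, h1, Measure.restrict_smul]
    norm_num
  calc _ ≤ eLpNorm (fun x => weighted m f (2 * x)) 2 (volume.restrict (Ioi 0)) := by
        refine eLpNorm_mono fun x => ?_
        rw [norm_weighted, norm_weighted]
        have : √(1 + x ^ 2) ≤ √(1 + (2 * x) ^ 2) := Real.sqrt_le_sqrt (by nlinarith [sq_nonneg x])
        gcongr
    _ = eLpNorm (weighted m f) 2 (ENNReal.ofReal (1 / 2) • volume.restrict (Ioi 0)) := by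
        rw [← hmap, eLpNorm_map_measure _ (by fun_prop)]
        · rfl
        · rw [hmap]
          exact (aestronglyMeasurable_weighted hf).smul_measure _
    _ ≤ eLpNorm (weighted m f) 2 (volume.restrict (Ioi 0)) := by
        refine eLpNorm_mono_measure _ ?_
        intro s
        simp only [Measure.smul_apply, smul_eq_mul]
        exact mul_le_of_le_one_left zero_le (by simp)

theorem locallyIntegrableOn_congr_ae {Ω : Set ℝ} {f f' : ℝ → ℂ}
    (h : LocallyIntegrableOn f Ω) (e : f =ᵐ[volume.restrict Ω] f') : LocallyIntegrableOn f' Ω := by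
  intro x hx
  obtain ⟨s, hs, hi⟩ := h x hx
  refine ⟨s ∩ Ω, inter_mem hs self_mem_nhdsWithin, ?_⟩
  exact (hi.mono_set inter_subset_left).congr (ae_restrict_of_ae_restrict_of_subset
    inter_subset_right e)

theorem IsWeakDeriv.congr_left {Ω : Set ℝ} {f f' g : ℝ → ℂ}
    (h : IsWeakDeriv Ω f g) (e : f =ᵐ[volume.restrict Ω] f') : IsWeakDeriv Ω f' g := by
  refine ⟨locallyIntegrableOn_congr_ae h.1 e, h.2.1, fun φ h1 h2 h3 => ?_⟩
  rw [← h.2.2 φ h1 h2 h3]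
  refine integral_congr_ae ?_
  filter_upwards [e] with x hx
  rw [hx]

theorem weighted_congr_ae {μ : Measure ℝ} {f g : ℝ → ℂ} (m : ℕ) (h : f =ᵐ[μ] g) :
    weighted m f =ᵐ[μ] weighted m g := by
  filter_upwards [h] with x hx
  simp only [weighted, hx]

theorem IsPrimitive.aestronglyMeasurable {f g : ℝ → ℂ} (h : IsPrimitive f g) :
    AEStronglyMeasurable g := by
  have hgl : LocallyIntegrable g := fun x => by
    refine ⟨Icc (x - 1) (x + 1), Icc_mem_nhds (by linarith) (by linarith), ?_⟩
    exact (intervalIntegrable_iff_integrableOn_Icc_of_le (by linarith)).1 (h.1 _ _)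
  exact hgl.aestronglyMeasurable

theorem eLpNorm_weighted_zero_le (f : ℝ → ℂ) (μ : Measure ℝ) :
    eLpNorm (weighted 0 f) 2 μ ≤ eLpNorm (weighted 1 f) 2 μ := eLpNorm_mono fun x => by
  rw [norm_weighted, norm_weighted]
  gcongr
  · exact one_le_bracket x
  · norm_num

/-- The function `weakDeriv` is an arbitrary choice, so it is first identified almost everywhere
with the given primitives; only values of f on the half-line enter. -/
theorem memPot_of_isPrimitive {f f₀ f₁ f₂ : ℝ → ℂ} (hf : EqOn f f₀ (Ioi 0))
    (h1 : IsPrimitive f₀ f₁) (h2 : IsPrimitive f₁ f₂) {B : ℝ} (hB : 0 ≤ B)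
    (b0 : eLpNorm (weighted 1 f₀) 2 (volume.restrict (Ioi 0)) ≤ ENNReal.ofReal B)
    (b1 : eLpNorm (weighted 1 f₁) 2 (volume.restrict (Ioi 0)) ≤ ENNReal.ofReal B)
    (b2 : eLpNorm (weighted 0 f₂) 2 (volume.restrict (Ioi 0)) ≤ ENNReal.ofReal B) :
    MemPot f ∧ normPot f ≤ 4 * B := by
  have e0 : f₀ =ᵐ[volume.restrict (Ioi 0)] f := by
    filter_upwards [ae_restrict_mem measurableSet_Ioi] with x hx
    exact (hf hx).symm
  have w0 : IsWeakDeriv (Ioi 0) f f₁ := h1.isWeakDeriv.congr_left e0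
  have e1 : weakDeriv (Ioi 0) f =ᵐ[volume.restrict (Ioi 0)] f₁ := w0.weakDeriv_ae_eq isOpen_Ioi
  have w1 : IsWeakDeriv (Ioi 0) (weakDeriv (Ioi 0) f) f₂ :=
    h2.isWeakDeriv.congr_left e1.symm
  have e2 := w1.weakDeriv_ae_eq isOpen_Ioi
  have key : ∀ {g g' : ℝ → ℂ} (m : ℕ), g =ᵐ[volume.restrict (Ioi 0)] g' →
      AEStronglyMeasurable g' (volume.restrict (Ioi 0)) →
      eLpNorm (weighted m g') 2 (volume.restrict (Ioi 0)) ≤ ENNReal.ofReal B →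
      MemL2 (Ioi 0) m g ∧ normL2 (Ioi 0) m g ^ 2 ≤ B ^ 2 := by
    intro g g' m e hm hb
    have hw := weighted_congr_ae m e
    have hl : MemLp (weighted m g') 2 (volume.restrict (Ioi 0)) :=
      ⟨aestronglyMeasurable_weighted hm, hb.trans_lt ENNReal.ofReal_lt_top⟩
    refine ⟨(memLp_congr_ae hw).2 hl, ?_⟩
    rw [normL2, eLpNorm_congr_ae hw]
    exact pow_le_pow_left₀ ENNReal.toReal_nonneg (ENNReal.toReal_le_of_le_ofReal hB hb) 2
  have hc0 := h1.continuous.aestronglyMeasurable (μ := volume.restrict (Ioi (0 : ℝ)))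
  have hc1 := h2.continuous.aestronglyMeasurable (μ := volume.restrict (Ioi (0 : ℝ)))
  obtain ⟨m00, n00⟩ := key 0 e0.symm hc0 ((eLpNorm_weighted_zero_le _ _).trans b0)
  obtain ⟨m01, n01⟩ := key 1 e0.symm hc0 b0
  obtain ⟨m10, n10⟩ := key 0 e1 hc1 ((eLpNorm_weighted_zero_le _ _).trans b1)
  obtain ⟨m11, n11⟩ := key 1 e1 hc1 b1
  obtain ⟨m20, n20⟩ := key 0 e2 h2.aestronglyMeasurable.restrict b2
  refine ⟨⟨⟨m00, ⟨_, w0⟩, m10, ⟨_, w1⟩, m20⟩, ⟨m01, ⟨_, w0⟩, m11⟩⟩, ?_⟩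
  -- At most three squares, each at most B², stand under the root, so each of the two norms is at
  -- most 2B and their sum at most 4B.
  have s1 : normH (Ioi 0) 2 0 f ≤ 2 * B := by
    refine Real.sqrt_le_iff.2 ⟨by positivity, ?_⟩
    simp only [sqNormH]
    nlinarith
  have s2 : normH (Ioi 0) 1 1 f ≤ 2 * B := by
    refine Real.sqrt_le_iff.2 ⟨by positivity, ?_⟩
    simp only [sqNormH]
    nlinarith
  rw [normPot]; linarith

theorem IsPrimitive.sub {f g f' g' : ℝ → ℂ} (h : IsPrimitive f g) (h' : IsPrimitive f' g') :
    IsPrimitive (fun x => f x - f' x) fun x => g x - g' x :=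
  ⟨fun s t => (h.1 s t).sub (h'.1 s t), fun s t => by
    rw [intervalIntegral.integral_sub (h.1 s t) (h'.1 s t), h.2, h'.2]; ring⟩

/-- The potential on the half-line attached to a kernel. -/
noncomputable def potU (φ φ₁ : ℝ → ℂ) (x : ℝ) : ℂ := pot φ φ₁ (2 * x)

theorem eLpNorm_weighted_const_mul_le (m : ℕ) {f : ℝ → ℂ} (a : ℂ) {b M : ℝ} (hb : 0 ≤ b)
    (ha : ‖a‖ ≤ b) (hf : eLpNorm (weighted m f) 2 (volume.restrict (Ioi 0)) ≤ ENNReal.ofReal M) :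
    eLpNorm (weighted m fun x => a * f x) 2 (volume.restrict (Ioi 0)) ≤ ENNReal.ofReal (b * M) := by
  have := eLpNorm_weighted_mul_le (g := fun _ => a) hf hb fun x _ => ha
  simpa only [mul_comm a] using this

theorem exists_normPot_potU_sub_le {N : ℝ} (hN : 0 ≤ N) : ∃ C, 0 ≤ C ∧ ∀ (κ κ' : Ker N) (δ : ℝ),
    Ker.Close κ κ' δ → ∀ f : ℝ → ℂ, EqOn f (fun x => potU κ.φ κ.φ₁ x - potU κ'.φ κ'.φ₁ x) (Ioi 0) →
      MemPot f ∧ normPot f ≤ C * δ := by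
  obtain ⟨M0, hM0, m0, -, l0⟩ := l2Bd_pot hN
  obtain ⟨M1, hM1, m1, -, l1⟩ := l2Bd_pot' hN
  obtain ⟨M2, hM2, m2, -, l2⟩ := l2Bd_pot'' hN
  -- The powers of 2 come from differentiating x ↦ pot(2x), the leading 4 from
  -- `memPot_of_isPrimitive`.
  refine ⟨4 * (M0 + 2 * M1 + 4 * M2), by positivity, fun κ κ' δ h f hf => ?_⟩
  have hδ := h.nonneg
  have p0 := (κ.isPrimitive_pot.sub κ'.isPrimitive_pot).comp_mul two_ne_zero
  have p1 := ((κ.isPrimitive_pot'.sub κ'.isPrimitive_pot').comp_mul two_ne_zero).const_mul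
    ((2 : ℝ) : ℂ)
  have := memPot_of_isPrimitive hf p0 p1 (B := (M0 + 2 * M1 + 4 * M2) * δ) (by positivity)
    ?_ ?_ ?_
  · refine ⟨this.1, this.2.trans (by linarith)⟩
  · refine (eLpNorm_weighted_comp_two_mul_le 1 ((m0 κ).sub (m0 κ'))).trans ((l0 κ κ' δ h).trans ?_)
    exact ENNReal.ofReal_le_ofReal (by nlinarith [mul_nonneg hM1 hδ, mul_nonneg hM2 hδ])
  · refine (eLpNorm_weighted_const_mul_le 1 _ zero_le_two (by simp)
      ((eLpNorm_weighted_comp_two_mul_le 1 ((m1 κ).sub (m1 κ'))).trans (l1 κ κ' δ h))).trans ?_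
    exact ENNReal.ofReal_le_ofReal (by nlinarith [mul_nonneg hM0 hδ, mul_nonneg hM2 hδ])
  · refine (eLpNorm_weighted_const_mul_le 0 _ zero_le_two (by simp)
      (eLpNorm_weighted_const_mul_le 0 _ zero_le_two (by simp)
      ((eLpNorm_weighted_comp_two_mul_le 0 ((m2 κ).sub (m2 κ'))).trans (l2 κ κ' δ h)))).trans ?_
    exact ENNReal.ofReal_le_ofReal (by nlinarith [mul_nonneg hM0 hδ, mul_nonneg hM1 hδ])

theorem isKernel_zero {N : ℝ} (hN : 0 ≤ N) : IsKernel N (fun _ => 0) (fun _ => 0) fun _ => 0 where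
  nonneg := hN
  hasDeriv t := hasDerivAt_const t 0
  cont := continuous_const
  ftc s t := by simp
  mem0 := MemLp.zero
  mem0' := by simp
  mem1 := MemLp.zero
  mem1' := by simp
  mem2 := MemLp.zero
  le0 := by simp
  le0' := by simp
  le1 := by simp
  le1' := by simp
  le2 := by simp

theorem potU_zero (x : ℝ) : potU (fun _ => 0) (fun _ => 0) x = 0 := by
  have h : tr (fun _ => 0) (2 * x) = 0 := by
    have := tr_sub (MemLp.zero (p := 2) (ε := ℂ) (μ := (volume : Measure ℝ))) MemLp.zero (2 * x)
    simpa using this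
  rw [potU, pot, wv, bval, remB, h]
  simp

/-- Comparison with the zero kernel, whose potential is 0. The bound N fixes the constant, while the
actual size δ of the kernel makes the estimate linear in the data. -/
theorem exists_normPot_potU_le {N : ℝ} (hN : 0 ≤ N) : ∃ C, 0 ≤ C ∧ ∀ (κ : Ker N) (δ : ℝ),
    IsKernel δ κ.φ κ.φ₁ κ.φ₂ → ∀ f : ℝ → ℂ, EqOn f (potU κ.φ κ.φ₁) (Ioi 0) →
      MemPot f ∧ normPot f ≤ C * δ := by
  obtain ⟨C, hC, H⟩ := exists_normPot_potU_sub_le hN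
  refine ⟨C, hC, fun κ δ h f hf => H κ ⟨_, _, _, isKernel_zero hN⟩ δ ?_ f fun x hx => ?_⟩
  · simpa [Ker.Close] using h
  · simp only [hf hx, potU_zero, sub_zero]

/-! ### From the L² equation to integrable rows -/

/-- The restriction of a function to the positive half-line, extended by zero. -/
noncomputable def pos (f : ℝ → ℂ) : ℝ → ℂ := (Ioi (0 : ℝ)).indicator f

theorem pos_of_pos {f : ℝ → ℂ} {s : ℝ} (hs : 0 < s) : pos f s = f s := indicator_of_mem hs f

theorem pos_of_nonpos {f : ℝ → ℂ} {s : ℝ} (hs : s ≤ 0) : pos f s = 0 :=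
  indicator_of_notMem (s := Ioi (0 : ℝ)) (not_lt.2 hs) f

theorem integrable_pos {f : ℝ → ℂ} (hf : IntegrableOn f (Ioi 0)) : Integrable (pos f) :=
  hf.integrable_indicator measurableSet_Ioi

theorem integral_pos_mul (f g : ℝ → ℂ) : ∫ s, pos f s * g s = ∫ s in Ioi (0 : ℝ), f s * g s := by
  rw [← integral_indicator measurableSet_Ioi]
  congr 1; ext s
  rcases lt_or_ge 0 s with hs | hs
  · rw [pos_of_pos hs, indicator_of_mem (mem_Ioi.2 hs)]
  · rw [pos_of_nonpos hs, indicator_of_notMem (by simpa using hs), zero_mul]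

theorem integrableOn_rpow_one_add {a : ℝ} (ha : a < -1) :
    IntegrableOn (fun t : ℝ => (1 + t) ^ a) (Ioi 0) := by
  refine (integrableOn_comp_add_left_Ioi (fun t : ℝ => t ^ a) 1 0).2 ?_
  rw [add_zero]
  exact integrableOn_Ioi_rpow_of_lt ha one_pos

/-- A quarter power of weight can be spared: (1 + s)^{1/4} f is the product of (1 + s)^{−3/4} and (1
+ s) f, both square integrable on the half-line. -/
theorem integrable_pos_rpow_mul {f : ℝ → ℂ} (hf : MemLp f 2)
    (hf' : MemLp (fun s : ℝ => (s : ℂ) * f s) 2) :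
    IntegrableOn (fun s : ℝ => (((1 + s) ^ (1 / 4 : ℝ) : ℝ) : ℂ) * f s) (Ioi 0) := by
  have h1 : MemLp (fun s : ℝ => (1 + (s : ℂ)) * f s) 2 (volume.restrict (Ioi 0)) := by
    refine MemLp.restrict _ ((hf.add hf').ae_eq (ae_of_all _ fun s => ?_))
    simp only [Pi.add_apply]; ring
  have hm : AEStronglyMeasurable (fun s : ℝ => (((1 + s) ^ (-(3 / 4) : ℝ) : ℝ) : ℂ))
      (volume.restrict (Ioi 0)) := by
    have : Measurable fun s : ℝ => (((1 + s) ^ (-(3 / 4) : ℝ) : ℝ) : ℂ) := by fun_prop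
    exact this.aestronglyMeasurable
  have h2 : MemLp (fun s : ℝ => (((1 + s) ^ (-(3 / 4) : ℝ) : ℝ) : ℂ)) 2
      (volume.restrict (Ioi 0)) := by
    rw [memLp_two_iff_integrable_sq_norm hm]
    refine integrableOn_rpow_three_half.congr_fun (fun s hs => ?_) measurableSet_Ioi
    have hs' : (0 : ℝ) < s := hs
    have h0 : 0 ≤ 1 + s := by positivity
    simp only [Complex.norm_real, Real.norm_eq_abs, sq_abs]
    rw [← Real.rpow_natCast, ← Real.rpow_mul h0]; norm_num
  refine Integrable.congr (memLp_mul_integrable h2 h1) ?_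
  filter_upwards [ae_restrict_mem measurableSet_Ioi] with s hs
  have hs' : (0 : ℝ) < 1 + s := by have : (0 : ℝ) < s := hs; positivity
  have e : (1 + s) ^ (1 / 4 : ℝ) = (1 + s) ^ (-(3 / 4) : ℝ) * (1 + s) := by
    rw [← Real.rpow_add_one hs'.ne']; norm_num
  rw [e]; push_cast; ring

/-- The decay 1/(1 + t) of B is not integrable. A quarter power is borrowed from f, as (1 + t)^{1/4}
≤ (1 + t + s)^{1/4}, and (1 + t)^{−5/4} is integrable. -/
theorem integrable_mul_shear_of_decay {B f : ℝ → ℂ} (hB : Continuous B) {C : ℝ}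
    (hBC : ∀ t, 0 < t → ‖B t‖ ≤ C / (1 + t)) (hf : MemLp f 2)
    (hf' : MemLp (fun s : ℝ => (s : ℂ) * f s) 2) :
    Integrable (fun p : ℝ × ℝ => pos B p.1 * f (p.1 + p.2))
      ((volume : Measure ℝ).prod (volume.restrict (Ioi 0))) := by
  have hF : Integrable (pos fun t : ℝ => ((C * (1 + t) ^ (-(5 / 4) : ℝ) : ℝ) : ℂ)) :=
    integrable_pos (((integrableOn_rpow_one_add (by norm_num)).const_mul C).ofReal)
  have hG := integrable_pos (integrable_pos_rpow_mul hf hf')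
  have hFG := (integrable_shear hF hG).restrict (s := univ ×ˢ Ioi (0 : ℝ))
  rw [← Measure.prod_restrict, Measure.restrict_univ] at hFG
  have hm : AEStronglyMeasurable (fun p : ℝ × ℝ => pos B p.1 * f (p.1 + p.2))
      ((volume : Measure ℝ).prod (volume.restrict (Ioi 0))) := by
    have h1 : AEStronglyMeasurable (pos B) volume :=
      hB.aestronglyMeasurable.indicator measurableSet_Ioi
    have h2 := aestronglyMeasurable_add hf.1 univ (Ioi 0)
    rw [Measure.restrict_univ] at h2
    exact h1.comp_fst.mul h2
  refine hFG.mono hm ?_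
  have hpos : ∀ᵐ p : ℝ × ℝ ∂((volume : Measure ℝ).prod (volume.restrict (Ioi (0 : ℝ)))), 0 < p.2 :=
    Measure.quasiMeasurePreserving_snd.ae (ae_restrict_mem measurableSet_Ioi)
  filter_upwards [hpos] with p hp
  rcases lt_or_ge 0 p.1 with h1 | h1
  · rw [pos_of_pos h1, pos_of_pos h1, pos_of_pos (add_pos h1 hp), norm_mul, norm_mul, norm_mul,
      Complex.norm_real, Complex.norm_real]
    have hC : 0 ≤ C := by
      have := (norm_nonneg _).trans (hBC _ h1)
      by_contra hc
      exact absurd this (not_le.2 (div_neg_of_neg_of_pos (not_le.1 hc) (by positivity)))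
    rw [Real.norm_of_nonneg (by positivity), Real.norm_of_nonneg (by positivity), ← mul_assoc]
    refine mul_le_mul_of_nonneg_right ((hBC _ h1).trans ?_) (norm_nonneg _)
    rw [mul_assoc, div_eq_mul_inv]
    refine mul_le_mul_of_nonneg_left ?_ hC
    have e : (1 + p.1)⁻¹ = (1 + p.1) ^ (-(5 / 4) : ℝ) * (1 + p.1) ^ (1 / 4 : ℝ) := by
      rw [← Real.rpow_add (by positivity), ← Real.rpow_neg_one]; norm_num
    rw [e]
    refine mul_le_mul_of_nonneg_left ?_ (by positivity)
    exact Real.rpow_le_rpow (by positivity) (by linarith) (by norm_num)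
  · rw [pos_of_nonpos h1, zero_mul, norm_zero]; positivity

/-- The Bochner integral in L² is identified with the pointwise integral by pairing both with
indicators of sets of finite measure. -/
theorem coeFn_integral_smul_tr {B f : ℝ → ℂ} (hf : MemLp f 2)
    (hBf : Integrable (fun p : ℝ × ℝ => pos B p.1 * f (p.1 + p.2))
      ((volume : Measure ℝ).prod (volume.restrict (Ioi 0))))
    (hi : IntegrableOn (fun t => B t • tr f t) (Ioi 0)) :
    ((∫ t in Ioi (0 : ℝ), B t • tr f t : HalfL2) : ℝ → ℂ)
      =ᵐ[volume.restrict (Ioi 0)] xcorr (pos B) f := by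
  set V : HalfL2 := ∫ t in Ioi (0 : ℝ), B t • tr f t with hV
  have hX : Integrable (xcorr (pos B) f) (volume.restrict (Ioi 0)) := hBf.integral_prod_right
  refine ae_eq_of_forall_setIntegral_eq_of_sigmaFinite
    (fun s hs h => ?_)
    (fun s hs _ => hX.integrableOn) fun s hs hfin => ?_
  · have : IsFiniteMeasure ((volume.restrict (Ioi (0 : ℝ))).restrict s) := ⟨by simpa using h⟩
    exact ((Lp.memLp V).restrict s).integrable (by norm_num)
  rw [← L2.inner_indicatorConstLp_one (𝕜 := ℂ) hs hfin.ne V, hV, ← innerSL_apply_apply ℂ,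
    ← ContinuousLinearMap.integral_comp_comm _ hi]
  have hint : Integrable (fun p : ℝ × ℝ => pos B p.1 * f (p.1 + p.2))
      ((volume : Measure ℝ).prod ((volume.restrict (Ioi 0)).restrict s)) := by
    have := hBf.restrict (s := univ ×ˢ s)
    rwa [← Measure.prod_restrict, Measure.restrict_univ] at this
  have hsw := integral_integral_swap (f := fun t σ => pos B t * f (t + σ)) hint
  have e : ∫ σ in s, xcorr (pos B) f σ ∂(volume.restrict (Ioi 0)) =
      ∫ t, pos B t * ∫ σ in s, f (t + σ) ∂(volume.restrict (Ioi 0)) := by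
    simp only [xcorr]
    rw [← hsw]
    congr 1; ext t
    rw [integral_const_mul]
  rw [e, integral_pos_mul]
  refine integral_congr_ae (ae_of_all _ fun t => ?_)
  simp only [map_smul, smul_eq_mul, innerSL_apply_apply]
  rw [L2.inner_indicatorConstLp_one (𝕜 := ℂ) hs hfin.ne]
  congr 1
  exact integral_congr_ae (ae_restrict_of_ae (coeFn_tr hf t))

/-- The functions `A` and `B` whose half-line Fourier transforms are the entries of the row
`[k₀, k₁] + …` of a solution of the Riemann–Hilbert problem. -/
structure IsRow (φ φ₁ : ℝ → ℂ) (k₀ k₁ : ℂ) (A B : ℝ → ℂ) : Prop where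
  integrableOn_fst : IntegrableOn A (Ioi 0)
  integrableOn_snd : IntegrableOn B (Ioi 0)
  eq_fst : ∀ σ, A σ = 4 * Complex.I * (k₁ * φ₁ σ + xcorr (pos B) φ₁ σ)
  eq_snd : ∀ s, B s = k₀ * conj (φ s) + xcorr (pos A) (fun s => conj (φ s)) s

/-- B is defined through pairings with α, and A by the pointwise formula; the equation for α says
that A represents α. The decay of B makes A integrable, and then the convolution formula makes B
integrable. -/
theorem IsKernel.exists_isRow {N : ℝ} {φ φ₁ φ₂ : ℝ → ℂ} (h : IsKernel N φ φ₁ φ₂) (k₀ k₁ : ℂ)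
    {α : HalfL2} (hα : (1 + opK φ φ₁ 0) α = (4 * Complex.I * k₁) • tr φ₁ 0 - k₀ • srcF φ φ₁ 0) :
    ∃ A B, IsRow φ φ₁ k₀ k₁ A B ∧ MemLp (pos A) 2 ∧ tr (pos A) 0 = α ∧
      (∀ t, B t = k₀ * conj (φ t) + inner ℂ (tr φ t) α) ∧
      ∃ C, ∀ t, 0 ≤ t → ‖B t‖ ≤ C / (1 + t) := by
  have hN := h.nonneg
  set B : ℝ → ℂ := fun t => k₀ * conj (φ t) + inner ℂ (tr φ t) α with hB
  have hBc : Continuous B := by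
    have h1 := h.continuous
    have h2 : Continuous fun t => (inner ℂ (tr φ t) α : ℂ) :=
      (continuous_tr φ).inner continuous_const
    exact (continuous_const.mul (Complex.continuous_conj.comp h1)).add h2
  set C : ℝ := ‖k₀‖ * (4 * N) + 2 * N * ‖α‖ with hC
  have hBC : ∀ t, 0 ≤ t → ‖B t‖ ≤ C / (1 + t) := by
    intro t ht
    refine (norm_add_le _ _).trans ?_
    rw [hC, add_div, norm_mul, RCLike.norm_conj]
    refine add_le_add ?_ ((norm_inner_le_norm _ _).trans ?_)
    · rw [mul_div_assoc]; gcongr; exact h.norm_apply ht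
    · rw [mul_div_right_comm]; gcongr; exact h.norm_tr0 ht
  have hprod := integrable_mul_shear_of_decay hBc (fun t ht => hBC t ht.le) h.mem1 h.mem1'
  have hi0 : IntegrableOn (fun t => (-4 * Complex.I * inner ℂ (tr φ t) α) • tr φ₁ t) (Ioi 0) :=
    h.integrableOn_opK 0 α
  have hi1 : IntegrableOn (fun t => k₀ • (-4 * Complex.I * conj (φ t)) • tr φ₁ t) (Ioi 0) :=
    (h.integrableOn_srcF 0).smul k₀
  have hsum : ∀ t, B t • tr φ₁ t = (Complex.I / 4) •
      ((-4 * Complex.I * inner ℂ (tr φ t) α) • tr φ₁ t +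
        k₀ • (-4 * Complex.I * conj (φ t)) • tr φ₁ t) := by
    intro t
    simp only [smul_smul, ← add_smul, hB]
    congr 1
    linear_combination (k₀ * conj (φ t) + inner ℂ (tr φ t) α) * Complex.I_mul_I
  have hi : IntegrableOn (fun t => B t • tr φ₁ t) (Ioi 0) :=
    ((hi0.add hi1).smul (Complex.I / 4)).congr (ae_of_all _ fun t => (hsum t).symm)
  have hV := coeFn_integral_smul_tr h.mem1 hprod hi
  have hVeq : α = (4 * Complex.I * k₁) • tr φ₁ 0 +
      (4 * Complex.I) • ∫ t in Ioi (0 : ℝ), B t • tr φ₁ t := by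
    simp_rw [hsum]
    rw [integral_smul, integral_add hi0 hi1, integral_smul, ← h.opK_apply]
    change α + opK φ φ₁ 0 α = _ at hα
    rw [smul_smul, show 4 * Complex.I * (Complex.I / 4) = -1 by
      linear_combination Complex.I_mul_I]
    refine (eq_sub_of_add_eq hα).trans ?_
    rw [neg_one_smul, srcF]
    abel
  set A : ℝ → ℂ := fun σ => 4 * Complex.I * (k₁ * φ₁ σ + xcorr (pos B) φ₁ σ) with hA
  have hAα : α =ᵐ[volume.restrict (Ioi 0)] A := by
    have e1 := Lp.coeFn_add ((4 * Complex.I * k₁) • tr φ₁ 0)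
      ((4 * Complex.I) • ∫ t in Ioi (0 : ℝ), B t • tr φ₁ t)
    have e2 := Lp.coeFn_smul (4 * Complex.I * k₁) (tr φ₁ 0)
    have e3 := Lp.coeFn_smul (4 * Complex.I) (∫ t in Ioi (0 : ℝ), B t • tr φ₁ t)
    rw [← hVeq] at e1
    filter_upwards [e1, e2, e3, hV, coeFn_tr h.mem1 0] with ξ h1 h2 h3 h4 h5
    rw [h1, Pi.add_apply, h2, h3, Pi.smul_apply, Pi.smul_apply, h4, h5, zero_add]
    simp only [smul_eq_mul, hA]; ring
  have hAm : MemLp (pos A) 2 :=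
    (memLp_indicator_iff_restrict measurableSet_Ioi).2 ((memLp_congr_ae hAα).1 (Lp.memLp α))
  have hAtr : tr (pos A) 0 = α := by
    refine Lp.ext ((coeFn_tr hAm 0).trans ?_)
    filter_upwards [hAα, ae_restrict_mem measurableSet_Ioi] with ξ h1 h2
    rw [h1, zero_add, pos_of_pos h2]
  have hAi : IntegrableOn A (Ioi 0) := by
    have h1 : IntegrableOn (xcorr (pos B) φ₁) (Ioi 0) := hprod.integral_prod_right
    exact ((h.integrable1.integrableOn.const_mul k₁).add h1).const_mul _
  have hBeq : ∀ s, B s = k₀ * conj (φ s) + xcorr (pos A) (fun s => conj (φ s)) s := fun s => by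
    rw [hB, ← inner_tr_zero hAm h.mem0 (fun ξ hξ => pos_of_nonpos hξ), hAtr]
  refine ⟨A, B, ⟨hAi, ?_, fun σ => rfl, hBeq⟩, hAm, hAtr, fun t => rfl, C, hBC⟩
  have h2 := integrable_xcorr (integrable_pos hAi) (integrable_conj h.integrable0)
  have : B = _ := funext hBeq
  rw [this]
  exact (((integrable_conj h.integrable0).const_mul k₀).add h2).integrableOn

/-! ### Reciprocity, energy identity and the second reconstruction formula -/

theorem continuous_xcorr {F G : ℝ → ℂ} (hF : Integrable F) (hG : Continuous G) {C : ℝ}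
    (hC : ∀ t, ‖G t‖ ≤ C) : Continuous (xcorr F G) := by
  refine continuous_of_dominated (bound := fun s => ‖F s‖ * C)
    (fun τ => hF.1.mul (Continuous.aestronglyMeasurable (by fun_prop)))
    (fun τ => ae_of_all _ fun s => ?_) (hF.norm.mul_const C) (ae_of_all _ fun s => by fun_prop)
  rw [norm_mul]; gcongr; exact hC _

/-- Transposition of the Hankel operator with kernel `g`. -/
theorem integral_mul_xcorr_pos {f f' g : ℝ → ℂ} (hf : IntegrableOn f (Ioi 0))
    (hf' : IntegrableOn f' (Ioi 0)) (hg : Continuous g) {C : ℝ} (hC : ∀ t, ‖g t‖ ≤ C) :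
    ∫ t in Ioi (0 : ℝ), f t * xcorr (pos f') g t = ∫ t in Ioi (0 : ℝ), xcorr (pos f) g t * f' t := by
  have hint : Integrable (Function.uncurry fun s t : ℝ => pos f' s * pos f t * g (s + t))
      ((volume : Measure ℝ).prod volume) := by
    refine ((integrable_pos hf').mul_prod (integrable_pos hf)).mul_bdd (c := C) ?_
      (ae_of_all _ fun p => hC _)
    exact Continuous.aestronglyMeasurable (by fun_prop)
  have h := integral_integral_swap hint
  rw [← integral_pos_mul, ← integral_indicator measurableSet_Ioi]
  refine Eq.trans ?_ (h.symm.trans ?_)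
  · congr 1; ext t
    rw [xcorr, ← integral_const_mul]
    congr 1; ext s; ring
  · congr 1; ext s
    rcases lt_or_ge 0 s with hs | hs
    · rw [indicator_of_mem (mem_Ioi.2 hs), xcorr, ← integral_mul_const]
      congr 1; ext t
      rw [pos_of_pos hs, add_comm s t]; ring
    · rw [indicator_of_notMem (by simpa using hs)]
      simp [pos_of_nonpos hs]

section
variable {N : ℝ} {φ φ₁ φ₂ : ℝ → ℂ} {k₀ k₁ : ℂ} {A B : ℝ → ℂ}

theorem IsKernel.norm_le (h : IsKernel N φ φ₁ φ₂) (t : ℝ) : ‖φ t‖ ≤ 2 * N :=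
  (h.norm_tr_le_3 t).2.2.2.1

theorem IsKernel.norm_le₁ (h : IsKernel N φ φ₁ φ₂) (t : ℝ) : ‖φ₁ t‖ ≤ 2 * N :=
  (h.norm_tr_le_3 t).2.2.2.2

theorem IsKernel.norm_conj_le (h : IsKernel N φ φ₁ φ₂) (t : ℝ) : ‖conj (φ t)‖ ≤ 2 * N := by
  rw [RCLike.norm_conj]; exact h.norm_le t

theorem IsKernel.norm_conj_le₁ (h : IsKernel N φ φ₁ φ₂) (t : ℝ) : ‖conj (φ₁ t)‖ ≤ 2 * N := by
  rw [RCLike.norm_conj]; exact h.norm_le₁ t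

theorem IsKernel.continuous_conj (h : IsKernel N φ φ₁ φ₂) : Continuous fun s => conj (φ s) :=
  Complex.continuous_conj.comp h.continuous

theorem IsKernel.continuous_conj₁ (h : IsKernel N φ φ₁ φ₂) : Continuous fun s => conj (φ₁ s) :=
  Complex.continuous_conj.comp h.cont

theorem IsRow.continuous_fst (hr : IsRow φ φ₁ k₀ k₁ A B) (h : IsKernel N φ φ₁ φ₂) :
    Continuous A := by
  rw [funext hr.eq_fst]
  have := continuous_xcorr (integrable_pos hr.integrableOn_snd) h.cont h.norm_le₁
  have := h.cont
  fun_prop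

theorem IsRow.continuous_snd (hr : IsRow φ φ₁ k₀ k₁ A B) (h : IsKernel N φ φ₁ φ₂) :
    Continuous B := by
  rw [funext hr.eq_snd]
  have := continuous_xcorr (integrable_pos hr.integrableOn_fst) h.continuous_conj h.norm_conj_le
  have := h.continuous_conj
  fun_prop

theorem IsRow.integrable_fst (hr : IsRow φ φ₁ k₀ k₁ A B) (h : IsKernel N φ φ₁ φ₂) :
    Integrable A := by
  rw [funext hr.eq_fst]
  exact ((h.integrable1.const_mul k₁).add
    (integrable_xcorr (integrable_pos hr.integrableOn_snd) h.integrable1)).const_mul _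

theorem IsRow.integrable_snd (hr : IsRow φ φ₁ k₀ k₁ A B) (h : IsKernel N φ φ₁ φ₂) :
    Integrable B := by
  rw [funext hr.eq_snd]
  exact ((integrable_conj h.integrable0).const_mul k₀).add
    (integrable_xcorr (integrable_pos hr.integrableOn_fst) (integrable_conj h.integrable0))

theorem IsRow.exists_norm_fst_le (hr : IsRow φ φ₁ k₀ k₁ A B) (h : IsKernel N φ φ₁ φ₂) :
    ∃ C, ∀ s, ‖A s‖ ≤ C := by
  refine ⟨4 * (‖k₁‖ * (2 * N) + (∫ s, ‖pos B s‖) * (2 * N)), fun s => ?_⟩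
  rw [hr.eq_fst, norm_mul]
  have h1 := norm_xcorr_le (integrable_pos hr.integrableOn_snd) h.norm_le₁ s
  have h2 : ‖k₁ * φ₁ s‖ ≤ ‖k₁‖ * (2 * N) := by rw [norm_mul]; gcongr; exact h.norm_le₁ s
  rw [show ‖4 * Complex.I‖ = 4 by simp]
  exact mul_le_mul_of_nonneg_left ((norm_add_le _ _).trans (add_le_add h2 h1)) (by norm_num)

theorem IsRow.exists_norm_snd_le (hr : IsRow φ φ₁ k₀ k₁ A B) (h : IsKernel N φ φ₁ φ₂) :
    ∃ C, ∀ s, ‖B s‖ ≤ C := by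
  refine ⟨‖k₀‖ * (2 * N) + (∫ s, ‖pos A s‖) * (2 * N), fun s => ?_⟩
  rw [hr.eq_snd]
  have h1 := norm_xcorr_le (integrable_pos hr.integrableOn_fst) h.norm_conj_le s
  have h2 : ‖k₀ * conj (φ s)‖ ≤ ‖k₀‖ * (2 * N) := by
    rw [norm_mul]; gcongr; exact h.norm_conj_le s
  exact (norm_add_le _ _).trans (add_le_add h2 h1)

theorem integrableOn_mul_of_norm_le {f g : ℝ → ℂ} (hf : IntegrableOn f (Ioi 0)) (hg : Continuous g)
    {C : ℝ} (hC : ∀ t, ‖g t‖ ≤ C) : IntegrableOn (fun t => f t * g t) (Ioi 0) :=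
  Integrable.mul_bdd (c := C) hf hg.aestronglyMeasurable (ae_of_all _ hC)

/-- Reciprocity between two rows. -/
theorem IsRow.reciprocity {k₀' k₁' : ℂ} {A' B' : ℝ → ℂ} (hr : IsRow φ φ₁ k₀ k₁ A B)
    (hr' : IsRow φ φ₁ k₀' k₁' A' B') (h : IsKernel N φ φ₁ φ₂) :
    k₀' * (∫ t in Ioi (0 : ℝ), A t * conj (φ t)) +
        4 * Complex.I * k₁' * (∫ t in Ioi (0 : ℝ), B t * φ₁ t) =
      k₀ * (∫ t in Ioi (0 : ℝ), A' t * conj (φ t)) +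
        4 * Complex.I * k₁ * ∫ t in Ioi (0 : ℝ), B' t * φ₁ t := by
  -- Each of ∫ A B′ and ∫ B A′ is computed twice, once from the equations of either row. The double
  -- integrals agree because the Hankel operators are symmetric, and what remains is the relation.
  have key : ∀ {k₀ k₁ k₀' k₁' : ℂ} {A B A' B' : ℝ → ℂ}, IsRow φ φ₁ k₀ k₁ A B →
      IsRow φ φ₁ k₀' k₁' A' B' →
      (∫ t in Ioi (0 : ℝ), A t * B' t = k₀' * (∫ t in Ioi (0 : ℝ), A t * conj (φ t)) +
        ∫ t in Ioi (0 : ℝ), A t * xcorr (pos A') (fun s => conj (φ s)) t) ∧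
      (∫ t in Ioi (0 : ℝ), B t * A' t =
        4 * Complex.I * k₁' * (∫ t in Ioi (0 : ℝ), B t * φ₁ t) +
          4 * Complex.I * ∫ t in Ioi (0 : ℝ), B t * xcorr (pos B') φ₁ t) := by
    intro k₀ k₁ k₀' k₁' A B A' B' r r'
    have b1 := continuous_xcorr (integrable_pos r'.integrableOn_fst) h.continuous_conj h.norm_conj_le
    have b2 := continuous_xcorr (integrable_pos r'.integrableOn_snd) h.cont h.norm_le₁
    constructor
    · rw [← integral_const_mul, ← integral_add
        ((integrableOn_mul_of_norm_le r.integrableOn_fst h.continuous_conj h.norm_conj_le).const_mul _)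
        (integrableOn_mul_of_norm_le r.integrableOn_fst b1
          (norm_xcorr_le (integrable_pos r'.integrableOn_fst) h.norm_conj_le))]
      congr 1; ext t; rw [r'.eq_snd]; ring
    · rw [← integral_const_mul, ← integral_const_mul, ← integral_add
        ((integrableOn_mul_of_norm_le r.integrableOn_snd h.cont h.norm_le₁).const_mul _)
        ((integrableOn_mul_of_norm_le r.integrableOn_snd b2
          (norm_xcorr_le (integrable_pos r'.integrableOn_snd) h.norm_le₁)).const_mul _)]
      congr 1; ext t; rw [r'.eq_fst]; ring
  obtain ⟨e1, e2⟩ := key hr hr'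
  obtain ⟨e3, e4⟩ := key hr' hr
  have s1 := integral_mul_xcorr_pos hr.integrableOn_fst hr'.integrableOn_fst h.continuous_conj
    h.norm_conj_le
  have s2 := integral_mul_xcorr_pos hr.integrableOn_snd hr'.integrableOn_snd h.cont h.norm_le₁
  have c : ∀ f g : ℝ → ℂ, ∫ t in Ioi (0 : ℝ), f t * g t = ∫ t in Ioi (0 : ℝ), g t * f t :=
    fun f g => by congr 1; ext t; ring
  rw [c _ A'] at s1
  rw [c _ B'] at s2
  rw [s1] at e1
  rw [s2] at e2
  linear_combination e3 - e1 - e2 + e4 + c A B' + c B A'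

theorem integral_Ioi_deriv_eq_neg {f f' : ℝ → ℂ} (hf : ∀ t, HasDerivAt f (f' t) t)
    (hi : IntegrableOn f (Ioi 0)) (hi' : IntegrableOn f' (Ioi 0)) :
    ∫ t in Ioi (0 : ℝ), f' t = -f 0 := by
  have h := tendsto_zero_of_hasDerivAt_of_integrableOn_Ioi (a := 0) (fun t _ => hf t) hi' hi
  rw [integral_Ioi_of_hasDerivAt_of_tendsto (hf 0).continuousAt.continuousWithinAt
    (fun t _ => hf t) hi' h, zero_sub]

theorem xcorr_pos_zero (f g : ℝ → ℂ) : xcorr (pos f) g 0 = ∫ t in Ioi (0 : ℝ), f t * g t := by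
  rw [xcorr, integral_pos_mul]; simp

theorem xcorr_pos (f g : ℝ → ℂ) (τ : ℝ) :
    xcorr (pos f) g τ = ∫ t in Ioi (0 : ℝ), f t * g (t + τ) := by
  rw [xcorr, integral_pos_mul]

theorem conj_xcorr_pos (f g : ℝ → ℂ) (τ : ℝ) :
    conj (xcorr (pos f) g τ) = xcorr (pos fun s => conj (f s)) (fun s => conj (g s)) τ := by
  rw [xcorr_pos, xcorr_pos, ← integral_conj]
  simp only [map_mul]

/-- The derivative of the second function of the first row. -/
noncomputable def derSnd (φ₁ A : ℝ → ℂ) (t : ℝ) : ℂ :=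
  conj (φ₁ t) + xcorr (pos A) (fun s => conj (φ₁ s)) t

theorem IsRow.hasDerivAt_snd (hr : IsRow φ φ₁ 1 0 A B) (h : IsKernel N φ φ₁ φ₂) (t : ℝ) :
    HasDerivAt B (derSnd φ₁ A t) t := by
  have e : B = fun s => conj (φ s) + xcorr (pos A) (fun s => conj (φ s)) s := by
    ext s; rw [hr.eq_snd, one_mul]
  rw [e]
  exact (hasDerivAt_conj (h.hasDeriv t)).add
    (hasDerivAt_xcorr (integrable_pos hr.integrableOn_fst) (fun t => hasDerivAt_conj (h.hasDeriv t))
      h.continuous_conj₁ h.norm_conj_le h.norm_conj_le₁ t)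

theorem IsRow.integrable_derSnd (hr : IsRow φ φ₁ k₀ k₁ A B) (h : IsKernel N φ φ₁ φ₂) :
    Integrable (derSnd φ₁ A) :=
  (integrable_conj h.integrable1).add
    (integrable_xcorr (integrable_pos hr.integrableOn_fst) (integrable_conj h.integrable1))

theorem conj_derSnd (φ₁ A : ℝ → ℂ) (t : ℝ) :
    conj (derSnd φ₁ A t) = φ₁ t + xcorr (pos fun s => conj (A s)) φ₁ t := by
  rw [derSnd, map_add, conj_xcorr_pos]; simp

/-- The conjugate of the first row. -/
theorem IsRow.conj_row (hr : IsRow φ φ₁ 1 0 A B) (h : IsKernel N φ φ₁ φ₂) :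
    IsRow φ φ₁ (4 * Complex.I * conj (B 0)) 1 (fun t => 4 * Complex.I * conj (derSnd φ₁ A t))
      (fun t => conj (A t)) where
  integrableOn_fst := ((integrable_conj (hr.integrable_derSnd h)).const_mul _).integrableOn
  integrableOn_snd := integrable_conj hr.integrableOn_fst
  eq_fst σ := by rw [conj_derSnd, one_mul]
  eq_snd s := by
    have hs : Continuous fun t : ℝ => φ (t + s) := h.continuous.comp (by fun_prop)
    have hs1 : Continuous fun t : ℝ => φ₁ (t + s) := h.cont.comp (by fun_prop)
    have i1 := integrableOn_mul_of_norm_le (hr.integrable_derSnd h).integrableOn hs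
      (fun t => h.norm_le (t + s))
    have i2 := integrableOn_mul_of_norm_le hr.integrableOn_snd hs1 (fun t => h.norm_le₁ (t + s))
    have i3 := integrableOn_mul_of_norm_le hr.integrableOn_snd hs (fun t => h.norm_le (t + s))
    -- Integration by parts moves the derivative from φ(t + s) to B; the boundary term −B(0) φ(s) is
    -- the origin of the constant 4i conj B(0).
    have e := integral_Ioi_deriv_eq_neg (f := fun t => B t * φ (t + s))
      (f' := fun t => derSnd φ₁ A t * φ (t + s) + B t * φ₁ (t + s))
      (fun t => (hr.hasDerivAt_snd h t).mul ((h.hasDeriv (t + s)).comp_add_const t s)) i3 (i1.add i2)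
    rw [integral_add i1 i2, ← xcorr_pos, ← xcorr_pos, zero_add] at e
    have e2 : xcorr (pos fun t => 4 * Complex.I * conj (derSnd φ₁ A t)) (fun s => conj (φ s)) s =
        4 * Complex.I * conj (xcorr (pos (derSnd φ₁ A)) φ s) := by
      rw [conj_xcorr_pos, xcorr_pos, xcorr_pos, ← integral_const_mul]
      congr 1; ext t; ring
    rw [e2, hr.eq_fst, zero_mul, zero_add, eq_sub_of_add_eq' e]
    simp only [map_mul, map_sub, map_neg, Complex.conj_I, map_ofNat]
    ring

/-- The energy identity of the first row. -/
theorem IsRow.energy_identity (hr : IsRow φ φ₁ 1 0 A B) (h : IsKernel N φ φ₁ φ₂) :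
    (∫ t in Ioi (0 : ℝ), B t * φ₁ t) + conj (∫ t in Ioi (0 : ℝ), B t * φ₁ t) =
      -(B 0 * conj (B 0)) := by
  obtain ⟨C, hC⟩ := hr.exists_norm_snd_le h
  have hBc := hr.continuous_snd h
  have hcB : Continuous fun t => conj (B t) := Complex.continuous_conj.comp hBc
  have hcC : ∀ t, ‖conj (B t)‖ ≤ C := fun t => by rw [RCLike.norm_conj]; exact hC t
  have iD := (hr.integrable_derSnd h).integrableOn (s := Ioi 0)
  have i1 := integrableOn_mul_of_norm_le iD hcB hcC
  have i2 : IntegrableOn (fun t => B t * conj (derSnd φ₁ A t)) (Ioi 0) := by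
    refine (integrable_conj i1).congr (ae_of_all _ fun t => ?_)
    simp [mul_comm]
  -- The integral of (|B|²)′ is −|B(0)|². Inserting the equation for conj B′ leaves the integral of
  -- B φ₁ and a cross term.
  have e := integral_Ioi_deriv_eq_neg (f := fun t => B t * conj (B t))
    (f' := fun t => derSnd φ₁ A t * conj (B t) + B t * conj (derSnd φ₁ A t))
    (fun t => (hr.hasDerivAt_snd h t).mul (hasDerivAt_conj (hr.hasDerivAt_snd h t)))
    (integrableOn_mul_of_norm_le hr.integrableOn_snd hcB hcC) (i1.add i2)
  have e1 : ∫ t in Ioi (0 : ℝ), derSnd φ₁ A t * conj (B t) =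
      conj (∫ t in Ioi (0 : ℝ), B t * conj (derSnd φ₁ A t)) := by
    rw [← integral_conj]; simp [mul_comm]
  rw [integral_add i1 i2, e1] at e
  have iA := integrable_conj hr.integrableOn_fst
  have e2 : ∫ t in Ioi (0 : ℝ), B t * conj (derSnd φ₁ A t) = (∫ t in Ioi (0 : ℝ), B t * φ₁ t) +
      ∫ t in Ioi (0 : ℝ), B t * xcorr (pos fun s => conj (A s)) φ₁ t := by
    rw [← integral_add (integrableOn_mul_of_norm_le hr.integrableOn_snd h.cont h.norm_le₁)
      (integrableOn_mul_of_norm_le hr.integrableOn_snd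
        (continuous_xcorr (integrable_pos iA) h.cont h.norm_le₁)
        (norm_xcorr_le (integrable_pos iA) h.norm_le₁))]
    congr 1; ext t; rw [conj_derSnd]; ring
  -- By symmetry the cross term is −(i/4) ∫ |A|², purely imaginary, so it cancels against its
  -- conjugate.
  have e3 : 4 * Complex.I * ∫ t in Ioi (0 : ℝ), B t * xcorr (pos fun s => conj (A s)) φ₁ t =
      ((∫ t in Ioi (0 : ℝ), ‖A t‖ ^ 2 : ℝ) : ℂ) := by
    rw [integral_mul_xcorr_pos hr.integrableOn_snd iA h.cont h.norm_le₁, ← integral_const_mul,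
      ← integral_complex_ofReal]
    congr 1; ext t
    rw [← mul_assoc, ← Complex.normSq_eq_norm_sq, ← Complex.mul_conj, hr.eq_fst t]
    ring
  have e4 := congrArg conj e3
  rw [Complex.conj_ofReal, ← e3] at e4
  simp only [map_mul, Complex.conj_I, map_ofNat] at e4
  rw [e2, map_add] at e
  linear_combination e - Complex.I / 4 * e4 -
    (conj (∫ t in Ioi (0 : ℝ), B t * xcorr (pos fun s => conj (A s)) φ₁ t) +
      ∫ t in Ioi (0 : ℝ), B t * xcorr (pos fun s => conj (A s)) φ₁ t) * Complex.I_mul_I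

/-- The relation between the two rows behind the second reconstruction formula. -/
theorem IsRow.fst_zero_eq {A' B' : ℝ → ℂ} (hr : IsRow φ φ₁ 1 0 A B) (hr' : IsRow φ φ₁ 0 1 A' B')
    (h : IsKernel N φ φ₁ φ₂) :
    A' 0 = 4 * Complex.I * conj (derSnd φ₁ A 0 - B 0 * B' 0) -
      16 * (B 0 * conj (B 0)) * conj (B 0) := by
  -- Reciprocity with the conjugate row exchanges the integral of B′ φ₁ in A′(0) for that of conj A
  -- φ₁. Reciprocity with the first row gives B′(0) = 4i ∫ B φ₁, so the energy identity evaluates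
  -- conj B′(0) − B′(0) as 4i |B(0)|²; this is the cubic term.
  have e1 := hr'.reciprocity (hr.conj_row h) h
  have e2 := hr'.reciprocity hr h
  have e3 := hr.energy_identity h
  have e4 : B' 0 = ∫ t in Ioi (0 : ℝ), A' t * conj (φ t) := by
    rw [hr'.eq_snd, zero_mul, zero_add, xcorr_pos_zero]
  rw [← e4] at e1 e2
  have e5 := congrArg conj e2
  rw [hr'.eq_fst, map_sub, map_mul, conj_derSnd, xcorr_pos_zero, xcorr_pos_zero]
  simp only [map_mul, Complex.conj_I, map_ofNat, map_zero, map_one, map_add] at e1 e2 e5 ⊢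
  linear_combination e1 - 4 * Complex.I * conj (B 0) * e2 + 4 * Complex.I * conj (B 0) * e5
    + 16 * conj (B 0) * e3 - 16 * conj (B 0) * ((∫ t in Ioi (0 : ℝ), B t * φ₁ t) +
      conj (∫ t in Ioi (0 : ℝ), B t * φ₁ t)) * Complex.I_mul_I

end

theorem srcF_shift {φ φ₁ : ℝ → ℂ} (h1 : MemLp φ₁ 2) (c : ℝ) :
    srcF (fun s => φ (c + s)) (fun s => φ₁ (c + s)) 0 = srcF φ φ₁ c := by
  rw [srcF, srcF]
  have := setIntegral_comp_add_left_Ioi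
    (fun t => (-4 * Complex.I * conj (φ t)) • tr φ₁ t) c 0
  rw [add_zero] at this
  rw [← this]
  congr 1; ext1 t
  rw [tr_shift h1]

theorem tr_shift_zero {f : ℝ → ℂ} (hf : MemLp f 2) (c : ℝ) :
    tr (fun s => f (c + s)) 0 = tr f c := by rw [tr_shift hf, add_zero]

/-- The first row comes from `solA`, the second from −`solY`; their values at 0, which the
reconstruction integrals pick out, are thereby expressed by b(c) and its derivative. -/
theorem IsKernel.exists_rows {N : ℝ} {φ φ₁ φ₂ : ℝ → ℂ} (h : IsKernel N φ φ₁ φ₂) (c : ℝ) :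
    ∃ A B A' B', IsRow (fun s => φ (c + s)) (fun s => φ₁ (c + s)) 1 0 A B ∧
      IsRow (fun s => φ (c + s)) (fun s => φ₁ (c + s)) 0 1 A' B' ∧ B 0 = bval φ φ₁ c ∧
      A' 0 = 4 * Complex.I * conj (bval' φ φ₁ c) -
        16 * (bval φ φ₁ c * conj (bval φ φ₁ c)) * conj (bval φ φ₁ c) := by
  have hs := h.shift c
  have e1 : (1 + opK (fun s => φ (c + s)) (fun s => φ₁ (c + s)) 0) (solA φ φ₁ c) =
      (4 * Complex.I * 0) • tr (fun s => φ₁ (c + s)) 0 -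
        (1 : ℂ) • srcF (fun s => φ (c + s)) (fun s => φ₁ (c + s)) 0 := by
    rw [opK_shift h.mem0 h.mem1, srcF_shift h.mem1, solA, resK, map_neg, inverse_apply (h.isUnit c),
      mul_zero, zero_smul, one_smul, zero_sub]
  have e2 : (1 + opK (fun s => φ (c + s)) (fun s => φ₁ (c + s)) 0) (-solY φ φ₁ c) =
      (4 * Complex.I * 1) • tr (fun s => φ₁ (c + s)) 0 -
        (0 : ℂ) • srcF (fun s => φ (c + s)) (fun s => φ₁ (c + s)) 0 := by
    rw [opK_shift h.mem0 h.mem1, tr_shift_zero h.mem1, solY, resK, map_neg, map_smul,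
      inverse_apply (h.isUnit c)]
    module
  obtain ⟨A, B, r, mA, tA, hB, -⟩ := hs.exists_isRow 1 0 e1
  obtain ⟨A', B', r', -, -, hB', -⟩ := hs.exists_isRow 0 1 e2
  have b0 : B 0 = bval φ φ₁ c := by
    rw [hB, tr_shift_zero h.mem0, bval, remB, add_zero, one_mul]
  refine ⟨A, B, A', B', r, r', b0, ?_⟩
  rw [r.fst_zero_eq r' hs, b0]
  congr 3
  rw [derSnd, ← inner_tr_zero mA hs.mem1 (fun ξ hξ => pos_of_nonpos hξ), tA, tr_shift_zero h.mem1,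
    hB', tr_shift_zero h.mem0, bval', remB', inner_neg_right, add_zero]
  ring

/-! ### Cauchy transforms and existence for the Riemann–Hilbert problem -/

/-- The Cauchy transform of the Fourier transform of `G`. -/
noncomputable def cauchyT (G : ℝ → ℂ) (z : ℂ) : ℂ :=
  if 0 < z.im then lap G z else -lap (fun s => G (-s)) (-z)

theorem cauchyT_of_pos (G : ℝ → ℂ) {z : ℂ} (hz : 0 < z.im) : cauchyT G z = lap G z := if_pos hz

theorem cauchyT_of_neg (G : ℝ → ℂ) {z : ℂ} (hz : z.im < 0) :
    cauchyT G z = -lap (fun s => G (-s)) (-z) := if_neg (not_lt.2 hz.le)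

/-- The boundary values of `cauchyT G` from above and from below. -/
noncomputable def cauchyP (G : ℝ → ℂ) (s : ℝ) : ℂ := ft (pos G) s

noncomputable def cauchyM (G : ℝ → ℂ) (s : ℝ) : ℂ := -ft (pos fun s => G (-s)) (-s)

theorem integral_mul_pos (f g : ℝ → ℂ) : ∫ s, g s * pos f s = ∫ s in Ioi (0 : ℝ), g s * f s := by
  simp_rw [mul_comm (g _)]
  exact integral_pos_mul f g

theorem ft_pos (G : ℝ → ℂ) (s : ℝ) : ft (pos G) s = lap G s := by
  rw [ft, integral_mul_pos, lap]
  congr 1; ext ξ; ring_nf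

section
variable {G : ℝ → ℂ}

theorem differentiableOn_cauchyT (hG : Integrable G) :
    DifferentiableOn ℂ (cauchyT G) {z | z.im ≠ 0} := by
  intro z hz
  refine DifferentiableAt.differentiableWithinAt ?_
  rcases lt_or_gt_of_ne (hz : z.im ≠ 0) with h | h
  · have h1 : DifferentiableAt ℂ (fun z => -lap (fun s => G (-s)) (-z)) z := by
      have := differentiableAt_lap (ζ := -z) hG.comp_neg.integrableOn (by simpa using h)
      exact (this.comp z differentiableAt_id.neg).neg
    refine h1.congr_of_eventuallyEq ?_
    filter_upwards [(isOpen_lt Complex.continuous_im continuous_const).mem_nhds h] with w hw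
    exact cauchyT_of_neg G hw
  · refine (differentiableAt_lap hG.integrableOn h).congr_of_eventuallyEq ?_
    filter_upwards [(isOpen_lt continuous_const Complex.continuous_im).mem_nhds h] with w hw
    exact cauchyT_of_pos G hw

theorem tendsto_lap_boundary (hG : Integrable G) (s : ℝ) :
    Tendsto (fun ε : ℝ => lap G (s + ε * Complex.I)) (𝓝[>] 0) (𝓝 (ft (pos G) s)) := by
  rw [ft_pos]
  have h := continuousOn_lap hG.integrableOn (s : ℂ) (by simp)
  refine h.tendsto.comp (tendsto_nhdsWithin_iff.2 ⟨?_, ?_⟩)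
  · have : Continuous fun ε : ℝ => (s + ε * Complex.I : ℂ) := by fun_prop
    have := (this.tendsto 0).mono_left (nhdsWithin_le_nhds (s := Ioi 0))
    simpa using this
  · filter_upwards [self_mem_nhdsWithin] with ε hε
    have : (0 : ℝ) < ε := hε
    simpa using this.le

theorem tendsto_cauchyT_above (hG : Integrable G) (s : ℝ) :
    Tendsto (fun ε : ℝ => cauchyT G (s + ε * Complex.I)) (𝓝[>] 0) (𝓝 (cauchyP G s)) := by
  refine (tendsto_lap_boundary hG s).congr' ?_
  filter_upwards [self_mem_nhdsWithin] with ε hε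
  rw [cauchyT_of_pos]
  have : (0 : ℝ) < ε := hε
  simpa using this

theorem tendsto_cauchyT_below (hG : Integrable G) (s : ℝ) :
    Tendsto (fun ε : ℝ => cauchyT G (s - ε * Complex.I)) (𝓝[>] 0) (𝓝 (cauchyM G s)) := by
  refine (tendsto_lap_boundary hG.comp_neg (-s)).neg.congr' ?_
  filter_upwards [self_mem_nhdsWithin] with ε hε
  have : (0 : ℝ) < ε := hε
  rw [cauchyT_of_neg]
  · congr 2; push_cast; ring
  · simpa using this

theorem cauchyP_sub_cauchyM (hG : Integrable G) (s : ℝ) :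
    cauchyP G s - cauchyM G s = ft G s := by
  have h := integral_add_compl (measurableSet_Ioi (a := (0 : ℝ))) (integrable_cexp_mul hG s)
  rw [cauchyP, cauchyM, sub_neg_eq_add, show ft G s = _ from h.symm, ft, integral_mul_pos, ft,
    integral_mul_pos]
  congr 1
  rw [compl_Ioi]
  have := integral_comp_neg_Ioi (0 : ℝ) fun z : ℝ => Complex.exp (Complex.I * s * z) * G z
  rw [neg_zero] at this
  rw [← this]
  congr 1; ext z; push_cast; ring_nf

theorem memLp_two_of_bounded (hG : Integrable G) {C : ℝ} (hC : ∀ s, ‖G s‖ ≤ C) : MemLp G 2 := by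
  rw [memLp_two_iff_integrable_sq_norm hG.1]
  refine (hG.norm.const_mul C).mono' (hG.1.norm.pow 2) (ae_of_all _ fun s => ?_)
  rw [Real.norm_of_nonneg (by positivity), sq]
  exact mul_le_mul_of_nonneg_right (hC s) (norm_nonneg _)

theorem memLp_pos (hG : MemLp G 2) : MemLp (pos G) 2 := hG.indicator measurableSet_Ioi

theorem memLp_cauchyP (hG : Integrable G) (h2 : MemLp G 2) : MemLp (cauchyP G) 2 :=
  memLp_ft (integrable_pos hG.integrableOn) (memLp_pos h2)

theorem memLp_comp_neg {f : ℝ → ℂ} (h2 : MemLp f 2) : MemLp (fun s => f (-s)) 2 :=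
  h2.comp_measurePreserving (Measure.measurePreserving_neg volume)

theorem eLpNorm_comp_neg {f : ℝ → ℂ} (h2 : MemLp f 2) :
    eLpNorm (fun s => f (-s)) 2 volume = eLpNorm f 2 volume :=
  eLpNorm_comp_measurePreserving h2.1 (Measure.measurePreserving_neg volume)

theorem memLp_cauchyM (hG : Integrable G) (h2 : MemLp G 2) : MemLp (cauchyM G) 2 :=
  (memLp_comp_neg (memLp_cauchyP hG.comp_neg (memLp_comp_neg h2))).neg

/-- On the line at height y the function is the Fourier transform of e^{−ξy} G on the half-line, so
Plancherel gives a bound independent of y. -/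
theorem hardy_lap (hG : Integrable G) (h2 : MemLp G 2) {y : ℝ} (hy : 0 < y) :
    MemLp (fun s : ℝ => lap G (s + y * Complex.I)) 2 ∧
    eLpNorm (fun s : ℝ => lap G (s + y * Complex.I)) 2 volume ≤
      ENNReal.ofReal √(2 * Real.pi) * eLpNorm G 2 volume := by
  set H : ℝ → ℂ := pos fun ξ => (Real.exp (-(ξ * y)) : ℂ) * G ξ with hH
  have hle : ∀ ξ, ‖H ξ‖ ≤ ‖G ξ‖ := by
    intro ξ
    rcases lt_or_ge 0 ξ with h | h
    · rw [hH, pos_of_pos h, norm_mul, Complex.norm_real, Real.norm_of_nonneg (by positivity)]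
      refine mul_le_of_le_one_left (norm_nonneg _) ?_
      rw [Real.exp_le_one_iff]
      have := mul_pos h hy
      linarith
    · rw [hH, pos_of_nonpos h, norm_zero]; positivity
  have hm : AEStronglyMeasurable H volume := by
    refine AEStronglyMeasurable.indicator ?_ measurableSet_Ioi
    exact (Continuous.aestronglyMeasurable (by fun_prop)).mul hG.1
  have hH1 : Integrable H := hG.mono hm (ae_of_all _ hle)
  have hH2 : MemLp H 2 := h2.mono hm (ae_of_all _ hle)
  have e : (fun s : ℝ => lap G (s + y * Complex.I)) = ft H := by
    ext s
    rw [ft, hH, integral_mul_pos, lap]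
    congr 1; ext ξ
    rw [← mul_assoc, Complex.ofReal_exp, ← Complex.exp_add]
    congr 2; push_cast
    linear_combination (ξ : ℂ) * y * Complex.I_mul_I
  rw [e, eLpNorm_ft hH1 hH2]
  exact ⟨memLp_ft hH1 hH2, mul_le_mul_right (eLpNorm_mono_ae (ae_of_all _ hle)) _⟩

theorem hardy_cauchyT (hG : Integrable G) (h2 : MemLp G 2) {y : ℝ} (hy : y ≠ 0) :
    eLpNorm (fun s : ℝ => cauchyT G (s + y * Complex.I)) 2 volume ≤
      ENNReal.ofReal √(2 * Real.pi) * eLpNorm G 2 volume := by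
  rcases lt_or_gt_of_ne hy with h | h
  · have hl := hardy_lap hG.comp_neg (memLp_comp_neg h2) (y := -y) (by linarith)
    have e : (fun s : ℝ => cauchyT G (s + y * Complex.I)) =
        -fun s : ℝ => (fun s : ℝ => lap (fun s => G (-s)) (s + (-y : ℝ) * Complex.I)) (-s) := by
      ext s
      rw [cauchyT_of_neg _ (by simpa using h), Pi.neg_apply]
      congr 2; push_cast; ring
    rw [e, eLpNorm_neg, eLpNorm_comp_neg hl.1, ← eLpNorm_comp_neg h2]
    exact hl.2
  · have e : (fun s : ℝ => cauchyT G (s + y * Complex.I)) = fun s : ℝ => lap G (s + y * Complex.I) := by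
      ext s; rw [cauchyT_of_pos _ (by simpa using h)]
    rw [e]
    exact (hardy_lap hG h2 h).2

theorem norm_lap_le_div {C : ℝ} (hC : ∀ s, ‖G s‖ ≤ C) {ζ : ℂ} (hζ : 0 < ζ.im) :
    ‖lap G ζ‖ ≤ C / ζ.im := by
  have h1 : ∫ ξ in Ioi (0 : ℝ), Real.exp (-ζ.im * ξ) * C = C / ζ.im := by
    rw [integral_mul_const, integral_exp_mul_Ioi (by linarith)]
    simp; field_simp
  rw [← h1]
  refine norm_integral_le_of_norm_le ((integrableOn_exp_mul_Ioi (by linarith) 0).mul_const C)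
    (ae_of_all _ fun ξ => ?_)
  rw [norm_mul, norm_exp_I_mul, show -(ξ * ζ.im) = -ζ.im * ξ by ring]
  exact mul_le_mul_of_nonneg_left (hC ξ) (Real.exp_pos _).le

theorem tendsto_cauchyT_zero {C : ℝ} (hC : ∀ s, ‖G s‖ ≤ C) :
    Tendsto (cauchyT G) (comap (fun z : ℂ => |z.im|) atTop) (𝓝 0) := by
  have h1 : Tendsto (fun z : ℂ => C / |z.im|) (comap (fun z : ℂ => |z.im|) atTop) (𝓝 0) :=
    (tendsto_const_nhds.div_atTop tendsto_id).comp tendsto_comap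
  refine squeeze_zero_norm' ?_ h1
  filter_upwards [tendsto_comap (f := fun z : ℂ => |z.im|) (eventually_gt_atTop 0)] with z hz
  rcases lt_or_gt_of_ne (abs_pos.1 (show 0 < |z.im| from hz)) with h | h
  · rw [cauchyT_of_neg _ h, norm_neg, abs_of_neg h]
    exact norm_lap_le_div (fun s => hC _) (by simpa using h)
  · rw [cauchyT_of_pos _ h, abs_of_pos h]
    exact norm_lap_le_div hC h

end

/-- Boundedness off the real line. -/
def BddOff (f : ℂ → ℂ) : Prop := ∃ C : ℝ, ∀ z : ℂ, z.im ≠ 0 → ‖f z‖ ≤ C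

theorem bddOff_cauchyT {G : ℝ → ℂ} (hG : Integrable G) : BddOff (cauchyT G) := by
  refine ⟨∫ s, ‖G s‖, fun z hz => ?_⟩
  have key : ∀ {G : ℝ → ℂ} {z : ℂ}, Integrable G → 0 ≤ z.im → ‖lap G z‖ ≤ ∫ s, ‖G s‖ :=
    fun hG hz => (norm_lap_le hG.integrableOn hz).trans
      (setIntegral_le_integral hG.norm (ae_of_all _ fun _ => norm_nonneg _))
  rcases lt_or_gt_of_ne hz with h | h
  · rw [cauchyT_of_neg _ h, norm_neg]
    refine (key hG.comp_neg (by simpa using h.le)).trans (le_of_eq ?_)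
    exact integral_neg_eq_self (fun s => ‖G s‖) volume
  · rw [cauchyT_of_pos _ h]; exact key hG h.le

section
variable {rp rm : ℝ → ℂ} {x : ℝ} {G : Fin 2 → Fin 2 → ℝ → ℂ}

/-- Solution of a Riemann–Hilbert problem by Cauchy transforms. -/
theorem isRHSolution_of_jump (hG : ∀ i j, Integrable (G i j))
    (hb : ∀ i j, ∃ C, ∀ s, ‖G i j s‖ ≤ C)
    (hjump : ∀ᵐ s : ℝ, (Matrix.of fun i j => ft (G i j) s) =
      (1 + Matrix.of fun i j => cauchyM (G i j) s) * jumpMatrix rp rm x s) :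
    IsRHSolution rp rm x (fun z => 1 + Matrix.of fun i j => cauchyT (G i j) z)
      (fun s => 1 + Matrix.of fun i j => cauchyP (G i j) s)
      (fun s => 1 + Matrix.of fun i j => cauchyM (G i j) s) := by
  have h2 : ∀ i j, MemLp (G i j) 2 := fun i j => by
    obtain ⟨C, hC⟩ := hb i j
    exact memLp_two_of_bounded (hG i j) hC
  refine ⟨fun i j => ?_, ?_, ?_, ae_of_all _ fun s => ?_, ae_of_all _ fun s => ?_, fun i j => ?_,
    fun i j => ?_, ?_⟩
  · exact (differentiableOn_cauchyT (hG i j)).const_add _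
  · have hfin : ∀ i j, ENNReal.ofReal √(2 * Real.pi) * eLpNorm (G i j) 2 volume ≠ ⊤ := fun i j =>
      ENNReal.mul_ne_top ENNReal.ofReal_ne_top (h2 i j).2.ne
    refine ⟨∑ i, ∑ j, (ENNReal.ofReal √(2 * Real.pi) * eLpNorm (G i j) 2 volume).toNNReal,
      fun y hy i j => ?_⟩
    simp only [add_sub_cancel_left, Matrix.of_apply]
    refine (hardy_cauchyT (hG i j) (h2 i j) hy).trans ?_
    rw [← ENNReal.coe_toNNReal (hfin i j), ENNReal.coe_le_coe]
    refine (Finset.single_le_sum (f := fun j => (ENNReal.ofReal √(2 * Real.pi) *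
      eLpNorm (G i j) 2 volume).toNNReal) (fun _ _ => zero_le) (Finset.mem_univ j)).trans ?_
    exact Finset.single_le_sum (f := fun i => ∑ j, (ENNReal.ofReal √(2 * Real.pi) *
      eLpNorm (G i j) 2 volume).toNNReal) (fun _ _ => zero_le) (Finset.mem_univ i)
  · rw [show (𝓝 (1 : Matrix (Fin 2) (Fin 2) ℂ)) = 𝓝 (1 + 0) by rw [add_zero]]
    refine tendsto_const_nhds.add (tendsto_pi_nhds.2 fun i => tendsto_pi_nhds.2 fun j => ?_)
    obtain ⟨C, hC⟩ := hb i j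
    exact tendsto_cauchyT_zero hC
  · exact tendsto_const_nhds.add (tendsto_pi_nhds.2 fun i => tendsto_pi_nhds.2 fun j =>
      tendsto_cauchyT_above (hG i j) s)
  · exact tendsto_const_nhds.add (tendsto_pi_nhds.2 fun i => tendsto_pi_nhds.2 fun j =>
      tendsto_cauchyT_below (hG i j) s)
  · simp only [add_sub_cancel_left, Matrix.of_apply]
    exact memLp_cauchyP (hG i j) (h2 i j)
  · simp only [add_sub_cancel_left, Matrix.of_apply]
    exact memLp_cauchyM (hG i j) (h2 i j)
  · filter_upwards [hjump] with s hs
    rw [← hs]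
    ext i j
    simp [← cauchyP_sub_cauchyM (hG i j)]

end

/-- Inversion at the single point 0, which is how the reconstruction integrals reduce to values of
the rows at 0. -/
theorem integral_ft {G : ℝ → ℂ} (hG : Integrable G) (hc : Continuous G) (hi : Integrable (ft G)) :
    ∫ s, ft G s = 2 * Real.pi * G 0 := by
  have hpi : -(2 * Real.pi) ≠ 0 := by have := Real.pi_pos; linarith
  have e : (𝓕 G : ℝ → ℂ) = fun s => ft G (-(2 * Real.pi) * s) := by
    ext s; rw [fourier_eq_ft, neg_mul]
  have hi' : Integrable (𝓕 G : ℝ → ℂ) := by rw [e]; exact hi.comp_mul_left' hpi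
  have h := hG.fourierInv_fourier_eq hi' (v := 0) hc.continuousAt
  rw [fourierInv_eq_ft, mul_zero] at h
  have e0 : ft (𝓕 G) 0 = ∫ s, (𝓕 G : ℝ → ℂ) s := by rw [ft]; simp
  rw [e0, e, Measure.integral_comp_mul_left (ft G)] at h
  rw [← h, abs_inv, abs_neg, abs_of_pos (by positivity : 0 < 2 * Real.pi)]
  have : (Real.pi : ℂ) ≠ 0 := by exact_mod_cast Real.pi_ne_zero
  rw [Complex.real_smul]; push_cast; field_simp

theorem ft_comp_neg (f : ℝ → ℂ) (s : ℝ) : ft (fun t => f (-t)) s = ft f (-s) := by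
  rw [ft, ft, ← integral_neg_eq_self]
  congr 1; ext t; push_cast; ring_nf

theorem ft_const_mul (k : ℂ) (f : ℝ → ℂ) (s : ℝ) : ft (fun t => k * f t) s = k * ft f s := by
  rw [ft, ft, ← integral_const_mul]
  congr 1; ext t; ring

theorem ft_add {f g : ℝ → ℂ} (hf : Integrable f) (hg : Integrable g) (s : ℝ) :
    ft (fun t => f t + g t) s = ft f s + ft g s := by
  rw [ft, ft, ft, ← integral_add (integrable_cexp_mul hf s) (integrable_cexp_mul hg s)]
  congr 1; ext t; ring

theorem ft_comp_add_left (f : ℝ → ℂ) (c s : ℝ) :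
    ft (fun t => f (c + t)) s = Complex.exp (-(Complex.I * s * c)) * ft f s := by
  rw [ft, ft, ← integral_const_mul, ← integral_add_left_eq_self
    (fun t : ℝ => Complex.exp (-(Complex.I * s * c)) * (Complex.exp (Complex.I * s * t) * f t)) c]
  congr 1; ext t
  rw [← mul_assoc, ← Complex.exp_add]
  congr 2; push_cast; ring

section
variable {N : ℝ} {φ φ₁ φ₂ : ℝ → ℂ} {k₀ k₁ : ℂ} {A B : ℝ → ℂ}

/-- In frequency the Hankel equations are products. At −z the bracket is the boundary value of η
from above, and in the companion formula at z it is that of μ from below; the two equations are the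
two columns of the jump relation. -/
theorem IsRow.ft_fst (hr : IsRow φ φ₁ k₀ k₁ A B) (h : IsKernel N φ φ₁ φ₂) (z : ℝ) :
    ft A z = 4 * Complex.I * (k₁ + ft (pos B) (-z)) * ft φ₁ z := by
  have hi := integrable_pos hr.integrableOn_snd
  rw [funext hr.eq_fst, ft_const_mul, ft_add (h.integrable1.const_mul _)
    (integrable_xcorr hi h.integrable1), ft_const_mul, ft_xcorr hi h.integrable1]
  ring

theorem IsRow.ft_snd (hr : IsRow φ φ₁ k₀ k₁ A B) (h : IsKernel N φ φ₁ φ₂) (z : ℝ) :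
    ft B z = (k₀ + ft (pos A) (-z)) * ft (fun s => conj (φ s)) z := by
  have hi := integrable_pos hr.integrableOn_fst
  have hc := integrable_conj h.integrable0
  rw [funext hr.eq_snd, ft_add (hc.const_mul _) (integrable_xcorr hi hc), ft_const_mul,
    ft_xcorr hi hc]
  ring

end

section
variable {rp rm : ℝ → ℂ}

/-- The oscillating factor is a translation of the kernel by 2x, which is why c = 2x. -/
theorem ft_conj_shift {φ : ℝ → ℂ} {z : ℝ} (h : rp z = ft φ (-z)) (x : ℝ) :
    ft (fun s => conj (φ (2 * x + s))) z =
      conj (rp z) * Complex.exp (-2 * Complex.I * z * x) := by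
  rw [ft_comp_add_left (fun s => conj (φ s)), h, conj_ft, neg_neg, mul_comm]
  congr 2; push_cast; ring

theorem ft_shift {φ₁ : ℝ → ℂ} {z : ℝ} (h : rm z = -4 * Complex.I * ft φ₁ (-z)) (x : ℝ) :
    -4 * Complex.I * ft (fun s => φ₁ (2 * x + s)) (-z) =
      rm z * Complex.exp (2 * Complex.I * z * x) := by
  rw [ft_comp_add_left, h, mul_comm (Complex.exp _), ← mul_assoc]
  congr 2; push_cast; ring

theorem ae_eq_ft_of_data (hd : IsScatteringData rp rm) : ∀ᵐ z : ℝ,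
    rp z = ft (fun s => (1 / (2 * Real.pi) : ℂ) * ft rp s) (-z) ∧
    rm z = -4 * Complex.I * ft (fun s => (Complex.I / (8 * Real.pi) : ℂ) * ft rm s) (-z) := by
  have hk := isKernel_of_data hd.mem_plus hd.mem_minus hd.relation
  have hpi : (Real.pi : ℂ) ≠ 0 := by exact_mod_cast Real.pi_ne_zero
  have ip : Integrable (ft rp) := by
    refine (hk.integrable0.const_mul (2 * Real.pi : ℂ)).congr (ae_of_all _ fun s => ?_)
    field_simp
  have im : Integrable (ft rm) := by
    refine (hk.integrable1.const_mul (-Complex.I * (8 * Real.pi) : ℂ)).congr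
      (ae_of_all _ fun s => ?_)
    field_simp
    linear_combination -ft rm s * Complex.I_mul_I
  filter_upwards [ft_inversion hd.mem_plus.spec.1 hd.mem_plus.spec.2.1 ip,
    ft_inversion hd.mem_minus.spec.1 hd.mem_minus.spec.2.1 im] with z h1 h2
  constructor
  · rw [ft_const_mul, h1]
    push_cast; rfl
  · rw [ft_const_mul, h2]
    push_cast
    field_simp
    linear_combination 8 * ft (ft rm) (-z) * Complex.I_mul_I

/-- Solvability of the Riemann–Hilbert problem, with the two reconstruction integrals. -/
theorem IsScatteringData.exists_isRHSolution (hd : IsScatteringData rp rm) {N : ℝ}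
    {φ φ₁ φ₂ : ℝ → ℂ} (h : IsKernel N φ φ₁ φ₂)
    (hae : ∀ᵐ z : ℝ, rp z = ft φ (-z) ∧ rm z = -4 * Complex.I * ft φ₁ (-z)) (x : ℝ) :
    ∃ M Mp Mm, IsRHSolution rp rm x M Mp Mm ∧ (∀ i j, BddOff fun z => M z i j) ∧
      2 / (Real.pi * Complex.I) *
        (∫ z : ℝ, conj (rp z) * Complex.exp (-2 * Complex.I * z * x) * Mm z 0 0) =
          -4 * Complex.I * bval φ φ₁ (2 * x) ∧
      -1 / Real.pi * (∫ z : ℝ, rm z * Complex.exp (2 * Complex.I * z * x) * Mp z 1 1) =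
        2 * (4 * Complex.I * conj (bval' φ φ₁ (2 * x)) - 16 * (bval φ φ₁ (2 * x) *
          conj (bval φ φ₁ (2 * x))) * conj (bval φ φ₁ (2 * x))) := by
  obtain ⟨A, B, A', B', r, r', b0, a0⟩ := h.exists_rows (2 * x)
  have hs := h.shift (2 * x)
  set ψ : ℝ → ℂ := fun s => φ (2 * x + s) with hψ
  set ψ₁ : ℝ → ℂ := fun s => φ₁ (2 * x + s) with hψ₁
  set a : Fin 2 → ℝ → ℂ := ![A, A'] with ha
  set b : Fin 2 → ℝ → ℂ := ![B, B'] with hb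
  have rows : ∀ i, IsRow ψ ψ₁ ((1 : Matrix (Fin 2) (Fin 2) ℂ) i 0)
      ((1 : Matrix (Fin 2) (Fin 2) ℂ) i 1) (a i) (b i) := by
    rw [Fin.forall_fin_two]
    exact ⟨by simpa [ha, hb] using r, by simpa [ha, hb] using r'⟩
  -- The reflection accounts for r₋ being a transform at −z, and the sign makes the lower boundary
  -- value of the first column equal to the transform of `pos (a i)` at −z.
  set G : Fin 2 → Fin 2 → ℝ → ℂ := fun i => ![fun s => -(a i (-s)), b i] with hG
  have hft : ∀ᵐ z : ℝ, ft (fun s => conj (ψ s)) z =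
      conj (rp z) * Complex.exp (-2 * Complex.I * z * x) ∧
      -4 * Complex.I * ft ψ₁ (-z) = rm z * Complex.exp (2 * Complex.I * z * x) := by
    filter_upwards [hae] with z hz
    exact ⟨ft_conj_shift hz.1 x, ft_shift hz.2 x⟩
  have hM : ∀ i z, cauchyM (G i 0) z = ft (pos (a i)) (-z) := by
    intro i z
    have e : (pos fun s => G i 0 (-s)) = fun s => -1 * pos (a i) s := by
      ext s
      rcases lt_or_ge 0 s with h | h
      · rw [pos_of_pos h, pos_of_pos h]; simp [hG]
      · rw [pos_of_nonpos h, pos_of_nonpos h, mul_zero]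
    rw [cauchyM, e, ft_const_mul]; ring
  have e0 : ∀ i z, ft (G i 0) z =
      ((1 : Matrix (Fin 2) (Fin 2) ℂ) i 1 + cauchyP (G i 1) z) * (-4 * Complex.I * ft ψ₁ (-z)) := by
    intro i z
    have e : G i 0 = fun s => -1 * (fun t => a i (-t)) s := by ext s; simp [hG]
    rw [e, ft_const_mul, ft_comp_neg, (rows i).ft_fst hs, neg_neg, cauchyP]
    simp only [hG, Matrix.cons_val_one, Matrix.cons_val_fin_one]
    ring
  have e1 : ∀ i z, ft (G i 1) z = ((1 : Matrix (Fin 2) (Fin 2) ℂ) i 0 + cauchyM (G i 0) z) *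
      ft (fun s => conj (ψ s)) z := by
    intro i z
    rw [hM, ← (rows i).ft_snd hs]; simp [hG]
  have hGi : ∀ i j, Integrable (G i j) := by
    intro i j
    fin_cases j
    · exact ((rows i).integrable_fst hs).comp_neg.neg
    · exact (rows i).integrable_snd hs
  have hbd : ∀ i j, ∃ C, ∀ s, ‖G i j s‖ ≤ C := by
    intro i j
    fin_cases j
    · obtain ⟨C, hC⟩ := (rows i).exists_norm_fst_le hs
      exact ⟨C, fun s => by simpa [hG] using hC (-s)⟩
    · obtain ⟨C, hC⟩ := (rows i).exists_norm_snd_le hs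
      exact ⟨C, fun s => by simpa [hG] using hC s⟩
  have hsol := isRHSolution_of_jump (rp := rp) (rm := rm) (x := x) hGi hbd (by
    filter_upwards [hft] with z hz
    ext i j
    -- The rows give the first column of the jump as η₊ r₋ e^{2izx}; the jump of the second column
    -- expresses η₊ through lower values, as the jump matrix requires.
    have e2 := cauchyP_sub_cauchyM (hGi i 1) z
    rw [e1, hz.1] at e2
    rw [Matrix.mul_apply, Fin.sum_univ_two]
    fin_cases j
    · simp only [jumpMatrix, Fin.zero_eta, Matrix.of_apply, Matrix.add_apply, e0, hz.2,
        Matrix.cons_val_zero, Matrix.cons_val_one, Matrix.cons_val', Matrix.cons_val_fin_one]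
      have e3 : Complex.exp (-2 * Complex.I * z * x) * Complex.exp (2 * Complex.I * z * x) = 1 := by
        rw [← Complex.exp_add, ← Complex.exp_zero]; congr 1; ring
      linear_combination (rm z * Complex.exp (2 * Complex.I * z * x)) * e2 +
        ((1 : Matrix (Fin 2) (Fin 2) ℂ) i 0 + cauchyM (G i 0) z) * conj (rp z) * rm z * e3
    · simp only [jumpMatrix, Fin.mk_one, Matrix.of_apply, Matrix.add_apply, e1, hz.1,
        Matrix.cons_val_zero, Matrix.cons_val_one, Matrix.cons_val', Matrix.cons_val_fin_one,
        mul_zero, add_zero])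
  have hexp : ∀ k z : ℝ, ‖Complex.exp (k * Complex.I * z * x)‖ = 1 := fun k z => by
    rw [Complex.norm_exp]; simp
  have ip : Integrable (ft fun s => conj (ψ s)) := by
    have : Integrable fun z : ℝ => conj (rp z) * Complex.exp ((-2 : ℝ) * Complex.I * z * x) :=
      (integrable_conj hd.mem_plus.spec.1).mul_bdd (c := 1)
        (Continuous.aestronglyMeasurable (by fun_prop)) (ae_of_all _ fun z => (hexp _ z).le)
    refine this.congr ?_
    filter_upwards [hft] with z hz
    rw [hz.1]; push_cast; rfl
  have im : Integrable (ft ψ₁) := by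
    have : Integrable fun z : ℝ => rm z * Complex.exp ((2 : ℝ) * Complex.I * z * x) :=
      hd.mem_minus.spec.1.mul_bdd (c := 1)
        (Continuous.aestronglyMeasurable (by fun_prop)) (ae_of_all _ fun z => (hexp _ z).le)
    have h2 : Integrable fun z => -4 * Complex.I * ft ψ₁ (-z) := by
      refine this.congr ?_
      filter_upwards [hft] with z hz
      rw [hz.2]; push_cast; rfl
    have h3 := h2.comp_neg.const_mul (Complex.I / 4)
    refine h3.congr (ae_of_all _ fun z => ?_)
    simp only [neg_neg]
    linear_combination -ft ψ₁ z * Complex.I_mul_I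
  have iB : Integrable (ft B) := by
    have e : ft B = fun z => (1 + ft (pos A) (-z)) * ft (fun s => conj (ψ s)) z :=
      funext fun z => r.ft_snd hs z
    have hA := integrable_pos r.integrableOn_fst
    rw [e]
    refine ip.bdd_mul (c := 1 + ∫ s, ‖pos A s‖) ?_ (ae_of_all _ fun z => ?_)
    · have := continuous_ft hA
      exact Continuous.aestronglyMeasurable (by fun_prop)
    · refine (norm_add_le _ _).trans ?_
      rw [norm_one]; gcongr; exact norm_ft_le _ _
  have iA : Integrable (ft A') := by
    have e : ft A' = fun z => 4 * Complex.I * (1 + ft (pos B') (-z)) * ft ψ₁ z :=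
      funext fun z => r'.ft_fst hs z
    have hB := integrable_pos r'.integrableOn_snd
    rw [e]
    refine im.bdd_mul (c := 4 * (1 + ∫ s, ‖pos B' s‖)) ?_ (ae_of_all _ fun z => ?_)
    · have := continuous_ft hB
      exact Continuous.aestronglyMeasurable (by fun_prop)
    · rw [norm_mul, show ‖4 * Complex.I‖ = 4 by simp]
      refine mul_le_mul_of_nonneg_left ((norm_add_le _ _).trans ?_) (by norm_num)
      rw [norm_one]; gcongr; exact norm_ft_le _ _
  have hpi : (Real.pi : ℂ) ≠ 0 := by exact_mod_cast Real.pi_ne_zero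
  refine ⟨_, _, _, hsol, fun i j => ?_, ?_, ?_⟩
  · obtain ⟨C, hC⟩ := bddOff_cauchyT (hGi i j)
    exact ⟨‖(1 : Matrix (Fin 2) (Fin 2) ℂ) i j‖ + C,
      fun z hz => (norm_add_le _ _).trans (add_le_add_right (hC z hz) _)⟩
  · have e : ∫ z : ℝ, conj (rp z) * Complex.exp (-2 * Complex.I * z * x) *
        (1 + Matrix.of fun i j => cauchyM (G i j) z : Matrix (Fin 2) (Fin 2) ℂ) 0 0 =
        ∫ z, ft B z := by
      refine integral_congr_ae ?_
      filter_upwards [hft] with z hz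
      have := e1 0 z
      simp only [hG, hb, Matrix.cons_val_zero, Matrix.cons_val_one, Matrix.cons_val_fin_one] at this
      rw [this, hz.1, Matrix.add_apply, Matrix.of_apply, mul_comm]
      rfl
    rw [e, integral_ft (r.integrable_snd hs) (r.continuous_snd hs) iB, b0]
    field_simp
    linear_combination 4 * bval φ φ₁ (2 * x) * Complex.I_mul_I
  · have e : ∫ z : ℝ, rm z * Complex.exp (2 * Complex.I * z * x) *
        (1 + Matrix.of fun i j => cauchyP (G i j) z : Matrix (Fin 2) (Fin 2) ℂ) 1 1 =
        ∫ z, -ft A' (-z) := by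
      refine integral_congr_ae ?_
      filter_upwards [hft] with z hz
      have h1 := e0 1 z
      have h2 : ft (G 1 0) z = -ft A' (-z) := by
        have e : G 1 0 = fun s => -1 * (fun t => A' (-t)) s := by ext s; simp [hG, ha]
        rw [e, ft_const_mul, ft_comp_neg]; ring
      rw [← h2, h1, hz.2, Matrix.add_apply, Matrix.of_apply, mul_comm]
    rw [e, integral_neg, integral_neg_eq_self (ft A'),
      integral_ft (r'.integrable_fst hs) (r'.continuous_fst hs) iA, a0]
    field_simp

end

/-! ### Functions without jump, and uniqueness of the solution -/

/-- A continuous function on the plane that is analytic off the real line is entire. -/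
theorem differentiable_of_continuous_of_differentiableOn {F : ℂ → ℂ} (hc : Continuous F)
    (hd : DifferentiableOn ℂ F {z | z.im ≠ 0}) : Differentiable ℂ F := by
  rw [← differentiableOn_univ,
    ← Complex.isConservativeOn_and_continuousOn_iff_isDifferentiableOn isOpen_univ]
  refine ⟨fun z w _ => ?_, hc.continuousOn⟩
  rw [← add_eq_zero_iff_eq_neg, Complex.wedgeIntegral_add_wedgeIntegral_eq]
  -- A rectangle with a side on the real axis has no real point in its interior, so Cauchy's theorem
  -- applies to it; any other rectangle is cut along the axis into two such.
  have key : ∀ z w : ℂ, (z.im = 0 ∨ w.im = 0) →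
      (∫ x : ℝ in z.re..w.re, F (x + z.im * Complex.I)) -
      (∫ x : ℝ in z.re..w.re, F (x + w.im * Complex.I)) +
      Complex.I • (∫ y : ℝ in z.im..w.im, F (w.re + y * Complex.I)) -
      Complex.I • (∫ y : ℝ in z.im..w.im, F (z.re + y * Complex.I)) = 0 := by
    intro z w h
    refine Complex.integral_boundary_rect_eq_zero_of_continuousOn_of_differentiableOn F z w
      hc.continuousOn (hd.mono ?_)
    intro v hv
    have h2 := (Complex.mem_reProdIm.1 hv).2
    simp only [mem_Ioo, min_lt_iff, lt_max_iff] at h2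
    intro (h0 : v.im = 0)
    rw [h0] at h2
    rcases h with h | h <;> rw [h] at h2 <;> rcases h2 with ⟨h3 | h3, h4 | h4⟩ <;> linarith
  have e1 := key z (w.re : ℂ) (by simp)
  have e2 := key (z.re : ℂ) w (by simp)
  simp only [Complex.ofReal_re, Complex.ofReal_im] at e1 e2
  have hi : ∀ s a b : ℝ, IntervalIntegrable (fun y : ℝ => F (s + y * Complex.I)) volume a b :=
    fun s a b => Continuous.intervalIntegrable (by fun_prop) _ _
  rw [← intervalIntegral.integral_add_adjacent_intervals (hi w.re z.im 0) (hi w.re 0 w.im),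
    ← intervalIntegral.integral_add_adjacent_intervals (hi z.re z.im 0) (hi z.re 0 w.im),
    smul_add, smul_add]
  linear_combination e1 + e2

section
variable {f : ℝ → ℝ → ℂ} {K : ℝ≥0}

theorem eLpNorm_one_restrict_le {g : ℝ → ℂ} (hg : AEStronglyMeasurable g)
    (hK : eLpNorm g 2 volume ≤ K) (s : Set ℝ) :
    eLpNorm g 1 (volume.restrict s) ≤ K * volume s ^ (1 / 2 : ℝ) := by
  have h := eLpNorm_le_eLpNorm_mul_rpow_measure_univ (μ := volume.restrict s) (p := 1) (q := 2)
    (by norm_num) hg.restrict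
  rw [Measure.restrict_apply_univ] at h
  norm_num at h ⊢
  exact h.trans (mul_le_mul_left ((eLpNorm_restrict_le _ _ _ _).trans hK) _)

/-- Vitali's theorem: the uniform L² bound makes the family uniformly integrable on a bounded
interval, so convergence almost everywhere becomes convergence in L¹. -/
theorem tendsto_eLpNorm_one_sub (hf : ∀ y, MemLp (f y) 2) (hK : ∀ y, eLpNorm (f y) 2 volume ≤ K)
    {y₀ : ℝ} (hc : ∀ᵐ s, ContinuousAt (fun y => f y s) y₀) (a b : ℝ) :
    Tendsto (fun y => eLpNorm (f y - f y₀) 1 (volume.restrict (Ioc a b))) (𝓝 y₀) (𝓝 0) := by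
  refine tendsto_of_seq_tendsto fun u hu => ?_
  refine tendsto_Lp_finite_of_tendsto_ae le_rfl (by norm_num) (fun n => (hf (u n)).1.restrict)
    (((hf y₀).restrict _).mono_exponent (by norm_num)) (fun ε hε => ?_) ?_
  · refine ⟨(ε / (K + 1)) ^ 2, by positivity, fun n s hs hsδ => ?_⟩
    rw [eLpNorm_indicator_eq_eLpNorm_restrict hs, Measure.restrict_restrict hs]
    refine (eLpNorm_one_restrict_le (hf (u n)).1 (hK _) _).trans ?_
    rw [Measure.restrict_apply hs] at hsδ
    refine (mul_le_mul_right (ENNReal.rpow_le_rpow hsδ (by norm_num)) _).trans ?_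
    rw [ENNReal.ofReal_rpow_of_pos (by positivity), ← Real.sqrt_eq_rpow,
      Real.sqrt_sq (by positivity), ← ENNReal.ofReal_coe_nnreal,
      ← ENNReal.ofReal_mul (by positivity)]
    refine ENNReal.ofReal_le_ofReal ?_
    rw [mul_div_assoc', div_le_iff₀ (by positivity)]
    nlinarith [K.coe_nonneg]
  · filter_upwards [ae_restrict_of_ae hc] with s hs
    exact hs.tendsto.comp hu

theorem intervalIntegrable_of_memLp_two {g : ℝ → ℂ} (hg : MemLp g 2) (a b : ℝ) :
    IntervalIntegrable g volume a b := by
  rw [intervalIntegrable_iff, uIoc]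
  exact (hg.restrict _).integrable (by norm_num)

theorem norm_intervalIntegral_le_toReal {g : ℝ → ℂ} (hg : MemLp g 2) {a b s t : ℝ} (hst : s ≤ t)
    (ha : a ≤ s) (hb : t ≤ b) :
    ‖∫ x in s..t, g x‖ ≤ (eLpNorm g 1 (volume.restrict (Ioc a b))).toReal := by
  have hi : ∀ a b, Integrable g (volume.restrict (Ioc a b)) := fun a b =>
    (hg.restrict _).integrable (by norm_num)
  rw [intervalIntegral.integral_of_le hst, eLpNorm_one_eq_lintegral_enorm]
  refine (norm_integral_le_integral_norm _).trans ?_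
  rw [← integral_norm_eq_lintegral_enorm (hi a b).1]
  exact setIntegral_mono_set (hi a b).norm (ae_of_all _ fun _ => norm_nonneg _)
    (Ioc_subset_Ioc ha hb).eventuallyLE

/-- Averaging over a short horizontal segment turns boundary values that exist only almost
everywhere into a function continuous across the axis. -/
theorem continuous_integral_of_memLp_two (hf : ∀ y, MemLp (f y) 2)
    (hK : ∀ y, eLpNorm (f y) 2 volume ≤ K)
    (hc : ∀ y₀, ∀ᵐ s, ContinuousAt (fun y => f y s) y₀) {δ : ℝ} (hδ : 0 ≤ δ) :
    Continuous fun p : ℝ × ℝ => ∫ x in p.1..p.1 + δ, f p.2 x := by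
  rw [continuous_iff_continuousAt]
  rintro ⟨s₀, y₀⟩
  have h1 : Tendsto (fun p : ℝ × ℝ => ∫ x in p.1..p.1 + δ, f y₀ x) (𝓝 (s₀, y₀))
      (𝓝 (∫ x in s₀..s₀ + δ, f y₀ x)) := by
    have hp : Continuous fun t => ∫ x in (0 : ℝ)..t, f y₀ x :=
      intervalIntegral.continuous_primitive (intervalIntegrable_of_memLp_two (hf y₀)) 0
    have e : ∀ s, ∫ x in s..s + δ, f y₀ x =
        (∫ x in (0 : ℝ)..s + δ, f y₀ x) - ∫ x in (0 : ℝ)..s, f y₀ x := fun s => by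
      rw [eq_sub_iff_add_eq', intervalIntegral.integral_add_adjacent_intervals]
      · exact intervalIntegrable_of_memLp_two (hf y₀) _ _
      · exact intervalIntegrable_of_memLp_two (hf y₀) _ _
    simp_rw [e]
    exact Continuous.tendsto (f := fun p : ℝ × ℝ =>
      (∫ x in (0 : ℝ)..p.1 + δ, f y₀ x) - ∫ x in (0 : ℝ)..p.1, f y₀ x) (by fun_prop) (s₀, y₀)
  have h2 : Tendsto (fun p : ℝ × ℝ => (∫ x in p.1..p.1 + δ, f p.2 x) -
      ∫ x in p.1..p.1 + δ, f y₀ x) (𝓝 (s₀, y₀)) (𝓝 0) := by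
    have h3 := tendsto_eLpNorm_one_sub hf hK (hc y₀) (s₀ - 1) (s₀ + 1 + δ)
    have h4 := (ENNReal.tendsto_toReal ENNReal.zero_ne_top).comp h3
    refine squeeze_zero_norm' ?_ (h4.comp (continuous_snd.tendsto (s₀, y₀)))
    have hev : ∀ᶠ p : ℝ × ℝ in 𝓝 (s₀, y₀), p.1 ∈ Icc (s₀ - 1) (s₀ + 1) :=
      continuous_fst.continuousAt.eventually (Icc_mem_nhds (by simp) (by simp))
    filter_upwards [hev] with p hp
    rw [← intervalIntegral.integral_sub (intervalIntegrable_of_memLp_two (hf _) _ _)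
      (intervalIntegrable_of_memLp_two (hf _) _ _)]
    exact norm_intervalIntegral_le_toReal ((hf p.2).sub (hf y₀)) (by linarith) hp.1
      (by linarith [hp.2])
  have := h2.add h1
  rw [ContinuousAt]
  simpa using this

end

theorem differentiableOn_integral_translate {H : ℂ → ℂ}
    (hd : DifferentiableOn ℂ H {z | z.im ≠ 0}) (δ : ℝ) :
    ∀ z : ℂ, z.im ≠ 0 → HasDerivAt (fun z => ∫ t in (0 : ℝ)..δ, H (z + t))
      (∫ t in (0 : ℝ)..δ, deriv H (z + t)) z := by
  intro z hz
  have hU : IsOpen {z : ℂ | z.im ≠ 0} := isOpen_ne_fun Complex.continuous_im continuous_const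
  have hd' := hd.deriv hU
  set r := |z.im| / 2 with hr
  have hzpos : 0 < |z.im| := abs_pos.2 hz
  have hball : ∀ w ∈ Metric.closedBall z r, ∀ t : ℝ, w + t ∈ {z : ℂ | z.im ≠ 0} := by
    intro w hw t h0
    have h1 : |(w - z).im| ≤ ‖w - z‖ := Complex.abs_im_le_norm _
    have h2 : ‖w - z‖ ≤ r := by rwa [← dist_eq_norm]
    have h3 : w.im = 0 := by simpa using h0
    rw [Complex.sub_im, h3, zero_sub, abs_neg] at h1
    linarith
  have hcont : ContinuousOn (fun p : ℂ × ℝ => deriv H (p.1 + p.2))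
      (Metric.closedBall z r ×ˢ uIcc 0 δ) := by
    refine hd'.continuousOn.comp (by fun_prop) ?_
    rintro ⟨w, t⟩ ⟨hw, -⟩
    exact hball w hw t
  obtain ⟨C, hC⟩ := ((isCompact_closedBall z r).prod isCompact_uIcc).exists_bound_of_continuousOn hcont
  have hz0 : ∀ w ∈ Metric.closedBall z r, Continuous fun t : ℝ => H (w + t) := fun w hw =>
    hd.continuousOn.comp_continuous (by fun_prop) (hball w hw)
  have hzz : z ∈ Metric.closedBall z r := Metric.mem_closedBall_self (by positivity)
  refine (intervalIntegral.hasDerivAt_integral_of_dominated_loc_of_deriv_le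
    (F := fun w (t : ℝ) => H (w + t)) (F' := fun w (t : ℝ) => deriv H (w + t)) (bound := fun _ => C)
    (Metric.ball_mem_nhds z (by positivity : 0 < r)) ?_
    ((hz0 z hzz).intervalIntegrable _ _) ?_ (ae_of_all _ fun t ht w hw => ?_)
    intervalIntegrable_const (ae_of_all _ fun t ht w hw => ?_)).2
  · filter_upwards [Metric.ball_mem_nhds z (by positivity : 0 < r)] with w hw
    exact (hz0 w (Metric.ball_subset_closedBall hw)).aestronglyMeasurable
  · exact (hd'.continuousOn.comp_continuous (by fun_prop) (hball z hzz)).aestronglyMeasurable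
  · exact hC (w, t) ⟨Metric.ball_subset_closedBall hw, uIoc_subset_uIcc ht⟩
  · have := (hd.differentiableAt (hU.mem_nhds
      (hball w (Metric.ball_subset_closedBall hw) t))).hasDerivAt
    exact this.comp_add_const w t

/-- A function in the Hardy classes of both half-planes whose boundary values agree vanishes. -/
theorem eq_zero_of_hardy {H : ℂ → ℂ} (hd : DifferentiableOn ℂ H {z | z.im ≠ 0}) {K : ℝ≥0}
    (h2 : ∀ y : ℝ, MemLp (fun s : ℝ => H (s + y * Complex.I)) 2)
    (hK : ∀ y : ℝ, eLpNorm (fun s : ℝ => H (s + y * Complex.I)) 2 volume ≤ K)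
    (hb : ∀ᵐ s : ℝ, ContinuousAt (fun y : ℝ => H (s + y * Complex.I)) 0) {z : ℂ} (hz : z.im ≠ 0) :
    H z = 0 := by
  have hU : IsOpen {z : ℂ | z.im ≠ 0} := isOpen_ne_fun Complex.continuous_im continuous_const
  have hc : ∀ y₀ : ℝ, ∀ᵐ s : ℝ, ContinuousAt (fun y : ℝ => H (s + y * Complex.I)) y₀ := by
    intro y₀
    by_cases h0 : y₀ = 0
    · rw [h0]; exact hb
    · refine ae_of_all _ fun s => ?_
      have h1 : ContinuousAt H (s + y₀ * Complex.I) :=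
        hd.continuousOn.continuousAt (hU.mem_nhds (by simpa using h0))
      exact ContinuousAt.comp (f := fun y : ℝ => (s + y * Complex.I : ℂ)) h1 (by fun_prop)
  have hconst : ∀ δ : ℝ, 0 < δ → ∀ w : ℂ, w.im ≠ 0 → H (w + δ) = H w := by
    intro δ hδ w hw
    -- The horizontal average is continuous across the axis, hence entire; it is bounded by
    -- Cauchy–Schwarz, hence constant. Its derivative off the axis is H(z + δ) − H(z), which is
    -- therefore zero.
    set F : ℂ → ℂ := fun z => ∫ t in (0 : ℝ)..δ, H (z + t) with hF
    have eF : ∀ z, F z = ∫ x in z.re..z.re + δ, H (x + z.im * Complex.I) := by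
      intro z
      have := intervalIntegral.integral_comp_add_left (a := 0) (b := δ)
        (fun x : ℝ => H (x + z.im * Complex.I)) z.re
      rw [add_zero] at this
      rw [← this]
      refine intervalIntegral.integral_congr fun t _ => congrArg H ?_
      conv_lhs => rw [← Complex.re_add_im z]
      push_cast; ring
    have hFc : Continuous F := by
      rw [show F = (fun p : ℝ × ℝ => ∫ x in p.1..p.1 + δ, H (x + p.2 * Complex.I)) ∘
        fun z : ℂ => (z.re, z.im) from funext eF]
      exact (continuous_integral_of_memLp_two (f := fun y s => H (s + y * Complex.I)) h2 hK hc
        hδ.le).comp (by fun_prop)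
    have hFd : Differentiable ℂ F := differentiable_of_continuous_of_differentiableOn hFc
      fun z hz => (differentiableOn_integral_translate hd δ z hz).differentiableAt.differentiableWithinAt
    have hFb : Bornology.IsBounded (range F) := by
      rw [isBounded_iff_forall_norm_le]
      refine ⟨(K * ENNReal.ofReal δ ^ (1 / 2 : ℝ)).toReal, ?_⟩
      rintro _ ⟨z, rfl⟩
      rw [eF]
      refine (norm_intervalIntegral_le_toReal (h2 z.im) (by linarith) le_rfl le_rfl).trans ?_
      refine ENNReal.toReal_mono (ENNReal.mul_ne_top ENNReal.coe_ne_top (by simp)) ?_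
      refine (eLpNorm_one_restrict_le (h2 z.im).1 (hK _) _).trans (le_of_eq ?_)
      rw [Real.volume_Ioc]; congr 3; ring
    have hF0 : ∀ z, F z = F w := fun z => hFd.apply_eq_apply_of_bounded hFb z w
    have hd0 := differentiableOn_integral_translate hd δ w hw
    have e1 : (fun z => ∫ t in (0 : ℝ)..δ, H (z + t)) = fun _ => F w := funext hF0
    rw [e1] at hd0
    have e2 := hd0.unique (hasDerivAt_const w (F w))
    have hw' : ∀ t : ℝ, (w + t : ℂ) ∈ {z : ℂ | z.im ≠ 0} := fun t => by simpa using hw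
    have e3 : ∫ t in (0 : ℝ)..δ, deriv H (w + t) = H (w + δ) - H (w + (0 : ℝ)) := by
      refine intervalIntegral.integral_eq_sub_of_hasDerivAt (f := fun t : ℝ => H (w + t))
        (fun t _ => ?_) ?_
      · have h1 := (hd.differentiableAt (hU.mem_nhds (hw' t))).hasDerivAt
        have h2 := (h1.comp_const_add w (t : ℂ)).comp_ofReal
        exact h2
      · exact ((hd.deriv hU).continuousOn.comp_continuous (by fun_prop) hw').intervalIntegrable _ _
    rw [e2, Complex.ofReal_zero, add_zero] at e3
    exact (sub_eq_zero.1 e3.symm)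
  have hall : ∀ s : ℝ, H (s + z.im * Complex.I) = H (z.im * Complex.I) := by
    intro s
    rcases lt_trichotomy s 0 with h | h | h
    · rw [← hconst (-s) (by linarith) (s + z.im * Complex.I) (by simpa using hz)]
      congr 1; push_cast; ring
    · rw [h]; simp
    · rw [← hconst s h (z.im * Complex.I) (by simpa using hz)]
      congr 1; ring
  -- A constant that is square integrable on a line is zero.
  have h3 := h2 z.im
  simp_rw [hall] at h3
  rw [memLp_const_iff (by norm_num) (by norm_num)] at h3
  rcases h3 with h3 | h3
  · rw [← Complex.re_add_im z, hall, h3]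
  · simp at h3

/-- `f` is analytic off the real line with boundary values `fp` and `fm`. -/
structure HasBoundaryValues (f : ℂ → ℂ) (fp fm : ℝ → ℂ) : Prop where
  analytic : DifferentiableOn ℂ f {z | z.im ≠ 0}
  plus : ∀ᵐ s : ℝ, Tendsto (fun ε : ℝ => f (s + ε * Complex.I)) (𝓝[>] 0) (𝓝 (fp s))
  minus : ∀ᵐ s : ℝ, Tendsto (fun ε : ℝ => f (s - ε * Complex.I)) (𝓝[>] 0) (𝓝 (fm s))

/-- The uniform `L²` bound of the Hardy classes. -/
def HardyBound (f : ℂ → ℂ) : Prop :=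
  ∃ K : ℝ≥0, ∀ y : ℝ, y ≠ 0 → eLpNorm (fun s : ℝ => f (s + y * Complex.I)) 2 volume ≤ K

section
variable {f g : ℂ → ℂ} {fp fm gp gm : ℝ → ℂ}

theorem HasBoundaryValues.mul (hf : HasBoundaryValues f fp fm) (hg : HasBoundaryValues g gp gm) :
    HasBoundaryValues (fun z => f z * g z) (fun s => fp s * gp s) (fun s => fm s * gm s) where
  analytic := hf.analytic.mul hg.analytic
  plus := by filter_upwards [hf.plus, hg.plus] with s h1 h2 using h1.mul h2
  minus := by filter_upwards [hf.minus, hg.minus] with s h1 h2 using h1.mul h2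

theorem HasBoundaryValues.add (hf : HasBoundaryValues f fp fm) (hg : HasBoundaryValues g gp gm) :
    HasBoundaryValues (fun z => f z + g z) (fun s => fp s + gp s) (fun s => fm s + gm s) where
  analytic := hf.analytic.add hg.analytic
  plus := by filter_upwards [hf.plus, hg.plus] with s h1 h2 using h1.add h2
  minus := by filter_upwards [hf.minus, hg.minus] with s h1 h2 using h1.add h2

theorem HasBoundaryValues.neg (hf : HasBoundaryValues f fp fm) :
    HasBoundaryValues (fun z => -f z) (fun s => -fp s) (fun s => -fm s) where
  analytic := hf.analytic.neg
  plus := by filter_upwards [hf.plus] with s h1 using h1.neg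
  minus := by filter_upwards [hf.minus] with s h1 using h1.neg

theorem line_mem_off {y : ℝ} (hy : y ≠ 0) (s : ℝ) :
    (s + y * Complex.I : ℂ) ∈ {z : ℂ | z.im ≠ 0} := by simpa using hy

theorem HasBoundaryValues.continuous_line (hf : HasBoundaryValues f fp fm) {y : ℝ} (hy : y ≠ 0) :
    Continuous fun s : ℝ => f (s + y * Complex.I) :=
  hf.analytic.continuousOn.comp_continuous (by fun_prop) (line_mem_off hy)

theorem HardyBound.mul (hf : HardyBound f) (hg : BddOff g) : HardyBound fun z => f z * g z := by
  obtain ⟨K, hK⟩ := hf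
  obtain ⟨C, hC⟩ := hg
  refine ⟨C.toNNReal * K, fun y hy => ?_⟩
  have h1 : eLpNorm (fun s : ℝ => f (s + y * Complex.I) * g (s + y * Complex.I)) 2 volume ≤
      ENNReal.ofReal C * eLpNorm (fun s : ℝ => f (s + y * Complex.I)) 2 volume := by
    refine eLpNorm_le_mul_eLpNorm_of_ae_le_mul (ae_of_all _ fun s => ?_) 2
    rw [norm_mul, mul_comm]
    exact mul_le_mul_of_nonneg_right (hC _ (line_mem_off hy s)) (norm_nonneg _)
  refine h1.trans ?_
  rw [ENNReal.coe_mul]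
  exact mul_le_mul_right (hK y hy) _

theorem HardyBound.add (hf : HardyBound f) (hg : HardyBound g)
    (hf' : HasBoundaryValues f fp fm) (hg' : HasBoundaryValues g gp gm) :
    HardyBound fun z => f z + g z := by
  obtain ⟨K, hK⟩ := hf
  obtain ⟨L, hL⟩ := hg
  refine ⟨K + L, fun y hy => ?_⟩
  refine (eLpNorm_add_le (hf'.continuous_line hy).aestronglyMeasurable
    (hg'.continuous_line hy).aestronglyMeasurable (by norm_num)).trans ?_
  rw [ENNReal.coe_add]
  exact add_le_add (hK y hy) (hL y hy)

theorem HardyBound.neg (hf : HardyBound f) : HardyBound fun z => -f z := by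
  obtain ⟨K, hK⟩ := hf
  refine ⟨K, fun y hy => ?_⟩
  have := eLpNorm_neg (fun s : ℝ => f (s + y * Complex.I)) 2 volume
  exact this.le.trans (hK y hy)

/-- By Fatou the boundary function inherits the L² bound. Extending f by it to the axis gives a
function to which `eq_zero_of_hardy` applies. -/
theorem HasBoundaryValues.eq_zero (hf : HasBoundaryValues f fp fm) (hH : HardyBound f)
    (h : fp =ᵐ[volume] fm) {z : ℂ} (hz : z.im ≠ 0) : f z = 0 := by
  obtain ⟨K, hK⟩ := hH
  have hm : ∀ y : ℝ, y ≠ 0 → MemLp (fun s : ℝ => f (s + y * Complex.I)) 2 := fun y hy =>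
    ⟨(hf.continuous_line hy).aestronglyMeasurable, (hK y hy).trans_lt ENNReal.coe_lt_top⟩
  set u : ℕ → ℝ := fun n => 1 / ((n : ℝ) + 1) with hu
  have hupos : ∀ n, 0 < u n := fun n => by positivity
  have hu0 : Tendsto u atTop (𝓝[>] 0) :=
    tendsto_nhdsWithin_iff.2 ⟨tendsto_one_div_add_atTop_nhds_zero_nat, Eventually.of_forall hupos⟩
  have hlim : ∀ᵐ s : ℝ, Tendsto (fun n => f (s + u n * Complex.I)) atTop (𝓝 (fp s)) := by
    filter_upwards [hf.plus] with s hs using hs.comp hu0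
  have hfp : AEStronglyMeasurable fp volume :=
    aestronglyMeasurable_of_tendsto_ae atTop (fun n => (hm _ (hupos n).ne').1) hlim
  have hfpK : eLpNorm fp 2 volume ≤ K := by
    refine (Lp.eLpNorm_lim_le_liminf_eLpNorm (fun n => (hm _ (hupos n).ne').1) fp hlim).trans ?_
    refine (liminf_le_liminf (Eventually.of_forall fun n => hK _ (hupos n).ne')).trans ?_
    simp
  set H : ℂ → ℂ := fun z => if z.im = 0 then fp z.re else f z with hH
  have hHf : ∀ z : ℂ, z.im ≠ 0 → H z = f z := fun z hz => if_neg hz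
  have hHy : ∀ y : ℝ, y ≠ 0 →
      (fun s : ℝ => H (s + y * Complex.I)) = fun s : ℝ => f (s + y * Complex.I) := fun y hy =>
    funext fun s => hHf _ (line_mem_off hy s)
  have hH0 : (fun s : ℝ => H (s + (0 : ℝ) * Complex.I)) = fp := by
    ext s; simp [hH]
  rw [← hHf z hz]
  refine eq_zero_of_hardy (K := K) (hf.analytic.congr hHf) (fun y => ?_) (fun y => ?_) ?_ hz
  · by_cases hy : y = 0
    · rw [hy, hH0]; exact ⟨hfp, hfpK.trans_lt ENNReal.coe_lt_top⟩
    · rw [hHy y hy]; exact hm y hy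
  · by_cases hy : y = 0
    · rw [hy, hH0]; exact hfpK
    · rw [hHy y hy]; exact hK y hy
  · filter_upwards [hf.plus, hf.minus, h] with s h1 h2 h3
    rw [← continuousWithinAt_compl_self, ContinuousWithinAt, show H (s + (0 : ℝ) * Complex.I) = fp s
      from congrFun hH0 s, ← Iio_union_Ioi, nhdsWithin_union, tendsto_sup]
    constructor
    · rw [h3]
      have hneg : Tendsto (fun y : ℝ => -y) (𝓝[<] 0) (𝓝[>] 0) := by
        have := tendsto_neg_nhdsLT (a := (0 : ℝ))
        rwa [neg_zero] at this
      refine (h2.comp hneg).congr' ?_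
      filter_upwards [self_mem_nhdsWithin] with y hy
      rw [hHf _ (line_mem_off (ne_of_lt hy) s)]
      simp
    · refine h1.congr' ?_
      filter_upwards [self_mem_nhdsWithin] with y hy
      rw [hHf _ (line_mem_off (ne_of_gt hy) s)]

end

section
variable {rp rm : ℝ → ℂ} {x : ℝ} {M N : ℂ → Matrix (Fin 2) (Fin 2) ℂ}
  {Mp Mm Np Nm : ℝ → Matrix (Fin 2) (Fin 2) ℂ}

theorem IsRHSolution.hasBoundaryValues (h : IsRHSolution rp rm x M Mp Mm) (i j : Fin 2) :
    HasBoundaryValues (fun z => M z i j) (fun s => Mp s i j) (fun s => Mm s i j) where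
  analytic := h.analytic i j
  plus := by
    filter_upwards [h.boundary_plus] with s hs
    exact tendsto_pi_nhds.1 (tendsto_pi_nhds.1 hs i) j
  minus := by
    filter_upwards [h.boundary_minus] with s hs
    exact tendsto_pi_nhds.1 (tendsto_pi_nhds.1 hs i) j

theorem hasBoundaryValues_const (c : ℂ) :
    HasBoundaryValues (fun _ => c) (fun _ => c) (fun _ => c) where
  analytic := differentiableOn_const c
  plus := ae_of_all _ fun _ => tendsto_const_nhds
  minus := ae_of_all _ fun _ => tendsto_const_nhds

theorem IsRHSolution.hasBoundaryValues_sub_one (h : IsRHSolution rp rm x M Mp Mm) (i j : Fin 2) :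
    HasBoundaryValues (fun z => (M z - 1) i j) (fun s => (Mp s - 1) i j)
      (fun s => (Mm s - 1) i j) := by
  have := (h.hasBoundaryValues i j).add
    (hasBoundaryValues_const (-(1 : Matrix (Fin 2) (Fin 2) ℂ) i j))
  simp only [← sub_eq_add_neg] at this
  exact this

theorem IsRHSolution.hardyBound (h : IsRHSolution rp rm x M Mp Mm) (i j : Fin 2) :
    HardyBound fun z => (M z - 1) i j := by
  obtain ⟨K, hK⟩ := h.hardy
  exact ⟨K, fun y hy => hK y hy i j⟩

theorem det_one_add_jumpMatrix (rp rm : ℝ → ℂ) (x s : ℝ) :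
    (1 + jumpMatrix rp rm x s).det = 1 := by
  have e3 : Complex.exp (-2 * Complex.I * s * x) * Complex.exp (2 * Complex.I * s * x) = 1 := by
    rw [← Complex.exp_add, ← Complex.exp_zero]; congr 1; ring
  rw [Matrix.det_fin_two]
  simp [jumpMatrix]
  simp only [neg_mul] at e3
  linear_combination -conj (rp s) * rm s * e3

theorem IsRHSolution.plus_eq (h : IsRHSolution rp rm x M Mp Mm) :
    ∀ᵐ s, Mp s = Mm s * (1 + jumpMatrix rp rm x s) := by
  filter_upwards [h.jump] with s hs
  rw [mul_add, mul_one, ← hs]; abel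

/-- A bounded solution has determinant one. -/
theorem IsRHSolution.det_eq_one (h : IsRHSolution rp rm x M Mp Mm)
    (hb : ∀ i j, BddOff fun z => M z i j) {z : ℂ} (hz : z.im ≠ 0) : (M z).det = 1 := by
  -- Every term contains an entry of P − 1, which is in the Hardy class, times at most one bounded
  -- entry of P.
  have e : ∀ P : Matrix (Fin 2) (Fin 2) ℂ, P.det - 1 =
      ((P - 1) 0 0 * P 1 1 + (P - 1) 1 1) + -((P - 1) 0 1 * P 1 0) := by
    intro P; rw [Matrix.det_fin_two]; simp; ring
  have v00 := (h.hasBoundaryValues_sub_one 0 0).mul (h.hasBoundaryValues 1 1)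
  have v01 := (h.hasBoundaryValues_sub_one 0 1).mul (h.hasBoundaryValues 1 0)
  have b00 := (h.hardyBound 0 0).mul (hb 1 1)
  have b01 := (h.hardyBound 0 1).mul (hb 1 0)
  have hv := (v00.add (h.hasBoundaryValues_sub_one 1 1)).add v01.neg
  have hbd := (b00.add (h.hardyBound 1 1) v00 (h.hasBoundaryValues_sub_one 1 1)).add b01.neg
    (v00.add (h.hasBoundaryValues_sub_one 1 1)) v01.neg
  have := hv.eq_zero hbd (by
    filter_upwards [h.plus_eq] with s hs
    rw [← e, ← e, hs, Matrix.det_mul, det_one_add_jumpMatrix, mul_one]) hz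
  rw [← e] at this
  exact sub_eq_zero.1 this

/-- Uniqueness of the solution of the Riemann–Hilbert problem. -/
theorem IsRHSolution.unique (h : IsRHSolution rp rm x M Mp Mm)
    (hb : ∀ i j, BddOff fun z => M z i j) (h' : IsRHSolution rp rm x N Np Nm) {z : ℂ}
    (hz : z.im ≠ 0) : N z = M z := by
  have hadj : ∀ k j, HasBoundaryValues (fun z => (M z).adjugate k j) (fun s => (Mp s).adjugate k j)
      (fun s => (Mm s).adjugate k j) ∧ BddOff fun z => (M z).adjugate k j := by
    have hneg : ∀ i j, BddOff fun z => -M z i j := fun i j => by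
      obtain ⟨C, hC⟩ := hb i j
      exact ⟨C, fun z hz => by rw [norm_neg]; exact hC z hz⟩
    simp only [Matrix.adjugate_fin_two]
    simp only [Fin.forall_fin_two]
    exact ⟨⟨⟨h.hasBoundaryValues 1 1, hb 1 1⟩, ⟨(h.hasBoundaryValues 0 1).neg, hneg 0 1⟩⟩,
      ⟨⟨(h.hasBoundaryValues 1 0).neg, hneg 1 0⟩, ⟨h.hasBoundaryValues 0 0, hb 0 0⟩⟩⟩
  have hsub : ∀ i j, HasBoundaryValues (fun z => (N z - 1) i j + -(M z - 1) i j)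
      (fun s => (Np s - 1) i j + -(Mp s - 1) i j) (fun s => (Nm s - 1) i j + -(Mm s - 1) i j) ∧
      HardyBound fun z => (N z - 1) i j + -(M z - 1) i j := fun i j =>
    ⟨(h'.hasBoundaryValues_sub_one i j).add (h.hasBoundaryValues_sub_one i j).neg,
      (h'.hardyBound i j).add (h.hardyBound i j).neg (h'.hasBoundaryValues_sub_one i j)
        (h.hasBoundaryValues_sub_one i j).neg⟩
  have e : ∀ (P Q : Matrix (Fin 2) (Fin 2) ℂ) (i j : Fin 2), ((P - Q) * Q.adjugate) i j =
      ((P - 1) i 0 + -(Q - 1) i 0) * Q.adjugate 0 j +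
        ((P - 1) i 1 + -(Q - 1) i 1) * Q.adjugate 1 j := by
    intro P Q i j
    rw [Matrix.mul_apply, Fin.sum_univ_two]
    simp only [Matrix.sub_apply]; ring
  -- Since the matrix 1 + R has determinant one, it cancels against its adjugate and the product has
  -- no jump. Only M has to be bounded; N enters through the Hardy entries of N − M.
  have hzero : (N z - M z) * (M z).adjugate = 0 := by
    ext i j
    have v0 := (hsub i 0).1.mul (hadj 0 j).1
    have v1 := (hsub i 1).1.mul (hadj 1 j).1
    have b0 := (hsub i 0).2.mul (hadj 0 j).2
    have b1 := (hsub i 1).2.mul (hadj 1 j).2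
    have := (v0.add v1).eq_zero (b0.add b1 v0 v1) (by
      filter_upwards [h.plus_eq, h'.plus_eq] with s hs hs'
      rw [← e, ← e, hs, hs', ← sub_mul, Matrix.adjugate_mul_distrib, mul_assoc,
        ← mul_assoc (1 + jumpMatrix rp rm x s), Matrix.mul_adjugate, det_one_add_jumpMatrix,
        one_smul, one_mul]) hz
    rw [← e] at this
    exact this
  have h2 := congrArg (· * M z) hzero
  simp only [mul_assoc, Matrix.adjugate_mul, h.det_eq_one hb hz, one_smul, mul_one, zero_mul] at h2
  exact sub_eq_zero.1 h2

/-- Two solutions with the same values off the real line have the same boundary values. -/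
theorem IsRHSolution.boundary_eq (h : IsRHSolution rp rm x M Mp Mm)
    (h' : IsRHSolution rp rm x N Np Nm) (he : ∀ z : ℂ, z.im ≠ 0 → N z = M z) :
    Np =ᵐ[volume] Mp ∧ Nm =ᵐ[volume] Mm := by
  constructor
  · filter_upwards [h.boundary_plus, h'.boundary_plus] with s h1 h2
    refine tendsto_nhds_unique h2 (h1.congr' ?_)
    filter_upwards [self_mem_nhdsWithin] with ε hε
    rw [he _ (line_mem_off (ne_of_gt hε) s)]
  · filter_upwards [h.boundary_minus, h'.boundary_minus] with s h1 h2
    refine tendsto_nhds_unique h2 (h1.congr' ?_)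
    filter_upwards [self_mem_nhdsWithin] with ε hε
    rw [he]
    have : (0 : ℝ) < ε := hε
    simpa using this.ne'

end

/-! ### Reconstruction formulas and uniqueness of the potential -/

section
variable {N : ℝ} (κ : Ker N)

theorem norm_potU (φ φ₁ : ℝ → ℂ) (x : ℝ) : ‖potU φ φ₁ x‖ = ‖wv φ φ₁ (2 * x)‖ := by
  rw [potU, pot, norm_mul, norm_phase, mul_one]

theorem massFromInfty_potU (φ φ₁ : ℝ → ℂ) (x : ℝ) :
    massFromInfty (potU φ φ₁) x = -(massC φ φ₁ (2 * x) / 2) := by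
  rw [massFromInfty, massC]
  simp_rw [norm_potU]
  rw [integral_comp_mul_left_Ioi (fun t => ‖wv φ φ₁ t‖ ^ 2) x two_pos, smul_eq_mul]
  ring

theorem potU_mul_exp (φ φ₁ : ℝ → ℂ) (x : ℝ) :
    potU φ φ₁ x * Complex.exp (Complex.I * massFromInfty (potU φ φ₁) x) = wv φ φ₁ (2 * x) := by
  rw [massFromInfty_potU, potU, pot, phase, mul_assoc, ← Complex.exp_add]
  push_cast
  rw [mul_neg, add_neg_cancel, Complex.exp_zero, mul_one]

theorem gaugeFactor_potU (φ φ₁ : ℝ → ℂ) (x : ℝ) :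
    gaugeFactor (potU φ φ₁) x = Complex.exp (Complex.I / 4 * massC φ φ₁ (2 * x)) := by
  rw [gaugeFactor, massFromInfty_potU]
  congr 1
  push_cast
  field_simp
  linear_combination -4 * (massC φ φ₁ (2 * x) : ℂ) * Complex.I_mul_I

theorem conj_potU_mul_gaugeFactor (φ φ₁ : ℝ → ℂ) (x : ℝ) :
    conj (potU φ φ₁ x) * gaugeFactor (potU φ φ₁) x =
      conj (wv φ φ₁ (2 * x)) * Complex.exp (-(Complex.I / 4) * massC φ φ₁ (2 * x)) := by
  rw [gaugeFactor_potU, potU, pot, phase, map_mul, ← Complex.exp_conj, mul_assoc, ← Complex.exp_add]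
  congr 2
  simp only [map_mul, Complex.conj_I, Complex.conj_ofReal]
  push_cast; ring

theorem Ker.hasDerivAt_massC (c : ℝ) :
    HasDerivAt (massC κ.φ κ.φ₁) (-‖wv κ.φ κ.φ₁ c‖ ^ 2) c :=
  hasDerivAt_integral_Ioi κ.continuous_norm_sq_wv (κ.integrableOn_norm_sq_wv 0) c

theorem Ker.hasDerivAt_conj_potU_mul_gaugeFactor (x : ℝ) :
    HasDerivAt (fun y => conj (potU κ.φ κ.φ₁ y) * gaugeFactor (potU κ.φ κ.φ₁) y)
      ((2 * conj (wv' κ.φ κ.φ₁ (2 * x)) + Complex.I / 2 * (wv κ.φ κ.φ₁ (2 * x) *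
        conj (wv κ.φ κ.φ₁ (2 * x))) * conj (wv κ.φ κ.φ₁ (2 * x))) *
        Complex.exp (-(Complex.I / 4) * massC κ.φ κ.φ₁ (2 * x))) x := by
  have e : (fun y => conj (potU κ.φ κ.φ₁ y) * gaugeFactor (potU κ.φ κ.φ₁) y) = fun y =>
      conj (wv κ.φ κ.φ₁ (2 * y)) * Complex.exp (-(Complex.I / 4) * massC κ.φ κ.φ₁ (2 * y)) :=
    funext fun y => conj_potU_mul_gaugeFactor _ _ y
  rw [e]
  have hl : HasDerivAt (fun y : ℝ => 2 * y) 2 x := by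
    simpa using (hasDerivAt_id x).const_mul 2
  have h1 := HasDerivAt.scomp x (hasDerivAt_conj (κ.isKernel.hasDerivAt_wv (2 * x))) hl
  have h2 := (((κ.hasDerivAt_massC (2 * x)).comp x hl).ofReal_comp.const_mul
    (-(Complex.I / 4))).cexp
  refine (h1.mul h2).congr_deriv ?_
  simp only [Function.comp_apply, Complex.real_smul]
  rw [Complex.mul_conj, Complex.normSq_eq_norm_sq]
  push_cast; ring

/-- The potential `potU` satisfies the second reconstruction formula. -/
theorem Ker.gaugeFactor_mul_deriv (x : ℝ) :
    gaugeFactor (potU κ.φ κ.φ₁) x *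
      deriv (fun y => conj (potU κ.φ κ.φ₁ y) * gaugeFactor (potU κ.φ κ.φ₁) y) x =
      2 * (4 * Complex.I * conj (bval' κ.φ κ.φ₁ (2 * x)) - 16 * (bval κ.φ κ.φ₁ (2 * x) *
          conj (bval κ.φ κ.φ₁ (2 * x))) * conj (bval κ.φ κ.φ₁ (2 * x))) := by
  have e : Complex.exp (Complex.I / 4 * massC κ.φ κ.φ₁ (2 * x)) *
      Complex.exp (-(Complex.I / 4) * massC κ.φ κ.φ₁ (2 * x)) = 1 := by
    rw [← Complex.exp_add, ← Complex.exp_zero]; congr 1; ring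
  rw [(κ.hasDerivAt_conj_potU_mul_gaugeFactor x).deriv, gaugeFactor_potU, mul_left_comm, e, wv, wv']
  simp only [map_mul, map_neg, Complex.conj_I, map_ofNat]
  generalize conj (bval κ.φ κ.φ₁ (2 * x)) = β
  linear_combination -32 * bval κ.φ κ.φ₁ (2 * x) * β ^ 2 * (Complex.I ^ 2 - 1) * Complex.I_mul_I

theorem Ker.integrableOn_norm_sq_potU :
    IntegrableOn (fun y => ‖potU κ.φ κ.φ₁ y‖ ^ 2) (Ioi 0) := by
  simp_rw [norm_potU]
  refine (integrableOn_Ioi_comp_mul_left_iff (fun t => ‖wv κ.φ κ.φ₁ t‖ ^ 2) 0 two_pos).2 ?_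
  rw [mul_zero]
  exact κ.integrableOn_norm_sq_wv 0

end

section
variable {rp rm : ℝ → ℂ}

/-- The kernel of the scattering data. -/
noncomputable def IsScatteringData.ker (hd : IsScatteringData rp rm) {N : ℝ}
    (hN : normData rp + normData rm ≤ N) : Ker N :=
  ⟨_, _, _, (isKernel_of_data hd.mem_plus hd.mem_minus hd.relation).mono hN⟩

variable (hd : IsScatteringData rp rm) {N : ℝ} (hN : normData rp + normData rm ≤ N)

theorem IsScatteringData.exists_solution (x : ℝ) :
    ∃ M Mp Mm, IsRHSolution rp rm x M Mp Mm ∧ (∀ i j, BddOff fun z => M z i j) ∧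
      2 / (Real.pi * Complex.I) *
        (∫ z : ℝ, conj (rp z) * Complex.exp (-2 * Complex.I * z * x) * Mm z 0 0) =
          wv (hd.ker hN).φ (hd.ker hN).φ₁ (2 * x) ∧
      -1 / Real.pi * (∫ z : ℝ, rm z * Complex.exp (2 * Complex.I * z * x) * Mp z 1 1) =
        gaugeFactor (potU (hd.ker hN).φ (hd.ker hN).φ₁) x *
          deriv (fun y => conj (potU (hd.ker hN).φ (hd.ker hN).φ₁ y) *
            gaugeFactor (potU (hd.ker hN).φ (hd.ker hN).φ₁) y) x := by
  obtain ⟨M, Mp, Mm, h, hb, e1, e2⟩ :=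
    hd.exists_isRHSolution (hd.ker hN).isKernel (ae_eq_ft_of_data hd) x
  exact ⟨M, Mp, Mm, h, hb, e1, e2.trans ((hd.ker hN).gaugeFactor_mul_deriv x).symm⟩

theorem IsScatteringData.isReconstructed :
    IsReconstructed rp rm (potU (hd.ker hN).φ (hd.ker hN).φ₁) := by
  refine ⟨(hd.ker hN).integrableOn_norm_sq_potU, fun x _ => ?_⟩
  obtain ⟨M, Mp, Mm, h, -, e1, e2⟩ := hd.exists_solution hN x
  exact ⟨M, Mp, Mm, h, by rw [e1, potU_mul_exp],
    ((hd.ker hN).hasDerivAt_conj_potU_mul_gaugeFactor x).differentiableAt, e2.symm⟩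

/-- The first formula suffices: its modulus determines |u|, hence the mass beyond every point, hence
the exponential factor, and division recovers u. -/
theorem IsScatteringData.eqOn_of_isReconstructed {u : ℝ → ℂ} (hu : IsReconstructed rp rm u) :
    EqOn u (potU (hd.ker hN).φ (hd.ker hN).φ₁) (Ioi 0) := by
  set κ := hd.ker hN with hκ
  have key : ∀ x, 0 < x → u x * Complex.exp (Complex.I * massFromInfty u x) =
      wv κ.φ κ.φ₁ (2 * x) := by
    intro x hx
    obtain ⟨P, Pp, Pm, hP, e, -⟩ := hu.2 x hx
    obtain ⟨M, Mp, Mm, h, hb, e1, -⟩ := hd.exists_solution hN x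
    have hm := (h.boundary_eq hP fun z hz => h.unique hb hP hz).2
    rw [← hκ] at e1
    rw [e, ← e1]
    congr 1
    refine integral_congr_ae ?_
    filter_upwards [hm] with z hz
    rw [hz]
  have hnorm : ∀ x, 0 < x → ‖u x‖ = ‖potU κ.φ κ.φ₁ x‖ := by
    intro x hx
    rw [norm_potU, ← key x hx, norm_mul, mul_comm Complex.I, Complex.norm_exp_ofReal_mul_I, mul_one]
  intro x hx
  have hmass : massFromInfty u x = massFromInfty (potU κ.φ κ.φ₁) x := by
    rw [massFromInfty, massFromInfty]
    congr 1
    refine setIntegral_congr_fun measurableSet_Ioi fun y hy => ?_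
    have hxy : (0 : ℝ) < y := lt_trans hx hy
    simp only [hnorm y hxy]
  have h1 := (key x hx).trans (potU_mul_exp κ.φ κ.φ₁ x).symm
  rw [hmass] at h1
  exact mul_right_cancel₀ (Complex.exp_ne_zero _) h1

end

end KaupNewell

/-! ### Conclusion -/

theorem lemma4p11 (ρ : ℝ) (hρ : 0 < ρ) :
    ∃ C : ℝ, 0 < C ∧
      -- solvability, reconstruction of the potential, regularity and bound
      (∀ rp rm : ℝ → ℂ, KaupNewell.IsScatteringData rp rm →
        KaupNewell.normData rp ≤ ρ → KaupNewell.normData rm ≤ ρ →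
        (∀ x : ℝ, ∃ M Mp Mm, KaupNewell.IsRHSolution rp rm x M Mp Mm ∧
          ∀ N Np Nm, KaupNewell.IsRHSolution rp rm x N Np Nm →
            ∀ z : ℂ, z.im ≠ 0 → N z = M z) ∧
        ∃ u : ℝ → ℂ, KaupNewell.IsReconstructed rp rm u ∧
          (∀ u' : ℝ → ℂ, KaupNewell.IsReconstructed rp rm u' →
            Set.EqOn u' u (Set.Ioi 0)) ∧
          KaupNewell.MemPot u ∧
          KaupNewell.normPot u ≤ C * (KaupNewell.normData rp + KaupNewell.normData rm)) ∧
      -- Lipschitz continuity on bounded sets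
      (∀ rp rm rp' rm' : ℝ → ℂ, KaupNewell.IsScatteringData rp rm →
        KaupNewell.IsScatteringData rp' rm' →
        KaupNewell.normData rp ≤ ρ → KaupNewell.normData rm ≤ ρ →
        KaupNewell.normData rp' ≤ ρ → KaupNewell.normData rm' ≤ ρ →
        ∀ u u' : ℝ → ℂ, KaupNewell.IsReconstructed rp rm u →
          KaupNewell.IsReconstructed rp' rm' u' →
          KaupNewell.normPot (fun x => u x - u' x) ≤
            C * (KaupNewell.normData (fun z => rp z - rp' z) +
              KaupNewell.normData (fun z => rm z - rm' z))) := by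
  -- The size of a kernel is at most the sum of the norms of r₊ and r₋, so all kernels in question
  -- belong to `Ker (ρ + ρ)`.
  have hN : 0 ≤ ρ + ρ := by linarith
  obtain ⟨C₁, hC₁, H₁⟩ := KaupNewell.exists_normPot_potU_le hN
  obtain ⟨C₂, hC₂, H₂⟩ := KaupNewell.exists_normPot_potU_sub_le hN
  refine ⟨C₁ + C₂ + 1, by linarith, fun rp rm hd hp hm => ⟨fun x => ?_, ?_⟩,
    fun rp rm rp' rm' hd hd' hp hm hp' hm' u u' hu hu' => ?_⟩
  · obtain ⟨M, Mp, Mm, h, hb, -⟩ := hd.exists_solution (add_le_add hp hm) x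
    exact ⟨M, Mp, Mm, h, fun N Np Nm hN z hz => h.unique hb hN hz⟩
  · have hle := add_le_add hp hm
    obtain ⟨h1, h2⟩ := H₁ (hd.ker hle) _
      (KaupNewell.isKernel_of_data hd.mem_plus hd.mem_minus hd.relation) _ fun x _ => rfl
    refine ⟨_, hd.isReconstructed hle, fun u' hu' => hd.eqOn_of_isReconstructed hle hu', h1,
      h2.trans (mul_le_mul_of_nonneg_right (by linarith) ?_)⟩
    exact add_nonneg (KaupNewell.normData_nonneg _) (KaupNewell.normData_nonneg _)
  · have hle := add_le_add hp hm
    have hle' := add_le_add hp' hm'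
    have h := (H₂ (hd.ker hle) (hd'.ker hle') _
      (KaupNewell.isKernel_sub_of_data hd.mem_plus hd.mem_minus hd.relation hd'.mem_plus
        hd'.mem_minus hd'.relation) (fun x => u x - u' x) fun x hx => by
        simp only [hd.eqOn_of_isReconstructed hle hu hx,
          hd'.eqOn_of_isReconstructed hle' hu' hx]).2
    refine h.trans (mul_le_mul_of_nonneg_right (by linarith) ?_)
    exact add_nonneg (KaupNewell.normData_nonneg _) (KaupNewell.normData_nonneg _)
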